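/- Let $N\ge 1$ be an integer, $k>0$, $0<\alpha<1$, $\sigma,\gamma\le 0$ with $\sigma+2(\gamma+1)>0$ and $\sigma>-N$ (the last condition is automatic for $N\ge 2$), and let $\rho_1\ge\rho_2\ge 1$. Put $$(\rho_1\rho_2)_c=1+\frac{\sigma+2(\gamma+1)}{N}\max\{\rho_1+1,\rho_2+1\},\qquad r_i=(r_i)_c=\frac{N(\rho_1\rho_2-1)}{(\rho_i+1)(\sigma+2\gamma+2)}\quad(i=1,2),$$ and assume $\rho_1\rho_2>(\rho_1\rho_2)_c$ (so that $1<r_1\le r_2$). Let $\langle t\rangle=t+kt^{1-\alpha}$ and $g(z)=z/(1+kz^\alpha)$, and for $t>0$ let $$S_\alpha(t)=\frac1{2\pi i}\int e^{zt}\,\frac{g(z)}{z}\,(g(z)-\Delta)^{-1}\,dz ,\qquad S_\alpha(0)=I,$$ be the solution operator of the linear equation $\partial_tu-(1+kD^\alpha_{0^+})\Delta u=0$ on $\mathbb R^N$, where $D^\alpha_{0^+}$ is the Riemann–Liouville derivative in time; $S_\alpha(t)$ acts on functions as convolution with its kernel. Call $\theta$ admissible if $1<\theta<\dfrac{N}{(N-2r_1)_+}$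 (the right-hand side is $\infty$ if $N\le 2r_1$). For such $\theta$ let $p_i=\theta r_i$ and $\frac1{q_i}=\frac N2\big(\frac1{r_i}-\frac1{p_i}\big)$. With $I=[0,\infty)$ let $X_i^\theta=C_b(I;L^{r_i})\cap\mathcal C_{q_i}(I;L^{p_i})$, where $w\in\mathcal C_{q_i}(I;L^{p_i})$ means that $t\mapsto\langle t\rangle^{1/q_i}w(t)$ is continuous and bounded from $I$ to $L^{p_i}$ and that $\langle t\rangle^{1/q_i}\|w(t)\|_{L^{p_i}}\to0$ as $t\to0$; its norm is $\|w\|_{X_i^\theta}=\sup_{t\in I}\|w(t)\|_{L^{r_i}}+\sup_{t\in I}\langle t\rangle^{1/q_i}\|w(t)\|_{L^{p_i}}$. A mild solution of the coupled Rayleigh–Stokes system $$\partial_tu-(1+kD^\alpha_{0^+})\Delta u=|x|^\sigma t^\gamma v^{\rho_1},\quad \partial_tv-(1+kD^\alpha_{0^+})\Delta v=|x|^\sigma t^\gamma u^{\rho_2},\quad (u,v)|_{t=0}=(u_0,v_0)$$ is a pair $(u,v)\in C(I;L^{r_1})\times C(I;L^{r_2})$ such that, for every $t\ge0$ and almost every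 $x$, the integrals converge and $$u(x,t)=S_\alpha(t)u_0(x)+\int_0^tS_\alpha(t-s)\big(|\cdot|^\sigma s^\gamma v^{\rho_1}(\cdot,s)\big)(x)\,ds,\qquad v(x,t)=S_\alpha(t)v_0(x)+\int_0^tS_\alpha(t-s)\big(|\cdot|^\sigma s^\gamma u^{\rho_2}(\cdot,s)\big)(x)\,ds .$$ For functions that may change sign, each of the powers $w^{\rho}$ is understood as $|w|^{\rho}$ or as $|w|^{\rho-1}w$; the result holds for every choice. Then there is $\delta>0$ such that the following holds for all $(u_0,v_0)\in L^{r_1}\times L^{r_2}$ with $\|u_0\|_{L^{r_1}}\le\delta$ and $\|v_0\|_{L^{r_2}}\le\delta$. 1. There is a unique mild solution $(u,v)$ that belongs to $X_1^\theta\times X_2^\theta$ for every admissible $\theta$. Moreover, for each single admissible $\theta$ with $\frac{\rho_1}{p_2}-\frac{\sigma}{N}<1$ and $\frac{\rho_2}{p_1}-\frac{\sigma}{N}<1$ (that is, such that $|x|^\sigma|v|^{\rho_1}$ and $|x|^\sigma|u|^{\rho_2}$ are locally integrable for all $v\in L^{p_2}$, $u\in L^{p_1}$), it is the only mild solution in $X_1^\theta\times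 X_2^\theta$. 2. If $u_0\ge0$ and $v_0\ge0$ almost everywhere, then $u(\cdot,t)\ge0$ and $v(\cdot,t)\ge0$ almost everywhere, for every $t\ge0$. 3. The solution depends continuously on the data: for every admissible $\theta$, the map $(u_0,v_0)\mapsto(u,v)$ from these small data, with the norm of $L^{r_1}\times L^{r_2}$, to $X_1^\theta\times X_2^\theta$, with the norm $\max\{\|u\|_{X_1^\theta},\|v\|_{X_2^\theta}\}$, is continuous. -/

import Mathlib

open MeasureTheory Set Filter Topology
open scoped ENNReal

noncomputable section

namespace RayleighStokes

/-- The spatial domain `ℝ^N` with the Euclidean norm. -/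
abbrev Space (N : ℕ) : Type := EuclideanSpace ℝ (Fin N)

/-! ### The solution operator -/

/-- The Gauss-Weierstrass kernel of `e^{τΔ}` on `ℝ^N`, for `τ > 0`. -/
def heatKernel (N : ℕ) (τ : ℝ) (x : Space N) : ℝ :=
  (4 * Real.pi * τ) ^ (-(N : ℝ) / 2) * Real.exp (-‖x‖ ^ 2 / (4 * τ))

/-- The convolution kernel of the resolvent `(ζ - Δ)⁻¹ = ∫₀^∞ e^{-ζτ} e^{τΔ} dτ`, for `Re ζ > 0`. -/
def resolventKernel (N : ℕ) (ζ : ℂ) (x : Space N) : ℂ :=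
  ∫ τ in Ioi (0 : ℝ), Complex.exp (-ζ * (τ : ℂ)) * ((heatKernel N τ x : ℝ) : ℂ)

/-- The symbol `g(z) = z / (1 + k z^α)`, the reciprocal of the Laplace transform of
`h(t) = 1 + k t^{-α} / Γ(1-α)`. It maps `Re z > 0` into itself. -/
def symbol (k α : ℝ) (z : ℂ) : ℂ := z / (1 + (k : ℂ) * z ^ (α : ℂ))

/-- The convolution kernel of `S_α(t) = (1 / 2πi) ∫ e^{zt} (g(z)/z) (g(z) - Δ)⁻¹ dz`, for `t > 0`.
The path of integration is the vertical line `z = 1 + iη`, on which the resolvent is given by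
`resolventKernel` and, for `x ≠ 0`, the integrand decays like `exp (-c |η|^{(1-α)/2} ‖x‖)`; by
Cauchy's theorem this is the same as the integral over a contour `Γ_{δ,φ}`, `φ ∈ (π/2, π)`.
The value is real, because the integrand at `-η` is the conjugate of the integrand at `η`. -/
def solutionKernel (N : ℕ) (k α t : ℝ) (x : Space N) : ℝ :=
  ((1 / (2 * Real.pi) : ℂ) * ∫ η : ℝ,
    Complex.exp ((1 + (η : ℂ) * Complex.I) * (t : ℂ)) *
      (symbol k α (1 + (η : ℂ) * Complex.I) / (1 + (η : ℂ) * Complex.I)) *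
      resolventKernel N (symbol k α (1 + (η : ℂ) * Complex.I)) x).re

/-- The solution operator `S_α(t)`: the identity at `t = 0`, a convolution for `t > 0`. -/
def solutionOp {N : ℕ} (k α t : ℝ) (f : Space N → ℝ) (x : Space N) : ℝ :=
  if t = 0 then f x else ∫ y, solutionKernel N k α t (x - y) * f y

/-! ### Function spaces on `I = [0,∞)` -/

/-- `⟨t⟩ = t + k t^{1-α}`. -/
def bracket (k α t : ℝ) : ℝ := t + k * t ^ (1 - α)

/-- `1/q`, where `1/q = (N/2) (1/r - 1/p)`. -/
def invQ (N : ℕ) (p r : ℝ) : ℝ := (N : ℝ) / 2 * (1 / r - 1 / p)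

/-- The function `⟨t⟩^{1/q} u(t)`, `q = q(p,r)`. At `t = 0` it vanishes if `r < p`. -/
def weighted {N : ℕ} (k α p r : ℝ) (u : ℝ → Space N → ℝ) : ℝ → Space N → ℝ :=
  fun t x => bracket k α t ^ invQ N p r * u t x

/-- `sup_{t ≥ 0} ‖u(t)‖_{L^p}`, with values in `[0,∞]`. -/
def supNorm {N : ℕ} (p : ℝ) (u : ℝ → Space N → ℝ) : ℝ≥0∞ :=
  ⨆ t ∈ Ici (0 : ℝ), eLpNorm (u t) (ENNReal.ofReal p) volume

/-- `u ∈ C([0,∞); L^p)`. -/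
def MemC {N : ℕ} (p : ℝ) (u : ℝ → Space N → ℝ) : Prop :=
  (∀ t ∈ Ici (0 : ℝ), MemLp (u t) (ENNReal.ofReal p) volume) ∧
  ∀ t₀ ∈ Ici (0 : ℝ),
    Tendsto (fun t => eLpNorm (u t - u t₀) (ENNReal.ofReal p) volume) (𝓝[Ici 0] t₀) (𝓝 0)

/-- `u ∈ C_b([0,∞); L^p)`. -/
def MemCb {N : ℕ} (p : ℝ) (u : ℝ → Space N → ℝ) : Prop :=
  MemC p u ∧ supNorm p u < ∞

/-- `u ∈ 𝒞_{q(p,r)}([0,∞); L^p)`: the function `⟨t⟩^{1/q} u` is continuous with values in `L^p`,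
`sup_t ⟨t⟩^{1/q} ‖u(t)‖_{L^p}` is finite, and `⟨t⟩^{1/q} ‖u(t)‖_{L^p} → 0` as `t → 0`. -/
def MemWeighted {N : ℕ} (k α p r : ℝ) (u : ℝ → Space N → ℝ) : Prop :=
  MemCb p (weighted k α p r u) ∧
  Tendsto (fun t => eLpNorm (weighted k α p r u t) (ENNReal.ofReal p) volume) (𝓝[>] 0) (𝓝 0)

/-- `u ∈ C_b(I; L^r) ∩ 𝒞_{q(p,r)}(I; L^p)`. -/
def MemX {N : ℕ} (k α p r : ℝ) (u : ℝ → Space N → ℝ) : Prop :=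
  MemCb r u ∧ MemWeighted k α p r u

/-- The norm `sup_t ‖u(t)‖_{L^r} + sup_t ⟨t⟩^{1/q} ‖u(t)‖_{L^p}` of that space. -/
def normX {N : ℕ} (k α p r : ℝ) (u : ℝ → Space N → ℝ) : ℝ≥0∞ :=
  supNorm r u + supNorm p (weighted k α p r u)

/-! ### Mild solutions -/

/-- The two usual meanings of `s^ρ` for real `s`, namely `|s|^ρ` and `|s|^{ρ-1} s`. Both are `s^ρ`
for `s ≥ 0`, and for an integer `ρ` one of them is the ordinary power. -/
def IsPower (ρ : ℝ) (f : ℝ → ℝ) : Prop :=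
  (f = fun s => |s| ^ ρ) ∨ (f = fun s => |s| ^ (ρ - 1) * s)

/-- The source term `|x|^σ s^γ f(v(x,s))` at time `s`. -/
def source {N : ℕ} (σ γ : ℝ) (f : ℝ → ℝ) (v : ℝ → Space N → ℝ) (s : ℝ) (y : Space N) : ℝ :=
  ‖y‖ ^ σ * s ^ γ * f (v s y)

/-- `u(x,t) = S_α(t) u₀(x) + ∫₀ᵗ S_α(t-s) |x|^σ s^γ f(v(x,s)) ds` for every `t ≥ 0` and almost every
`x`, where the integrals on the right converge. -/
def Duhamel {N : ℕ} (k α σ γ : ℝ) (f : ℝ → ℝ) (u₀ : Space N → ℝ) (u v : ℝ → Space N → ℝ) : Prop :=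
  ∀ t ∈ Ici (0 : ℝ), ∀ᵐ x : Space N,
    (∀ᵐ s ∂(volume.restrict (Ioo 0 t)),
      Integrable (fun y => solutionKernel N k α (t - s) (x - y) * source σ γ f v s y)) ∧
    IntervalIntegrable (fun s => solutionOp k α (t - s) (source σ γ f v s) x) volume 0 t ∧
    u t x = solutionOp k α t u₀ x + ∫ s in (0 : ℝ)..t, solutionOp k α (t - s) (source σ γ f v s) x

/-- `(u,v)` is a global mild solution, with `u ∈ C([0,∞); L^{r₁})` and `v ∈ C([0,∞); L^{r₂})`, of
`∂ₜu - (1 + k D^α) Δu = |x|^σ t^γ f₁(v)`, `∂ₜv - (1 + k D^α) Δv = |x|^σ t^γ f₂(u)`,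
`u(0) = u₀`, `v(0) = v₀`. -/
structure IsMildSolution {N : ℕ} (k α σ γ : ℝ) (f₁ f₂ : ℝ → ℝ) (r₁ r₂ : ℝ)
    (u₀ v₀ : Space N → ℝ) (u v : ℝ → Space N → ℝ) : Prop where
  cont_u : MemC r₁ u
  cont_v : MemC r₂ v
  eq_u : Duhamel k α σ γ f₁ u₀ u v
  eq_v : Duhamel k α σ γ f₂ v₀ v u

/-! ### Exponents -/

/-- `(ρ₁ρ₂)_c = 1 + (σ + 2(γ+1))/N · max {ρ₁+1, ρ₂+1}`. -/
def criticalProduct (N : ℕ) (σ γ ρ₁ ρ₂ : ℝ) : ℝ :=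
  1 + (σ + 2 * (γ + 1)) / N * max (ρ₁ + 1) (ρ₂ + 1)

/-- `(r_i)_c = N(ρ₁ρ₂ - 1) / ((ρ_i + 1)(σ + 2γ + 2))`; the last argument is `ρ_i`. -/
def criticalR (N : ℕ) (σ γ ρ₁ ρ₂ ρi : ℝ) : ℝ :=
  N * (ρ₁ * ρ₂ - 1) / ((ρi + 1) * (σ + 2 * γ + 2))

/-- `1 < θ < N / (N - 2 r₁)₊`, where the right-hand side is `∞` if `N ≤ 2 r₁`. -/
def Admissible (N : ℕ) (r₁ θ : ℝ) : Prop :=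
  1 < θ ∧ θ * max ((N : ℝ) - 2 * r₁) 0 < N

/-- Mild solutions `(u,v)` that belong, with `(p₁,p₂) = θ(r₁,r₂)`, to
`(C_b(I;L^{r₁}) ∩ 𝒞_{q₁}(I;L^{p₁})) × (C_b(I;L^{r₂}) ∩ 𝒞_{q₂}(I;L^{p₂}))`
for every admissible `θ`. -/
def IsGlobalSolution {N : ℕ} (k α σ γ : ℝ) (f₁ f₂ : ℝ → ℝ) (r₁ r₂ : ℝ)
    (u₀ v₀ : Space N → ℝ) (u v : ℝ → Space N → ℝ) : Prop :=
  IsMildSolution k α σ γ f₁ f₂ r₁ r₂ u₀ v₀ u v ∧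
  ∀ θ, Admissible N r₁ θ → MemX k α (θ * r₁) r₁ u ∧ MemX k α (θ * r₂) r₂ v

/-- `(u₀,v₀) ∈ L^{r₁} × L^{r₂}` with `‖u₀‖_{L^{r₁}} ≤ δ` and `‖v₀‖_{L^{r₂}} ≤ δ`. -/
def SmallData {N : ℕ} (δ r₁ r₂ : ℝ) (u₀ v₀ : Space N → ℝ) : Prop :=
  MemLp u₀ (ENNReal.ofReal r₁) volume ∧ MemLp v₀ (ENNReal.ofReal r₂) volume ∧
  eLpNorm u₀ (ENNReal.ofReal r₁) volume ≤ ENNReal.ofReal δ ∧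
  eLpNorm v₀ (ENNReal.ofReal r₂) volume ≤ ENNReal.ofReal δ

end RayleighStokes

end

open MeasureTheory Set Filter Topology
open scoped ENNReal

noncomputable section

namespace RayleighStokes

open Function (uncurry)
open ENNReal (ofReal ofReal_lt_top ofReal_le_ofReal ofReal_ne_top ofReal_mul ofReal_one ofReal_add rpow_le_rpow
  mul_lt_top tendsto_ofReal rpow_ne_top_of_nonneg rpow_lt_top_of_nonneg mul_rpow_of_nonneg mul_ne_top add_ne_top add_lt_top)

/-! ### Integrals over vertical lines -/

/-! The operator S_α(t) is an average ∫₀^∞ w(t,τ) e^{τΔ} dτ of heat operators, where w(·,τ) is the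
inverse Laplace transform of (g(z)/z) e^{-τg(z)}. On the half-line both (1+kx^α)⁻¹ and e^{-τg(x)}
are completely monotone, and a function with a completely monotone Laplace transform is nonnegative
(`nonneg_of_altMono_laplace`). So w(t,·) is a probability density. Its distribution function is read
off from the transform at x = 1/t, where g(1/t) = 1/⟨t⟩: the mass of (0,T] is at most a constant
times T/⟨t⟩ (`one_sub_subTail_le`). Hence ∫ w(t,τ) τ^{-κ} dτ ≤ C⟨t⟩^{-κ} for 0 ≤ κ < 1
(`exists_moment_subDens_le`), and every heat estimate with rate τ^{-κ} becomes an estimate of S_α(t)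
with rate ⟨t⟩^{-κ}. The restriction κ < 1 is what bounds the admissible θ from above.

The weight |x|^σ is absorbed by cutting it at |x| = √τ (`exists_heatBound_wt`). In the Duhamel
integral the substitution s = tτ leaves a fixed interval of integration. The critical exponents
satisfy ρ₁/r₂ = 1/r₁ + (σ+2γ+2)/N and the relation with the indices exchanged; with these all powers
of ⟨t⟩ cancel and a Beta integral remains (`DuhamelExp.bw_mul_mul_le`). The bracket is not
homogeneous, but t ≤ ⟨t⟩ and τ⟨t⟩ ≤ ⟨tτ⟩ for τ ≤ 1 are enough. The weighted norm of a Duhamel term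
is thus bounded by the power ρ of the weighted norm of its argument, and there is a corresponding
Lipschitz bound.

Since ρ₂ = 1 is allowed, the second equation alone gives no smallness. But ρ₁ > 1, so the
composition of the two mild maps contracts a small ball (`exists_isSystem`). Nonnegativity passes
from the Picard iterates, which start at zero, to the limit.

The contraction needs a ratio θ in a window that can be smaller than the admissible range. There is
a ratio in the window from which every admissible ratio is reached by applying the Duhamel formula
twice (`SystemParams.exists_window`), and the ratio 1, which is the space L^{r_i} itself, by
applying it once. Uniform and Lipschitz bounds travel along these steps (`Controlled.step`), which
gives membership in all the spaces and continuous dependence.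

Uniqueness needs no smallness of the competing solution. The difference satisfies a pair of Volterra
inequalities; near t = 0 their product has a small coefficient, because the weighted norms decay
there and ρ₁ > 1, and for later times the weight t^{-m} with large m makes the kernels small
(`eq_zero_of_volterra`). Interpolation with L^{r_i} first lowers the given ratio into the window
(`Good.interpolate`). A curve with values in L^p need not be jointly measurable in (t,x), so it is
first replaced by a jointly measurable version (`exists_measurable_version`). -/

theorem norm_sq_vertical (c η : ℝ) : ‖(c : ℂ) + η * Complex.I‖ ^ 2 = c ^ 2 + η ^ 2 := by
  rw [← Complex.normSq_eq_norm_sq, Complex.normSq_add_mul_I]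

theorem integrable_inv_sq_add_sq {c : ℝ} (hc : 0 < c) :
    Integrable fun η : ℝ => (c ^ 2 + η ^ 2)⁻¹ := by
  have h := (integrable_inv_one_add_sq.comp_div hc.ne').const_mul (c ^ 2)⁻¹
  refine h.congr (Eventually.of_forall fun η => ?_)
  have : 0 < c ^ 2 + η ^ 2 := by positivity
  simp only
  field_simp

theorem integral_inv_sq_add_sq {c : ℝ} (hc : 0 < c) :
    ∫ η : ℝ, (c ^ 2 + η ^ 2)⁻¹ = Real.pi / c := by
  have h : ∀ η : ℝ, (c ^ 2 + η ^ 2)⁻¹ = (c ^ 2)⁻¹ * (1 + (η / c) ^ 2)⁻¹ := fun η => by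
    have : 0 < c ^ 2 + η ^ 2 := by positivity
    field_simp
  simp_rw [h]
  rw [integral_const_mul, Measure.integral_comp_div (fun y : ℝ => (1 + y ^ 2)⁻¹) c,
    integral_univ_inv_one_add_sq, abs_of_pos hc, smul_eq_mul]
  field_simp

theorem continuous_vertical {H : ℂ → ℂ} {c : ℝ}
    (hH : ∀ z : ℂ, c ≤ z.re → DifferentiableAt ℂ H z) :
    Continuous fun η : ℝ => H (c + η * Complex.I) := by
  rw [continuous_iff_continuousAt]
  intro η
  have h1 : ContinuousAt H (c + η * Complex.I) := (hH _ (by simp)).continuousAt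
  exact ContinuousAt.comp (f := fun η : ℝ => (c + η * Complex.I : ℂ)) h1
    (by fun_prop)

theorem integrable_vertical {H : ℂ → ℂ} {c C : ℝ} (hc : 0 < c)
    (hH : ∀ z : ℂ, c ≤ z.re → DifferentiableAt ℂ H z)
    (hb : ∀ η : ℝ, ‖H (c + η * Complex.I)‖ ≤ C / ‖(c : ℂ) + η * Complex.I‖ ^ 2) :
    Integrable fun η : ℝ => H (c + η * Complex.I) := by
  refine ((integrable_inv_sq_add_sq hc).const_mul C).mono'
    (continuous_vertical hH).aestronglyMeasurable (Eventually.of_forall fun η => ?_)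
  simpa [norm_sq_vertical, div_eq_mul_inv] using hb η

/-- Cauchy's theorem on rectangles of height 2T: the horizontal sides contribute O(T⁻²). Decay is
required only in the strip between the two lines, because the factor e^{zt} of the inversion
integral is unbounded on the half-plane when t > 0. -/
theorem integral_vertical_eq {H : ℂ → ℂ} {c d C : ℝ} (hc : 0 < c) (hcd : c ≤ d)
    (hH : ∀ z : ℂ, c ≤ z.re → DifferentiableAt ℂ H z)
    (hb : ∀ z : ℂ, c ≤ z.re → z.re ≤ d → ‖H z‖ ≤ C / ‖z‖ ^ 2) :
    ∫ η : ℝ, H (c + η * Complex.I) = ∫ η : ℝ, H (d + η * Complex.I) := by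
  have hC : 0 ≤ C := by
    have h := (norm_nonneg _).trans (hb c (by simp) (by simpa using hcd))
    have h2 : 0 < ‖(c : ℂ)‖ ^ 2 := by simp; positivity
    by_contra hneg
    exact absurd h (not_le.2 (div_neg_of_neg_of_pos (not_le.1 hneg) h2))
  have i1 := integrable_vertical hc hH fun η => hb (c + η * Complex.I) (by simp) (by simpa using hcd)
  have i2 := integrable_vertical (hc.trans_le hcd) (fun z hz => hH z (hcd.trans hz))
    fun η => hb (d + η * Complex.I) (by simpa using hcd) (by simp)
  have t1 := intervalIntegral_tendsto_integral i1 tendsto_neg_atTop_atBot tendsto_id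
  have t2 := intervalIntegral_tendsto_integral i2 tendsto_neg_atTop_atBot tendsto_id
  have rect : ∀ T : ℝ, 0 < T → ‖(∫ y : ℝ in (-T)..T, H (d + y * Complex.I)) -
      ∫ y : ℝ in (-T)..T, H (c + y * Complex.I)‖ ≤ 2 * (C * (d - c)) * (T ^ 2)⁻¹ := by
    intro T hT
    have hr := Complex.integral_boundary_rect_eq_zero_of_differentiableOn H
      (c + (-T : ℝ) * Complex.I) (d + T * Complex.I) (by
        intro z hz
        refine (hH z ?_).differentiableWithinAt
        have := (Complex.mem_reProdIm.1 hz).1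
        simp [uIcc_of_le hcd] at this
        exact this.1)
    simp only [Complex.add_re, Complex.ofReal_re, Complex.mul_re, Complex.I_re, mul_zero,
      Complex.ofReal_im, Complex.I_im, mul_one, sub_self, add_zero, Complex.add_im,
      Complex.mul_im, zero_add] at hr
    have hor : ∀ y : ℝ, y ^ 2 = T ^ 2 →
        ‖∫ x : ℝ in c..d, H (x + y * Complex.I)‖ ≤ (C * (d - c)) * (T ^ 2)⁻¹ := by
      intro y hy
      have := intervalIntegral.norm_integral_le_of_norm_le_const (a := c) (b := d)
        (f := fun x : ℝ => H (x + y * Complex.I)) (C := C * (T ^ 2)⁻¹) (by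
          intro x hx
          rw [uIoc_of_le hcd] at hx
          refine (hb _ (by simpa using hx.1.le) (by simpa using hx.2)).trans ?_
          rw [norm_sq_vertical, hy, div_eq_mul_inv]
          have : 0 < T ^ 2 := by positivity
          gcongr
          nlinarith [sq_nonneg x])
      rw [abs_of_nonneg (sub_nonneg.2 hcd)] at this
      linarith
    have e : (∫ y : ℝ in (-T)..T, H (d + y * Complex.I)) -
        ∫ y : ℝ in (-T)..T, H (c + y * Complex.I) =
        Complex.I * ((∫ x : ℝ in c..d, H (x + (-T : ℝ) * Complex.I)) -
          ∫ x : ℝ in c..d, H (x + T * Complex.I)) := by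
      rw [smul_eq_mul, smul_eq_mul] at hr
      linear_combination (-Complex.I) * hr + ((∫ y : ℝ in (-T)..T, H (d + y * Complex.I)) -
        ∫ y : ℝ in (-T)..T, H (c + y * Complex.I)) * Complex.I_sq
    rw [e, norm_mul, Complex.norm_I, one_mul]
    refine (norm_sub_le _ _).trans ?_
    linarith [hor (-T) (by ring), hor T rfl]
  have lim0 : Tendsto (fun T : ℝ => 2 * (C * (d - c)) * (T ^ 2)⁻¹) atTop (𝓝 0) := by
    simpa using (tendsto_pow_atTop (two_ne_zero)).inv_tendsto_atTop.const_mul (2 * (C * (d - c)))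
  have l2 := squeeze_zero_norm' (eventually_gt_atTop (0 : ℝ) |>.mono rect) lim0
  have l3 := tendsto_nhds_unique l2 (t2.sub t1)
  exact (sub_eq_zero.1 l3.symm).symm

/-- The integral does not depend on the line, and it tends to zero as the line moves to the right,
by domination with C/(c² + η²). -/
theorem integral_vertical_eq_zero {H : ℂ → ℂ} {c C : ℝ} (hc : 0 < c)
    (hH : ∀ z : ℂ, c ≤ z.re → DifferentiableAt ℂ H z)
    (hb : ∀ z : ℂ, c ≤ z.re → ‖H z‖ ≤ C / ‖z‖ ^ 2) :
    ∫ η : ℝ, H (c + η * Complex.I) = 0 := by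
  have hC : 0 ≤ C := by
    have h := (norm_nonneg _).trans (hb c (by simp))
    have h2 : 0 < ‖(c : ℂ)‖ ^ 2 := by simp; positivity
    by_contra hneg
    exact absurd h (not_le.2 (div_neg_of_neg_of_pos (not_le.1 hneg) h2))
  have key : Tendsto (fun d : ℝ => ∫ η : ℝ, H (d + η * Complex.I)) atTop (𝓝 0) := by
    have := tendsto_integral_filter_of_dominated_convergence (l := atTop (α := ℝ))
      (F := fun (d : ℝ) (η : ℝ) => H (d + η * Complex.I)) (f := fun _ => 0) (μ := volume)
      (fun η => C * (c ^ 2 + η ^ 2)⁻¹)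
      ((eventually_ge_atTop c).mono fun d hd =>
        (continuous_vertical fun z hz => hH z (hd.trans hz)).aestronglyMeasurable)
      ((eventually_ge_atTop c).mono fun d hd => Eventually.of_forall fun η => by
        refine (hb _ (by simpa using hd)).trans ?_
        rw [norm_sq_vertical, div_eq_mul_inv]
        gcongr)
      ((integrable_inv_sq_add_sq hc).const_mul C)
      (Eventually.of_forall fun η => by
        have l0 : Tendsto (fun d : ℝ => C * (d ^ 2)⁻¹) atTop (𝓝 0) := by
          simpa using (tendsto_pow_atTop (two_ne_zero)).inv_tendsto_atTop.const_mul C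
        refine squeeze_zero_norm' ?_ l0
        filter_upwards [eventually_ge_atTop c] with d hd
        have hd0 : 0 < d := hc.trans_le hd
        refine (hb _ (by simpa using hd)).trans ?_
        rw [norm_sq_vertical, div_eq_mul_inv]
        gcongr
        nlinarith [sq_nonneg η])
    simpa using this
  have h2 : Tendsto (fun d : ℝ => ∫ η : ℝ, H (d + η * Complex.I)) atTop
      (𝓝 (∫ η : ℝ, H (c + η * Complex.I))) := by
    refine tendsto_const_nhds.congr' ?_
    filter_upwards [eventually_ge_atTop c] with d hd
    exact integral_vertical_eq hc hd hH fun z hz _ => hb z hz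
  exact tendsto_nhds_unique h2 key

/-- Cauchy's formula for the half-plane `c < Re z`. -/
theorem integral_vertical_div_sub {F : ℂ → ℂ} {c C x : ℝ} (hc : 0 < c) (hx : c < x)
    (hF : ∀ z : ℂ, c ≤ z.re → DifferentiableAt ℂ F z)
    (hb : ∀ z : ℂ, c ≤ z.re → ‖F z‖ ≤ C / ‖z‖ ^ 2) :
    ∫ η : ℝ, F (c + η * Complex.I) / (x - (c + η * Complex.I)) = 2 * Real.pi * F x := by
  have hC : 0 ≤ C := by
    have h := (norm_nonneg _).trans (hb c (by simp))
    have h2 : 0 < ‖(c : ℂ)‖ ^ 2 := by simp; positivity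
    by_contra hneg
    exact absurd h (not_le.2 (div_neg_of_neg_of_pos (not_le.1 hneg) h2))
  have ha : 0 < x - c := sub_pos.2 hx
  have hz0 : ∀ z : ℂ, c ≤ z.re → 0 < ‖z‖ := fun z hz =>
    norm_pos_iff.2 fun h => by simp [h] at hz; linarith
  have hden : ∀ z : ℂ, c ≤ z.re → x - c ≤ ‖z + (x - 2 * c : ℝ)‖ := fun z hz => by
    refine le_trans ?_ (Complex.re_le_norm _)
    simp; linarith
  have hden0 : ∀ z : ℂ, c ≤ z.re → z + (x - 2 * c : ℝ) ≠ 0 := fun z hz =>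
    norm_pos_iff.1 (ha.trans_le (hden z hz))
  -- The point 2c - x is the reflection of x in the line Re z = c. It lies outside the half-plane,
  -- so this reflected kernel has no pole there.
  have I1 : ∫ η : ℝ, F (c + η * Complex.I) / ((c + η * Complex.I) + (x - 2 * c : ℝ)) = 0 := by
    refine integral_vertical_eq_zero (H := fun z => F z / (z + (x - 2 * c : ℝ)))
      (C := C / (x - c)) hc (fun z hz => ?_) fun z hz => ?_
    · exact (hF z hz).div (by fun_prop) (hden0 z hz)
    · rw [norm_div, div_right_comm]
      exact div_le_div₀ (by positivity) (hb z hz) ha (hden z hz)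
  have hFx : DifferentiableAt ℂ F x := hF x (by simpa using hx.le)
  -- The difference quotient of F at x is holomorphic across x. Multiplied by the reflected kernel
  -- it decays like |z|⁻², so its integral vanishes as well; on the line the product of the two
  -- denominators is -(a² + η²) with a = x - c, the Poisson kernel up to a constant.
  have I2 : ∫ η : ℝ, dslope F x (c + η * Complex.I) /
      ((c + η * Complex.I) + (x - 2 * c : ℝ)) = 0 := by
    set H : ℂ → ℂ := fun z => dslope F x z / (z + (x - 2 * c : ℝ)) with hHdef
    have hds : ∀ z : ℂ, c ≤ z.re → ContinuousAt (dslope F x) z := by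
      intro z hz
      rcases eq_or_ne z x with rfl | hne
      · exact continuousAt_dslope_same.2 hFx
      · exact (continuousAt_dslope_of_ne hne).2 (hF z hz).continuousAt
    have hdd : ∀ z : ℂ, c ≤ z.re → DifferentiableAt ℂ (dslope F x) z := by
      intro z hz
      rcases eq_or_ne z x with rfl | hne
      · have hU : {z : ℂ | c < z.re} ∈ 𝓝 (x : ℂ) :=
          (isOpen_lt continuous_const Complex.continuous_re).mem_nhds (by simpa using hx)
        exact ((Complex.differentiableOn_dslope hU).2 fun z hz =>
          (hF z (le_of_lt hz)).differentiableWithinAt).differentiableAt hU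
      · exact (differentiableAt_dslope_of_ne hne).2 (hF z hz)
    have hHd : ∀ z : ℂ, c ≤ z.re → DifferentiableAt ℂ H z := fun z hz =>
      (hdd z hz).div (by fun_prop) (hden0 z hz)
    have hK : IsCompact (Metric.closedBall (x : ℂ) 1 ∩ {z : ℂ | c ≤ z.re}) :=
      (isCompact_closedBall _ _).inter_right (isClosed_le continuous_const Complex.continuous_re)
    obtain ⟨M, hM⟩ := hK.exists_bound_of_continuousOn (f := fun z : ℂ => (z ^ 2 * H z : ℂ))
      fun z hz => ((continuousAt_id.pow 2).mul (hHd z hz.2).continuousAt).continuousWithinAt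
    -- The constant for the points at distance more than 1 from x, where numerator and both
    -- denominators are compared directly. The disc around x is covered by compactness.
    set D := (C / c ^ 2 + ‖F x‖) * ((1 + x) * (1 + |x - 2 * c| / (x - c))) with hD
    have hx0 : 0 < x := hc.trans hx
    refine integral_vertical_eq_zero (H := H) (C := max M D) hc hHd fun z hz => ?_
    have hzp := hz0 z hz
    rw [le_div_iff₀ (by positivity)]
    by_cases hzx : ‖z - x‖ ≤ 1
    · refine le_trans (le_of_eq ?_) ((hM z ⟨by simpa [dist_eq_norm] using hzx, hz⟩).trans
        (le_max_left _ _))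
      rw [norm_mul, norm_pow, mul_comm]
    · refine le_trans ?_ (le_max_right _ _)
      push Not at hzx
      have hne : z ≠ x := fun h => by simp [h] at hzx; linarith
      have hnF : ‖F z‖ ≤ C / c ^ 2 := by
        refine (hb z hz).trans ?_
        have : c ≤ ‖z‖ := hz.trans (Complex.re_le_norm z)
        gcongr
      have e1 : ‖H z‖ = ‖F z - F x‖ / (‖z - x‖ * ‖z + (x - 2 * c : ℝ)‖) := by
        rw [hHdef]
        simp only
        rw [dslope_of_ne _ hne, slope_def_field, norm_div, norm_div, div_div]
      have e2 : ‖z‖ ≤ (1 + x) * ‖z - x‖ := by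
        have : ‖z‖ ≤ ‖z - x‖ + x := by
          calc ‖z‖ = ‖(z - x) + x‖ := by ring_nf
            _ ≤ ‖z - x‖ + ‖(x : ℂ)‖ := norm_add_le _ _
            _ = ‖z - x‖ + x := by rw [Complex.norm_real, Real.norm_of_nonneg hx0.le]
        nlinarith
      have e3 : ‖z‖ ≤ (1 + |x - 2 * c| / (x - c)) * ‖z + (x - 2 * c : ℝ)‖ := by
        have h1 : ‖z‖ ≤ ‖z + (x - 2 * c : ℝ)‖ + |x - 2 * c| := by
          calc ‖z‖ = ‖(z + (x - 2 * c : ℝ)) - (x - 2 * c : ℝ)‖ := by ring_nf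
            _ ≤ ‖z + (x - 2 * c : ℝ)‖ + ‖((x - 2 * c : ℝ) : ℂ)‖ := norm_sub_le _ _
            _ = _ := by rw [Complex.norm_real, Real.norm_eq_abs]
        have h2 : |x - 2 * c| ≤ |x - 2 * c| / (x - c) * ‖z + (x - 2 * c : ℝ)‖ := by
          rw [div_mul_eq_mul_div, le_div_iff₀ ha]
          exact mul_le_mul_of_nonneg_left (hden z hz) (abs_nonneg _)
        linarith
      have p1 : 0 < ‖z - x‖ := by linarith
      have p2 : 0 < ‖z + (x - 2 * c : ℝ)‖ := ha.trans_le (hden z hz)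
      rw [e1, div_mul_eq_mul_div, div_le_iff₀ (by positivity)]
      have e4 : ‖z‖ ^ 2 ≤ ((1 + x) * (1 + |x - 2 * c| / (x - c))) *
          (‖z - x‖ * ‖z + (x - 2 * c : ℝ)‖) := by
        calc ‖z‖ ^ 2 = ‖z‖ * ‖z‖ := sq _
          _ ≤ _ := mul_le_mul e2 e3 hzp.le (by positivity)
          _ = _ := by ring
      calc ‖F z - F x‖ * ‖z‖ ^ 2
          ≤ (C / c ^ 2 + ‖F x‖) * (((1 + x) * (1 + |x - 2 * c| / (x - c))) *
          (‖z - x‖ * ‖z + (x - 2 * c : ℝ)‖)) :=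
            mul_le_mul ((norm_sub_le _ _).trans (by gcongr)) e4 (by positivity)
              (by positivity)
        _ = _ := by rw [hD]; ring
  have hFi : Integrable fun η : ℝ => F (c + η * Complex.I) :=
    integrable_vertical hc hF fun η => hb _ (by simp)
  set a := x - c with hadef
  have hxa : (x : ℂ) = a + c := by rw [hadef]; push_cast; ring
  have hpos : ∀ η : ℝ, (a : ℂ) ^ 2 + (η : ℂ) ^ 2 ≠ 0 := fun η => by
    have : (a : ℝ) ^ 2 + η ^ 2 ≠ 0 := by positivity
    exact_mod_cast this
  have hm : ∀ η : ℝ, (a : ℂ) - η * Complex.I ≠ 0 := fun η h => by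
    have := congrArg Complex.re h; simp at this; linarith
  have hp : ∀ η : ℝ, (a : ℂ) + η * Complex.I ≠ 0 := fun η h => by
    have := congrArg Complex.re h; simp at this; linarith
  have hprod : ∀ η : ℝ, ((a : ℂ) - η * Complex.I) * (a + η * Complex.I) = a ^ 2 + η ^ 2 := fun η => by
    linear_combination (-(η : ℂ) ^ 2) * Complex.I_sq
  have icont : Continuous fun η : ℝ => ((a : ℂ) + η * Complex.I)⁻¹ :=
    Continuous.inv₀ (by fun_prop) hp
  have i1 : Integrable fun η : ℝ => F (c + η * Complex.I) * ((a : ℂ) + η * Complex.I)⁻¹ := by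
    refine hFi.mul_bdd (c := a⁻¹) icont.aestronglyMeasurable (Eventually.of_forall fun η => ?_)
    rw [norm_inv]
    exact inv_anti₀ ha (le_trans (by simp) (Complex.re_le_norm _))
  have i2 : Integrable fun η : ℝ => F (c + η * Complex.I) * (((a ^ 2 + η ^ 2)⁻¹ : ℝ) : ℂ) := by
    have hc2 : Continuous fun η : ℝ => (((a ^ 2 + η ^ 2)⁻¹ : ℝ) : ℂ) :=
      Complex.continuous_ofReal.comp (Continuous.inv₀ (by fun_prop) fun η => by positivity)
    refine hFi.mul_bdd (c := (a ^ 2)⁻¹) hc2.aestronglyMeasurable (Eventually.of_forall fun η => ?_)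
    rw [Complex.norm_real, Real.norm_of_nonneg (by positivity)]
    exact inv_anti₀ (by positivity) (by nlinarith [sq_nonneg η])
  have J1 : ∫ η : ℝ, F (c + η * Complex.I) * ((a : ℂ) + η * Complex.I)⁻¹ = 0 := by
    rw [← I1]
    congr 1 with η
    rw [div_eq_mul_inv, hadef]
    push_cast
    ring_nf
  have i3 : Integrable fun η : ℝ => F x * (((a ^ 2 + η ^ 2)⁻¹ : ℝ) : ℂ) :=
    (integrable_inv_sq_add_sq ha).ofReal.const_mul _
  have J2 : ∫ η : ℝ, F (c + η * Complex.I) * (((a ^ 2 + η ^ 2)⁻¹ : ℝ) : ℂ) =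
      F x * (Real.pi / a : ℝ) := by
    rw [← integral_inv_sq_add_sq ha, ← integral_complex_ofReal, ← integral_const_mul, ← sub_eq_zero,
      ← integral_sub i2 i3, ← neg_eq_zero,
      ← integral_neg, ← I2]
    congr 1 with η
    have hne : (c + η * Complex.I : ℂ) ≠ x := fun h => by
      have := congrArg Complex.re h; simp at this; linarith
    rw [dslope_of_ne _ hne, slope_def_field]
    have h1 : (c + η * Complex.I : ℂ) - x = -(a - η * Complex.I) := by rw [hxa]; ring
    have h2 : (c + η * Complex.I : ℂ) + (x - 2 * c : ℝ) = a + η * Complex.I := by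
      rw [hadef]; push_cast; ring
    rw [h1, h2, div_div, neg_mul, hprod]
    push_cast
    field_simp [hpos η]
  -- The identity 1/(a - iη) = 2a/(a² + η²) - 1/(a + iη): the Cauchy kernel is twice a Poisson
  -- kernel minus the reflected kernel, whose integral is zero.
  have : ∀ η : ℝ, F (c + η * Complex.I) / (x - (c + η * Complex.I)) =
      2 * a * (F (c + η * Complex.I) * (((a ^ 2 + η ^ 2)⁻¹ : ℝ) : ℂ)) -
        F (c + η * Complex.I) * ((a : ℂ) + η * Complex.I)⁻¹ := fun η => by
    have h1 : (x : ℂ) - (c + η * Complex.I) = a - η * Complex.I := by rw [hxa]; ring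
    rw [h1]
    push_cast
    rw [← hprod]
    field_simp [hm η, hp η]
    ring
  simp_rw [this]
  rw [integral_sub (i2.const_mul _) i1, integral_const_mul, J1, J2]
  have : (a : ℂ) ≠ 0 := by exact_mod_cast ha.ne'
  push_cast
  field_simp
  ring

/-! ### Inversion of the Laplace transform -/

/-- The integral of `e^{zt} F(z) / 2πi` over the line `Re z = c`. -/
def bromwich (F : ℂ → ℂ) (c t : ℝ) : ℂ :=
  (1 / (2 * Real.pi) : ℂ) * ∫ η : ℝ,
    Complex.exp ((c + η * Complex.I) * t) * F (c + η * Complex.I)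

theorem norm_exp_vertical (c η t : ℝ) :
    ‖Complex.exp ((c + η * Complex.I) * t)‖ = Real.exp (c * t) := by
  rw [Complex.norm_exp]
  simp

/-- Fubini: the integral in t of e^{-(x-z)t} is 1/(x - z), absolutely convergent since Re z = c < x,
and Cauchy's formula for the half-plane evaluates the rest. -/
theorem integral_exp_mul_bromwich {F : ℂ → ℂ} {c C x : ℝ} (hc : 0 < c) (hx : c < x)
    (hF : ∀ z : ℂ, c ≤ z.re → DifferentiableAt ℂ F z)
    (hb : ∀ z : ℂ, c ≤ z.re → ‖F z‖ ≤ C / ‖z‖ ^ 2) :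
    ∫ t in Ioi (0 : ℝ), (Real.exp (-x * t) : ℂ) * bromwich F c t = F x := by
  have hFi : Integrable fun η : ℝ => F (c + η * Complex.I) :=
    integrable_vertical hc hF fun η => hb _ (by simp)
  have hei : IntegrableOn (fun t : ℝ => Real.exp (-(x - c) * t)) (Ioi 0) :=
    integrableOn_exp_mul_Ioi (by linarith) 0
  have hint : Integrable (uncurry fun (t η : ℝ) =>
      (Real.exp (-x * t) : ℂ) * (Complex.exp ((c + η * Complex.I) * t) * F (c + η * Complex.I)))
      ((volume.restrict (Ioi 0)).prod volume) := by
    have := Integrable.mul_prod (μ := volume.restrict (Ioi (0 : ℝ))) (ν := volume)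
      hei.norm hFi.norm
    refine this.mono' ?_ (Eventually.of_forall fun p => ?_)
    · have h2 : Continuous fun η : ℝ => F (c + η * Complex.I) := continuous_vertical hF
      have : Continuous (uncurry fun (t η : ℝ) => (Real.exp (-x * t) : ℂ) *
          (Complex.exp ((c + η * Complex.I) * t) * F (c + η * Complex.I))) := by
        simp only [Function.uncurry_def]
        exact Continuous.mul (by fun_prop) (Continuous.mul (by fun_prop) (h2.comp continuous_snd))
      exact this.aestronglyMeasurable
    · simp only [uncurry]
      rw [norm_mul, norm_mul, norm_exp_vertical, Complex.norm_real, ← mul_assoc]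
      refine le_of_eq ?_
      congr 1
      rw [Real.norm_of_nonneg (Real.exp_nonneg _), Real.norm_of_nonneg (Real.exp_nonneg _),
        ← Real.exp_add]
      congr 1
      ring
  have e1 : ∀ t : ℝ, (Real.exp (-x * t) : ℂ) * bromwich F c t = (1 / (2 * Real.pi) : ℂ) *
      ∫ η : ℝ, (Real.exp (-x * t) : ℂ) *
        (Complex.exp ((c + η * Complex.I) * t) * F (c + η * Complex.I)) := fun t => by
    rw [integral_const_mul, bromwich]
    ring
  simp_rw [e1]
  rw [integral_const_mul, integral_integral_swap hint]
  have e2 : ∀ η : ℝ, ∫ t in Ioi (0 : ℝ), (Real.exp (-x * t) : ℂ) *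
        (Complex.exp ((c + η * Complex.I) * t) * F (c + η * Complex.I)) =
      F (c + η * Complex.I) / (x - (c + η * Complex.I)) := fun η => by
    have hre : ((c + η * Complex.I) - x : ℂ).re < 0 := by simp; linarith
    have h := integral_exp_mul_complex_Ioi hre 0
    have : ∀ t : ℝ, (Real.exp (-x * t) : ℂ) *
        (Complex.exp ((c + η * Complex.I) * t) * F (c + η * Complex.I)) =
        F (c + η * Complex.I) * Complex.exp (((c + η * Complex.I) - x) * t) := fun t => by
      push_cast
      rw [← mul_assoc, ← Complex.exp_add, mul_comm]
      congr 2
      ring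
    simp_rw [this]
    rw [integral_const_mul, h]
    have hne : ((c + η * Complex.I) - x : ℂ) ≠ 0 := fun h => by simp [h] at hre
    have hne' : (x - (c + η * Complex.I) : ℂ) ≠ 0 := fun h => hne (by linear_combination -h)
    simp only [Complex.ofReal_zero, mul_zero, Complex.exp_zero]
    field_simp
    ring
  simp_rw [e2]
  rw [integral_vertical_div_sub hc hx hF hb]
  have : (Real.pi : ℂ) ≠ 0 := by exact_mod_cast Real.pi_ne_zero
  field_simp

theorem bromwich_eq {F : ℂ → ℂ} {c d C : ℝ} (hc : 0 < c) (hcd : c ≤ d) (t : ℝ)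
    (hF : ∀ z : ℂ, c ≤ z.re → DifferentiableAt ℂ F z)
    (hb : ∀ z : ℂ, c ≤ z.re → ‖F z‖ ≤ C / ‖z‖ ^ 2) :
    bromwich F c t = bromwich F d t := by
  unfold bromwich
  congr 1
  refine integral_vertical_eq (H := fun z => Complex.exp (z * t) * F z)
    -- In the strip |e^{zt}| is at most e^{dt} or e^{ct}, according to the sign of t; the sum covers
    -- both cases.
    (C := (Real.exp (c * t) + Real.exp (d * t)) * C) hc hcd (fun z hz => ?_) fun z hz hz' => ?_
  · exact (by fun_prop : DifferentiableAt ℂ (fun z => Complex.exp (z * t)) z).mul (hF z hz)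
  · rw [norm_mul, mul_div_assoc]
    refine mul_le_mul ?_ (hb z hz) (norm_nonneg _) (by positivity)
    rw [Complex.norm_exp]
    simp only [Complex.mul_re, Complex.ofReal_re, Complex.ofReal_im, mul_zero, sub_zero]
    rcases le_total 0 t with ht | ht
    · have := Real.exp_le_exp.2 (mul_le_mul_of_nonneg_right hz' ht)
      linarith [Real.exp_pos (c * t)]
    · have := Real.exp_le_exp.2 (mul_le_mul_of_nonpos_right hz ht)
      linarith [Real.exp_pos (d * t)]

theorem bromwich_zero {F : ℂ → ℂ} {c C : ℝ} (hc : 0 < c)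
    (hF : ∀ z : ℂ, c ≤ z.re → DifferentiableAt ℂ F z)
    (hb : ∀ z : ℂ, c ≤ z.re → ‖F z‖ ≤ C / ‖z‖ ^ 2) : bromwich F c 0 = 0 := by
  unfold bromwich
  simp [integral_vertical_eq_zero hc hF hb]

theorem continuous_bromwich {F : ℂ → ℂ} {c : ℝ}
    (hF : Integrable fun η : ℝ => F (c + η * Complex.I)) : Continuous (bromwich F c) := by
  rw [continuous_iff_continuousAt]
  intro t₀
  refine ContinuousAt.mul continuousAt_const ?_
  refine continuousAt_of_dominated
    (bound := fun η => Real.exp (|c| * (|t₀| + 1)) * ‖F (c + η * Complex.I)‖) ?_ ?_ ?_ ?_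
  · refine Eventually.of_forall fun t => ?_
    have : Continuous fun η : ℝ => Complex.exp ((c + η * Complex.I) * t) := by fun_prop
    exact this.aestronglyMeasurable.mul hF.1
  · filter_upwards [Metric.ball_mem_nhds t₀ one_pos] with t ht
    refine Eventually.of_forall fun η => ?_
    rw [norm_mul, norm_exp_vertical]
    have : |t| ≤ |t₀| + 1 := by
      have h1 : |t - t₀| < 1 := ht
      have h2 : |t| ≤ |t - t₀| + |t₀| := by simpa using abs_add_le (t - t₀) t₀
      linarith
    refine mul_le_mul_of_nonneg_right (Real.exp_le_exp.2 ?_) (norm_nonneg _)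
    exact (le_abs_self _).trans ((abs_mul c t).le.trans (by gcongr))
  · exact hF.norm.const_mul _
  · exact Eventually.of_forall fun η => by fun_prop

theorem norm_bromwich_le (F : ℂ → ℂ) (c t : ℝ) :
    ‖bromwich F c t‖ ≤ Real.exp (c * t) * ∫ η : ℝ, ‖F (c + η * Complex.I)‖ := by
  unfold bromwich
  have h : ‖∫ η : ℝ, Complex.exp ((c + η * Complex.I) * t) * F (c + η * Complex.I)‖ ≤
      Real.exp (c * t) * ∫ η : ℝ, ‖F (c + η * Complex.I)‖ := by
    refine (norm_integral_le_integral_norm _).trans (le_of_eq ?_)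
    simp_rw [norm_mul, norm_exp_vertical]
    rw [integral_const_mul]
  have hpi : ‖(1 / (2 * Real.pi) : ℂ)‖ ≤ 1 := by
    rw [norm_div, norm_one, norm_mul, Complex.norm_real, Real.norm_of_nonneg Real.pi_pos.le]
    rw [div_le_one (by simp [Real.pi_pos])]
    have := Real.pi_gt_three
    simp
    linarith
  rw [norm_mul]
  exact (mul_le_mul hpi h (norm_nonneg _) zero_le_one).trans (by rw [one_mul])

/-! ### Completely monotone functions -/

/-- The first `n` derivatives of `f` on `(0,∞)` exist and have alternating signs. -/
def AltMono : ℕ → (ℝ → ℝ) → Prop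
  | 0, f => ∀ x, 0 < x → 0 ≤ f x
  | n + 1, f => (∀ x, 0 < x → 0 ≤ f x) ∧
      ∃ f' : ℝ → ℝ, (∀ x, 0 < x → HasDerivAt f (-f' x) x) ∧ AltMono n f'

namespace AltMono

theorem of_succ {n : ℕ} : ∀ {f : ℝ → ℝ}, AltMono (n + 1) f → AltMono n f := by
  induction n with
  | zero => exact fun h => h.1
  | succ n ih => exact fun ⟨h0, f', h1, h2⟩ => ⟨h0, f', h1, ih h2⟩

theorem add {n : ℕ} : ∀ {f g : ℝ → ℝ}, AltMono n f → AltMono n g → AltMono n fun x => f x + g x := by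
  induction n with
  | zero => exact fun hf hg x hx => add_nonneg (hf x hx) (hg x hx)
  | succ n ih =>
    rintro f g ⟨hf0, f', hf1, hf2⟩ ⟨hg0, g', hg1, hg2⟩
    refine ⟨fun x hx => add_nonneg (hf0 x hx) (hg0 x hx), _, fun x hx => ?_, ih hf2 hg2⟩
    exact ((hf1 x hx).fun_add (hg1 x hx)).congr_deriv (by ring)

theorem mul {n : ℕ} : ∀ {f g : ℝ → ℝ}, AltMono n f → AltMono n g → AltMono n fun x => f x * g x := by
  induction n with
  | zero => exact fun hf hg x hx => mul_nonneg (hf x hx) (hg x hx)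
  | succ n ih =>
    rintro f g hf hg
    have hf' := hf.of_succ
    have hg' := hg.of_succ
    obtain ⟨hf0, f', hf1, hf2⟩ := hf
    obtain ⟨hg0, g', hg1, hg2⟩ := hg
    refine ⟨fun x hx => mul_nonneg (hf0 x hx) (hg0 x hx), _, fun x hx => ?_,
      (ih hf2 hg').add (ih hf' hg2)⟩
    exact ((hf1 x hx).fun_mul (hg1 x hx)).congr_deriv (by ring)

theorem const {c : ℝ} (hc : 0 ≤ c) (n : ℕ) : AltMono n fun _ => c := by
  have h0 : ∀ n : ℕ, AltMono n fun _ => (0 : ℝ) := by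
    intro n
    induction n with
    | zero => exact fun x _ => le_rfl
    | succ n ih => exact ⟨fun x _ => le_rfl, _, fun x _ => by simpa using hasDerivAt_const x (0 : ℝ), ih⟩
  cases n with
  | zero => exact fun x _ => hc
  | succ n => exact ⟨fun x _ => hc, _, fun x _ => by simpa using hasDerivAt_const x c, h0 n⟩

/-- A solution of `f' = -φ f` is completely monotone if `φ` is. -/
theorem of_hasDerivAt_mul {f φ : ℝ → ℝ} (hf : ∀ x, 0 < x → 0 ≤ f x)
    (hφ : ∀ n, AltMono n φ) (hd : ∀ x, 0 < x → HasDerivAt f (-(φ x * f x)) x) (n : ℕ) :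
    AltMono n f := by
  induction n with
  | zero => exact hf
  | succ n ih => exact ⟨hf, _, hd, (hφ n).mul ih⟩

theorem rpow_neg {a : ℝ} (ha : 0 ≤ a) (n : ℕ) : AltMono n fun x => x ^ (-a) := by
  induction n generalizing a with
  | zero => exact fun x hx => Real.rpow_nonneg hx.le _
  | succ n ih =>
    refine ⟨fun x hx => Real.rpow_nonneg hx.le _, fun x => a * x ^ (-(a + 1)), fun x hx => ?_,
      (const ha n).mul (ih (by positivity))⟩
    exact (Real.hasDerivAt_rpow_const (p := -a) (Or.inl hx.ne')).congr_deriv (by ring_nf)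

end AltMono

/-- `1 / (1 + k x^α)` is completely monotone. -/
theorem altMono_inv_one_add {k α : ℝ} (hk : 0 ≤ k) (hα0 : 0 ≤ α) (hα1 : α ≤ 1) (n : ℕ) :
    AltMono n fun x => (1 + k * x ^ α)⁻¹ := by
  have hpos : ∀ x : ℝ, 0 < x → 0 < 1 + k * x ^ α := fun x hx => by positivity
  induction n with
  | zero => exact fun x hx => (inv_pos.2 (hpos x hx)).le
  | succ n ih =>
    -- The derivative contains the square of the function itself, so the induction hypothesis closes
    -- the loop.
    refine ⟨fun x hx => (inv_pos.2 (hpos x hx)).le,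
      fun x => (k * α * x ^ (-(1 - α))) * ((1 + k * x ^ α)⁻¹ * (1 + k * x ^ α)⁻¹), fun x hx => ?_,
      (((AltMono.const (mul_nonneg hk hα0) n)).mul (AltMono.rpow_neg (by linarith) n)).mul (ih.mul ih)⟩
    have h1 := ((Real.hasDerivAt_rpow_const (x := x) (p := α) (Or.inl hx.ne')).const_mul k).const_add 1
    refine (h1.fun_inv (hpos x hx).ne').congr_deriv ?_
    have := (hpos x hx).ne'
    rw [show -(1 - α) = α - 1 by ring]
    field_simp

/-- `e^{-τ g}` is completely monotone for `g(x) = x / (1 + k x^α)`. -/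
theorem altMono_exp_symbol {k α τ : ℝ} (hk : 0 ≤ k) (hα0 : 0 ≤ α) (hα1 : α ≤ 1) (hτ : 0 ≤ τ) (n : ℕ) :
    AltMono n fun x => Real.exp (-(τ * (x / (1 + k * x ^ α)))) := by
  have hpos : ∀ x : ℝ, 0 < x → 0 < 1 + k * x ^ α := fun x hx => by positivity
  -- Here φ = τg'. With d = 1 + kx^α one has g' = (1-α)/d + α/d², a combination of completely
  -- monotone functions with nonnegative coefficients.
  refine AltMono.of_hasDerivAt_mul (φ := fun x => τ * ((1 - α) * (1 + k * x ^ α)⁻¹ +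
    α * ((1 + k * x ^ α)⁻¹ * (1 + k * x ^ α)⁻¹))) (fun x _ => (Real.exp_pos _).le) (fun m => ?_)
    (fun x hx => ?_) n
  · have h := altMono_inv_one_add hk hα0 hα1 m
    exact (AltMono.const hτ m).mul (((AltMono.const (by linarith) m).mul h).add
      ((AltMono.const hα0 m).mul (h.mul h)))
  · have h1 := ((Real.hasDerivAt_rpow_const (x := x) (p := α) (Or.inl hx.ne')).const_mul k).const_add 1
    have h2 := (((hasDerivAt_id' x).fun_div h1 (hpos x hx).ne').const_mul τ).fun_neg.exp
    refine h2.congr_deriv ?_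
    have h3 : x ^ α = x * x ^ (α - 1) := by
      rw [Real.rpow_sub_one hx.ne']
      field_simp
    have := (hpos x hx).ne'
    field_simp
    rw [h3]
    ring

/-! ### A function with a completely monotone Laplace transform is nonnegative -/

theorem integrableOn_pow_mul_exp {f : ℝ → ℝ} {C x : ℝ} (hf : Continuous f)
    (hb : ∀ t, 0 < t → |f t| ≤ C * Real.exp t) (hx : 1 < x) (n : ℕ) :
    IntegrableOn (fun t => t ^ n * (Real.exp (-x * t) * f t)) (Ioi 0) := by
  have h := (integrableOn_rpow_mul_exp_neg_mul_rpow (s := n) (p := 1) (b := x - 1)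
    (by have := n.cast_nonneg (α := ℝ); linarith) one_pos (by linarith)).const_mul C
  refine h.mono' (by fun_prop) ?_
  refine (ae_restrict_iff' measurableSet_Ioi).2 (Eventually.of_forall fun t ht => ?_)
  have ht : 0 < t := ht
  rw [norm_mul, norm_mul, Real.norm_of_nonneg (by positivity), Real.norm_of_nonneg (by positivity),
    Real.rpow_natCast, Real.rpow_one]
  calc t ^ n * (Real.exp (-x * t) * ‖f t‖) ≤ t ^ n * (Real.exp (-x * t) * (C * Real.exp t)) := by
        gcongr; exact hb t ht
    _ = C * (t ^ n * (Real.exp (-x * t) * Real.exp t)) := by ring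
    _ = _ := by rw [← Real.exp_add]; ring_nf

theorem hasDerivAt_laplace {f : ℝ → ℝ} {C x : ℝ} (hf : Continuous f)
    (hb : ∀ t, 0 < t → |f t| ≤ C * Real.exp t) (hx : 1 < x) (n : ℕ) :
    HasDerivAt (fun y => ∫ t in Ioi (0 : ℝ), t ^ n * (Real.exp (-y * t) * f t))
      (-∫ t in Ioi (0 : ℝ), t ^ (n + 1) * (Real.exp (-x * t) * f t)) x := by
  have hx' : 1 < (x + 1) / 2 := by linarith
  have hC : 0 ≤ C := by
    have h1 := (abs_nonneg _).trans (hb 1 one_pos)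
    exact nonneg_of_mul_nonneg_left h1 (Real.exp_pos 1)
  have hbd := integrableOn_pow_mul_exp (f := fun t => C * Real.exp t) (C := C) (by fun_prop)
    (fun t ht => by rw [abs_of_nonneg (by positivity)]) hx' (n + 1)
  have hnhds : Ioi ((x + 1) / 2) ∈ 𝓝 x := Ioi_mem_nhds (by linarith)
  have := (hasDerivAt_integral_of_dominated_loc_of_deriv_le (μ := volume.restrict (Ioi (0 : ℝ)))
    (F := fun y t => t ^ n * (Real.exp (-y * t) * f t))
    (F' := fun y t => -(t ^ (n + 1) * (Real.exp (-y * t) * f t))) hnhds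
    (Eventually.of_forall fun y => by fun_prop)
    (integrableOn_pow_mul_exp hf hb hx n) (by fun_prop)
    (bound := fun t => t ^ (n + 1) * (Real.exp (-((x + 1) / 2) * t) * (C * Real.exp t)))
    ((ae_restrict_iff' measurableSet_Ioi).2 (Eventually.of_forall fun t ht y hy => ?_)) hbd
    (Eventually.of_forall fun t y _ => ?_)).2
  · rwa [integral_neg] at this
  · have ht : 0 < t := ht
    have hy : (x + 1) / 2 < y := hy
    rw [norm_neg, norm_mul, norm_mul, Real.norm_of_nonneg (by positivity),
      Real.norm_of_nonneg (by positivity)]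
    gcongr
    exact hb t ht
  · have h1 : HasDerivAt (fun y : ℝ => Real.exp (-y * t)) (Real.exp (-y * t) * (-1 * t)) y :=
      (((hasDerivAt_id' y).fun_neg).mul_const t).exp
    exact ((h1.mul_const (f t)).const_mul (t ^ n)).congr_deriv (by ring)

/-- Each derivative of the transform brings down a factor -t. The alternating signs of the
derivatives of L are therefore the signs of the integrals with t^n. -/
theorem laplace_nonneg {f : ℝ → ℝ} {L : ℝ → ℝ} {C : ℝ} (hf : Continuous f)
    (hb : ∀ t, 0 < t → |f t| ≤ C * Real.exp t) (hL : ∀ n, AltMono n L)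
    (h : ∀ x, 1 < x → ∫ t in Ioi (0 : ℝ), Real.exp (-x * t) * f t = L x) (n : ℕ) {x : ℝ} (hx : 1 < x) :
    0 ≤ ∫ t in Ioi (0 : ℝ), t ^ n * (Real.exp (-x * t) * f t) := by
  -- The order m stays free in the induction: M is the transform with the factor t^m, and its
  -- derivative is minus the transform with t^{m+1}.
  have key : ∀ m : ℕ, ∀ M : ℝ → ℝ, (∀ x, 1 < x →
      ∫ t in Ioi (0 : ℝ), t ^ m * (Real.exp (-x * t) * f t) = M x) → ∀ j, AltMono j M →
      ∀ x, 1 < x → 0 ≤ ∫ t in Ioi (0 : ℝ), t ^ (m + j) * (Real.exp (-x * t) * f t) := by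
    intro m M hM j
    induction j generalizing m M with
    | zero => exact fun hj x hx => by rw [add_zero, hM x hx]; exact hj x (by linarith)
    | succ j ih =>
      rintro ⟨h0, M', h1, h2⟩ x hx
      rw [show m + (j + 1) = (m + 1) + j by ring]
      refine ih (m + 1) M' (fun y hy => ?_) h2 x hx
      have d1 := hasDerivAt_laplace hf hb hy m
      have d2 : HasDerivAt (fun y => ∫ t in Ioi (0 : ℝ), t ^ m * (Real.exp (-y * t) * f t))
          (-M' y) y := (h1 y (by linarith)).congr_of_eventuallyEq
            (by filter_upwards [lt_mem_nhds hy] with z hz using hM z hz)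
      exact neg_injective (d1.unique d2)
  have := key 0 L (fun x hx => by simpa using h x hx) n (hL n) x hx
  simpa using this

/-- The function y e^{1-y} has the value 1 at y = 1 and stays below a constant less than 1 away from
it. Its powers are the approximate identity of the positivity proof. -/
theorem mul_exp_one_sub_le {d y : ℝ} (hd0 : 0 < d) (hd1 : d < 1) (h : d ≤ |y - 1|) :
    y * Real.exp (1 - y) ≤ max ((1 + d) * Real.exp (-d)) ((1 - d) * Real.exp d) := by
  rcases le_abs.1 h with h | h
  · refine le_trans ?_ (le_max_left _ _)
    have h1 := Real.add_one_le_exp (y - 1 - d)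
    have h2 : y ≤ (1 + d) * Real.exp (y - 1 - d) := by nlinarith
    calc y * Real.exp (1 - y) ≤ (1 + d) * Real.exp (y - 1 - d) * Real.exp (1 - y) := by gcongr
      _ = _ := by rw [mul_assoc, ← Real.exp_add]; ring_nf
  · refine le_trans ?_ (le_max_right _ _)
    have h1 := Real.add_one_le_exp (y - 1 + d)
    have h2 : y ≤ (1 - d) * Real.exp (y - 1 + d) := by nlinarith
    calc y * Real.exp (1 - y) ≤ (1 - d) * Real.exp (y - 1 + d) * Real.exp (1 - y) := by gcongr
      _ = _ := by rw [mul_assoc, ← Real.exp_add]; ring_nf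

theorem max_mul_exp_lt_one {d : ℝ} (hd0 : 0 < d) :
    max ((1 + d) * Real.exp (-d)) ((1 - d) * Real.exp d) < 1 := by
  have h1 := Real.add_one_lt_exp hd0.ne'
  have h2 := Real.add_one_lt_exp (neg_ne_zero.2 hd0.ne')
  refine max_lt ?_ ?_
  · calc (1 + d) * Real.exp (-d) < Real.exp d * Real.exp (-d) := by gcongr; linarith
      _ = 1 := by rw [← Real.exp_add]; simp
  · calc (1 - d) * Real.exp d < Real.exp (-d) * Real.exp d := by gcongr; linarith
      _ = 1 := by rw [← Real.exp_add]; simp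

/-- The Post–Widder argument. The powers of φ(t) = (t/t₀)e^{1-t/t₀} concentrate at t₀, and the
integral of φ^n e^{-2t} f is a positive multiple of the n-th moment at x = 2 + n/t₀, hence
nonnegative. If f(t₀) < 0, division by q'^n with q' < 1 keeps the negative part near t₀ while the
part far from t₀ tends to zero, a contradiction. -/
theorem nonneg_of_altMono_laplace {f : ℝ → ℝ} {L : ℝ → ℝ} {C : ℝ} (hf : Continuous f)
    (hb : ∀ t, 0 < t → |f t| ≤ C * Real.exp t) (hL : ∀ n, AltMono n L)
    (h : ∀ x, 1 < x → ∫ t in Ioi (0 : ℝ), Real.exp (-x * t) * f t = L x) {t₀ : ℝ} (ht₀ : 0 < t₀) :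
    0 ≤ f t₀ := by
  by_contra hneg
  push Not at hneg
  obtain ⟨ε, hε, hball⟩ : ∃ ε > 0, ∀ t, |t - t₀| < ε → f t < f t₀ / 2 := by
    have := (hf.tendsto t₀).eventually (gt_mem_nhds (show f t₀ < f t₀ / 2 by linarith))
    obtain ⟨ε, hε, h⟩ := Metric.eventually_nhds_iff.1 this
    exact ⟨ε, hε, fun t ht => h ht⟩
  obtain ⟨d, hd0, hd1, hdε⟩ : ∃ d : ℝ, 0 < d ∧ d < 1 ∧ d * t₀ < ε := by
    refine ⟨min (1 / 2) (ε / (2 * t₀)), by positivity, (min_le_left _ _).trans_lt (by norm_num), ?_⟩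
    calc _ ≤ ε / (2 * t₀) * t₀ := by gcongr; exact min_le_right _ _
      _ = ε / 2 := by field_simp
      _ < ε := by linarith
  set q := max ((1 + d) * Real.exp (-d)) ((1 - d) * Real.exp d) with hq
  have hq1 : q < 1 := max_mul_exp_lt_one hd0
  have hq0 : 0 < q := lt_max_of_lt_left (by positivity)
  set φ : ℝ → ℝ := fun t => t / t₀ * Real.exp (1 - t / t₀) with hφ
  have hφc : Continuous φ := by fun_prop
  have hφ0 : φ t₀ = 1 := by simp [hφ, ht₀.ne']
  -- Between the bound q of φ away from t₀ and its peak value 1: φ/q' exceeds 1 near t₀ and is at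
  -- most q/q' < 1 far from it.
  set q' := (1 + q) / 2 with hq'
  have hqq' : q < q' := by linarith
  have hq'0 : 0 < q' := by linarith
  obtain ⟨e, he0, hed, hball2⟩ : ∃ e > 0, e < d * t₀ ∧ ∀ t, |t - t₀| < e → q' < φ t := by
    have := (hφc.tendsto t₀).eventually (lt_mem_nhds (show q' < φ t₀ by rw [hφ0]; linarith))
    obtain ⟨e, he, h⟩ := Metric.eventually_nhds_iff.1 this
    have hp : 0 < d * t₀ := by positivity
    exact ⟨min e (d * t₀ / 2), by positivity, (min_le_right _ _).trans_lt (by linarith),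
      fun t ht => h (lt_of_lt_of_le ht (min_le_left _ _))⟩
  have hdt : d * t₀ < t₀ := by nlinarith
  have hout : ∀ t, d * t₀ ≤ |t - t₀| → φ t ≤ q := fun t ht => by
    refine mul_exp_one_sub_le hd0 hd1 ?_
    rw [show t / t₀ - 1 = (t - t₀) / t₀ by field_simp, abs_div, abs_of_pos ht₀, le_div_iff₀ ht₀]
    exact ht
  set k : ℝ → ℝ := fun t => Real.exp (-2 * t) * f t with hk
  have hki : IntegrableOn k (Ioi 0) := by
    have := integrableOn_pow_mul_exp hf hb (show (1 : ℝ) < 2 by norm_num) 0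
    simpa only [pow_zero, one_mul] using this
  set B : Set ℝ := {t | |t - t₀| < e} with hB
  have hBm : MeasurableSet B := (isOpen_lt (by fun_prop) (by fun_prop)).measurableSet
  set O : Set ℝ := {t | d * t₀ ≤ |t - t₀|} with hO
  have hOm : MeasurableSet O := (isClosed_le (by fun_prop) (by fun_prop)).measurableSet
  set g : ℕ → ℝ → ℝ := fun n t => B.indicator k t + O.indicator (fun t => (φ t / q') ^ n * |k t|) t
    with hg
  have hφnn : ∀ t, 0 < t → 0 ≤ φ t := fun t ht => by positivity
  have hgi : ∀ n, ∀ t, 0 < t → |O.indicator (fun t => (φ t / q') ^ n * |k t|) t| ≤ |k t| := by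
    intro n t ht
    by_cases htO : t ∈ O
    · rw [indicator_of_mem htO, abs_of_nonneg (mul_nonneg (pow_nonneg (div_nonneg (hφnn t ht)
        hq'0.le) n) (abs_nonneg _))]
      refine mul_le_of_le_one_left (abs_nonneg _) (pow_le_one₀ (div_nonneg (hφnn t ht) hq'0.le) ?_)
      rw [div_le_one hq'0]
      exact (hout t htO).trans hqq'.le
    · rw [indicator_of_notMem htO]
      simp
  have hgm : ∀ n, AEStronglyMeasurable (O.indicator (fun t => (φ t / q') ^ n * |k t|))
      (volume.restrict (Ioi 0)) := fun n =>
    (Continuous.aestronglyMeasurable (by fun_prop)).indicator hOm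
  have hOi : ∀ n, IntegrableOn (O.indicator (fun t => (φ t / q') ^ n * |k t|)) (Ioi 0) := fun n =>
    hki.abs.mono' (hgm n) ((ae_restrict_iff' measurableSet_Ioi).2 (Eventually.of_forall (hgi n)))
  have hlim : Tendsto (fun n => ∫ t in Ioi (0 : ℝ), O.indicator (fun t => (φ t / q') ^ n * |k t|) t)
      atTop (𝓝 (∫ t in Ioi (0 : ℝ), 0)) := by
    refine tendsto_integral_of_dominated_convergence (fun t => |k t|) hgm hki.abs
      (fun n => (ae_restrict_iff' measurableSet_Ioi).2 (Eventually.of_forall (hgi n)))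
      ((ae_restrict_iff' measurableSet_Ioi).2 (Eventually.of_forall fun t ht => ?_))
    by_cases htO : t ∈ O
    · simp_rw [indicator_of_mem htO]
      have := tendsto_pow_atTop_nhds_zero_of_lt_one (div_nonneg (hφnn t ht) hq'0.le)
        ((div_lt_one hq'0).2 ((hout t htO).trans_lt hqq'))
      simpa using this.mul_const |k t|
    · simp_rw [indicator_of_notMem htO]
      exact tendsto_const_nhds
  have hkneg : ∀ t, |t - t₀| < d * t₀ → k t < 0 := fun t ht => by
    have := hball t (ht.trans hdε)
    exact mul_neg_of_pos_of_neg (Real.exp_pos _) (by linarith)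
  -- On B the weight (φ/q')^n is at least 1 and k is negative, so k itself is a majorant. Between B
  -- and O the function k is still negative and can be dropped.
  have hge : ∀ n, 0 ≤ (∫ t in Ioi (0 : ℝ), B.indicator k t) +
      ∫ t in Ioi (0 : ℝ), O.indicator (fun t => (φ t / q') ^ n * |k t|) t := by
    intro n
    rw [← integral_add (hki.indicator hBm) (hOi n)]
    have hx : (1 : ℝ) < 2 + n / t₀ := by
      have : 0 ≤ n / t₀ := by positivity
      linarith
    have h1 := laplace_nonneg hf hb hL h n hx
    have h2 := mul_nonneg (show 0 ≤ (Real.exp 1 / (t₀ * q')) ^ n by positivity) h1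
    rw [← integral_const_mul] at h2
    refine h2.trans (integral_mono_ae ((integrableOn_pow_mul_exp hf hb hx n).const_mul _)
      ((hki.indicator hBm).add (hOi n)) ((ae_restrict_iff' measurableSet_Ioi).2
        (Eventually.of_forall fun t ht => ?_)))
    have e1 : (Real.exp 1 / (t₀ * q')) ^ n * (t ^ n * (Real.exp (-(2 + n / t₀) * t) * f t)) =
        (φ t / q') ^ n * k t := by
      have e2 : Real.exp (-(2 + n / t₀) * t) = Real.exp (-(t / t₀)) ^ n * Real.exp (-2 * t) := by
        rw [← Real.exp_nat_mul, ← Real.exp_add]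
        ring_nf
      have e3 : φ t = t / t₀ * (Real.exp 1 * Real.exp (-(t / t₀))) := by
        rw [← Real.exp_add, hφ]; ring_nf
      rw [e2, e3, hk]
      simp only [div_pow, mul_pow]
      field_simp
    simp only [Pi.add_apply]
    rw [e1]
    have hpow : 0 ≤ (φ t / q') ^ n := pow_nonneg (div_nonneg (hφnn t ht) hq'0.le) n
    by_cases htB : |t - t₀| < e
    · have htO : t ∉ O := fun h => by simp only [hO, mem_ofPred_eq] at h; linarith
      rw [indicator_of_mem (show t ∈ B from htB), indicator_of_notMem htO, add_zero]
      have h3 : 1 ≤ (φ t / q') ^ n := one_le_pow₀ ((one_le_div hq'0).2 (hball2 t htB).le)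
      nlinarith [hkneg t (htB.trans hed)]
    · rw [indicator_of_notMem (show t ∉ B from htB), zero_add]
      by_cases htO : t ∈ O
      · rw [indicator_of_mem htO]
        exact mul_le_mul_of_nonneg_left (le_abs_self _) hpow
      · rw [indicator_of_notMem htO]
        exact mul_nonpos_of_nonneg_of_nonpos hpow (hkneg t (not_le.1 htO)).le
  have hfin : 0 ≤ ∫ t in Ioi (0 : ℝ), B.indicator k t := by
    have := ge_of_tendsto' (hlim.const_add _) hge
    simpa using this
  have hBk : ∀ t, B.indicator k t ≤ 0 := fun t =>
    indicator_nonpos (fun t ht => (hkneg t (lt_trans ht hed)).le) t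
  have hz : ∫ t in Ioi (0 : ℝ), -B.indicator k t = 0 := by
    refine le_antisymm ?_ (integral_nonneg fun t => neg_nonneg.2 (hBk t))
    rw [integral_neg]; linarith
  rw [integral_eq_zero_iff_of_nonneg (fun t => neg_nonneg.2 (hBk t)) (hki.indicator hBm).neg] at hz
  have hz2 := (ae_restrict_iff' measurableSet_Ioi).1 hz
  have hBz : volume B = 0 := by
    refine measure_mono_null ?_ (ae_iff.1 hz2)
    intro t ht
    have ht' : |t - t₀| < e := ht
    simp only [mem_ofPred_eq, indicator_of_mem ht, Pi.zero_apply, neg_eq_zero, Classical.not_imp]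
    exact ⟨by have := (abs_lt.1 ht').1; simp only [mem_Ioi]; linarith, (hkneg t (ht'.trans hed)).ne⟩
  have hBo : IsOpen B := isOpen_lt (by fun_prop) (by fun_prop)
  exact (hBo.measure_pos volume ⟨t₀, by simp [hB, he0]⟩).ne' hBz

/-! ### The symbol in the right half-plane -/

section Symbol

variable {k α : ℝ}

theorem re_cpow_nonneg (hα0 : 0 < α) (hα1 : α < 1) {z : ℂ} (hz : 0 < z.re) :
    0 ≤ (z ^ (α : ℂ)).re := by
  rw [Complex.cpow_ofReal_re]
  have h := abs_lt.1 (Complex.abs_arg_lt_pi_div_two_iff.2 (Or.inl hz))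
  refine mul_nonneg (by positivity) (Real.cos_nonneg_of_mem_Icc ⟨?_, ?_⟩) <;>
    nlinarith [Real.pi_pos]

theorem one_le_re_one_add (hk : 0 < k) (hα0 : 0 < α) (hα1 : α < 1) {z : ℂ} (hz : 0 < z.re) :
    1 ≤ (1 + (k : ℂ) * z ^ (α : ℂ)).re := by
  have := mul_nonneg hk.le (re_cpow_nonneg hα0 hα1 hz)
  simpa using this

theorem one_le_norm_one_add (hk : 0 < k) (hα0 : 0 < α) (hα1 : α < 1) {z : ℂ} (hz : 0 < z.re) :
    1 ≤ ‖1 + (k : ℂ) * z ^ (α : ℂ)‖ :=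
  (one_le_re_one_add hk hα0 hα1 hz).trans (Complex.re_le_norm _)

theorem one_add_ne_zero (hk : 0 < k) (hα0 : 0 < α) (hα1 : α < 1) {z : ℂ} (hz : 0 < z.re) :
    1 + (k : ℂ) * z ^ (α : ℂ) ≠ 0 :=
  norm_pos_iff.1 (one_pos.trans_le (one_le_norm_one_add hk hα0 hα1 hz))

theorem differentiableAt_symbol (hk : 0 < k) (hα0 : 0 < α) (hα1 : α < 1) {z : ℂ} (hz : 0 < z.re) :
    DifferentiableAt ℂ (symbol k α) z := by
  have h1 : DifferentiableAt ℂ (fun z : ℂ => z ^ (α : ℂ)) z :=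
    differentiableAt_id.cpow (differentiableAt_const _) (Or.inl hz)
  exact differentiableAt_id.div ((h1.const_mul _).const_add _) (one_add_ne_zero hk hα0 hα1 hz)

/-- Multiplication by the conjugate of the denominator; the product of z and the conjugate of z^α
has argument (1-α) arg z. -/
theorem re_symbol_eq {z : ℂ} (hz : 0 < z.re) :
    (symbol k α z).re = (z.re + k * (‖z‖ ^ (1 + α) * Real.cos ((1 - α) * Complex.arg z))) /
      ‖1 + (k : ℂ) * z ^ (α : ℂ)‖ ^ 2 := by
  have hz0 : 0 < ‖z‖ := hz.trans_le (Complex.re_le_norm z)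
  rw [symbol, Complex.div_re, ← Complex.normSq_eq_norm_sq, ← add_div]
  congr 1
  have h1 : ‖z‖ ^ (1 + α) = ‖z‖ * ‖z‖ ^ α := by rw [Real.rpow_add hz0, Real.rpow_one]
  have h2 : (1 - α) * Complex.arg z = Complex.arg z - Complex.arg z * α := by ring
  rw [h1, h2, Real.cos_sub]
  have h3 := Complex.norm_mul_cos_arg z
  have h4 := Complex.norm_mul_sin_arg z
  have h5 : (1 + (k : ℂ) * z ^ (α : ℂ)).re = 1 + k * (‖z‖ ^ α * Real.cos (Complex.arg z * α)) := by
    rw [← Complex.cpow_ofReal_re]; simp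
  have h6 : (1 + (k : ℂ) * z ^ (α : ℂ)).im = k * (‖z‖ ^ α * Real.sin (Complex.arg z * α)) := by
    rw [← Complex.cpow_ofReal_im]; simp
  rw [h5, h6]
  linear_combination (-(k * ‖z‖ ^ α * Real.cos (Complex.arg z * α))) * h3 -
    (k * ‖z‖ ^ α * Real.sin (Complex.arg z * α)) * h4

/-- `Re g(z) ≥ m |z|^{1-α}` on `Re z ≥ c`. -/
theorem exists_le_re_symbol (hk : 0 < k) (hα0 : 0 < α) (hα1 : α < 1) {c : ℝ} (hc : 0 < c) :
    ∃ m > 0, ∀ z : ℂ, c ≤ z.re → m * ‖z‖ ^ (1 - α) ≤ (symbol k α z).re := by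
  have hcos : 0 < Real.cos ((1 - α) * (Real.pi / 2)) := by
    refine Real.cos_pos_of_mem_Ioo ⟨?_, ?_⟩ <;> nlinarith [Real.pi_pos]
  -- The cosine is smallest as arg z tends to ±π/2, and |1 + kz^α| ≤ (c^{-α} + k)|z|^α because |z| ≥
  -- c.
  refine ⟨k * Real.cos ((1 - α) * (Real.pi / 2)) / (c ^ (-α) + k) ^ 2, by positivity,
    fun z hz => ?_⟩
  have hz' : 0 < z.re := hc.trans_le hz
  have hzn : c ≤ ‖z‖ := hz.trans (Complex.re_le_norm z)
  have hz0 : 0 < ‖z‖ := hc.trans_le hzn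
  rw [re_symbol_eq hz']
  have hD : ‖1 + (k : ℂ) * z ^ (α : ℂ)‖ ≤ (c ^ (-α) + k) * ‖z‖ ^ α := by
    refine (norm_add_le _ _).trans ?_
    rw [norm_one, norm_mul, Complex.norm_real, Real.norm_of_nonneg hk.le, Complex.norm_cpow_real,
      add_mul]
    gcongr
    rw [Real.rpow_neg hc.le, ← div_eq_inv_mul, one_le_div (by positivity)]
    gcongr
  have hDp := one_pos.trans_le (one_le_norm_one_add hk hα0 hα1 hz')
  rw [le_div_iff₀ (by positivity)]
  have hc2 : Real.cos ((1 - α) * (Real.pi / 2)) ≤ Real.cos ((1 - α) * Complex.arg z) := by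
    rw [← Real.cos_abs ((1 - α) * Complex.arg z)]
    have h := (Complex.abs_arg_lt_pi_div_two_iff.2 (Or.inl hz')).le
    rw [abs_mul, abs_of_pos (by linarith : 0 < 1 - α)]
    refine Real.cos_le_cos_of_nonneg_of_le_pi (by have : 0 < 1 - α := by linarith
                                                  positivity) ?_ ?_
    · nlinarith [Real.pi_pos]
    · gcongr
  calc k * Real.cos ((1 - α) * (Real.pi / 2)) / (c ^ (-α) + k) ^ 2 * ‖z‖ ^ (1 - α) *
        ‖1 + (k : ℂ) * z ^ (α : ℂ)‖ ^ 2
      ≤ k * Real.cos ((1 - α) * (Real.pi / 2)) / (c ^ (-α) + k) ^ 2 * ‖z‖ ^ (1 - α) *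
        ((c ^ (-α) + k) * ‖z‖ ^ α) ^ 2 := by gcongr
    _ = k * ((‖z‖ ^ (1 - α) * (‖z‖ ^ α * ‖z‖ ^ α)) * Real.cos ((1 - α) * (Real.pi / 2))) := by
        field_simp
    _ = k * (‖z‖ ^ (1 + α) * Real.cos ((1 - α) * (Real.pi / 2))) := by
        rw [← Real.rpow_add hz0, ← Real.rpow_add hz0]; ring_nf
    _ ≤ k * (‖z‖ ^ (1 + α) * Real.cos ((1 - α) * Complex.arg z)) := by gcongr
    _ ≤ _ := by linarith

/-- Exponential decay traded for polynomial decay of any order: raise y/M ≤ e^{y/M} to the power M.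
-/
theorem exp_neg_le_rpow {M y : ℝ} (hM : 0 < M) (hy : 0 < y) : Real.exp (-y) ≤ (M / y) ^ M := by
  have h1 : y / M ≤ Real.exp (y / M) := by linarith [Real.add_one_le_exp (y / M)]
  have h2 : (y / M) ^ M ≤ Real.exp y := by
    calc (y / M) ^ M ≤ Real.exp (y / M) ^ M := by gcongr
      _ = Real.exp y := by rw [← Real.exp_mul]; congr 1; field_simp
  rw [Real.exp_neg, ← inv_div, Real.inv_rpow (by positivity)]
  exact inv_anti₀ (by positivity) h2

theorem norm_exp_symbol (τ : ℝ) (z : ℂ) :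
    ‖Complex.exp (-symbol k α z * τ)‖ = Real.exp (-(τ * (symbol k α z).re)) := by
  rw [Complex.norm_exp]
  simp
  ring

/-- Decay of `e^{-τ g(z)}` on `Re z ≥ c`. -/
theorem exists_norm_exp_symbol_le (hk : 0 < k) (hα0 : 0 < α) (hα1 : α < 1) {c : ℝ} (hc : 0 < c) :
    ∃ K > 0, ∃ m > 0, ∀ τ : ℝ, 0 < τ → ∀ z : ℂ, c ≤ z.re →
      ‖Complex.exp (-symbol k α z * τ)‖ ≤
        K * τ ^ (-(2 / (1 - α))) * Real.exp (-(m * τ)) / ‖z‖ ^ 2 := by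
  obtain ⟨m, hm, h⟩ := exists_le_re_symbol hk hα0 hα1 hc
  have h1α : 0 < 1 - α := by linarith
  -- This power turns |z|^{1-α} into |z|², the decay that makes integrals over vertical lines
  -- converge.
  set M := 2 / (1 - α) with hM
  have hM0 : 0 < M := by positivity
  refine ⟨(2 * M / m) ^ M, by positivity, m * c ^ (1 - α) / 2, by positivity, fun τ hτ z hz => ?_⟩
  have hzn : c ≤ ‖z‖ := hz.trans (Complex.re_le_norm z)
  have hz0 : 0 < ‖z‖ := hc.trans_le hzn
  rw [norm_exp_symbol]
  have e1 : Real.exp (-(τ * m * ‖z‖ ^ (1 - α) / 2)) ≤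
      (2 * M / m) ^ M * τ ^ (-M) * (‖z‖ ^ 2)⁻¹ := by
    refine (exp_neg_le_rpow hM0 (by positivity)).trans (le_of_eq ?_)
    rw [show M / (τ * m * ‖z‖ ^ (1 - α) / 2) = (2 * M / m) * τ⁻¹ * (‖z‖ ^ (1 - α))⁻¹ by field_simp,
      Real.mul_rpow (by positivity) (by positivity), Real.mul_rpow (by positivity) (by positivity),
      Real.inv_rpow hτ.le, ← Real.rpow_neg hτ.le, Real.inv_rpow (by positivity),
      ← Real.rpow_mul hz0.le, hM, mul_div_cancel₀ _ h1α.ne']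
    norm_num
  have e2 : Real.exp (-(τ * m * ‖z‖ ^ (1 - α) / 2)) ≤ Real.exp (-(m * c ^ (1 - α) / 2 * τ)) := by
    rw [Real.exp_le_exp, neg_le_neg_iff]
    have : c ^ (1 - α) ≤ ‖z‖ ^ (1 - α) := by gcongr
    nlinarith [mul_pos hτ hm]
  -- The exponent is split into halves: one gives the factor |z|⁻², the other the exponential decay
  -- in τ.
  calc Real.exp (-(τ * (symbol k α z).re))
      ≤ Real.exp (-(τ * m * ‖z‖ ^ (1 - α) / 2)) * Real.exp (-(τ * m * ‖z‖ ^ (1 - α) / 2)) := by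
        rw [← Real.exp_add, Real.exp_le_exp]
        nlinarith [h z hz]
    _ ≤ _ := mul_le_mul e1 e2 (Real.exp_pos _).le (by positivity)
    _ = _ := by ring

theorem symbol_ofReal {x : ℝ} (hx : 0 ≤ x) :
    symbol k α (x : ℂ) = ((x / (1 + k * x ^ α) : ℝ) : ℂ) := by
  rw [symbol, ← Complex.ofReal_cpow hx]
  push_cast
  rfl

theorem norm_symbol_div_le (hk : 0 < k) (hα0 : 0 < α) (hα1 : α < 1) {z : ℂ} (hz : 0 < z.re) :
    ‖symbol k α z / z‖ ≤ 1 := by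
  have hz0 : z ≠ 0 := fun h => by simp [h] at hz
  rw [symbol, div_div_cancel_left' hz0, norm_inv]
  exact inv_le_one_of_one_le₀ (one_le_norm_one_add hk hα0 hα1 hz)

end Symbol

/-! ### The subordination density -/

/-- The hypotheses on the coefficient and the order of the equation. -/
structure SymbolParams (k α : ℝ) : Prop where
  k_pos : 0 < k
  α_pos : 0 < α
  α_lt : α < 1

/-- The function `a(z) e^{-τ g(z)}`. -/
def damped (k α : ℝ) (a : ℂ → ℂ) (τ : ℝ) (z : ℂ) : ℂ :=
  a z * Complex.exp (-symbol k α z * τ)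

/-- `a` is holomorphic in the right half-plane, and bounded on `Re z ≥ c` for every `c > 0`. -/
structure Prefactor (a : ℂ → ℂ) : Prop where
  diff : ∀ z : ℂ, 0 < z.re → DifferentiableAt ℂ a z
  bdd : ∀ c : ℝ, 0 < c → ∃ A, ∀ z : ℂ, c ≤ z.re → ‖a z‖ ≤ A

section Damped

variable {k α : ℝ} {a : ℂ → ℂ}

theorem prefactor_inv : Prefactor fun z => z⁻¹ := by
  refine ⟨fun z hz => differentiableAt_inv (fun h => by simp [h] at hz), fun c hc => ⟨c⁻¹, fun z hz => ?_⟩⟩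
  rw [norm_inv]
  exact inv_anti₀ hc (hz.trans (Complex.re_le_norm z))

theorem prefactor_symbol_div (P : SymbolParams k α) : Prefactor fun z => symbol k α z / z :=
  ⟨fun z hz => (differentiableAt_symbol P.k_pos P.α_pos P.α_lt hz).div differentiableAt_id
    (fun h => by simp [h] at hz), fun c hc => ⟨1, fun z hz =>
      norm_symbol_div_le P.k_pos P.α_pos P.α_lt (hc.trans_le hz)⟩⟩

theorem differentiableAt_damped (P : SymbolParams k α) (ha : Prefactor a) (τ : ℝ) {z : ℂ}
    (hz : 0 < z.re) : DifferentiableAt ℂ (damped k α a τ) z :=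
  (ha.diff z hz).mul ((differentiableAt_symbol P.k_pos P.α_pos P.α_lt hz).neg.mul_const _).cexp

theorem exists_norm_damped_le (P : SymbolParams k α) (ha : Prefactor a) {c : ℝ} (hc : 0 < c) :
    ∃ K > 0, ∃ m > 0, ∀ τ : ℝ, 0 < τ → ∀ z : ℂ, c ≤ z.re →
      ‖damped k α a τ z‖ ≤ K * τ ^ (-(2 / (1 - α))) * Real.exp (-(m * τ)) / ‖z‖ ^ 2 := by
  obtain ⟨K, hK, m, hm, h⟩ := exists_norm_exp_symbol_le P.k_pos P.α_pos P.α_lt hc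
  obtain ⟨A, hA⟩ := ha.bdd c hc
  have hA0 : 0 ≤ A := (norm_nonneg _).trans (hA c (by simp))
  refine ⟨(A + 1) * K, by positivity, m, hm, fun τ hτ z hz => ?_⟩
  rw [damped, norm_mul]
  calc ‖a z‖ * ‖Complex.exp (-symbol k α z * τ)‖
      ≤ (A + 1) * (K * τ ^ (-(2 / (1 - α))) * Real.exp (-(m * τ)) / ‖z‖ ^ 2) :=
        mul_le_mul ((hA z hz).trans (by linarith)) (h τ hτ z hz) (norm_nonneg _) (by positivity)
    _ = _ := by ring

theorem integrable_damped (P : SymbolParams k α) (ha : Prefactor a) {τ c : ℝ} (hτ : 0 < τ)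
    (hc : 0 < c) : Integrable fun η : ℝ => damped k α a τ (c + η * Complex.I) := by
  obtain ⟨K, hK, m, hm, h⟩ := exists_norm_damped_le P ha hc
  exact integrable_vertical hc (fun z hz => differentiableAt_damped P ha τ (hc.trans_le hz))
    fun η => h τ hτ _ (by simp)

/-- Freedom in the choice of the line shows that the inverse transform grows more slowly than e^{ct}
for every c > 0, up to a constant. Its Laplace transform then exists for all x > 0, not only for x >
1. -/
theorem bromwich_damped_eq (P : SymbolParams k α) (ha : Prefactor a) {τ c d : ℝ} (hτ : 0 < τ)
    (hc : 0 < c) (hd : 0 < d) (t : ℝ) :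
    bromwich (damped k α a τ) c t = bromwich (damped k α a τ) d t := by
  have key : ∀ c d : ℝ, 0 < c → c ≤ d →
      bromwich (damped k α a τ) c t = bromwich (damped k α a τ) d t := by
    intro c d hc hcd
    obtain ⟨K, hK, m, hm, h⟩ := exists_norm_damped_le P ha hc
    exact bromwich_eq hc hcd t (fun z hz => differentiableAt_damped P ha τ (hc.trans_le hz))
      (h τ hτ)
  rcases le_total c d with hcd | hcd
  · exact key c d hc hcd
  · exact (key d c hd hcd).symm

/-- The inverse Laplace transform of `a(z) e^{-τ g(z)}`. -/
def invDamped (k α : ℝ) (a : ℂ → ℂ) (τ t : ℝ) : ℝ := (bromwich (damped k α a τ) 1 t).re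

theorem continuous_bromwich_damped (P : SymbolParams k α) (ha : Prefactor a) {τ : ℝ} (hτ : 0 < τ) :
    Continuous (bromwich (damped k α a τ) 1) :=
  continuous_bromwich (integrable_damped P ha hτ one_pos)

theorem continuous_invDamped (P : SymbolParams k α) (ha : Prefactor a) {τ : ℝ} (hτ : 0 < τ) :
    Continuous (invDamped k α a τ) :=
  Complex.continuous_re.comp (continuous_bromwich_damped P ha hτ)

theorem invDamped_zero (P : SymbolParams k α) (ha : Prefactor a) {τ : ℝ} (hτ : 0 < τ) :
    invDamped k α a τ 0 = 0 := by
  obtain ⟨K, hK, m, hm, h⟩ := exists_norm_damped_le P ha one_pos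
  have := bromwich_zero one_pos
    (fun z hz => differentiableAt_damped P ha τ (one_pos.trans_le hz)) (h τ hτ)
  rw [invDamped, this, Complex.zero_re]

theorem norm_bromwich_damped_le (P : SymbolParams k α) (ha : Prefactor a) {τ c : ℝ} (hτ : 0 < τ)
    (hc : 0 < c) (t : ℝ) : ‖bromwich (damped k α a τ) 1 t‖ ≤
      (∫ η : ℝ, ‖damped k α a τ (c + η * Complex.I)‖) * Real.exp (c * t) := by
  rw [bromwich_damped_eq P ha hτ one_pos hc, mul_comm]
  exact norm_bromwich_le _ _ _

theorem abs_invDamped_le (P : SymbolParams k α) (ha : Prefactor a) {τ c : ℝ} (hτ : 0 < τ)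
    (hc : 0 < c) (t : ℝ) : |invDamped k α a τ t| ≤
      (∫ η : ℝ, ‖damped k α a τ (c + η * Complex.I)‖) * Real.exp (c * t) :=
  (Complex.abs_re_le_norm _).trans (norm_bromwich_damped_le P ha hτ hc t)

theorem integrableOn_exp_mul_of_norm_le {E : Type*} [NormedAddCommGroup E] [NormedSpace ℝ E]
    {f : ℝ → E} {C c x : ℝ} (hf : Continuous f)
    (hb : ∀ t, ‖f t‖ ≤ C * Real.exp (c * t)) (hx : c < x) :
    IntegrableOn (fun t => Real.exp (-x * t) • f t) (Ioi 0) := by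
  have h : IntegrableOn (fun t : ℝ => C * Real.exp (-(x - c) * t)) (Ioi 0) :=
    (integrableOn_exp_mul_Ioi (by linarith) 0).const_mul C
  refine h.mono' (by fun_prop) (Eventually.of_forall fun t => ?_)
  rw [norm_smul, Real.norm_of_nonneg (Real.exp_nonneg _)]
  calc Real.exp (-x * t) * ‖f t‖ ≤ Real.exp (-x * t) * (C * Real.exp (c * t)) := by
        gcongr; exact hb t
    _ = C * (Real.exp (-x * t) * Real.exp (c * t)) := by ring
    _ = _ := by rw [← Real.exp_add]; ring_nf

theorem integrableOn_exp_mul_invDamped (P : SymbolParams k α) (ha : Prefactor a) {τ x : ℝ}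
    (hτ : 0 < τ) (hx : 0 < x) :
    IntegrableOn (fun t => Real.exp (-x * t) * invDamped k α a τ t) (Ioi 0) :=
  integrableOn_exp_mul_of_norm_le (continuous_invDamped P ha hτ)
    (abs_invDamped_le P ha hτ (half_pos hx)) (half_lt_self hx)

theorem laplace_invDamped (P : SymbolParams k α) (ha : Prefactor a) {τ x : ℝ} (hτ : 0 < τ)
    (hx : 0 < x) : ∫ t in Ioi (0 : ℝ), Real.exp (-x * t) * invDamped k α a τ t =
      (damped k α a τ x).re := by
  -- The inversion is carried out on the line Re z = x/2, to the left of x.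
  obtain ⟨K, hK, m, hm, h⟩ := exists_norm_damped_le P ha (half_pos hx)
  have h1 := integral_exp_mul_bromwich (half_pos hx) (half_lt_self hx)
    (fun z hz => differentiableAt_damped P ha τ ((half_pos hx).trans_le hz)) (h τ hτ)
  rw [← h1]
  have hi : IntegrableOn (fun t => (Real.exp (-x * t) : ℂ) * bromwich (damped k α a τ) (x / 2) t)
      (Ioi 0) := by
    have := integrableOn_exp_mul_of_norm_le (continuous_bromwich_damped P ha hτ)
      (norm_bromwich_damped_le P ha hτ (half_pos hx)) (half_lt_self hx)
    refine this.congr (Eventually.of_forall fun t => ?_)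
    simp only [Complex.real_smul]
    rw [bromwich_damped_eq P ha hτ one_pos (half_pos hx)]
  have h2 := (Complex.reCLM.integral_comp_comm hi)
  simp only [Complex.reCLM_apply] at h2
  rw [← h2]
  refine integral_congr_ae (Eventually.of_forall fun t => ?_)
  simp only [Complex.re_ofReal_mul]
  rw [invDamped, bromwich_damped_eq P ha hτ one_pos (half_pos hx)]

theorem invDamped_nonneg (P : SymbolParams k α) (ha : Prefactor a) {τ t : ℝ} (hτ : 0 < τ)
    (ht : 0 ≤ t) {L : ℝ → ℝ} (hL : ∀ n, AltMono n L)
    (h : ∀ x : ℝ, 0 < x → (damped k α a τ x).re = L x) : 0 ≤ invDamped k α a τ t := by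
  rcases ht.eq_or_lt with rfl | ht
  · rw [invDamped_zero P ha hτ]
  · refine nonneg_of_altMono_laplace (C := ∫ η : ℝ, ‖damped k α a τ ((1 : ℝ) + η * Complex.I)‖)
      (continuous_invDamped P ha hτ) (fun t _ => ?_) hL (fun x hx => ?_) ht
    · simpa using abs_invDamped_le P ha hτ one_pos t
    · rw [laplace_invDamped P ha hτ (one_pos.trans hx), h x (one_pos.trans hx)]

theorem exp_damped_ofReal {x : ℝ} (hx : 0 ≤ x) (τ : ℝ) :
    Complex.exp (-symbol k α x * τ) = (Real.exp (-(τ * (x / (1 + k * x ^ α)))) : ℝ) := by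
  rw [symbol_ofReal hx]
  push_cast
  ring_nf

theorem hasDerivAt_re_const_mul {f : ℝ → ℂ} {f' c : ℂ} {t : ℝ} (h : HasDerivAt f f' t) :
    HasDerivAt (fun t => (c * f t).re) (c * f').re t :=
  Complex.reCLM.hasFDerivAt.comp_hasDerivAt t (h.const_mul c)

theorem aestronglyMeasurable_vertical_damped (P : SymbolParams k α) (ha : Prefactor a) (τ t : ℝ) :
    AEStronglyMeasurable fun η : ℝ => Complex.exp (((1 : ℝ) + η * Complex.I) * t) *
      damped k α a τ ((1 : ℝ) + η * Complex.I) := by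
  have h1 : Continuous fun η : ℝ => Complex.exp (((1 : ℝ) + η * Complex.I) * t) := by fun_prop
  exact (h1.mul (continuous_vertical fun z hz =>
    differentiableAt_damped P ha τ (one_pos.trans_le hz))).aestronglyMeasurable

theorem integrable_vertical_damped (P : SymbolParams k α) (ha : Prefactor a) {τ : ℝ} (hτ : 0 < τ)
    (t : ℝ) : Integrable fun η : ℝ => Complex.exp (((1 : ℝ) + η * Complex.I) * t) *
      damped k α a τ ((1 : ℝ) + η * Complex.I) := by
  refine ((integrable_damped P ha hτ one_pos).norm.const_mul (Real.exp (1 * t))).mono'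
    (aestronglyMeasurable_vertical_damped P ha τ t) (Eventually.of_forall fun η => ?_)
  rw [norm_mul, norm_exp_vertical]

/-- Differentiation in τ multiplies the prefactor by -g, and differentiation in t multiplies it by
z. The first rule identifies the density as minus the derivative of the tail, the second gives the
monotonicity of the tail in t. -/
theorem hasDerivAt_invDamped_right (P : SymbolParams k α) (ha : Prefactor a)
    (hb : Prefactor fun z => symbol k α z * a z) {τ : ℝ} (hτ : 0 < τ) (t : ℝ) :
    HasDerivAt (fun τ => invDamped k α a τ t)
      (-invDamped k α (fun z => symbol k α z * a z) τ t) τ := by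
  obtain ⟨K, hK, m, hm, h⟩ := exists_norm_damped_le P hb one_pos
  -- The bound on the integrand blows up at τ = 0, so τ is kept away from zero.
  have hnhds : Ioi (τ / 2) ∈ 𝓝 τ := Ioi_mem_nhds (by linarith)
  have hM : 0 < 2 / (1 - α) := by have := P.α_lt; exact div_pos two_pos (by linarith)
  have key := (hasDerivAt_integral_of_dominated_loc_of_deriv_le (μ := volume)
    (F := fun (τ : ℝ) (η : ℝ) => Complex.exp (((1 : ℝ) + η * Complex.I) * t) *
      damped k α a τ ((1 : ℝ) + η * Complex.I))
    (F' := fun (τ : ℝ) (η : ℝ) => -(Complex.exp (((1 : ℝ) + η * Complex.I) * t) *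
      damped k α (fun z => symbol k α z * a z) τ ((1 : ℝ) + η * Complex.I)))
    (bound := fun η => (Real.exp (1 * t) * (K * (τ / 2) ^ (-(2 / (1 - α))))) *
      ((1 : ℝ) ^ 2 + η ^ 2)⁻¹)
    hnhds (Eventually.of_forall fun τ => aestronglyMeasurable_vertical_damped P ha τ t)
    (integrable_vertical_damped P ha hτ t) (aestronglyMeasurable_vertical_damped P hb τ t).neg
    (Eventually.of_forall fun η τ' hτ' => ?_) ((integrable_inv_sq_add_sq one_pos).const_mul _)
    (Eventually.of_forall fun η τ' _ => ?_)).2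
  · rw [integral_neg] at key
    refine (hasDerivAt_re_const_mul (c := (1 / (2 * Real.pi) : ℂ)) key).congr_deriv ?_
    rw [mul_neg, Complex.neg_re]
    rfl
  · have hτ' : τ / 2 < τ' := hτ'
    have hτ0 : 0 < τ' := (half_pos hτ).trans hτ'
    rw [norm_neg, norm_mul, norm_exp_vertical, mul_assoc]
    gcongr
    refine (h τ' hτ0 _ (by simp)).trans ?_
    rw [norm_sq_vertical, div_eq_mul_inv]
    refine mul_le_mul_of_nonneg_right ?_ (by positivity)
    calc K * τ' ^ (-(2 / (1 - α))) * Real.exp (-(m * τ'))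
        ≤ K * (τ / 2) ^ (-(2 / (1 - α))) * 1 := by
          have h1 : τ' ^ (-(2 / (1 - α))) ≤ (τ / 2) ^ (-(2 / (1 - α))) :=
            Real.rpow_le_rpow_of_nonpos (half_pos hτ) hτ'.le (by linarith)
          have h2 : Real.exp (-(m * τ')) ≤ 1 := Real.exp_le_one_iff.2 (by
            have := mul_pos hm hτ0; linarith)
          gcongr
      _ = _ := mul_one _
  · have h1 : HasDerivAt (fun τ : ℝ => Complex.exp (-symbol k α ((1 : ℝ) + η * Complex.I) * τ))
        (Complex.exp (-symbol k α ((1 : ℝ) + η * Complex.I) * τ') *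
          (-symbol k α ((1 : ℝ) + η * Complex.I) * 1)) τ' :=
      ((Complex.ofRealCLM.hasDerivAt (x := τ')).const_mul _).cexp
    refine ((h1.const_mul (a ((1 : ℝ) + η * Complex.I))).const_mul _).congr_deriv ?_
    simp only [damped]
    ring

theorem hasDerivAt_invDamped_left (P : SymbolParams k α) (ha : Prefactor a)
    (hb : Prefactor fun z => z * a z) {τ : ℝ} (hτ : 0 < τ) (t : ℝ) :
    HasDerivAt (invDamped k α a τ) (invDamped k α (fun z => z * a z) τ t) t := by
  have hnhds : Iio (t + 1) ∈ 𝓝 t := Iio_mem_nhds (by linarith)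
  have key := (hasDerivAt_integral_of_dominated_loc_of_deriv_le (𝕜 := ℝ) (μ := (volume : Measure ℝ))
    (F := fun (t : ℝ) (η : ℝ) => Complex.exp (((1 : ℝ) + η * Complex.I) * t) *
      damped k α a τ ((1 : ℝ) + η * Complex.I))
    (F' := fun (t : ℝ) (η : ℝ) => Complex.exp (((1 : ℝ) + η * Complex.I) * t) *
      damped k α (fun z => z * a z) τ ((1 : ℝ) + η * Complex.I))
    (bound := fun η => Real.exp (t + 1) *
      ‖damped k α (fun z => z * a z) τ ((1 : ℝ) + η * Complex.I)‖)
    hnhds (Eventually.of_forall fun t => aestronglyMeasurable_vertical_damped P ha τ t)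
    (integrable_vertical_damped P ha hτ t) (aestronglyMeasurable_vertical_damped P hb τ t)
    (Eventually.of_forall fun η t' ht' => ?_)
    ((integrable_damped P hb hτ one_pos).norm.const_mul _)
    (Eventually.of_forall fun η t' _ => ?_)).2
  · exact hasDerivAt_re_const_mul (c := (1 / (2 * Real.pi) : ℂ)) key
  · have ht' : t' < t + 1 := ht'
    rw [norm_mul, norm_exp_vertical, one_mul]
    gcongr
  · have h1 : HasDerivAt (fun t : ℝ => Complex.exp (((1 : ℝ) + η * Complex.I) * t))
        (Complex.exp (((1 : ℝ) + η * Complex.I) * t') * (((1 : ℝ) + η * Complex.I) * 1)) t' :=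
      ((Complex.ofRealCLM.hasDerivAt (x := t')).const_mul _).cexp
    refine (h1.mul_const _).congr_deriv ?_
    simp only [damped]
    ring

end Damped

/-! ### The density and its distribution function -/

section Density

variable {k α : ℝ}

/-- The density in `τ` with `S_α(t) = ∫ subDens t τ e^{τΔ} dτ`. -/
def subDens (k α t τ : ℝ) : ℝ := invDamped k α (fun z => symbol k α z / z) τ t

/-- `∫_τ^∞ subDens t`. -/
def subTail (k α t τ : ℝ) : ℝ := invDamped k α (fun z => z⁻¹) τ t

/-- The transform in t is (1 + kx^α)⁻¹e^{-τg(x)}, a product of completely monotone functions. -/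
theorem subDens_nonneg (P : SymbolParams k α) {t τ : ℝ} (ht : 0 ≤ t) (hτ : 0 < τ) :
    0 ≤ subDens k α t τ := by
  refine invDamped_nonneg P (prefactor_symbol_div P) hτ ht (fun n =>
    (altMono_inv_one_add P.k_pos.le P.α_pos.le P.α_lt.le n).mul
    (altMono_exp_symbol P.k_pos.le P.α_pos.le P.α_lt.le hτ.le n)) fun x hx => ?_
  rw [damped, exp_damped_ofReal hx.le, symbol_ofReal hx.le, Complex.re_mul_ofReal,
    ← Complex.ofReal_div, Complex.ofReal_re, div_div_cancel_left' hx.ne']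

/-- The derivative in t has the transform e^{-τg(x)}, which is completely monotone, so this
derivative is nonnegative. -/
theorem monotoneOn_subTail (P : SymbolParams k α) {τ : ℝ} (hτ : 0 < τ) :
    MonotoneOn (fun t => subTail k α t τ) (Ici 0) := by
  have hb : Prefactor fun z : ℂ => z * z⁻¹ := by
    refine ⟨fun z hz => differentiableAt_id.mul (prefactor_inv.diff z hz), fun c hc => ⟨1, fun z _ => ?_⟩⟩
    rcases eq_or_ne z 0 with rfl | h
    · simp
    · simp [h]
  refine monotoneOn_of_deriv_nonneg (convex_Ici 0)
    (continuous_invDamped P prefactor_inv hτ).continuousOn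
    (fun t _ => (hasDerivAt_invDamped_left P prefactor_inv hb hτ t).differentiableAt.differentiableWithinAt)
    fun t ht => ?_
  rw [interior_Ici] at ht
  rw [show (fun t => subTail k α t τ) = invDamped k α (fun z => z⁻¹) τ from rfl,
    (hasDerivAt_invDamped_left P prefactor_inv hb hτ t).deriv]
  refine invDamped_nonneg P hb hτ (le_of_lt ht)
    (altMono_exp_symbol P.k_pos.le P.α_pos.le P.α_lt.le hτ.le) fun x hx => ?_
  have : (x : ℂ) ≠ 0 := by exact_mod_cast hx.ne'
  rw [damped, exp_damped_ofReal hx.le, mul_inv_cancel₀ this, one_mul, Complex.ofReal_re]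

theorem subTail_zero (P : SymbolParams k α) {τ : ℝ} (hτ : 0 < τ) : subTail k α 0 τ = 0 :=
  invDamped_zero P prefactor_inv hτ

theorem subTail_nonneg (P : SymbolParams k α) {t τ : ℝ} (ht : 0 ≤ t) (hτ : 0 < τ) :
    0 ≤ subTail k α t τ := by
  rw [← subTail_zero P hτ]
  exact monotoneOn_subTail P hτ self_mem_Ici ht ht

theorem continuous_subTail (P : SymbolParams k α) {τ : ℝ} (hτ : 0 < τ) :
    Continuous fun t => subTail k α t τ := continuous_invDamped P prefactor_inv hτ

theorem hasDerivAt_subTail (P : SymbolParams k α) {τ : ℝ} (hτ : 0 < τ) (t : ℝ) :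
    HasDerivAt (fun τ => subTail k α t τ) (-subDens k α t τ) τ := by
  have e : (fun z => symbol k α z * z⁻¹) = fun z => symbol k α z / z := by
    funext z
    rw [div_eq_mul_inv]
  have h := hasDerivAt_invDamped_right P prefactor_inv (by rw [e]; exact prefactor_symbol_div P) hτ t
  rw [e] at h
  exact h

theorem laplace_subTail (P : SymbolParams k α) {τ x : ℝ} (hτ : 0 < τ) (hx : 0 < x) :
    ∫ t in Ioi (0 : ℝ), Real.exp (-x * t) * subTail k α t τ =
      x⁻¹ * Real.exp (-(τ * (x / (1 + k * x ^ α)))) := by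
  rw [show (fun t => Real.exp (-x * t) * subTail k α t τ) =
    fun t => Real.exp (-x * t) * invDamped k α (fun z => z⁻¹) τ t from rfl,
    laplace_invDamped P prefactor_inv hτ hx, damped, exp_damped_ofReal hx.le,
    Complex.re_mul_ofReal, ← Complex.ofReal_inv, Complex.ofReal_re]

/-- By monotonicity in t, the part of the Laplace integral over (t,∞) is at least x⁻¹e^{-xt} times
the tail at t, while the whole integral is at most x⁻¹. This leaves the bound e^{xt}, and x → 0. -/
theorem subTail_le_one (P : SymbolParams k α) {t τ : ℝ} (ht : 0 ≤ t) (hτ : 0 < τ) :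
    subTail k α t τ ≤ 1 := by
  have key : ∀ x : ℝ, 0 < x → subTail k α t τ ≤ Real.exp (x * t) := by
    intro x hx
    have hi := integrableOn_exp_mul_invDamped P prefactor_inv hτ hx
    have h1 : ∫ s in Ioi t, Real.exp (-x * s) * subTail k α t τ ≤
        ∫ s in Ioi (0 : ℝ), Real.exp (-x * s) * subTail k α s τ := by
      refine (setIntegral_mono_on ((integrableOn_exp_mul_Ioi (by linarith) t).mul_const _)
        (hi.mono_set (Ioi_subset_Ioi ht)) measurableSet_Ioi fun s hs => ?_).trans
        (setIntegral_mono_set hi ?_ (Ioi_subset_Ioi ht).eventuallyLE)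
      · exact mul_le_mul_of_nonneg_left
          (monotoneOn_subTail P hτ ht (mem_Ici.2 (ht.trans (mem_Ioi.1 hs).le)) (mem_Ioi.1 hs).le) (Real.exp_nonneg _)
      · refine (ae_restrict_iff' measurableSet_Ioi).2 (Eventually.of_forall fun s hs => ?_)
        exact mul_nonneg (Real.exp_nonneg _) (subTail_nonneg P (mem_Ioi.1 hs).le hτ)
    rw [laplace_subTail P hτ hx, integral_mul_const, integral_exp_mul_Ioi (by linarith)] at h1
    have h2 : Real.exp (-(τ * (x / (1 + k * x ^ α)))) ≤ 1 := Real.exp_le_one_iff.2 (by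
      have := P.k_pos
      have : 0 ≤ τ * (x / (1 + k * x ^ α)) := by positivity
      linarith)
    have h3 : x⁻¹ * Real.exp (-(τ * (x / (1 + k * x ^ α)))) ≤ x⁻¹ * 1 := by gcongr
    have h4 : Real.exp (-x * t) * subTail k α t τ ≤ 1 := by
      have h5 := h1.trans h3
      rw [div_mul_eq_mul_div, div_le_iff_of_neg (by linarith)] at h5
      rw [show x⁻¹ * 1 * -x = -1 by field_simp] at h5
      linarith
    calc subTail k α t τ = Real.exp (x * t) * (Real.exp (-x * t) * subTail k α t τ) := by
          rw [← mul_assoc, ← Real.exp_add]; simp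
      _ ≤ Real.exp (x * t) * 1 := by gcongr
      _ = _ := mul_one _
  have hlim : Tendsto (fun x : ℝ => Real.exp (x * t)) (𝓝[>] 0) (𝓝 1) := by
    have : Continuous fun x : ℝ => Real.exp (x * t) := by fun_prop
    simpa using (this.tendsto 0).mono_left nhdsWithin_le_nhds
  exact ge_of_tendsto hlim (eventually_mem_nhdsWithin.mono fun x hx => key x hx)

/-- The bracket enters here, through g(1/t) = 1/⟨t⟩. In the Laplace integral at x = 1/t the tail is
bounded by its value at t before time t and by 1 afterwards. This gives e^{-τ/⟨t⟩} ≤ 1 - (1 - e⁻¹)(1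
- tail), and the left side is at least 1 - τ/⟨t⟩. -/
theorem one_sub_subTail_le (P : SymbolParams k α) {t τ : ℝ} (ht : 0 < t) (hτ : 0 < τ) :
    (1 - subTail k α t τ) * (1 - Real.exp (-1)) ≤ τ / bracket k α t := by
  have hx : 0 < t⁻¹ := inv_pos.2 ht
  set x := t⁻¹ with hxt
  have hi := integrableOn_exp_mul_invDamped P prefactor_inv hτ hx
  have hi2 := integrableOn_exp_mul_Ioi (a := -x) (by linarith) 0
  have h0 := laplace_subTail P hτ hx
  have hle : ∫ s in Ioi (0 : ℝ), Real.exp (-x * s) * subTail k α s τ ≤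
      ∫ s in Ioi (0 : ℝ), (Real.exp (-x * s) * subTail k α t τ +
        (Ioi t).indicator (fun s => Real.exp (-x * s) * (1 - subTail k α t τ)) s) := by
    refine setIntegral_mono_on hi ((hi2.mul_const _).add ((hi2.mul_const _).indicator
      measurableSet_Ioi)) measurableSet_Ioi fun s hs => ?_
    have he := Real.exp_nonneg (-x * s)
    by_cases hst : s ∈ Ioi t
    · rw [indicator_of_mem hst]
      have := mul_le_mul_of_nonneg_left (subTail_le_one P (mem_Ioi.1 hs).le hτ) he
      linarith
    · rw [indicator_of_notMem hst, add_zero]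
      exact mul_le_mul_of_nonneg_left
        (monotoneOn_subTail P hτ (mem_Ici.2 (mem_Ioi.1 hs).le) (mem_Ici.2 ht.le) (not_lt.1 hst)) he
  rw [h0, integral_add (hi2.mul_const _) ((hi2.mul_const _).indicator measurableSet_Ioi),
    setIntegral_indicator measurableSet_Ioi, integral_mul_const, integral_mul_const,
    inter_eq_self_of_subset_right (Ioi_subset_Ioi ht.le), integral_exp_mul_Ioi (by linarith),
    integral_exp_mul_Ioi (by linarith)] at hle
  have hxt1 : -x * t = -1 := by rw [hxt]; field_simp
  have hg : x / (1 + k * x ^ α) = (bracket k α t)⁻¹ := by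
    rw [hxt, bracket, Real.inv_rpow ht.le, Real.rpow_sub ht, Real.rpow_one]
    have := P.k_pos
    have : 0 < t ^ α := by positivity
    field_simp
  rw [hxt1, hg, mul_zero, Real.exp_zero] at hle
  have h1 : 1 - τ * (bracket k α t)⁻¹ ≤ Real.exp (-(τ * (bracket k α t)⁻¹)) := by
    linarith [Real.add_one_le_exp (-(τ * (bracket k α t)⁻¹))]
  have h2 : Real.exp (-(τ * (bracket k α t)⁻¹)) ≤
      subTail k α t τ + Real.exp (-1) * (1 - subTail k α t τ) := by
    have := mul_le_mul_of_nonneg_left hle hx.le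
    rw [← mul_assoc, mul_inv_cancel₀ hx.ne', one_mul] at this
    refine this.trans (le_of_eq ?_)
    field_simp
  rw [div_eq_mul_inv]
  linarith

end Density

theorem tendsto_zero_of_le {ι : Type*} {l : Filter ι} {f g : ι → ℝ≥0∞} (hg : Tendsto g l (𝓝 0))
    (h : ∀ᶠ i in l, f i ≤ g i) : Tendsto f l (𝓝 0) :=
  tendsto_of_tendsto_of_tendsto_of_le_of_le' tendsto_const_nhds hg (.of_forall fun _ => zero_le) h

/-! ### Moments of the density -/

section Moments

variable {k α : ℝ}

theorem measurable_symbol : Measurable (symbol k α) := by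
  unfold symbol
  fun_prop

theorem measurable_subDens : Measurable fun p : ℝ × ℝ => subDens k α p.1 p.2 := by
  have hs := measurable_symbol (k := k) (α := α)
  have h1 : Measurable (uncurry fun (p : ℝ × ℝ) (η : ℝ) =>
      Complex.exp (((1 : ℝ) + η * Complex.I) * p.1) *
        damped k α (fun z => symbol k α z / z) p.2 ((1 : ℝ) + η * Complex.I)) := by
    simp only [damped, Function.uncurry_def]
    have h2 : Measurable fun q : (ℝ × ℝ) × ℝ => symbol k α ((1 : ℝ) + q.2 * Complex.I) :=
      hs.comp (by fun_prop)
    fun_prop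
  have h2 := (h1.stronglyMeasurable.integral_prod_right (ν := volume)).measurable
  exact Complex.measurable_re.comp (h2.const_mul _)

theorem tendsto_subTail_atTop (P : SymbolParams k α) (t : ℝ) :
    Tendsto (fun τ => subTail k α t τ) atTop (𝓝 0) := by
  obtain ⟨K, hK, m, hm, h⟩ := exists_norm_damped_le P prefactor_inv one_pos
  have hM : 0 < 2 / (1 - α) := by have := P.α_lt; exact div_pos two_pos (by linarith)
  have hbd : ∀ τ : ℝ, 0 < τ → |subTail k α t τ| ≤
      (K * Real.pi * Real.exp (1 * t)) * τ ^ (-(2 / (1 - α))) := by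
    intro τ hτ
    refine (abs_invDamped_le P prefactor_inv hτ one_pos t).trans ?_
    have h2 : ∫ η : ℝ, ‖damped k α (fun z => z⁻¹) τ ((1 : ℝ) + η * Complex.I)‖ ≤
        ∫ η : ℝ, (K * τ ^ (-(2 / (1 - α)))) * ((1 : ℝ) ^ 2 + η ^ 2)⁻¹ := by
      refine integral_mono (integrable_damped P prefactor_inv hτ one_pos).norm
        ((integrable_inv_sq_add_sq one_pos).const_mul _) fun η => ?_
      refine (h τ hτ _ (by simp)).trans ?_
      rw [norm_sq_vertical, div_eq_mul_inv]
      refine mul_le_mul_of_nonneg_right ?_ (by positivity)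
      have : Real.exp (-(m * τ)) ≤ 1 := Real.exp_le_one_iff.2 (by
        have := mul_pos hm hτ; linarith)
      exact mul_le_of_le_one_right (by positivity) this
    rw [integral_const_mul, integral_inv_sq_add_sq one_pos, div_one] at h2
    calc _ ≤ K * τ ^ (-(2 / (1 - α))) * Real.pi * Real.exp (1 * t) := by gcongr
      _ = _ := by ring
  refine squeeze_zero_norm' ((eventually_gt_atTop 0).mono hbd) ?_
  simpa using (tendsto_rpow_neg_atTop hM).const_mul (K * Real.pi * Real.exp (1 * t))

/-- The probability measure with density `subDens t`. -/
def subMeasure (k α t : ℝ) : Measure ℝ :=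
  (volume.restrict (Ioi 0)).withDensity fun τ => ofReal (subDens k α t τ)

theorem measurable_subDens_right (t : ℝ) : Measurable fun τ => subDens k α t τ := by
  have h1 : Measurable (uncurry (subDens k α)) := measurable_subDens
  exact h1.of_uncurry_left

theorem integrableOn_subDens_Ioi (P : SymbolParams k α) {t T : ℝ} (ht : 0 ≤ t) (hT : 0 < T) :
    IntegrableOn (subDens k α t) (Ioi T) ∧
      ∫ τ in Ioi T, subDens k α t τ = subTail k α t T := by
  have hd : ∀ τ, 0 < τ → HasDerivAt (fun τ => -subTail k α t τ) (subDens k α t τ) τ := fun τ hτ =>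
    (hasDerivAt_subTail P hτ t).fun_neg.congr_deriv (neg_neg _)
  have hl : Tendsto (fun τ => -subTail k α t τ) atTop (𝓝 0) := by
    simpa using (tendsto_subTail_atTop P t).neg
  have hn : ∀ τ ∈ Ioi T, 0 ≤ subDens k α t τ := fun τ hτ => subDens_nonneg P ht (hT.trans hτ)
  have hc := (hd T hT).continuousAt.continuousWithinAt (s := Ici T)
  refine ⟨integrableOn_Ioi_deriv_of_nonneg hc (fun τ hτ => hd τ (hT.trans hτ)) hn hl, ?_⟩
  rw [integral_Ioi_of_hasDerivAt_of_nonneg hc (fun τ hτ => hd τ (hT.trans hτ)) hn hl]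
  ring

theorem subMeasure_Ioi (P : SymbolParams k α) {t T : ℝ} (ht : 0 ≤ t) (hT : 0 < T) :
    subMeasure k α t (Ioi T) = ofReal (subTail k α t T) := by
  obtain ⟨hi, he⟩ := integrableOn_subDens_Ioi P ht hT
  rw [subMeasure, withDensity_apply _ measurableSet_Ioi, Measure.restrict_restrict measurableSet_Ioi,
    inter_eq_self_of_subset_left (Ioi_subset_Ioi hT.le), ← he,
    ofReal_integral_eq_lintegral_ofReal hi]
  exact (ae_restrict_iff' measurableSet_Ioi).2
    (Eventually.of_forall fun τ hτ => subDens_nonneg P ht (hT.trans hτ))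

theorem one_sub_exp_neg_one_pos : 0 < 1 - Real.exp (-1) :=
  sub_pos.2 (by simpa using Real.exp_lt_exp.2 (show (-1 : ℝ) < 0 by norm_num))

theorem bracket_pos (P : SymbolParams k α) {t : ℝ} (ht : 0 < t) : 0 < bracket k α t := by
  have := P.k_pos
  unfold bracket
  positivity

/-- The total mass is the limit of the tails at 1/(n+1), which `one_sub_subTail_le` forces to be 1.
-/
theorem subMeasure_univ (P : SymbolParams k α) {t : ℝ} (ht : 0 < t) :
    subMeasure k α t univ = 1 := by
  have hb := bracket_pos P ht
  have hsub : subMeasure k α t univ = subMeasure k α t (Ioi 0) := by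
    rw [subMeasure, withDensity_apply _ MeasurableSet.univ, withDensity_apply _ measurableSet_Ioi,
      Measure.restrict_restrict measurableSet_Ioi, inter_self, Measure.restrict_univ]
  have hU : (⋃ n : ℕ, Ioi (1 / ((n : ℝ) + 1))) = Ioi 0 := by
    ext x
    simp only [mem_iUnion, mem_Ioi]
    refine ⟨fun ⟨n, hn⟩ => lt_trans (by positivity) hn, fun hx => exists_nat_one_div_lt hx⟩
  have hmono : Monotone fun n : ℕ => Ioi (1 / ((n : ℝ) + 1)) := fun m n hmn =>
    Ioi_subset_Ioi (Nat.one_div_le_one_div hmn)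
  have h1 := tendsto_measure_iUnion_atTop (μ := subMeasure k α t) hmono
  rw [hU] at h1
  have h2 : Tendsto (fun n : ℕ => subTail k α t (1 / ((n : ℝ) + 1))) atTop (𝓝 1) := by
    have hl : Tendsto (fun n : ℕ => 1 - (1 / ((n : ℝ) + 1)) / bracket k α t / (1 - Real.exp (-1)))
        atTop (𝓝 (1 - 0 / bracket k α t / (1 - Real.exp (-1)))) :=
      ((tendsto_one_div_add_atTop_nhds_zero_nat.div_const _).div_const _).const_sub 1
    rw [zero_div, zero_div, sub_zero] at hl
    refine tendsto_of_tendsto_of_tendsto_of_le_of_le hl tendsto_const_nhds (fun n => ?_)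
      fun n => subTail_le_one P ht.le (by positivity)
    have := one_sub_subTail_le P ht (τ := 1 / ((n : ℝ) + 1)) (by positivity)
    rw [← le_div_iff₀ one_sub_exp_neg_one_pos] at this
    simp only
    linarith
  have h3 : Tendsto (fun n : ℕ => subMeasure k α t (Ioi (1 / ((n : ℝ) + 1)))) atTop (𝓝 1) := by
    simp_rw [fun n : ℕ => subMeasure_Ioi P ht.le (T := 1 / ((n : ℝ) + 1)) (by positivity)]
    simpa using tendsto_ofReal h2
  rw [hsub]
  exact tendsto_nhds_unique h1 h3

theorem subMeasure_Iic_le (P : SymbolParams k α) {t T : ℝ} (ht : 0 < t) (hT : 0 < T) :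
    subMeasure k α t (Iic T) ≤
      ofReal (T / bracket k α t / (1 - Real.exp (-1))) := by
  have : IsProbabilityMeasure (subMeasure k α t) := ⟨subMeasure_univ P ht⟩
  rw [← compl_Ioi, prob_compl_eq_one_sub measurableSet_Ioi, subMeasure_Ioi P ht.le hT,
    ← ofReal_one, ← ENNReal.ofReal_sub _ (subTail_nonneg P ht.le hT)]
  refine ofReal_le_ofReal ?_
  rw [le_div_iff₀ one_sub_exp_neg_one_pos]
  exact one_sub_subTail_le P ht hT

/-- `∫_0^∞ |ω(τ)| τ^{-κ} dτ`. -/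
def moment (κ : ℝ) (ω : ℝ → ℝ) : ℝ≥0∞ :=
  ∫⁻ τ in Ioi (0 : ℝ), ‖ω τ‖ₑ * ofReal (τ ^ (-κ))

theorem lintegral_subMeasure (P : SymbolParams k α) {t : ℝ} (ht : 0 ≤ t) {g : ℝ → ℝ≥0∞}
    (hg : Measurable g) :
    ∫⁻ τ, g τ ∂(subMeasure k α t) = ∫⁻ τ in Ioi (0 : ℝ), ‖subDens k α t τ‖ₑ * g τ := by
  rw [subMeasure, lintegral_withDensity_eq_lintegral_mul _
    (measurable_subDens_right t).ennreal_ofReal hg]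
  refine setLIntegral_congr_fun measurableSet_Ioi fun τ hτ => ?_
  simp only [Pi.mul_apply]
  rw [Real.enorm_of_nonneg (subDens_nonneg P ht hτ)]

theorem moment_zero_subDens (P : SymbolParams k α) {t : ℝ} (ht : 0 < t) :
    moment 0 (subDens k α t) = 1 := by
  have h := lintegral_subMeasure P ht.le (g := fun _ => 1) measurable_const
  rw [lintegral_one, subMeasure_univ P ht] at h
  rw [h, moment]
  simp

/-- Layer-cake formula for the variable τ⁻¹: the probability of τ ≤ 1/s is at most min(1, c/(s⟨t⟩)).
Integrability of s^{κ-1} at 0 needs κ > 0, and that of s^{κ-2} at infinity needs κ < 1. -/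
theorem exists_moment_subDens_le (P : SymbolParams k α) {κ : ℝ} (hκ0 : 0 ≤ κ) (hκ1 : κ < 1) :
    ∃ C > 0, ∀ t, 0 < t →
      moment κ (subDens k α t) ≤ ofReal (C * bracket k α t ^ (-κ)) := by
  rcases hκ0.eq_or_lt with rfl | hκ0
  · refine ⟨1, one_pos, fun t ht => ?_⟩
    rw [moment_zero_subDens P ht]
    simp
  set c := (1 - Real.exp (-1))⁻¹ with hc
  have hc0 : 0 < c := inv_pos.2 one_sub_exp_neg_one_pos
  have h1κ : 0 < 1 - κ := by linarith
  refine ⟨κ * (1 / κ + c / (1 - κ)), by positivity, fun t ht => ?_⟩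
  set b := bracket k α t with hb
  have hb0 : 0 < b := bracket_pos P ht
  have hnn : 0 ≤ᵐ[subMeasure k α t] fun τ : ℝ => τ⁻¹ := by
    have : ∀ᵐ τ ∂(volume.restrict (Ioi (0 : ℝ))), (0 : ℝ) ≤ τ⁻¹ :=
      (ae_restrict_iff' measurableSet_Ioi).2
        (Eventually.of_forall fun τ hτ => inv_nonneg.2 (le_of_lt hτ))
    exact (withDensity_absolutelyContinuous _ _).ae_le this
  have h1 : moment κ (subDens k α t) = ∫⁻ τ, ofReal (τ⁻¹ ^ κ) ∂(subMeasure k α t) := by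
    rw [lintegral_subMeasure P ht.le (by fun_prop), moment]
    refine setLIntegral_congr_fun measurableSet_Ioi fun τ hτ => ?_
    rw [Real.inv_rpow (le_of_lt hτ), Real.rpow_neg (le_of_lt hτ)]
  have : IsProbabilityMeasure (subMeasure k α t) := ⟨subMeasure_univ P ht⟩
  rw [h1, lintegral_rpow_eq_lintegral_meas_le_mul _ hnn (by fun_prop) hκ0]
  have hbd1 : ∀ s : ℝ, 0 < s → subMeasure k α t {τ | s ≤ τ⁻¹} ≤ ofReal (c / (s * b)) := by
    intro s hs
    refine (measure_mono fun τ hτ => ?_).trans ((subMeasure_Iic_le P ht (inv_pos.2 hs)).trans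
      (le_of_eq ?_))
    · have hτ : s ≤ τ⁻¹ := hτ
      have : 0 < τ := inv_pos.1 (hs.trans_le hτ)
      exact (le_inv_comm₀ hs this).1 hτ
    · rw [← hb, hc]; congr 1; field_simp
  -- The two bounds on the probability change roles at s = 1/⟨t⟩, up to a constant.
  have hsplit : ∫⁻ s in Ioi (0 : ℝ), subMeasure k α t {τ | s ≤ τ⁻¹} * ofReal (s ^ (κ - 1)) ≤
      (∫⁻ s in Ioc 0 b⁻¹, ofReal (s ^ (κ - 1))) +
        ∫⁻ s in Ioi b⁻¹, ofReal (c / b * s ^ (κ - 2)) := by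
    rw [← Ioc_union_Ioi_eq_Ioi (inv_pos.2 hb0).le,
      lintegral_union measurableSet_Ioi Ioc_disjoint_Ioi_same]
    refine add_le_add (lintegral_mono fun s => mul_le_of_le_one_left' prob_le_one)
      (setLIntegral_mono' measurableSet_Ioi fun s hs => ?_)
    have hs0 : 0 < s := (inv_pos.2 hb0).trans hs
    refine (mul_le_mul_left (hbd1 s hs0) _).trans ?_
    rw [← ofReal_mul (by positivity)]
    refine ofReal_le_ofReal (le_of_eq ?_)
    rw [show κ - 1 = (κ - 2) + 1 by ring, Real.rpow_add_one hs0.ne']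
    field_simp
  have i1 : ∫⁻ s in Ioc 0 b⁻¹, ofReal (s ^ (κ - 1)) = ofReal (b ^ (-κ) / κ) := by
    have hi : IntegrableOn (fun s : ℝ => s ^ (κ - 1)) (Ioc 0 b⁻¹) :=
      (intervalIntegrable_iff_integrableOn_Ioc_of_le (inv_pos.2 hb0).le).1
        (intervalIntegral.intervalIntegrable_rpow' (by linarith))
    rw [← ofReal_integral_eq_lintegral_ofReal hi ((ae_restrict_iff' measurableSet_Ioc).2
      (Eventually.of_forall fun s hs => Real.rpow_nonneg hs.1.le _)),
      ← intervalIntegral.integral_of_le (inv_pos.2 hb0).le, integral_rpow (Or.inl (by linarith))]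
    congr 1
    rw [sub_add_cancel, Real.zero_rpow hκ0.ne', sub_zero, Real.inv_rpow hb0.le, Real.rpow_neg hb0.le]
  have i2 : ∫⁻ s in Ioi b⁻¹, ofReal (c / b * s ^ (κ - 2)) =
      ofReal (c * b ^ (-κ) / (1 - κ)) := by
    have hi : IntegrableOn (fun s : ℝ => c / b * s ^ (κ - 2)) (Ioi b⁻¹) :=
      (integrableOn_Ioi_rpow_of_lt (by linarith) (inv_pos.2 hb0)).const_mul _
    rw [← ofReal_integral_eq_lintegral_ofReal hi ((ae_restrict_iff' measurableSet_Ioi).2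
      (Eventually.of_forall fun s hs => by
        have : 0 < s := (inv_pos.2 hb0).trans hs
        simp only [Pi.zero_apply]
        positivity)),
      integral_const_mul, integral_Ioi_rpow_of_lt (by linarith) (inv_pos.2 hb0)]
    congr 1
    rw [Real.inv_rpow hb0.le, ← Real.rpow_neg hb0.le, show -(κ - 2 + 1) = -κ + 1 by ring,
      Real.rpow_add_one hb0.ne', show κ - 2 + 1 = -(1 - κ) by ring]
    field_simp
  refine (mul_le_mul_right hsplit _).trans ?_
  rw [i1, i2, ← ofReal_add (by positivity) (by positivity), ← ofReal_mul hκ0.le]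
  refine ofReal_le_ofReal (le_of_eq ?_)
  field_simp

theorem integrableOn_subDens (P : SymbolParams k α) {t : ℝ} (ht : 0 < t) :
    IntegrableOn (subDens k α t) (Ioi 0) := by
  refine ⟨(measurable_subDens_right t).aestronglyMeasurable, ?_⟩
  have h := moment_zero_subDens P ht
  simp only [moment, neg_zero, Real.rpow_zero, ofReal_one, mul_one] at h
  rw [HasFiniteIntegral, h]
  exact ENNReal.one_lt_top

theorem integral_subDens (P : SymbolParams k α) {t : ℝ} (ht : 0 < t) :
    ∫ τ in Ioi (0 : ℝ), subDens k α t τ = 1 := by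
  have hnn : ∀ᵐ τ ∂(volume.restrict (Ioi (0 : ℝ))), 0 ≤ subDens k α t τ :=
    (ae_restrict_iff' measurableSet_Ioi).2
      (Eventually.of_forall fun τ hτ => subDens_nonneg P ht.le hτ)
  rw [integral_eq_lintegral_of_nonneg_ae hnn (measurable_subDens_right t).aestronglyMeasurable]
  have h := subMeasure_univ P ht
  rw [subMeasure, withDensity_apply _ MeasurableSet.univ, Measure.restrict_univ] at h
  rw [h, ENNReal.toReal_one]

/-- Scheffé's lemma: all the densities have integral 1 and |a - b| = a + b - 2 min(a,b), while the
minimum converges by domination with the density at t₀. -/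
theorem tendsto_moment_zero_sub (P : SymbolParams k α) {t₀ : ℝ} (ht₀ : 0 < t₀) :
    Tendsto (fun t => moment 0 fun τ => subDens k α t τ - subDens k α t₀ τ) (𝓝 t₀) (𝓝 0) := by
  have hmin : Tendsto (fun t => ∫ τ in Ioi (0 : ℝ), min (subDens k α t τ) (subDens k α t₀ τ))
      (𝓝 t₀) (𝓝 (∫ τ in Ioi (0 : ℝ), subDens k α t₀ τ)) := by
    refine tendsto_integral_filter_of_dominated_convergence (subDens k α t₀)
      (Eventually.of_forall fun t => ((measurable_subDens_right t).min
        (measurable_subDens_right t₀)).aestronglyMeasurable) ?_ (integrableOn_subDens P ht₀)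
      ((ae_restrict_iff' measurableSet_Ioi).2 (Eventually.of_forall fun τ hτ => ?_))
    · filter_upwards [lt_mem_nhds ht₀] with t ht
      refine (ae_restrict_iff' measurableSet_Ioi).2 (Eventually.of_forall fun τ hτ => ?_)
      rw [Real.norm_of_nonneg (le_min (subDens_nonneg P ht.le hτ) (subDens_nonneg P ht₀.le hτ))]
      exact min_le_right _ _
    · have hc : Continuous fun t => subDens k α t τ :=
        continuous_invDamped P (prefactor_symbol_div P) hτ
      have := (hc.min (continuous_const (y := subDens k α t₀ τ))).tendsto t₀
      rwa [min_self] at this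
  have heq : ∀ t, 0 < t → moment 0 (fun τ => subDens k α t τ - subDens k α t₀ τ) =
      ofReal (2 - 2 * ∫ τ in Ioi (0 : ℝ), min (subDens k α t τ) (subDens k α t₀ τ)) := by
    intro t ht
    have i1 := integrableOn_subDens P ht
    have i2 := integrableOn_subDens P ht₀
    have i3 : IntegrableOn (fun τ => min (subDens k α t τ) (subDens k α t₀ τ)) (Ioi 0) := i1.inf i2
    have e1 : (2 - 2 * ∫ τ in Ioi (0 : ℝ), min (subDens k α t τ) (subDens k α t₀ τ)) =
        ∫ τ in Ioi (0 : ℝ), |subDens k α t τ - subDens k α t₀ τ| := by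
      have h12 := integral_sub (i1.add i2) (i3.const_mul 2)
      simp only [Pi.add_apply] at h12
      rw [integral_add i1 i2, integral_const_mul, integral_subDens P ht, integral_subDens P ht₀,
        one_add_one_eq_two] at h12
      rw [← h12]
      refine integral_congr_ae (Eventually.of_forall fun τ => ?_)
      simp only
      rcases le_total (subDens k α t τ) (subDens k α t₀ τ) with h | h
      · rw [min_eq_left h, abs_of_nonpos (by linarith)]; ring
      · rw [min_eq_right h, abs_of_nonneg (by linarith)]; ring
    have e2 := ofReal_integral_eq_lintegral_ofReal (i1.sub i2).abs
      (Eventually.of_forall fun _ => abs_nonneg _)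
    simp only [Pi.sub_apply] at e2
    rw [e1, e2, moment]
    simp [← Real.enorm_eq_ofReal_abs]
  have hlim := tendsto_ofReal ((hmin.const_mul 2).const_sub 2)
  rw [integral_subDens P ht₀] at hlim
  norm_num at hlim
  refine hlim.congr' ?_
  filter_upwards [lt_mem_nhds ht₀] with t ht using (heq t ht).symm

theorem moment_sub_le (ω₁ ω₂ : ℝ → ℝ) (κ : ℝ) (h₁ : Measurable ω₁) :
    moment κ (fun τ => ω₁ τ - ω₂ τ) ≤ moment κ ω₁ + moment κ ω₂ := by
  unfold moment
  rw [← lintegral_add_left (by fun_prop)]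
  refine lintegral_mono fun τ => ?_
  rw [← add_mul]
  gcongr
  exact enorm_sub_le

theorem moment_interpolate {ω : ℝ → ℝ} (hω : Measurable ω) {κ κ' : ℝ} (hκ0 : 0 ≤ κ) (hκ : κ < κ') :
    moment κ ω ≤ moment 0 ω ^ (1 - κ / κ') * moment κ' ω ^ (κ / κ') := by
  have hκ' : 0 < κ' := hκ0.trans_lt hκ
  have h1 : κ / κ' ≤ 1 := (div_le_one hκ').2 hκ.le
  refine le_trans (le_of_eq ?_) (ENNReal.lintegral_mul_norm_pow_le (p := 1 - κ / κ') (q := κ / κ')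
    (by fun_prop) (by fun_prop) (by linarith) (by positivity) (by ring))
  refine setLIntegral_congr_fun measurableSet_Ioi fun τ hτ => ?_
  have hτ : 0 < τ := hτ
  rw [neg_zero, Real.rpow_zero, ofReal_one, mul_one,
    mul_rpow_of_nonneg _ _ (by positivity : 0 ≤ κ / κ'), ← mul_assoc,
    ← ENNReal.rpow_add_of_nonneg _ _ (by linarith) (by positivity),
    ENNReal.ofReal_rpow_of_pos (by positivity), ← Real.rpow_mul hτ.le]
  rw [sub_add_cancel, ENNReal.rpow_one, show -κ' * (κ / κ') = -κ by field_simp]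

theorem bracket_le_bracket (P : SymbolParams k α) {s t : ℝ} (hs : 0 ≤ s) (hst : s ≤ t) :
    bracket k α s ≤ bracket k α t := by
  have := P.k_pos
  have := P.α_lt
  unfold bracket
  gcongr

/-- Interpolation between order 0, where the difference tends to zero, and the order (1+κ)/2. The
latter is still less than 1, so its moments are bounded for t near t₀. -/
theorem tendsto_moment_sub (P : SymbolParams k α) {t₀ κ : ℝ} (ht₀ : 0 < t₀) (hκ0 : 0 ≤ κ)
    (hκ1 : κ < 1) :
    Tendsto (fun t => moment κ fun τ => subDens k α t τ - subDens k α t₀ τ) (𝓝 t₀) (𝓝 0) := by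
  obtain ⟨C, hC, hbd⟩ := exists_moment_subDens_le P (κ := (1 + κ) / 2) (by linarith) (by linarith)
  have hκ' : κ < (1 + κ) / 2 := by linarith
  have hκ'0 : 0 < (1 + κ) / 2 := by linarith
  have h1 : κ / ((1 + κ) / 2) < 1 := (div_lt_one hκ'0).2 hκ'
  have hθ : 0 ≤ κ / ((1 + κ) / 2) := by positivity
  set D := ofReal (C * bracket k α (t₀ / 2) ^ (-((1 + κ) / 2))) with hD
  have hb0 := bracket_pos P (half_pos ht₀)
  have hbd' : ∀ t, t₀ / 2 < t → moment ((1 + κ) / 2) (subDens k α t) ≤ D := fun t ht => by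
    refine (hbd t ((half_pos ht₀).trans ht)).trans (ofReal_le_ofReal ?_)
    refine mul_le_mul_of_nonneg_left ?_ hC.le
    exact Real.rpow_le_rpow_of_nonpos hb0 (bracket_le_bracket P (half_pos ht₀).le ht.le)
      (by linarith)
  have hlim : Tendsto (fun t => moment 0 (fun τ => subDens k α t τ - subDens k α t₀ τ) ^
      (1 - κ / ((1 + κ) / 2)) * (D + D) ^ (κ / ((1 + κ) / 2))) (𝓝 t₀) (𝓝 0) := by
    have h2 := (ENNReal.continuous_rpow_const (y := 1 - κ / ((1 + κ) / 2))).tendsto 0 |>.comp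
      (tendsto_moment_zero_sub P ht₀)
    rw [ENNReal.zero_rpow_of_pos (by linarith)] at h2
    have hne : (D + D) ^ (κ / ((1 + κ) / 2)) ≠ ∞ :=
      rpow_ne_top_of_nonneg hθ (by simp [hD])
    simpa using ENNReal.Tendsto.mul_const h2 (Or.inr hne)
  refine tendsto_zero_of_le hlim ?_
  filter_upwards [lt_mem_nhds (half_lt_self ht₀)] with t ht
  have hm : Measurable fun τ => subDens k α t τ - subDens k α t₀ τ :=
    (measurable_subDens_right t).sub (measurable_subDens_right t₀)
  refine (moment_interpolate hm hκ0 hκ').trans (mul_le_mul_right (rpow_le_rpow ?_ hθ) _)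
  exact (moment_sub_le _ _ _ (measurable_subDens_right t)).trans
    (add_le_add (hbd' t ht) (hbd' t₀ (half_lt_self ht₀)))

end Moments

/-! ### `L^p` seminorms of nonnegative functions -/

/-- `(∫ f^p)^{1/p}`. -/
def lpn {X : Type*} [MeasurableSpace X] (p : ℝ) (f : X → ℝ≥0∞) (μ : Measure X := by volume_tac) :
    ℝ≥0∞ := (∫⁻ x, f x ^ p ∂μ) ^ (1 / p)

section Lpn

variable {X : Type*} [MeasurableSpace X] {μ : Measure X}

theorem eLpNorm_eq_lpn {p : ℝ} (hp : 0 < p) (u : X → ℝ) :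
    eLpNorm u (ofReal p) μ = lpn p (fun x => ‖u x‖ₑ) μ := by
  rw [eLpNorm_eq_lintegral_rpow_enorm_toReal (by simpa using hp) ofReal_ne_top,
    ENNReal.toReal_ofReal hp.le, lpn]

theorem lpn_mono {p : ℝ} (hp : 0 < p) {f g : X → ℝ≥0∞} (h : ∀ᵐ x ∂μ, f x ≤ g x) :
    lpn p f μ ≤ lpn p g μ := by
  unfold lpn
  refine rpow_le_rpow (lintegral_mono_ae (h.mono fun x hx => ?_)) (by positivity)
  exact rpow_le_rpow hx hp.le

theorem lpn_congr {p : ℝ} {f g : X → ℝ≥0∞} (h : f =ᵐ[μ] g) : lpn p f μ = lpn p g μ := by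
  unfold lpn
  congr 1
  exact lintegral_congr_ae (h.mono fun x hx => by simp only [hx])

theorem lpn_add_le {p : ℝ} (hp : 1 ≤ p) {f g : X → ℝ≥0∞} (hf : AEMeasurable f μ)
    (hg : AEMeasurable g μ) : lpn p (fun x => f x + g x) μ ≤ lpn p f μ + lpn p g μ :=
  ENNReal.lintegral_Lp_add_le hf hg hp

theorem lpn_const_mul {p : ℝ} (hp : 0 < p) (c : ℝ≥0∞) {f : X → ℝ≥0∞} (hf : Measurable f) :
    lpn p (fun x => c * f x) μ = c * lpn p f μ := by
  unfold lpn
  simp_rw [mul_rpow_of_nonneg _ _ hp.le]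
  rw [lintegral_const_mul _ (by fun_prop), mul_rpow_of_nonneg _ _ (by positivity),
    ← ENNReal.rpow_mul, mul_one_div_cancel hp.ne', ENNReal.rpow_one]

theorem lpn_rpow {p : ℝ} (hp : 0 < p) (f : X → ℝ≥0∞) : lpn p f μ ^ p = ∫⁻ x, f x ^ p ∂μ := by
  rw [lpn, ← ENNReal.rpow_mul, one_div_mul_cancel hp.ne', ENNReal.rpow_one]

theorem lpn_le_iff {p : ℝ} (hp : 0 < p) {f : X → ℝ≥0∞} {C : ℝ≥0∞} :
    lpn p f μ ≤ C ↔ ∫⁻ x, f x ^ p ∂μ ≤ C ^ p := by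
  rw [← lpn_rpow hp, ENNReal.rpow_le_rpow_iff hp]

theorem lpn_mul_le {p q r : ℝ} (hp : 0 < p) (hpq : p < q) (h : 1 / p = 1 / q + 1 / r)
    {f g : X → ℝ≥0∞} (hf : AEMeasurable f μ) (hg : AEMeasurable g μ) :
    lpn p (fun x => f x * g x) μ ≤ lpn q f μ * lpn r g μ :=
  ENNReal.lintegral_Lp_mul_le_Lq_mul_Lr hp hpq h μ hf hg

end Lpn

/-- Minkowski's integral inequality. -/
theorem lpn_lintegral_le {X Y : Type*} [MeasurableSpace X] [MeasurableSpace Y] {μ : Measure X}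
    {ν : Measure Y} [SigmaFinite μ] [SFinite ν] {p : ℝ} (hp : 1 ≤ p) {F : X → Y → ℝ≥0∞}
    (hF : Measurable (uncurry F)) {m : X → ℝ≥0∞} (hm : AEMeasurable m μ)
    (h : ∀ᵐ s ∂μ, lpn p (F s) ν ≤ m s) :
    lpn p (fun y => ∫⁻ s, F s y ∂μ) ν ≤ ∫⁻ s, m s ∂μ := by
  have hp0 : 0 < p := one_pos.trans_le hp
  refine ENNReal.le_of_forall_pos_le_add fun ε hε hfin => ?_
  -- A positive function of small integral is added to m, so that negative powers of m' make sense.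
  obtain ⟨g, hg0, hgm, hgε⟩ := exists_pos_lintegral_lt_of_sigmaFinite μ
    (ε := (ε : ℝ≥0∞)) (by exact_mod_cast hε.ne')
  set m' : X → ℝ≥0∞ := fun s => m s + g s with hm'
  have hm'm : AEMeasurable m' μ := hm.add hgm.coe_nnreal_ennreal.aemeasurable
  have hint : ∫⁻ s, m' s ∂μ ≤ ∫⁻ s, m s ∂μ + ε := by
    rw [hm', lintegral_add_right _ hgm.coe_nnreal_ennreal]
    gcongr
  refine le_trans ?_ hint
  have hm'0 : ∀ s, m' s ≠ 0 := fun s => by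
    simp only [hm', ne_eq, add_eq_zero, not_and]
    exact fun _ => by exact_mod_cast (hg0 s).ne'
  have hm't : ∀ᵐ s ∂μ, m' s ≠ ∞ := by
    filter_upwards [ae_lt_top' hm hfin.ne] with s hs
    simp only [hm', ne_eq, ENNReal.add_eq_top, ENNReal.coe_ne_top, or_false]
    exact hs.ne
  rw [lpn_le_iff hp0]
  -- Hölder's inequality for F = (F m'^{(1-p)/p}) · m'^{(p-1)/p}. The powers of m' then cancel
  -- against the bound of the norm of F s.
  have hpw : ∀ y, (∫⁻ s, F s y ∂μ) ^ p ≤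
      (∫⁻ s, F s y ^ p * m' s ^ (1 - p) ∂μ) * (∫⁻ s, m' s ∂μ) ^ (p - 1) := by
    intro y
    have hFy : Measurable fun s => F s y := hF.of_uncurry_right
    have h1 : ∫⁻ s, F s y ∂μ ≤ (∫⁻ s, F s y ^ p * m' s ^ (1 - p) ∂μ) ^ (1 / p) *
        (∫⁻ s, m' s ∂μ) ^ (1 - 1 / p) := by
      refine le_trans (lintegral_mono_ae ?_) (ENNReal.lintegral_mul_norm_pow_le
        ((hFy.pow_const p).aemeasurable.mul (hm'm.pow_const _)) hm'm (by positivity)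
        (sub_nonneg.2 ((div_le_one hp0).2 hp)) (by ring))
      filter_upwards [hm't] with s hs
      simp only [Pi.mul_apply]
      rw [mul_rpow_of_nonneg _ _ (by positivity), ← ENNReal.rpow_mul, ← ENNReal.rpow_mul,
        mul_one_div_cancel hp0.ne', ENNReal.rpow_one, mul_assoc, ← ENNReal.rpow_add _ _ (hm'0 s) hs]
      rw [show (1 - p) * (1 / p) + (1 - 1 / p) = 0 by field_simp; ring, ENNReal.rpow_zero, mul_one]
    calc (∫⁻ s, F s y ∂μ) ^ p ≤ ((∫⁻ s, F s y ^ p * m' s ^ (1 - p) ∂μ) ^ (1 / p) *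
        (∫⁻ s, m' s ∂μ) ^ (1 - 1 / p)) ^ p := rpow_le_rpow h1 hp0.le
      _ = _ := by
        rw [mul_rpow_of_nonneg _ _ hp0.le, ← ENNReal.rpow_mul, ← ENNReal.rpow_mul,
          one_div_mul_cancel hp0.ne', ENNReal.rpow_one]
        congr 2
        field_simp
  have hFm : AEMeasurable (fun q : Y × X => F q.2 q.1 ^ p * m' q.2 ^ (1 - p)) (ν.prod μ) := by
    refine (Measurable.aemeasurable ?_).mul ?_
    · exact (hF.comp measurable_swap).pow_const p
    · exact (hm'm.pow_const (1 - p)).comp_quasiMeasurePreserving Measure.quasiMeasurePreserving_snd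
  calc ∫⁻ y, (∫⁻ s, F s y ∂μ) ^ p ∂ν
      ≤ ∫⁻ y, (∫⁻ s, F s y ^ p * m' s ^ (1 - p) ∂μ) * (∫⁻ s, m' s ∂μ) ^ (p - 1) ∂ν :=
        lintegral_mono hpw
    _ = (∫⁻ y, ∫⁻ s, F s y ^ p * m' s ^ (1 - p) ∂μ ∂ν) * (∫⁻ s, m' s ∂μ) ^ (p - 1) :=
        lintegral_mul_const'' _ (AEMeasurable.lintegral_prod_right' hFm)
    _ = (∫⁻ s, ∫⁻ y, F s y ^ p * m' s ^ (1 - p) ∂ν ∂μ) * (∫⁻ s, m' s ∂μ) ^ (p - 1) := by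
        rw [lintegral_lintegral_swap hFm]
    _ ≤ (∫⁻ s, m' s ∂μ) * (∫⁻ s, m' s ∂μ) ^ (p - 1) := by
        refine mul_le_mul_left (lintegral_mono_ae ?_) _
        filter_upwards [h, hm't] with s hs hst
        have hFs : Measurable fun y => F s y ^ p := hF.of_uncurry_left.pow_const p
        rw [lintegral_mul_const _ hFs]
        have h2 : ∫⁻ y, F s y ^ p ∂ν ≤ m' s ^ p := by
          rw [← lpn_rpow hp0]
          exact rpow_le_rpow (hs.trans le_self_add) hp0.le
        calc (∫⁻ y, F s y ^ p ∂ν) * m' s ^ (1 - p) ≤ m' s ^ p * m' s ^ (1 - p) := by gcongr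
          _ = m' s := by
            rw [← ENNReal.rpow_add _ _ (hm'0 s) hst, show p + (1 - p) = 1 by ring, ENNReal.rpow_one]
    _ ≤ (∫⁻ s, m' s ∂μ) ^ p := by
        refine le_of_eq ?_
        have hne : (∫⁻ s, m' s ∂μ) ≠ ∞ :=
          ((hint.trans_lt (add_lt_top.2 ⟨hfin, ENNReal.coe_lt_top⟩))).ne
        nth_rw 1 [← ENNReal.rpow_one (∫⁻ s, m' s ∂μ)]
        rw [← ENNReal.rpow_add_of_nonneg _ _ zero_le_one (by linarith)]
        congr 1
        ring

/-! ### The heat semigroup -/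

section Heat

variable {N : ℕ}

theorem heatKernel_nonneg (τ : ℝ) (hτ : 0 ≤ τ) (x : Space N) : 0 ≤ heatKernel N τ x := by
  unfold heatKernel
  positivity

theorem measurable_heatKernel : Measurable fun p : ℝ × Space N => heatKernel N p.1 p.2 := by
  unfold heatKernel
  fun_prop

theorem heatKernel_le {τ : ℝ} (hτ : 0 < τ) (x : Space N) :
    heatKernel N τ x ≤ (4 * Real.pi * τ) ^ (-(N : ℝ) / 2) := by
  unfold heatKernel
  refine mul_le_of_le_one_right (by positivity) (Real.exp_le_one_iff.2 ?_)
  rw [neg_div]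
  exact neg_nonpos.2 (by positivity)

theorem lintegral_heatKernel {τ : ℝ} (hτ : 0 < τ) :
    ∫⁻ x : Space N, ofReal (heatKernel N τ x) = 1 := by
  have hb : 0 < 1 / (4 * τ) := by positivity
  have h1 := GaussianFourier.integral_rexp_neg_mul_sq_norm (V := Space N) hb
  have h2 : ∫ x : Space N, heatKernel N τ x = 1 := by
    have e : ∀ x : Space N, heatKernel N τ x =
        (4 * Real.pi * τ) ^ (-(N : ℝ) / 2) * Real.exp (-(1 / (4 * τ)) * ‖x‖ ^ 2) := fun x => by
      unfold heatKernel; congr 2; field_simp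
    simp_rw [e]
    rw [integral_const_mul, h1, finrank_euclideanSpace, Fintype.card_fin,
      show Real.pi / (1 / (4 * τ)) = 4 * Real.pi * τ by field_simp,
      ← Real.rpow_add (by positivity)]
    rw [show -(N : ℝ) / 2 + N / 2 = 0 by ring, Real.rpow_zero]
  -- The integral is 1; for a function that is not integrable it would be 0 by convention.
  have hi : Integrable fun x : Space N => heatKernel N τ x := by
    by_contra hn
    rw [integral_undef hn] at h2
    exact zero_ne_one h2
  rw [← ofReal_integral_eq_lintegral_ofReal hi
    (Eventually.of_forall fun x => heatKernel_nonneg τ hτ.le x), h2, ofReal_one]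

/-- `e^{τΔ} f` for nonnegative `f`. -/
def heatConv (τ : ℝ) (f : Space N → ℝ≥0∞) (x : Space N) : ℝ≥0∞ :=
  ∫⁻ y, ofReal (heatKernel N τ (x - y)) * f y

theorem measurable_heatConv {f : Space N → ℝ≥0∞} (hf : Measurable f) :
    Measurable fun p : ℝ × Space N => heatConv p.1 f p.2 := by
  have h1 : Measurable fun q : (ℝ × Space N) × Space N => heatKernel N q.1.1 (q.1.2 - q.2) :=
    measurable_heatKernel.comp
      (f := fun q : (ℝ × Space N) × Space N => (q.1.1, q.1.2 - q.2)) (by fun_prop)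
  exact Measurable.lintegral_prod_right' (f := fun q : (ℝ × Space N) × Space N =>
    ofReal (heatKernel N q.1.1 (q.1.2 - q.2)) * f q.2) (by fun_prop)

theorem measurable_heatConv_right {f : Space N → ℝ≥0∞} (hf : Measurable f) (τ : ℝ) :
    Measurable fun x => heatConv τ f x := by
  have h : Measurable (uncurry fun (τ : ℝ) (x : Space N) => heatConv τ f x) :=
    measurable_heatConv hf
  exact h.of_uncurry_left

theorem measurable_heatKernel_sub (τ : ℝ) (x : Space N) :
    Measurable fun y : Space N => heatKernel N τ (x - y) := by
  unfold heatKernel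
  fun_prop

theorem lintegral_heatKernel_sub {τ : ℝ} (hτ : 0 < τ) (x : Space N) :
    ∫⁻ y : Space N, ofReal (heatKernel N τ (x - y)) = 1 := by
  rw [lintegral_sub_left_eq_self (fun y => ofReal (heatKernel N τ y)),
    lintegral_heatKernel hτ]

/-- Jensen's inequality for the heat kernel, which is a probability density. -/
theorem heatConv_rpow_le {τ c : ℝ} (hτ : 0 < τ) (hc : 1 ≤ c) {f : Space N → ℝ≥0∞}
    (hf : Measurable f) (x : Space N) :
    heatConv τ f x ^ c ≤ heatConv τ (fun y => f y ^ c) x := by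
  have hc0 : 0 < c := one_pos.trans_le hc
  have hm := (measurable_heatKernel_sub τ x).ennreal_ofReal
  have h1 := ENNReal.lintegral_mul_norm_pow_le (μ := volume) (p := 1 / c) (q := 1 - 1 / c)
    (f := fun y => ofReal (heatKernel N τ (x - y)) * f y ^ c)
    (g := fun y => ofReal (heatKernel N τ (x - y)))
    (hm.mul (hf.pow_const c)).aemeasurable hm.aemeasurable (by positivity)
    (sub_nonneg.2 ((div_le_one hc0).2 hc)) (by ring)
  rw [lintegral_heatKernel_sub hτ x, ENNReal.one_rpow, mul_one] at h1
  have h2 : heatConv τ f x ≤ heatConv τ (fun y => f y ^ c) x ^ (1 / c) := by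
    refine le_trans (le_of_eq ?_) h1
    unfold heatConv
    refine lintegral_congr fun y => ?_
    rw [mul_rpow_of_nonneg _ _ (by positivity), ← ENNReal.rpow_mul,
      mul_one_div_cancel hc0.ne', ENNReal.rpow_one, mul_right_comm,
      ← ENNReal.rpow_add_of_nonneg _ _ (by positivity) (sub_nonneg.2 ((div_le_one hc0).2 hc)),
      add_sub_cancel, ENNReal.rpow_one]
  calc heatConv τ f x ^ c ≤ (heatConv τ (fun y => f y ^ c) x ^ (1 / c)) ^ c :=
        rpow_le_rpow h2 hc0.le
    _ = _ := by rw [← ENNReal.rpow_mul, one_div_mul_cancel hc0.ne', ENNReal.rpow_one]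

theorem lintegral_heatConv {τ : ℝ} (hτ : 0 < τ) {f : Space N → ℝ≥0∞} (hf : Measurable f) :
    ∫⁻ x, heatConv τ f x = ∫⁻ y, f y := by
  unfold heatConv
  have hm : Measurable fun q : Space N × Space N => heatKernel N τ (q.1 - q.2) :=
    measurable_heatKernel.comp (f := fun q : Space N × Space N => (τ, q.1 - q.2)) (by fun_prop)
  rw [lintegral_lintegral_swap (by fun_prop)]
  refine lintegral_congr fun y => ?_
  rw [lintegral_mul_const _ (by
    exact (hm.comp measurable_prodMk_right).ennreal_ofReal),
    lintegral_sub_right_eq_self (fun x => ofReal (heatKernel N τ x)),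
    lintegral_heatKernel hτ, one_mul]

/-- The `L^c`-`L^b` estimate of the heat semigroup. -/
theorem lpn_heatConv_le {τ c b : ℝ} (hτ : 0 < τ) (hc : 1 ≤ c) (hcb : c ≤ b)
    {f : Space N → ℝ≥0∞} (hf : Measurable f) :
    lpn b (heatConv τ f) ≤
      ofReal (τ ^ (-((N : ℝ) / 2 * (1 / c - 1 / b)))) * lpn c f := by
  have hc0 : 0 < c := one_pos.trans_le hc
  have hb0 : 0 < b := hc0.trans_le hcb
  set H : ℝ≥0∞ := ofReal ((4 * Real.pi * τ) ^ (-(N : ℝ) / 2)) with hH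
  set J := ∫⁻ y, f y ^ c with hJ
  have hfc : Measurable fun y => f y ^ c := hf.pow_const c
  have hsup : ∀ x, heatConv τ (fun y => f y ^ c) x ≤ H * J := by
    intro x
    rw [hJ, ← lintegral_const_mul _ hfc]
    refine lintegral_mono fun y => ?_
    gcongr
    exact ofReal_le_ofReal (heatKernel_le hτ _)
  have hbc : 0 ≤ b / c - 1 := sub_nonneg.2 ((one_le_div hc0).2 hcb)
  -- Of the b/c factors e^{τΔ}(f^c), one is integrated exactly by conservation of mass, and the
  -- others are bounded by the maximum of the kernel.
  have h1 : ∫⁻ x, heatConv τ f x ^ b ≤ J * (H * J) ^ (b / c - 1) := by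
    calc ∫⁻ x, heatConv τ f x ^ b
        ≤ ∫⁻ x, heatConv τ (fun y => f y ^ c) x * (H * J) ^ (b / c - 1) := by
          refine lintegral_mono fun x => ?_
          calc heatConv τ f x ^ b = (heatConv τ f x ^ c) ^ (b / c) := by
                rw [← ENNReal.rpow_mul, mul_div_cancel₀ _ hc0.ne']
            _ ≤ heatConv τ (fun y => f y ^ c) x ^ (b / c) :=
                rpow_le_rpow (heatConv_rpow_le hτ hc hf x) (by positivity)
            _ = heatConv τ (fun y => f y ^ c) x * heatConv τ (fun y => f y ^ c) x ^ (b / c - 1) := by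
                nth_rw 2 [← ENNReal.rpow_one (heatConv τ (fun y => f y ^ c) x)]
                rw [← ENNReal.rpow_add_of_nonneg _ _ zero_le_one hbc, add_sub_cancel]
            _ ≤ _ := by
                gcongr
                exact hsup x
      _ = J * (H * J) ^ (b / c - 1) := by
          rw [lintegral_mul_const _ (measurable_heatConv_right hfc τ),
            lintegral_heatConv hτ hfc]
  have h2 : lpn b (heatConv τ f) ≤ H ^ (1 / c - 1 / b) * J ^ (1 / c) := by
    calc lpn b (heatConv τ f) ≤ (J * (H * J) ^ (b / c - 1)) ^ (1 / b) :=
          rpow_le_rpow h1 (by positivity)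
      _ = (H ^ (b / c - 1) * J ^ (b / c)) ^ (1 / b) := by
          congr 1
          rw [mul_rpow_of_nonneg _ _ hbc, mul_left_comm]
          congr 1
          nth_rw 1 [← ENNReal.rpow_one J]
          rw [← ENNReal.rpow_add_of_nonneg _ _ zero_le_one hbc, add_sub_cancel]
      _ = H ^ (1 / c - 1 / b) * J ^ (1 / c) := by
          rw [mul_rpow_of_nonneg _ _ (by positivity), ← ENNReal.rpow_mul,
            ← ENNReal.rpow_mul, show (b / c - 1) * (1 / b) = 1 / c - 1 / b by field_simp,
            show b / c * (1 / b) = 1 / c by field_simp]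
  refine h2.trans ?_
  rw [lpn, ← hJ]
  gcongr
  have hκ : 0 ≤ 1 / c - 1 / b := sub_nonneg.2 (one_div_le_one_div_of_le hc0 hcb)
  rw [hH, ENNReal.ofReal_rpow_of_pos (by positivity), ← Real.rpow_mul (by positivity)]
  refine ofReal_le_ofReal ?_
  rw [show -(N : ℝ) / 2 * (1 / c - 1 / b) = -((N : ℝ) / 2 * (1 / c - 1 / b)) by ring]
  refine Real.rpow_le_rpow_of_nonpos hτ ?_ (by rw [neg_nonpos]; positivity)
  nlinarith [Real.pi_gt_three]

end Heat

/-! ### The heat semigroup on weighted spaces -/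

section Weighted

variable {N : ℕ}

/-- The weight `|y|^σ`. -/
def wt (σ : ℝ) (y : Space N) : ℝ≥0∞ := ofReal (‖y‖ ^ σ)

theorem measurable_wt (σ : ℝ) : Measurable (wt σ : Space N → ℝ≥0∞) := by
  unfold wt
  fun_prop

theorem lintegral_comp_inv_smul {R : ℝ} (hR : 0 < R) {g : Space N → ℝ≥0∞} (hg : Measurable g) :
    ∫⁻ x, g (R⁻¹ • x) = ofReal (R ^ N) * ∫⁻ x, g x := by
  have h1 := lintegral_map (μ := (volume : Measure (Space N))) hg (measurable_const_smul (R⁻¹))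
  rw [Measure.map_addHaar_smul _ (inv_pos.2 hR).ne', lintegral_smul_measure, smul_eq_mul,
    finrank_euclideanSpace, Fintype.card_fin] at h1
  rw [← h1, inv_pow, inv_inv, abs_of_pos (by positivity)]

/-- The weight is homogeneous of degree σ, and the dilation by R contributes the volume factor
R^{N/m}. -/
theorem lpn_wt_indicator_scale {σ m R : ℝ} (hm : 0 < m) (hR : 0 < R) {s : Set ℝ} (hs : MeasurableSet s) :
    lpn m (fun x : Space N => ({x | ‖x‖ / R ∈ s} : Set (Space N)).indicator (wt σ) x) =
      ofReal (R ^ ((N : ℝ) / m + σ)) *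
        lpn m (fun x : Space N => ({x | ‖x‖ ∈ s} : Set (Space N)).indicator (wt σ) x) := by
  have hms : MeasurableSet ({x | ‖x‖ ∈ s} : Set (Space N)) := measurable_norm hs
  have hmeas : Measurable fun x : Space N => ({x | ‖x‖ ∈ s} : Set (Space N)).indicator (wt σ) x :=
    (measurable_wt σ).indicator hms
  have e : ∀ x : Space N, ({x | ‖x‖ / R ∈ s} : Set (Space N)).indicator (wt σ) x =
      ofReal (R ^ σ) * ({x | ‖x‖ ∈ s} : Set (Space N)).indicator (wt σ) (R⁻¹ • x) := by
    intro x
    have hn : ‖R⁻¹ • x‖ = ‖x‖ / R := by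
      rw [norm_smul, norm_inv, Real.norm_of_nonneg hR.le, inv_mul_eq_div]
    by_cases hx : ‖x‖ / R ∈ s
    · rw [indicator_of_mem (by exact hx), indicator_of_mem (by rw [mem_ofPred_eq, hn]; exact hx), wt,
        wt, hn, ← ofReal_mul (by positivity), ← Real.mul_rpow hR.le (by positivity),
        mul_div_cancel₀ _ hR.ne']
    · rw [indicator_of_notMem (by exact hx), indicator_of_notMem (by rw [mem_ofPred_eq, hn]; exact hx),
        mul_zero]
  simp_rw [e]
  have hm2 : Measurable fun x : Space N =>
      ({x | ‖x‖ ∈ s} : Set (Space N)).indicator (wt σ) (R⁻¹ • x) :=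
    hmeas.comp (measurable_const_smul _)
  rw [lpn_const_mul hm _ hm2]
  unfold lpn
  rw [lintegral_comp_inv_smul hR (hmeas.pow_const m), mul_rpow_of_nonneg _ _ (by positivity),
    ← mul_assoc, ENNReal.ofReal_rpow_of_pos (by positivity), ← ofReal_mul (by positivity),
    ← Real.rpow_natCast, ← Real.rpow_mul hR.le, ← Real.rpow_add hR, mul_one_div, add_comm]

theorem lintegral_wt_indicator_lt_top (hN : 1 ≤ N) {σ m : ℝ} (hm : 0 < m) {s : Set ℝ}
    (hs : MeasurableSet s)
    (h : IntegrableOn (fun y : ℝ => y ^ ((N : ℝ) - 1 + σ * m)) (Ioi 0 ∩ s)) :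
    lpn m (fun x : Space N => ({x | ‖x‖ ∈ s} : Set (Space N)).indicator (wt σ) x) < ∞ := by
  have : Nonempty (Fin N) := ⟨⟨0, hN⟩⟩
  have hi : Integrable (fun x : Space N => s.indicator (fun y : ℝ => y ^ (σ * m)) ‖x‖) := by
    rw [integrable_fun_norm_addHaar volume (f := s.indicator fun y : ℝ => y ^ (σ * m)),
      finrank_euclideanSpace, Fintype.card_fin]
    have h2 : IntegrableOn (s.indicator fun y : ℝ => y ^ ((N : ℝ) - 1 + σ * m)) (Ioi 0) := by
      rw [integrableOn_indicator_iff hs, inter_comm]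
      exact h
    refine h2.congr_fun (fun y hy => ?_) measurableSet_Ioi
    have hy : 0 < y := hy
    by_cases hys : y ∈ s
    · simp only [indicator_of_mem hys, smul_eq_mul]
      rw [Real.rpow_add hy, ← Real.rpow_natCast, Nat.cast_sub hN, Nat.cast_one]
    · simp [indicator_of_notMem hys]
  unfold lpn
  refine rpow_lt_top_of_nonneg (by positivity) (ne_of_lt ?_)
  refine lt_of_le_of_lt (lintegral_mono fun x => ?_) hi.2
  by_cases hx : ‖x‖ ∈ s
  · simp only []
    rw [indicator_of_mem (show x ∈ {x : Space N | ‖x‖ ∈ s} from hx), indicator_of_mem hx, wt,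
      ENNReal.ofReal_rpow_of_nonneg (by positivity) hm.le, ← Real.rpow_mul (norm_nonneg x),
      Real.enorm_of_nonneg (by positivity)]
  · simp only []
    rw [indicator_of_notMem (show x ∉ {x : Space N | ‖x‖ ∈ s} from hx), ENNReal.zero_rpow_of_pos hm]
    exact zero_le

theorem exists_lpn_wt_ball_le (hN : 1 ≤ N) {σ m : ℝ} (hm : 0 < m) (h : 0 < (N : ℝ) / m + σ) :
    ∃ C : ℝ, 0 ≤ C ∧ ∀ R : ℝ, 0 < R →
      lpn m (fun x : Space N => ({x | ‖x‖ / R ∈ Iio 1} : Set (Space N)).indicator (wt σ) x) ≤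
        ofReal (C * R ^ ((N : ℝ) / m + σ)) := by
  have hf := lintegral_wt_indicator_lt_top hN hm (σ := σ) (s := Iio 1) measurableSet_Iio (by
    rw [Ioi_inter_Iio, intervalIntegral.integrableOn_Ioo_rpow_iff one_pos]
    have := mul_pos h hm
    rw [add_mul, div_mul_cancel₀ _ hm.ne'] at this
    linarith)
  refine ⟨(lpn m fun x : Space N => ({x | ‖x‖ ∈ Iio 1} : Set (Space N)).indicator (wt σ) x).toReal,
    ENNReal.toReal_nonneg, fun R hR => ?_⟩
  rw [lpn_wt_indicator_scale hm hR measurableSet_Iio, mul_comm,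
    ofReal_mul ENNReal.toReal_nonneg, ENNReal.ofReal_toReal hf.ne]

theorem exists_lpn_wt_compl_ball_le (hN : 1 ≤ N) {σ m : ℝ} (hm : 0 < m) (h : (N : ℝ) / m + σ < 0) :
    ∃ C : ℝ, 0 ≤ C ∧ ∀ R : ℝ, 0 < R →
      lpn m (fun x : Space N => ({x | ‖x‖ / R ∈ Ici 1} : Set (Space N)).indicator (wt σ) x) ≤
        ofReal (C * R ^ ((N : ℝ) / m + σ)) := by
  have hf := lintegral_wt_indicator_lt_top hN hm (σ := σ) (s := Ici 1) measurableSet_Ici (by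
    have hsub : Ioi (0 : ℝ) ∩ Ici 1 = Ici 1 :=
      inter_eq_self_of_subset_right (Ici_subset_Ioi.2 one_pos)
    rw [hsub, integrableOn_Ici_iff_integrableOn_Ioi]
    refine integrableOn_Ioi_rpow_of_lt ?_ one_pos
    have := mul_neg_of_neg_of_pos h hm
    rw [add_mul, div_mul_cancel₀ _ hm.ne'] at this
    linarith)
  refine ⟨(lpn m fun x : Space N => ({x | ‖x‖ ∈ Ici 1} : Set (Space N)).indicator (wt σ) x).toReal,
    ENNReal.toReal_nonneg, fun R hR => ?_⟩
  rw [lpn_wt_indicator_scale hm hR measurableSet_Ici, mul_comm,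
    ofReal_mul ENNReal.toReal_nonneg, ENNReal.ofReal_toReal hf.ne]

theorem heatConv_add {τ : ℝ} {f g : Space N → ℝ≥0∞} (hf : Measurable f) (x : Space N) :
    heatConv τ (fun y => f y + g y) x = heatConv τ f x + heatConv τ g x := by
  unfold heatConv
  simp_rw [mul_add]
  exact lintegral_add_left ((measurable_heatKernel_sub τ x).ennreal_ofReal.mul hf) _

/-- Smoothing in `L^a → L^b` of the multiplication by `φ` followed by the heat semigroup. -/
def HeatBound (N : ℕ) (φ : Space N → ℝ≥0∞) (a b β C : ℝ) : Prop :=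
  ∀ τ : ℝ, 0 < τ → ∀ f : Space N → ℝ≥0∞, Measurable f →
    lpn b (heatConv τ fun y => φ y * f y) ≤ ofReal (C * τ ^ (-β)) * lpn a f

theorem heatBound_one {a b : ℝ} (ha : 1 ≤ a) (hab : a ≤ b) :
    HeatBound N (fun _ => 1) a b ((N : ℝ) / 2 * (1 / a - 1 / b)) 1 := by
  intro τ hτ f hf
  simpa using lpn_heatConv_le hτ ha hab hf

/-- Hölder's inequality puts the piece φ of the weight into L^m, and the smoothing L^c → L^b
follows. A piece cut at radius √τ has L^m norm of order τ^{N/(2m)+σ/2}, so the exponent m disappears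
from the final power of τ. -/
theorem lpn_heatConv_mul_le {σ a b c m : ℝ} (ha : 0 < a) (hm : 0 < m) (hcm : 1 / c = 1 / m + 1 / a)
    (hc : 1 ≤ c) (hcb : c ≤ b) {C e : ℝ} {φ : Space N → ℝ≥0∞} (hφ : Measurable φ) {τ : ℝ} (hτ : 0 < τ)
    (hbd : lpn m φ ≤ ofReal (C * Real.sqrt τ ^ e)) (he : e = (N : ℝ) / m + σ) (hC : 0 ≤ C)
    {f : Space N → ℝ≥0∞} (hf : Measurable f) :
    lpn b (heatConv τ fun y => φ y * f y) ≤
      ofReal (C * τ ^ (-((N : ℝ) / 2 * (1 / a - 1 / b) - σ / 2))) * lpn a f := by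
  have hc0 : 0 < c := one_pos.trans_le hc
  have hcm' : c < m := by
    have : 1 / m < 1 / c := by rw [hcm]; linarith [one_div_pos.2 ha]
    exact lt_of_one_div_lt_one_div hm this
  refine (lpn_heatConv_le hτ hc hcb (hφ.mul hf)).trans ?_
  calc _ ≤ ofReal (τ ^ (-((N : ℝ) / 2 * (1 / c - 1 / b)))) *
        (ofReal (C * Real.sqrt τ ^ e) * lpn a f) := by
        gcongr
        exact (lpn_mul_le hc0 hcm' hcm hφ.aemeasurable hf.aemeasurable).trans (by gcongr)
    _ = _ := by
        rw [← mul_assoc, ← ofReal_mul (by positivity)]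
        congr 2
        rw [Real.sqrt_eq_rpow, ← Real.rpow_mul hτ.le, mul_left_comm, ← Real.rpow_add hτ]
        congr 2
        rw [he, hcm]
        field_simp
        ring

/-- For σ < 0 the weight lies in no L^m, but its part inside |y| < √τ does for m slightly below
N/|σ|, and its part outside for m slightly above. Both parts give the same power of τ. -/
theorem exists_heatBound_wt (hN : 1 ≤ N) {σ a b : ℝ} (hσ : σ ≤ 0) (ha : 0 < a) (hb : 0 < b)
    (h1 : 1 / b < 1 / a - σ / N) (h2 : 1 / a - σ / N < 1) :
    ∃ C : ℝ, 0 < C ∧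
      HeatBound N (wt σ) a b ((N : ℝ) / 2 * (1 / a - 1 / b) - σ / 2) C := by
  have hN0 : (0 : ℝ) < N := by exact_mod_cast hN
  rcases hσ.eq_or_lt with rfl | hσ
  · refine ⟨1, one_pos, ?_⟩
    simp only [zero_div, sub_zero] at h1 h2 ⊢
    have := heatBound_one (N := N) (a := a) (b := b) ((div_le_one ha).1 h2.le)
      (le_of_one_div_le_one_div hb h1.le)
    simpa [HeatBound, wt] using this
  · set δ := min (min (1 - (1 / a - σ / N)) (1 / a - σ / N - 1 / b)) (-σ / N) / 2 with hδ
    have hσN : 0 < -σ / N := by have := neg_pos.2 hσ; positivity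
    have hδ0 : 0 < δ := by
      refine half_pos (lt_min (lt_min ?_ ?_) hσN) <;> linarith
    have d1 : 2 * δ ≤ 1 - (1 / a - σ / N) := by
      rw [hδ, mul_div_cancel₀ _ two_ne_zero]; exact (min_le_left _ _).trans (min_le_left _ _)
    have d2 : 2 * δ ≤ 1 / a - σ / N - 1 / b := by
      rw [hδ, mul_div_cancel₀ _ two_ne_zero]; exact (min_le_left _ _).trans (min_le_right _ _)
    have d3 : 2 * δ ≤ -σ / N := by
      rw [hδ, mul_div_cancel₀ _ two_ne_zero]; exact min_le_right _ _
    have hneg : -σ / N = -(σ / N) := neg_div _ _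
    have ha' := one_div_pos.2 ha
    have hb' := one_div_pos.2 hb
    -- exponents for the two parts of the weight
    have hm1 : 0 < -σ / N + δ := by linarith
    have hm2 : 0 < -σ / N - δ := by linarith
    have hN1 : (N : ℝ) / (1 / (-σ / N + δ)) + σ = N * δ := by field_simp; ring
    have hN2 : (N : ℝ) / (1 / (-σ / N - δ)) + σ = -(N * δ) := by field_simp; ring
    obtain ⟨C1, hC1, hb1⟩ := exists_lpn_wt_ball_le hN (σ := σ) (m := 1 / (-σ / N + δ))
      (by positivity) (by rw [hN1]; positivity)
    obtain ⟨C2, hC2, hb2⟩ := exists_lpn_wt_compl_ball_le hN (σ := σ) (m := 1 / (-σ / N - δ))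
      (by positivity) (by rw [hN2]; have : 0 < N * δ := by positivity
                          linarith)
    have hb1b : 1 ≤ b := by
      have : 1 / b < 1 := h1.trans h2
      exact ((div_lt_one hb).1 this).le
    refine ⟨C1 + C2 + 1, by positivity, fun τ hτ f hf => ?_⟩
    have hsτ : 0 < Real.sqrt τ := Real.sqrt_pos.2 hτ
    set s1 : Set (Space N) := {x | ‖x‖ / Real.sqrt τ ∈ Iio 1} with hs1
    set s2 : Set (Space N) := {x | ‖x‖ / Real.sqrt τ ∈ Ici 1} with hs2
    have ms1 : MeasurableSet s1 := (measurable_norm.div_const _) measurableSet_Iio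
    have ms2 : MeasurableSet s2 := (measurable_norm.div_const _) measurableSet_Ici
    have mf1 : Measurable fun x => s1.indicator (wt σ) x := (measurable_wt σ).indicator ms1
    have mf2 : Measurable fun x => s2.indicator (wt σ) x := (measurable_wt σ).indicator ms2
    have hsplit : ∀ y, wt σ y * f y = s1.indicator (wt σ) y * f y + s2.indicator (wt σ) y * f y := by
      intro y
      rw [← add_mul]
      congr 1
      by_cases hy : ‖y‖ / Real.sqrt τ < 1
      · rw [indicator_of_mem (show y ∈ s1 from hy),
          indicator_of_notMem (show y ∉ s2 from not_le.2 hy), add_zero]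
      · rw [indicator_of_notMem (show y ∉ s1 from hy),
          indicator_of_mem (show y ∈ s2 from not_lt.1 hy), zero_add]
    simp_rw [hsplit]
    have e1 : lpn b (heatConv τ fun y => s1.indicator (wt σ) y * f y) ≤
        ofReal (C1 * τ ^ (-((N : ℝ) / 2 * (1 / a - 1 / b) - σ / 2))) * lpn a f := by
      refine lpn_heatConv_mul_le (c := 1 / (1 / a + (-σ / N + δ))) ha (m := 1 / (-σ / N + δ))
        (by positivity) (by rw [one_div_one_div, one_div_one_div]; ring) ?_ ?_ mf1 hτ
        (hb1 _ hsτ) rfl hC1 hf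
      · rw [one_le_div (by positivity)]; linarith
      · rw [div_le_iff₀ (by positivity), ← div_le_iff₀' hb]; linarith
    have e2 : lpn b (heatConv τ fun y => s2.indicator (wt σ) y * f y) ≤
        ofReal (C2 * τ ^ (-((N : ℝ) / 2 * (1 / a - 1 / b) - σ / 2))) * lpn a f := by
      refine lpn_heatConv_mul_le (c := 1 / (1 / a + (-σ / N - δ))) ha (m := 1 / (-σ / N - δ))
        (by positivity) (by rw [one_div_one_div, one_div_one_div]; ring) ?_ ?_ mf2 hτ
        (hb2 _ hsτ) rfl hC2 hf
      · rw [one_le_div (by positivity)]; linarith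
      · rw [div_le_iff₀ (by positivity), ← div_le_iff₀' hb]; linarith
    have e3 : lpn b (heatConv τ fun y => s1.indicator (wt σ) y * f y + s2.indicator (wt σ) y * f y) ≤
        lpn b (heatConv τ fun y => s1.indicator (wt σ) y * f y) +
        lpn b (heatConv τ fun y => s2.indicator (wt σ) y * f y) := by
      refine le_trans (le_of_eq ?_) (lpn_add_le hb1b
        (measurable_heatConv_right (mf1.mul hf) τ).aemeasurable
        (measurable_heatConv_right (mf2.mul hf) τ).aemeasurable)
      congr 1
      funext x
      exact heatConv_add (mf1.mul hf) x
    refine (e3.trans (add_le_add e1 e2)).trans ?_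
    rw [← add_mul, ← ofReal_add (by positivity) (by positivity), ← add_mul]
    exact mul_le_mul_left (ofReal_le_ofReal
      (mul_le_mul_of_nonneg_right (by linarith) (by positivity))) _

end Weighted

/-! ### Superpositions of heat operators -/

section HeatOp

variable {N : ℕ} {Z : Type*} [MeasurableSpace Z]

/-- `∫ e^{h(z)Δ} F(z) dμ(z)`. -/
def heatOp (μ : Measure Z) (h : Z → ℝ) (F : Z → Space N → ℝ) (x : Space N) : ℝ :=
  ∫ q, heatKernel N (h q.1) (x - q.2) * F q.1 q.2 ∂(μ.prod volume)

/-- `∫ e^{h(z)Δ} |F(z)| dμ(z)`. -/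
def heatAbs (μ : Measure Z) (h : Z → ℝ) (F : Z → Space N → ℝ) (x : Space N) : ℝ≥0∞ :=
  ∫⁻ z, heatConv (h z) (fun y => ‖F z y‖ₑ) x ∂μ

variable {μ : Measure Z} [SigmaFinite μ] {h : Z → ℝ}

theorem measurable_heatOp_integrand (hh : Measurable h) {F : Z → Space N → ℝ}
    (hF : Measurable (uncurry F)) :
    Measurable fun p : Space N × (Z × Space N) =>
      heatKernel N (h p.2.1) (p.1 - p.2.2) * F p.2.1 p.2.2 := by
  have h1 : Measurable fun p : Space N × (Z × Space N) => heatKernel N (h p.2.1) (p.1 - p.2.2) :=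
    measurable_heatKernel.comp (f := fun p : Space N × (Z × Space N) => (h p.2.1, p.1 - p.2.2))
      (by fun_prop)
  have h2 : Measurable fun p : Space N × (Z × Space N) => F p.2.1 p.2.2 := hF.comp measurable_snd
  exact h1.mul h2

theorem measurable_heatOp_section (hh : Measurable h) {F : Z → Space N → ℝ}
    (hF : Measurable (uncurry F)) (x : Space N) :
    Measurable fun q : Z × Space N => heatKernel N (h q.1) (x - q.2) * F q.1 q.2 :=
  (measurable_heatOp_integrand hh hF).comp (measurable_prodMk_left (x := x))

theorem measurable_heatOp_param {T : Type*} [MeasurableSpace T] (hh : Measurable h)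
    {F : T → Z → Space N → ℝ} (hF : Measurable fun p : T × (Z × Space N) => F p.1 p.2.1 p.2.2) :
    Measurable fun p : T × Space N => heatOp μ h (F p.1) p.2 := by
  have h1 : Measurable fun p : (T × Space N) × (Z × Space N) =>
      heatKernel N (h p.2.1) (p.1.2 - p.2.2) :=
    measurable_heatKernel.comp
      (f := fun p : (T × Space N) × (Z × Space N) => (h p.2.1, p.1.2 - p.2.2)) (by fun_prop)
  have h2 : Measurable fun p : (T × Space N) × (Z × Space N) => F p.1.1 p.2.1 p.2.2 :=
    hF.comp (f := fun p : (T × Space N) × (Z × Space N) => (p.1.1, p.2)) (by fun_prop)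
  exact (StronglyMeasurable.integral_prod_right' (h1.mul h2).stronglyMeasurable).measurable

theorem measurable_heatConv_family (hh : Measurable h) {f : Z → Space N → ℝ≥0∞}
    (hf : Measurable (uncurry f)) :
    Measurable (uncurry fun z x => heatConv (h z) (f z) x) := by
  have h1 : Measurable fun p : (Z × Space N) × Space N => heatKernel N (h p.1.1) (p.1.2 - p.2) :=
    measurable_heatKernel.comp
      (f := fun p : (Z × Space N) × Space N => (h p.1.1, p.1.2 - p.2)) (by fun_prop)
  have h2 : Measurable fun p : (Z × Space N) × Space N => f p.1.1 p.2 :=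
    hf.comp (f := fun p : (Z × Space N) × Space N => (p.1.1, p.2)) (by fun_prop)
  exact Measurable.lintegral_prod_right' (h1.ennreal_ofReal.mul h2)

theorem measurable_heatAbs (hh : Measurable h) {F : Z → Space N → ℝ}
    (hF : Measurable (uncurry F)) : Measurable (heatAbs μ h F) :=
  Measurable.lintegral_prod_left'
    (f := fun q : Z × Space N => heatConv (h q.1) (fun y => ‖F q.1 y‖ₑ) q.2)
    (measurable_heatConv_family (f := fun z y => ‖F z y‖ₑ) hh hF.enorm)

theorem lintegral_enorm_heatOp (hh : Measurable h) (hpos : ∀ᵐ z ∂μ, 0 < h z) {F : Z → Space N → ℝ}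
    (hF : Measurable (uncurry F)) (x : Space N) :
    ∫⁻ q, ‖heatKernel N (h q.1) (x - q.2) * F q.1 q.2‖ₑ ∂(μ.prod volume) = heatAbs μ h F x := by
  rw [lintegral_prod _ (measurable_heatOp_section hh hF x).enorm.aemeasurable]
  refine lintegral_congr_ae (hpos.mono fun z hz => ?_)
  refine lintegral_congr fun y => ?_
  rw [enorm_mul, Real.enorm_of_nonneg (heatKernel_nonneg _ hz.le _)]

theorem integrable_heatOp (hh : Measurable h) (hpos : ∀ᵐ z ∂μ, 0 < h z) {F : Z → Space N → ℝ}
    (hF : Measurable (uncurry F)) {x : Space N} (hx : heatAbs μ h F x < ∞) :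
    Integrable (fun q : Z × Space N => heatKernel N (h q.1) (x - q.2) * F q.1 q.2)
      (μ.prod volume) :=
  ⟨(measurable_heatOp_section hh hF x).aestronglyMeasurable, by
    rw [HasFiniteIntegral, lintegral_enorm_heatOp hh hpos hF]; exact hx⟩

theorem enorm_heatOp_le (hh : Measurable h) (hpos : ∀ᵐ z ∂μ, 0 < h z) {F : Z → Space N → ℝ}
    (hF : Measurable (uncurry F)) (x : Space N) :
    ‖heatOp μ h F x‖ₑ ≤ heatAbs μ h F x :=
  (enorm_integral_le_lintegral_enorm _).trans_eq (lintegral_enorm_heatOp hh hpos hF x)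

theorem heatOp_sub (hh : Measurable h) (hpos : ∀ᵐ z ∂μ, 0 < h z) {F G : Z → Space N → ℝ}
    (hF : Measurable (uncurry F)) (hG : Measurable (uncurry G)) {x : Space N}
    (hx : heatAbs μ h F x < ∞) (hx' : heatAbs μ h G x < ∞) :
    heatOp μ h F x - heatOp μ h G x = heatOp μ h (fun z y => F z y - G z y) x := by
  unfold heatOp
  rw [← integral_sub (integrable_heatOp hh hpos hF hx) (integrable_heatOp hh hpos hG hx')]
  simp_rw [mul_sub]

theorem heatOp_nonneg (hpos : ∀ᵐ z ∂μ, 0 < h z) {F : Z → Space N → ℝ}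
    (hF0 : ∀ᵐ z ∂μ, ∀ᵐ y, 0 ≤ F z y) (hF : Measurable (uncurry F)) (x : Space N) :
    0 ≤ heatOp μ h F x := by
  refine integral_nonneg_of_ae ?_
  have hms : MeasurableSet {q : Z × Space N | 0 ≤ F q.1 q.2} := measurableSet_le measurable_const hF
  have h1 : ∀ᵐ q ∂(μ.prod (volume : Measure (Space N))), 0 ≤ F q.1 q.2 :=
    (Measure.ae_prod_iff_ae_ae hms).2 hF0
  have h2 : ∀ᵐ q ∂(μ.prod (volume : Measure (Space N))), 0 < h q.1 :=
    Measure.quasiMeasurePreserving_fst.ae hpos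
  filter_upwards [h1, h2] with q hq1 hq2
  exact mul_nonneg (heatKernel_nonneg _ hq2.le _) hq1

theorem heatOp_congr {F G : Z → Space N → ℝ}
    (hF : Measurable (uncurry F)) (hG : Measurable (uncurry G))
    (hFG : ∀ᵐ z ∂μ, F z =ᵐ[volume] G z) (x : Space N) : heatOp μ h F x = heatOp μ h G x := by
  have hms : MeasurableSet {q : Z × Space N | F q.1 q.2 = G q.1 q.2} := measurableSet_eq_fun hF hG
  have h1 : ∀ᵐ q ∂(μ.prod (volume : Measure (Space N))), F q.1 q.2 = G q.1 q.2 :=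
    (Measure.ae_prod_iff_ae_ae hms).2 hFG
  exact integral_congr_ae (h1.mono fun q hq => by simp only [hq])

/-- The norm of the density that controls a superposition of heat operators. -/
def heatBudget (μ : Measure Z) (h : Z → ℝ) (a β : ℝ) (G : Z → Space N → ℝ) : ℝ≥0∞ :=
  ∫⁻ z, ofReal (h z ^ (-β)) * lpn a (fun y => ‖G z y‖ₑ) ∂μ

theorem measurable_lpn_family {G : Z → Space N → ℝ} (hG : Measurable (uncurry G)) (a : ℝ) :
    Measurable fun z => lpn a (fun y => ‖G z y‖ₑ) :=
  (Measurable.lintegral_prod_right' (f := fun q : Z × Space N => ‖G q.1 q.2‖ₑ ^ a)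
    (hG.enorm.pow_const a)).pow_const _

/-- Minkowski's inequality in z, with the smoothing bound for each z. The factor φ does not depend
on z, so a single bound with exponent β serves all heat times. -/
theorem lpn_heatAbs_le (hh : Measurable h) (hpos : ∀ᵐ z ∂μ, 0 < h z) {φ : Space N → ℝ}
    (hφ : Measurable φ) {a b β C : ℝ} (hb : 1 ≤ b) (hB : HeatBound N (fun y => ‖φ y‖ₑ) a b β C)
    (hC : 0 ≤ C) {G : Z → Space N → ℝ} (hG : Measurable (uncurry G)) :
    lpn b (heatAbs μ h fun z y => φ y * G z y) ≤ ofReal C * heatBudget μ h a β G := by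
  have hF : Measurable (uncurry fun z y => φ y * G z y) := (hφ.comp measurable_snd).mul hG
  have hl := measurable_lpn_family hG a
  have h1 : Measurable fun z => ofReal (h z ^ (-β)) * lpn a (fun y => ‖G z y‖ₑ) := by fun_prop
  rw [heatBudget, ← lintegral_const_mul _ h1]
  refine lpn_lintegral_le hb (measurable_heatConv_family hh hF.enorm)
    (h1.const_mul _).aemeasurable (hpos.mono fun z hz => ?_)
  have hGz : Measurable (G z) := hG.of_uncurry_left
  have := hB (h z) hz _ hGz.enorm
  simp_rw [enorm_mul]
  refine this.trans (le_of_eq ?_)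
  rw [ofReal_mul hC, mul_assoc]

/-- A finite norm gives absolute convergence at almost every x. This is the licence for linearity
and for Fubini's theorem. -/
theorem ae_heatAbs_lt_top (hh : Measurable h) (hpos : ∀ᵐ z ∂μ, 0 < h z) {φ : Space N → ℝ}
    (hφ : Measurable φ) {a b β C : ℝ} (hb : 1 ≤ b) (hB : HeatBound N (fun y => ‖φ y‖ₑ) a b β C)
    (hC : 0 ≤ C) {G : Z → Space N → ℝ} (hG : Measurable (uncurry G))
    (hfin : heatBudget μ h a β G < ∞) :
    ∀ᵐ x, heatAbs μ h (fun z y => φ y * G z y) x < ∞ := by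
  have hF : Measurable (uncurry fun z y => φ y * G z y) := (hφ.comp measurable_snd).mul hG
  have hb0 : 0 < b := one_pos.trans_le hb
  have h1 : lpn b (heatAbs μ h fun z y => φ y * G z y) < ∞ :=
    (lpn_heatAbs_le hh hpos hφ hb hB hC hG).trans_lt (mul_lt_top ofReal_lt_top hfin)
  have h2 : ∫⁻ x, heatAbs μ h (fun z y => φ y * G z y) x ^ b < ∞ := by
    rw [← lpn_rpow hb0]
    exact rpow_lt_top_of_nonneg hb0.le h1.ne
  filter_upwards [ae_lt_top ((measurable_heatAbs hh hF).pow_const b) h2.ne] with x hx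
  exact (ENNReal.rpow_lt_top_iff_of_pos hb0).1 hx

theorem lpn_heatOp_le (hh : Measurable h) (hpos : ∀ᵐ z ∂μ, 0 < h z) {φ : Space N → ℝ}
    (hφ : Measurable φ) {a b β C : ℝ} (hb : 1 ≤ b) (hB : HeatBound N (fun y => ‖φ y‖ₑ) a b β C)
    (hC : 0 ≤ C) {G : Z → Space N → ℝ} (hG : Measurable (uncurry G)) :
    lpn b (fun x => ‖heatOp μ h (fun z y => φ y * G z y) x‖ₑ) ≤
      ofReal C * heatBudget μ h a β G :=
  (lpn_mono (one_pos.trans_le hb) (Eventually.of_forall fun x =>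
    enorm_heatOp_le hh hpos ((hφ.comp measurable_snd).mul hG) x)).trans
    (lpn_heatAbs_le hh hpos hφ hb hB hC hG)

theorem lpn_heatOp_sub_le (hh : Measurable h) (hpos : ∀ᵐ z ∂μ, 0 < h z) {φ : Space N → ℝ}
    (hφ : Measurable φ) {a b β C : ℝ} (hb : 1 ≤ b) (hB : HeatBound N (fun y => ‖φ y‖ₑ) a b β C)
    (hC : 0 ≤ C) {G H : Z → Space N → ℝ} (hG : Measurable (uncurry G))
    (hH : Measurable (uncurry H)) (hGf : heatBudget μ h a β G < ∞)
    (hHf : heatBudget μ h a β H < ∞) :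
    lpn b (fun x => ‖heatOp μ h (fun z y => φ y * G z y) x -
        heatOp μ h (fun z y => φ y * H z y) x‖ₑ) ≤
      ofReal C * heatBudget μ h a β (fun z y => G z y - H z y) := by
  refine le_trans (le_of_eq ?_) (lpn_heatOp_le hh hpos hφ hb hB hC (G := fun z y => G z y - H z y)
    (hG.sub hH))
  refine lpn_congr ?_
  filter_upwards [ae_heatAbs_lt_top hh hpos hφ hb hB hC hG hGf,
    ae_heatAbs_lt_top hh hpos hφ hb hB hC hH hHf] with x hx1 hx2
  rw [heatOp_sub hh hpos ((hφ.comp measurable_snd).mul hG) ((hφ.comp measurable_snd).mul hH) hx1 hx2]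
  simp_rw [mul_sub]

end HeatOp

/-! ### The solution operator as a superposition of heat operators -/

section KernelFormula

variable {N : ℕ} {k α : ℝ}

/-- Away from the origin the Gaussian factor beats every negative power of τ. This compensates the
singularity at τ = 0 in the bound of the damped symbol. -/
theorem exists_heatKernel_mul_rpow_le {M : ℝ} (hM : 0 < M) {x : Space N} (hx : x ≠ 0) :
    ∃ C, ∀ τ : ℝ, 0 < τ → heatKernel N τ x * τ ^ (-M) ≤ C := by
  set L : ℝ := N / 2 + M with hL
  have hL0 : 0 < L := by positivity
  have hxn : 0 < ‖x‖ := norm_pos_iff.2 hx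
  refine ⟨(4 * Real.pi) ^ (-(N : ℝ) / 2) * (4 * L / ‖x‖ ^ 2) ^ L, fun τ hτ => ?_⟩
  have h1 := exp_neg_le_rpow (M := L) (y := ‖x‖ ^ 2 / (4 * τ)) hL0 (by positivity)
  have h2 : (L / (‖x‖ ^ 2 / (4 * τ))) ^ L = (4 * L / ‖x‖ ^ 2) ^ L * (τ ^ ((N : ℝ) / 2) * τ ^ M) := by
    rw [← Real.rpow_add hτ, ← hL, ← Real.mul_rpow (by positivity) hτ.le]
    congr 1
    field_simp
  unfold heatKernel
  rw [neg_div (4 * τ)]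
  rw [h2] at h1
  calc _ ≤ (4 * Real.pi * τ) ^ (-(N : ℝ) / 2) *
        ((4 * L / ‖x‖ ^ 2) ^ L * (τ ^ ((N : ℝ) / 2) * τ ^ M)) * τ ^ (-M) := by gcongr
    _ = _ := by
      rw [Real.mul_rpow (by positivity) hτ.le, Real.rpow_neg hτ.le M, neg_div,
        Real.rpow_neg hτ.le]
      have : τ ^ ((N : ℝ) / 2) ≠ 0 := by positivity
      have : τ ^ M ≠ 0 := by positivity
      field_simp

theorem measurable_vertical_symbol :
    Measurable fun p : ℝ × ℝ => symbol k α (1 + (p.1 : ℂ) * Complex.I) :=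
  measurable_symbol.comp (by fun_prop)

/-- The resolvent is written as a Laplace integral of heat kernels and the order of integration in η
and τ is exchanged. The double integral converges absolutely because x ≠ 0; the inner integral over
η is then the inversion integral of the density. -/
theorem solutionKernel_eq (P : SymbolParams k α) {t : ℝ} {x : Space N} (hx : x ≠ 0) :
    solutionKernel N k α t x = ∫ τ in Ioi (0 : ℝ), subDens k α t τ * heatKernel N τ x := by
  obtain ⟨K, hK, m, hm, h⟩ := exists_norm_damped_le P (prefactor_symbol_div P) one_pos
  have hM : 0 < 2 / (1 - α) := by have := P.α_lt; exact div_pos two_pos (by linarith)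
  obtain ⟨C, hC⟩ := exists_heatKernel_mul_rpow_le hM hx
  set Φ : ℝ → ℝ → ℂ := fun η τ => Complex.exp ((1 + (η : ℂ) * Complex.I) * (t : ℂ)) *
      damped k α (fun z => symbol k α z / z) τ (1 + (η : ℂ) * Complex.I) *
      ((heatKernel N τ x : ℝ) : ℂ) with hΦ
  have hΦm : Measurable (uncurry Φ) := by
    have h1 := measurable_vertical_symbol (k := k) (α := α)
    have h2 : Measurable fun p : ℝ × ℝ => heatKernel N p.2 x :=
      measurable_heatKernel.comp (f := fun p : ℝ × ℝ => (p.2, x)) (by fun_prop)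
    simp only [hΦ, damped, Function.uncurry_def]
    fun_prop
  have hint : Integrable (uncurry Φ) (volume.prod (volume.restrict (Ioi (0 : ℝ)))) := by
    have hg : Integrable (fun p : ℝ × ℝ => ((1 : ℝ) ^ 2 + p.1 ^ 2)⁻¹ *
        (Real.exp (1 * t) * K * C * Real.exp (-m * p.2)))
        (volume.prod (volume.restrict (Ioi (0 : ℝ)))) :=
      (integrable_inv_sq_add_sq one_pos).mul_prod
        ((integrableOn_exp_mul_Ioi (by linarith) 0).const_mul _)
    refine hg.mono' hΦm.aestronglyMeasurable ?_
    have hpos : ∀ᵐ p : ℝ × ℝ ∂((volume : Measure ℝ).prod (volume.restrict (Ioi (0 : ℝ)))), p.2 ∈ Ioi (0 : ℝ) :=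
      Measure.quasiMeasurePreserving_snd.ae (ae_restrict_mem measurableSet_Ioi)
    filter_upwards [hpos] with p hp
    have hp : 0 < p.2 := hp
    have h1 := h p.2 hp (1 + (p.1 : ℂ) * Complex.I) (by simp)
    have h2 := norm_exp_vertical 1 p.1 t
    have h3 := norm_sq_vertical 1 p.1
    simp only [Complex.ofReal_one] at h2 h3
    have h4 := hC p.2 hp
    have h5 := heatKernel_nonneg p.2 hp.le x
    simp only [hΦ, Function.uncurry_def, norm_mul]
    rw [h2, Complex.norm_real, Real.norm_of_nonneg h5]
    rw [h3] at h1
    calc _ ≤ Real.exp (1 * t) * (K * p.2 ^ (-(2 / (1 - α))) * Real.exp (-(m * p.2)) /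
          ((1 : ℝ) ^ 2 + p.1 ^ 2)) * heatKernel N p.2 x := by gcongr
      _ = (((1 : ℝ) ^ 2 + p.1 ^ 2)⁻¹ * (Real.exp (1 * t) * K * Real.exp (-m * p.2))) *
          (heatKernel N p.2 x * p.2 ^ (-(2 / (1 - α)))) := by
          rw [neg_mul]; ring
      _ ≤ (((1 : ℝ) ^ 2 + p.1 ^ 2)⁻¹ * (Real.exp (1 * t) * K * Real.exp (-m * p.2))) * C := by
          gcongr
      _ = _ := by ring
  have e1 : ∫ η : ℝ, Complex.exp ((1 + (η : ℂ) * Complex.I) * (t : ℂ)) *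
      (symbol k α (1 + (η : ℂ) * Complex.I) / (1 + (η : ℂ) * Complex.I)) *
      resolventKernel N (symbol k α (1 + (η : ℂ) * Complex.I)) x =
      ∫ η : ℝ, ∫ τ in Ioi (0 : ℝ), Φ η τ := by
    refine integral_congr_ae (Eventually.of_forall fun η => ?_)
    simp only [resolventKernel, hΦ, damped]
    rw [← integral_const_mul]
    refine integral_congr_ae (Eventually.of_forall fun τ => ?_)
    ring
  have e2 : ∀ τ, (1 / (2 * Real.pi) : ℂ) * ∫ η : ℝ, Φ η τ =
      bromwich (damped k α (fun z => symbol k α z / z) τ) 1 t * ((heatKernel N τ x : ℝ) : ℂ) := by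
    intro τ
    simp only [hΦ, bromwich, integral_mul_const, Complex.ofReal_one]
    push_cast
    ring
  rw [solutionKernel, e1, integral_integral_swap hint, ← integral_const_mul]
  simp_rw [e2]
  have hi2 : Integrable (fun τ => bromwich (damped k α (fun z => symbol k α z / z) τ) 1 t *
      ((heatKernel N τ x : ℝ) : ℂ)) (volume.restrict (Ioi (0 : ℝ))) := by
    simp_rw [← e2]
    exact hint.integral_prod_right.const_mul _
  have := Complex.reCLM.integral_comp_comm hi2
  simp only [Complex.reCLM_apply] at this
  rw [← this]
  refine integral_congr_ae (Eventually.of_forall fun τ => ?_)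
  simp only [Complex.re_mul_ofReal]
  rfl

end KernelFormula

/-! ### The solution operator and the Duhamel integral as superpositions of heat operators -/

section Conversion

variable {N : ℕ} {k α : ℝ}

theorem nullSingleton_space (hN : 1 ≤ N) : NullSingletonClass (volume : Measure (Space N)) := by
  have : Nonempty (Fin N) := ⟨⟨0, hN⟩⟩
  infer_instance

/-- The superposition of heat operators that represents `S_α(t)`. -/
def linOp (k α t : ℝ) (f : Space N → ℝ) : Space N → ℝ :=
  heatOp (volume.restrict (Ioi 0)) id fun τ y => subDens k α t τ * f y

/-- The parameter space of the Duhamel integral: `(τ,τ')` stands for the time `tτ` and for the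
variable `τ'` of the subordination formula. -/
def duhamelMeasure : Measure (ℝ × ℝ) := (volume.restrict (Ioo 0 1)).prod (volume.restrict (Ioi 0))

instance : SigmaFinite duhamelMeasure := by
  unfold duhamelMeasure
  infer_instance

/-- The density of the Duhamel integral `∫₀ᵗ S_α(t-s) G(s) ds`. -/
def duhamelDens (k α : ℝ) (G : ℝ → Space N → ℝ) (t : ℝ) (z : ℝ × ℝ) (y : Space N) : ℝ :=
  t * subDens k α (t * (1 - z.1)) z.2 * G (t * z.1) y

/-- The superposition of heat operators that represents `∫₀ᵗ S_α(t-s) G(s) ds`. -/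
def duhamelOp (k α : ℝ) (G : ℝ → Space N → ℝ) (t : ℝ) : Space N → ℝ :=
  heatOp duhamelMeasure Prod.snd (duhamelDens k α G t)

/-- The formula may fail only at y = x, a null set in positive dimension. -/
theorem ae_solutionKernel_eq (hN : 1 ≤ N) (P : SymbolParams k α) (t : ℝ) (x : Space N) :
    ∀ᵐ y : Space N, solutionKernel N k α t (x - y) =
      ∫ τ in Ioi (0 : ℝ), subDens k α t τ * heatKernel N τ (x - y) := by
  have := nullSingleton_space hN
  have h : ∀ᵐ y : Space N, y ≠ x := by
    rw [ae_iff]; simp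
  filter_upwards [h] with y hy
  exact solutionKernel_eq P (sub_ne_zero.2 hy.symm)

theorem integrable_solutionKernel (hN : 1 ≤ N) (P : SymbolParams k α) {t : ℝ}
    {f : Space N → ℝ} {x : Space N}
    (h : Integrable (fun q : ℝ × Space N => heatKernel N q.1 (x - q.2) * (subDens k α t q.1 * f q.2))
      ((volume.restrict (Ioi 0)).prod volume)) :
    Integrable (fun y => solutionKernel N k α t (x - y) * f y) := by
  refine h.integral_prod_right.congr ?_
  filter_upwards [ae_solutionKernel_eq hN P t x] with y hy
  rw [hy, ← integral_mul_const]
  refine integral_congr_ae (Eventually.of_forall fun τ => ?_)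
  ring

theorem solutionOp_eq (hN : 1 ≤ N) (P : SymbolParams k α) {t : ℝ} (ht : t ≠ 0)
    {f : Space N → ℝ} {x : Space N}
    (h : Integrable (fun q : ℝ × Space N => heatKernel N q.1 (x - q.2) * (subDens k α t q.1 * f q.2))
      ((volume.restrict (Ioi 0)).prod volume)) :
    solutionOp k α t f x = linOp k α t f x := by
  rw [solutionOp, if_neg ht, linOp, heatOp]
  simp only [id]
  rw [integral_prod_symm _ h]
  refine integral_congr_ae ?_
  filter_upwards [ae_solutionKernel_eq hN P t x] with y hy
  rw [hy, ← integral_mul_const]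
  refine integral_congr_ae (Eventually.of_forall fun τ => ?_)
  ring

theorem measurable_linDens (t : ℝ) {f : Space N → ℝ} (hf : Measurable f) :
    Measurable (uncurry fun (τ : ℝ) (y : Space N) => subDens k α t τ * f y) :=
  ((measurable_subDens_right t).comp measurable_fst).mul (hf.comp measurable_snd)

theorem ae_id_pos : ∀ᵐ τ ∂(volume.restrict (Ioi (0 : ℝ))), 0 < id τ :=
  (ae_restrict_mem measurableSet_Ioi).mono fun _ h => h

theorem solutionOp_eq_linOp (hN : 1 ≤ N) (P : SymbolParams k α) {t : ℝ} (ht : t ≠ 0)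
    {f : Space N → ℝ} (hf : Measurable f) {x : Space N}
    (h : heatAbs (volume.restrict (Ioi 0)) id (fun τ y => subDens k α t τ * f y) x < ∞) :
    solutionOp k α t f x = linOp k α t f x :=
  solutionOp_eq hN P ht (integrable_heatOp measurable_id ae_id_pos (measurable_linDens t hf) h)

theorem solutionOp_congr {t : ℝ} (ht : t ≠ 0) {f g : Space N → ℝ} (h : f =ᵐ[volume] g)
    (x : Space N) : solutionOp k α t f x = solutionOp k α t g x := by
  rw [solutionOp, solutionOp, if_neg ht, if_neg ht]
  exact integral_congr_ae (h.mono fun y hy => by simp only [hy])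

theorem measurable_duhamelDens {G : ℝ → Space N → ℝ} (hG : Measurable (uncurry G)) :
    Measurable fun p : ℝ × ((ℝ × ℝ) × Space N) => duhamelDens k α G p.1 p.2.1 p.2.2 := by
  unfold duhamelDens
  have h1 : Measurable fun p : ℝ × ((ℝ × ℝ) × Space N) =>
      subDens k α (p.1 * (1 - p.2.1.1)) p.2.1.2 :=
    measurable_subDens.comp (f := fun p : ℝ × ((ℝ × ℝ) × Space N) =>
      (p.1 * (1 - p.2.1.1), p.2.1.2)) (by fun_prop)
  have h2 : Measurable fun p : ℝ × ((ℝ × ℝ) × Space N) => G (p.1 * p.2.1.1) p.2.2 :=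
    hG.comp (f := fun p : ℝ × ((ℝ × ℝ) × Space N) => (p.1 * p.2.1.1, p.2.2)) (by fun_prop)
  fun_prop

theorem measurable_duhamelDens_right {G : ℝ → Space N → ℝ} (hG : Measurable (uncurry G))
    (t : ℝ) : Measurable (uncurry (duhamelDens k α G t)) :=
  (measurable_duhamelDens hG).comp (measurable_prodMk_left (x := t))

theorem measurable_duhamelOp {G : ℝ → Space N → ℝ} (hG : Measurable (uncurry G)) :
    Measurable (uncurry (duhamelOp k α G)) :=
  measurable_heatOp_param measurable_snd (measurable_duhamelDens hG)

theorem ae_duhamelMeasure : ∀ᵐ z ∂duhamelMeasure, z.1 ∈ Ioo (0 : ℝ) 1 ∧ 0 < z.2 := by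
  have h1 : ∀ᵐ z ∂duhamelMeasure, z.1 ∈ Ioo (0 : ℝ) 1 :=
    Measure.quasiMeasurePreserving_fst.ae (ae_restrict_mem measurableSet_Ioo)
  have h2 : ∀ᵐ z ∂duhamelMeasure, z.2 ∈ Ioi (0 : ℝ) :=
    Measure.quasiMeasurePreserving_snd.ae (ae_restrict_mem measurableSet_Ioi)
  filter_upwards [h1, h2] with z hz1 hz2 using ⟨hz1, hz2⟩

theorem ae_comp_mul_left {t : ℝ} (ht : 0 < t) {p : ℝ → Prop}
    (h : ∀ᵐ τ ∂(volume.restrict (Ioo (0 : ℝ) 1)), p (t * τ)) :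
    ∀ᵐ s ∂(volume.restrict (Ioo (0 : ℝ) t)), p s := by
  rw [ae_restrict_iff' measurableSet_Ioo] at h ⊢
  have hq : Measure.QuasiMeasurePreserving (fun s : ℝ => t⁻¹ * s) volume volume := by
    refine ⟨by fun_prop, ?_⟩
    rw [Real.map_volume_mul_left (inv_pos.2 ht).ne']
    exact Measure.smul_absolutelyContinuous
  filter_upwards [hq.ae h] with s hs hst
  have h1 : t * (t⁻¹ * s) = s := by field_simp
  rw [h1] at hs
  refine hs ⟨mul_pos (inv_pos.2 ht) hst.1, ?_⟩
  rw [inv_mul_lt_iff₀ ht, mul_one]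
  exact hst.2

/-- The substitution s = tτ turns the time integral into one over (0,1), so that t enters only
through the density. All three assertions follow by Fubini's theorem from the absolute convergence
at x. -/
theorem duhamel_conversion (hN : 1 ≤ N) (P : SymbolParams k α) {t : ℝ} (ht : 0 < t)
    {G : ℝ → Space N → ℝ} (hG : Measurable (uncurry G)) {x : Space N}
    (h : heatAbs duhamelMeasure Prod.snd (duhamelDens k α G t) x < ∞) :
    (∀ᵐ s ∂(volume.restrict (Ioo 0 t)),
      Integrable (fun y => solutionKernel N k α (t - s) (x - y) * G s y)) ∧
    IntervalIntegrable (fun s => solutionOp k α (t - s) (G s) x) volume 0 t ∧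
    ∫ s in (0 : ℝ)..t, solutionOp k α (t - s) (G s) x = duhamelOp k α G t x := by
  have hint := integrable_heatOp measurable_snd (ae_duhamelMeasure.mono fun z hz => hz.2)
    (measurable_duhamelDens_right hG t) h
  have hmp := measurePreserving_prodAssoc (volume.restrict (Ioo (0 : ℝ) 1))
    (volume.restrict (Ioi (0 : ℝ))) (volume : Measure (Space N))
  set Φ : ℝ × (ℝ × Space N) → ℝ := fun p => heatKernel N p.2.1 (x - p.2.2) *
    duhamelDens k α G t (p.1, p.2.1) p.2.2 with hΦ
  have hi2 : Integrable Φ ((volume.restrict (Ioo (0 : ℝ) 1)).prod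
      ((volume.restrict (Ioi (0 : ℝ))).prod (volume : Measure (Space N)))) := by
    rw [← hmp.integrable_comp_emb MeasurableEquiv.prodAssoc.measurableEmbedding]
    exact hint
  -- Sections of an integrable function are almost all integrable; this yields the convergence of
  -- the spatial integrals for almost every s.
  have hsec : ∀ᵐ τ ∂(volume.restrict (Ioo (0 : ℝ) 1)),
      Integrable (fun q : ℝ × Space N => heatKernel N q.1 (x - q.2) *
        (subDens k α (t - t * τ) q.1 * G (t * τ) q.2))
        ((volume.restrict (Ioi 0)).prod volume) := by
    filter_upwards [hi2.prod_right_ae] with τ hτ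
    refine (hτ.const_mul t⁻¹).congr (Eventually.of_forall fun q => ?_)
    simp only [hΦ, duhamelDens]
    rw [mul_one_sub]
    field_simp
  have heq : ∀ᵐ τ ∂(volume.restrict (Ioo (0 : ℝ) 1)),
      ∫ q, Φ (τ, q) ∂((volume.restrict (Ioi (0 : ℝ))).prod (volume : Measure (Space N))) =
        t * solutionOp k α (t - t * τ) (G (t * τ)) x := by
    filter_upwards [hsec, ae_restrict_mem measurableSet_Ioo] with τ hτ hτ1
    have hne : t - t * τ ≠ 0 := by
      have := mul_lt_mul_of_pos_left hτ1.2 ht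
      linarith
    rw [solutionOp_eq hN P hne hτ, linOp, heatOp, ← integral_const_mul]
    refine integral_congr_ae (Eventually.of_forall fun q => ?_)
    simp only [hΦ, duhamelDens, id]
    rw [mul_one_sub]
    ring
  have hi3 : IntegrableOn (fun τ => solutionOp k α (t - t * τ) (G (t * τ)) x) (Ioo 0 1) := by
    refine (hi2.integral_prod_left.const_mul t⁻¹).congr (heq.mono fun τ hτ => ?_)
    simp only at hτ ⊢
    rw [hτ]
    field_simp
  refine ⟨?_, ?_, ?_⟩
  · refine ae_comp_mul_left ht ?_
    exact hsec.mono fun τ hτ => integrable_solutionKernel hN P hτ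
  · rw [← intervalIntegrable_iff_integrableOn_Ioo_of_le zero_le_one] at hi3
    have := hi3.comp_mul_left (c := t⁻¹)
    refine (IntervalIntegrable.congr ?_ (by simpa using this))
    intro s _
    simp only [mul_inv_cancel_left₀ ht.ne']
  · have h1 := intervalIntegral.mul_integral_comp_mul_left (a := 0) (b := 1)
      (f := fun s => solutionOp k α (t - s) (G s) x) t
    rw [mul_zero, mul_one] at h1
    rw [← h1, intervalIntegral.integral_of_le zero_le_one, integral_Ioc_eq_integral_Ioo,
      ← integral_const_mul, ← integral_congr_ae heq, ← integral_prod _ hi2, duhamelOp, heatOp,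
      ← hmp.integral_comp' (g := Φ)]
    rfl

end Conversion

/-! ### The linear flow -/

section Linear

variable {N : ℕ} {k α : ℝ}

/-- The norm of `L^p`. -/
abbrev nrm (p : ℝ) (f : Space N → ℝ) : ℝ≥0∞ := eLpNorm f (ofReal p) volume

theorem nrm_eq_lpn {p : ℝ} (hp : 0 < p) (f : Space N → ℝ) : nrm p f = lpn p fun x => ‖f x‖ₑ :=
  eLpNorm_eq_lpn hp f

theorem one_le_ofReal {p : ℝ} (hp : 1 ≤ p) : 1 ≤ ofReal p := by
  rwa [ENNReal.one_le_ofReal]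

theorem nrm_add_le {p : ℝ} (hp : 1 ≤ p) {f g : Space N → ℝ} (hf : AEStronglyMeasurable f)
    (hg : AEStronglyMeasurable g) : nrm p (fun x => f x + g x) ≤ nrm p f + nrm p g :=
  eLpNorm_add_le hf hg (one_le_ofReal hp)

theorem nrm_sub_le {p : ℝ} (hp : 1 ≤ p) {f g : Space N → ℝ} (hf : AEStronglyMeasurable f)
    (hg : AEStronglyMeasurable g) : nrm p (fun x => f x - g x) ≤ nrm p f + nrm p g :=
  eLpNorm_sub_le hf hg (one_le_ofReal hp)

theorem nrm_mono {p : ℝ} {f g : Space N → ℝ} (h : ∀ᵐ x, |f x| ≤ |g x|) : nrm p f ≤ nrm p g :=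
  eLpNorm_mono_ae h

/-- The exponent of the smoothing from `L^r` to `L^p`. -/
abbrev smoothing (N : ℕ) (r p : ℝ) : ℝ := (N : ℝ) / 2 * (1 / r - 1 / p)

theorem smoothing_nonneg {r p : ℝ} (hr : 0 < r) (hrp : r ≤ p) : 0 ≤ smoothing N r p :=
  mul_nonneg (by positivity) (sub_nonneg.2 (one_div_le_one_div_of_le hr hrp))

theorem smoothing_self (r : ℝ) : smoothing N r r = 0 := by simp [smoothing]

theorem heatBudget_lin {a β : ℝ} {f : Space N → ℝ} (c : ℝ → ℝ) (hc : Measurable c)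
    (ha : 0 < a) (hf : Measurable f) :
    heatBudget (volume.restrict (Ioi 0)) id a β (fun τ y => c τ * f y) = moment β c * nrm a f := by
  have e : ∀ τ, lpn a (fun y => ‖c τ * f y‖ₑ) = ‖c τ‖ₑ * lpn a (fun y => ‖f y‖ₑ) := fun τ => by
    simp_rw [enorm_mul]
    exact lpn_const_mul ha _ hf.enorm
  rw [heatBudget, moment, nrm_eq_lpn ha, ← lintegral_mul_const _ (by fun_prop)]
  refine lintegral_congr fun τ => ?_
  rw [e, id]
  ring

theorem heatBound_const_one {a b : ℝ} (ha : 1 ≤ a) (hab : a ≤ b) :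
    HeatBound N (fun _ => ‖(1 : ℝ)‖ₑ) a b (smoothing N a b) 1 := by
  simp only [enorm_one]
  exact heatBound_one ha hab

theorem nrm_heatOp_lin_le {r p : ℝ} (hr : 1 ≤ r) (hrp : r ≤ p) {c : ℝ → ℝ} (hc : Measurable c)
    {f : Space N → ℝ} (hf : Measurable f) :
    nrm p (heatOp (volume.restrict (Ioi 0)) id fun τ y => c τ * f y) ≤
      moment (smoothing N r p) c * nrm r f := by
  have hp : 1 ≤ p := hr.trans hrp
  have := lpn_heatOp_le (μ := volume.restrict (Ioi 0)) measurable_id ae_id_pos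
    (φ := fun _ : Space N => (1 : ℝ)) measurable_const hp (heatBound_const_one hr hrp) zero_le_one
    (G := fun τ y => c τ * f y) ((hc.comp measurable_fst).mul (hf.comp measurable_snd))
  rw [heatBudget_lin c hc (one_pos.trans_le hr) hf, ofReal_one, one_mul] at this
  rw [nrm_eq_lpn (one_pos.trans_le hp)]
  simpa using this

theorem ae_heatAbs_lin_lt_top {r : ℝ} (hr : 1 ≤ r) {c : ℝ → ℝ} (hc : Measurable c)
    (hc1 : moment 0 c < ∞) {f : Space N → ℝ} (hf : Measurable f) (hfr : nrm r f < ∞) :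
    ∀ᵐ x, heatAbs (volume.restrict (Ioi 0)) id (fun τ y => c τ * f y) x < ∞ := by
  have := ae_heatAbs_lt_top (μ := volume.restrict (Ioi 0)) measurable_id ae_id_pos
    (φ := fun _ : Space N => (1 : ℝ)) measurable_const hr (heatBound_const_one hr le_rfl) zero_le_one
    (G := fun τ y => c τ * f y) ((hc.comp measurable_fst).mul (hf.comp measurable_snd))
    (by
      rw [heatBudget_lin c hc (one_pos.trans_le hr) hf, smoothing_self]
      exact mul_lt_top hc1 hfr)
  simpa using this

theorem moment_subDens_lt_top (P : SymbolParams k α) {t : ℝ} (ht : 0 < t) :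
    moment 0 (subDens k α t) < ∞ := by
  rw [moment_zero_subDens P ht]
  exact ENNReal.one_lt_top

/-- The smoothing rate of the heat semigroup, averaged over the subordination density, is its moment
of the same order. -/
theorem exists_linOp_le (P : SymbolParams k α) {r p : ℝ} (hr : 1 ≤ r) (hrp : r ≤ p)
    (hκ : smoothing N r p < 1) : ∃ C : ℝ, 0 < C ∧ ∀ t : ℝ, 0 < t → ∀ f : Space N → ℝ, Measurable f →
      nrm p (linOp k α t f) ≤ ofReal (C * bracket k α t ^ (-smoothing N r p)) * nrm r f := by
  obtain ⟨C, hC, h⟩ := exists_moment_subDens_le P (smoothing_nonneg (N := N) (by linarith) hrp) hκ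
  refine ⟨C, hC, fun t ht f hf => ?_⟩
  exact (nrm_heatOp_lin_le hr hrp (measurable_subDens_right t) hf).trans (by gcongr; exact h t ht)

theorem linOp_sub (P : SymbolParams k α) {r : ℝ} (hr : 1 ≤ r) {t : ℝ} (ht : 0 < t)
    {f g : Space N → ℝ} (hf : Measurable f) (hg : Measurable g) (hfr : nrm r f < ∞)
    (hgr : nrm r g < ∞) :
    (fun x => linOp k α t f x - linOp k α t g x) =ᵐ[volume] linOp k α t fun x => f x - g x := by
  filter_upwards [ae_heatAbs_lin_lt_top hr (measurable_subDens_right t) (moment_subDens_lt_top P ht)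
    hf hfr, ae_heatAbs_lin_lt_top hr (measurable_subDens_right t) (moment_subDens_lt_top P ht) hg hgr]
    with x h1 h2
  rw [linOp, linOp, heatOp_sub measurable_id ae_id_pos (measurable_linDens t hf)
    (measurable_linDens t hg) h1 h2, linOp]
  simp_rw [mul_sub]

/-- The difference is the superposition with the difference of the two densities, whose moment tends
to zero. -/
theorem tendsto_linOp_sub (P : SymbolParams k α) {r p : ℝ} (hr : 1 ≤ r) (hrp : r ≤ p)
    (hκ : smoothing N r p < 1) {f : Space N → ℝ} (hf : Measurable f) (hfr : nrm r f < ∞) {t₀ : ℝ}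
    (ht₀ : 0 < t₀) :
    Tendsto (fun t => nrm p fun x => linOp k α t f x - linOp k α t₀ f x) (𝓝 t₀) (𝓝 0) := by
  have hlim : Tendsto (fun t => moment (smoothing N r p) (fun τ => subDens k α t τ - subDens k α t₀ τ) *
      nrm r f) (𝓝 t₀) (𝓝 0) := by
    simpa using ENNReal.Tendsto.mul_const
      (tendsto_moment_sub P ht₀ (smoothing_nonneg (N := N) (by linarith) hrp) hκ) (Or.inr hfr.ne)
  refine tendsto_zero_of_le hlim ?_
  filter_upwards [lt_mem_nhds ht₀] with t ht
  refine le_trans (le_of_eq (eLpNorm_congr_ae ?_)) (nrm_heatOp_lin_le hr hrp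
    ((measurable_subDens_right (k := k) (α := α) t).sub (measurable_subDens_right t₀)) hf)
  filter_upwards [ae_heatAbs_lin_lt_top hr (measurable_subDens_right t) (moment_subDens_lt_top P ht)
    hf hfr, ae_heatAbs_lin_lt_top hr (measurable_subDens_right t₀) (moment_subDens_lt_top P ht₀) hf hfr]
    with x h1 h2
  rw [linOp, linOp, heatOp_sub measurable_id ae_id_pos (measurable_linDens t hf)
    (measurable_linDens t₀ hf) h1 h2]
  simp_rw [← sub_mul, Pi.sub_apply]

theorem linOp_nonneg (P : SymbolParams k α) {t : ℝ} (ht : 0 ≤ t) {f : Space N → ℝ}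
    (hf : Measurable f) (hf0 : 0 ≤ᵐ[volume] f) (x : Space N) : 0 ≤ linOp k α t f x := by
  refine heatOp_nonneg ae_id_pos ?_ (measurable_linDens t hf) x
  filter_upwards [ae_restrict_mem measurableSet_Ioi] with τ hτ
  filter_upwards [hf0] with y hy using mul_nonneg (subDens_nonneg P ht hτ) hy

theorem measurable_linOp {f : Space N → ℝ} (hf : Measurable f) :
    Measurable (uncurry fun t => linOp k α t f) := by
  refine measurable_heatOp_param (F := fun t τ y => subDens k α t τ * f y) measurable_id ?_
  have h1 : Measurable fun p : ℝ × (ℝ × Space N) => subDens k α p.1 p.2.1 :=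
    measurable_subDens.comp (f := fun p : ℝ × (ℝ × Space N) => (p.1, p.2.1)) (by fun_prop)
  fun_prop

/-- `⟨t⟩^κ` with values in `[0,∞]`. -/
abbrev bw (k α κ t : ℝ) : ℝ≥0∞ := ofReal (bracket k α t ^ κ)

theorem tendsto_bracket_zero (P : SymbolParams k α) :
    Tendsto (fun t => bracket k α t) (𝓝[>] 0) (𝓝 0) := by
  have h1 : Continuous fun t => bracket k α t := by
    unfold bracket
    have := Real.continuous_rpow_const (q := 1 - α) (by linarith [P.α_lt])
    fun_prop
  have h2 := h1.tendsto 0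
  have h3 : bracket k α 0 = 0 := by
    rw [bracket, Real.zero_rpow (by linarith [P.α_lt])]; simp
  rw [h3] at h2
  exact h2.mono_left nhdsWithin_le_nhds

theorem tendsto_bw_zero (P : SymbolParams k α) {κ : ℝ} (hκ : 0 < κ) :
    Tendsto (bw k α κ) (𝓝[>] 0) (𝓝 0) := by
  have h := ((Real.continuous_rpow_const hκ.le).tendsto 0).comp (tendsto_bracket_zero P)
  rw [Real.zero_rpow hκ.ne'] at h
  simpa using tendsto_ofReal h

theorem bw_mul_bw_neg (P : SymbolParams k α) {t : ℝ} (ht : 0 < t) (κ C : ℝ) (hC : 0 ≤ C) :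
    bw k α κ t * ofReal (C * bracket k α t ^ (-κ)) = ofReal C := by
  have hb := bracket_pos P ht
  rw [bw, ← ofReal_mul (by positivity), mul_left_comm, ← Real.rpow_add hb, add_neg_cancel,
    Real.rpow_zero, mul_one]

/-- Cutting off the large values makes f bounded without leaving L^r, hence puts it into every L^p
with p ≥ r; dominated convergence makes the error small. -/
theorem exists_truncation {r : ℝ} (hr : 1 ≤ r) {f : Space N → ℝ} (hf : Measurable f)
    (hfr : nrm r f < ∞) {ε : ℝ≥0∞} (hε : 0 < ε) :
    ∃ g : Space N → ℝ, Measurable g ∧ nrm r (fun x => f x - g x) < ε ∧ nrm r g < ∞ ∧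
      ∀ p, r ≤ p → nrm p g < ∞ := by
  have hr0 : 0 < r := one_pos.trans_le hr
  set g : ℕ → Space N → ℝ := fun n => {x | |f x| ≤ n}.indicator f with hg
  have hms : ∀ n : ℕ, MeasurableSet {x | |f x| ≤ n} := fun n =>
    measurableSet_le hf.abs measurable_const
  have hgm : ∀ n, Measurable (g n) := fun n => hf.indicator (hms n)
  have hfin : ∫⁻ x, ‖f x‖ₑ ^ r < ∞ := by
    rw [← lpn_rpow hr0, ← nrm_eq_lpn hr0]
    exact rpow_lt_top_of_nonneg hr0.le hfr.ne
  have hle : ∀ n x, ‖f x - g n x‖ₑ ≤ ‖f x‖ₑ := fun n x => by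
    by_cases hx : |f x| ≤ n
    · simp [hg, indicator_of_mem (show x ∈ {x | |f x| ≤ n} from hx)]
    · simp [hg, indicator_of_notMem (show x ∉ {x | |f x| ≤ n} from hx)]
  have hgle : ∀ n x, |g n x| ≤ |f x| := fun n x => by
    by_cases hx : |f x| ≤ n
    · simp [hg, indicator_of_mem (show x ∈ {x | |f x| ≤ n} from hx)]
    · simp [hg, indicator_of_notMem (show x ∉ {x | |f x| ≤ n} from hx)]
  have hlim : Tendsto (fun n => ∫⁻ x, ‖f x - g n x‖ₑ ^ r) atTop (𝓝 (∫⁻ _ : Space N, 0)) := by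
    refine tendsto_lintegral_of_dominated_convergence (fun x => ‖f x‖ₑ ^ r)
      (fun n => (hf.sub (hgm n)).enorm.pow_const r) (fun n => Eventually.of_forall fun x => ?_)
      hfin.ne (Eventually.of_forall fun x => ?_)
    · exact rpow_le_rpow (hle n x) hr0.le
    · obtain ⟨n₀, hn₀⟩ := exists_nat_ge |f x|
      refine tendsto_const_nhds.congr' ?_
      filter_upwards [eventually_ge_atTop n₀] with n hn
      have hx : |f x| ≤ n := hn₀.trans (by exact_mod_cast hn)
      simp [hg, indicator_of_mem (show x ∈ {x | |f x| ≤ n} from hx), hr0]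
  rw [lintegral_zero] at hlim
  have hlim2 := ((ENNReal.continuous_rpow_const (y := 1 / r)).tendsto 0).comp hlim
  rw [ENNReal.zero_rpow_of_pos (by positivity)] at hlim2
  obtain ⟨n, hn⟩ := (hlim2.eventually (gt_mem_nhds hε)).exists
  have hgr : nrm r (g n) < ∞ := (nrm_mono (Eventually.of_forall (hgle n))).trans_lt hfr
  refine ⟨g n, hgm n, by rwa [nrm_eq_lpn hr0], hgr, fun p hp => ?_⟩
  have hp0 : 0 < p := hr0.trans_le hp
  rw [nrm_eq_lpn hp0, lpn]
  refine rpow_lt_top_of_nonneg (by positivity) (ne_of_lt ?_)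
  have hgfin : ∫⁻ x, ‖g n x‖ₑ ^ r < ∞ := by
    rw [← lpn_rpow hr0, ← nrm_eq_lpn hr0]
    exact rpow_lt_top_of_nonneg hr0.le hgr.ne
  have hb : ∀ x, ‖g n x‖ₑ ≤ n := fun x => by
    have : |g n x| ≤ n := by
      by_cases hx : |f x| ≤ n
      · simpa [hg, indicator_of_mem (show x ∈ {x | |f x| ≤ n} from hx)] using hx
      · simp [hg, indicator_of_notMem (show x ∉ {x | |f x| ≤ n} from hx)]
    rw [Real.enorm_eq_ofReal_abs]
    exact (ofReal_le_ofReal this).trans_eq (by simp)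
  calc ∫⁻ x, ‖g n x‖ₑ ^ p ≤ ∫⁻ x, (n : ℝ≥0∞) ^ (p - r) * ‖g n x‖ₑ ^ r := by
        refine lintegral_mono fun x => ?_
        calc ‖g n x‖ₑ ^ p = ‖g n x‖ₑ ^ (p - r) * ‖g n x‖ₑ ^ r := by
              rw [← ENNReal.rpow_add_of_nonneg _ _ (by linarith) hr0.le, sub_add_cancel]
          _ ≤ _ := mul_le_mul_left (rpow_le_rpow (hb x) (by linarith)) _
    _ = (n : ℝ≥0∞) ^ (p - r) * ∫⁻ x, ‖g n x‖ₑ ^ r :=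
        lintegral_const_mul _ ((hgm n).enorm.pow_const r)
    _ < ∞ := mul_lt_top (rpow_lt_top_of_nonneg (by linarith) (by simp)) hgfin

/-- For data that also lie in L^p the weighted norm is at most ⟨t⟩^κ times a constant, with κ > 0.
General data are approximated by truncations, and the error is controlled uniformly in t by the
smoothing estimate. -/
theorem tendsto_weighted_linOp (P : SymbolParams k α) {r p : ℝ} (hr : 1 ≤ r) (hrp : r < p)
    (hN : 1 ≤ N) (hκ : smoothing N r p < 1) {f : Space N → ℝ} (hf : Measurable f)
    (hfr : nrm r f < ∞) :
    Tendsto (fun t => bw k α (smoothing N r p) t * nrm p (linOp k α t f)) (𝓝[>] 0) (𝓝 0) := by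
  have hr0 : 0 < r := one_pos.trans_le hr
  have hp : 1 ≤ p := hr.trans hrp.le
  have hN0 : (0 : ℝ) < N := by exact_mod_cast hN
  have hκ0 : 0 < smoothing N r p :=
    mul_pos (by positivity) (sub_pos.2 (one_div_lt_one_div_of_lt hr0 hrp))
  obtain ⟨C, hC, hbd⟩ := exists_linOp_le (N := N) P hr hrp.le hκ
  obtain ⟨C', hC', hbd'⟩ := exists_linOp_le (N := N) P hp le_rfl (by rw [smoothing_self]; exact one_pos)
  rw [smoothing_self] at hbd'
  simp only [neg_zero, Real.rpow_zero, mul_one] at hbd'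
  rw [ENNReal.tendsto_nhds_zero]
  intro ε hε
  have hε2 : 0 < ε / 2 := ENNReal.half_pos hε.ne'
  obtain ⟨g, hg, hfg, hgr, hgp⟩ := exists_truncation hr hf hfr
    (ε := ε / 2 / ofReal C) (ENNReal.div_pos hε2.ne' ofReal_ne_top)
  have hgp := hgp p hrp.le
  have hsmall : Tendsto (fun t => bw k α (smoothing N r p) t * (ofReal C' * nrm p g))
      (𝓝[>] 0) (𝓝 0) := by
    simpa using ENNReal.Tendsto.mul_const (tendsto_bw_zero P hκ0)
      (Or.inr (mul_lt_top ofReal_lt_top hgp).ne)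
  filter_upwards [(ENNReal.tendsto_nhds_zero.1 hsmall) (ε / 2) hε2, self_mem_nhdsWithin] with t h1 ht
  have ht : 0 < t := ht
  have hm : ∀ u : Space N → ℝ, Measurable u → Measurable (linOp k α t u) := fun u hu =>
    (measurable_linOp hu).of_uncurry_left
  have hsum : nrm p (linOp k α t f) ≤ nrm p (linOp k α t fun x => f x - g x) + nrm p (linOp k α t g) := by
    refine le_trans (le_of_eq (eLpNorm_congr_ae ?_)) (nrm_add_le hp
      (hm _ (hf.sub hg)).aestronglyMeasurable (hm g hg).aestronglyMeasurable)
    filter_upwards [linOp_sub P hr ht hf hg hfr hgr] with x hx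
    rw [← hx]
    ring
  calc bw k α (smoothing N r p) t * nrm p (linOp k α t f)
      ≤ bw k α (smoothing N r p) t *
          (ofReal (C * bracket k α t ^ (-smoothing N r p)) * nrm r (fun x => f x - g x)) +
        bw k α (smoothing N r p) t * (ofReal C' * nrm p g) := by
        rw [← mul_add]
        refine mul_le_mul_right (hsum.trans (add_le_add (hbd t ht _ (hf.sub hg)) (hbd' t ht g hg))) _
    _ ≤ ε / 2 + ε / 2 := by
        refine add_le_add ?_ h1
        rw [← mul_assoc, bw_mul_bw_neg P ht _ _ hC.le, mul_comm]
        exact (ENNReal.le_div_iff_mul_le (Or.inl (by simpa using hC)) (Or.inl (by simp))).1 hfg.le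
    _ = ε := ENNReal.add_halves ε

end Linear

/-! ### Strong continuity of the linear flow at time zero -/

section Initial

variable {N : ℕ} {k α : ℝ}

theorem tendsto_translation {r : ℝ} (hr : 1 ≤ r) {f : Space N → ℝ}
    (hf : MemLp f (ofReal r) volume) :
    Tendsto (fun z : Space N => nrm r fun x => f (-z + x) - f x) (𝓝 0) (𝓝 0) := by
  have : Fact (1 ≤ ofReal r) := ⟨one_le_ofReal hr⟩
  have : Fact (ofReal r ≠ ∞) := ⟨ofReal_ne_top⟩
  have hc : Continuous fun z : Space N => (DomAddAct.mk (-z) : (Space N)ᵈᵃᵃ) +ᵥ hf.toLp f := by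
    have h1 : Continuous fun z : Space N => (DomAddAct.mk (-z) : (Space N)ᵈᵃᵃ) :=
      DomAddAct.continuous_mk.comp continuous_neg
    exact h1.vadd continuous_const
  have h2 := hc.tendsto 0
  rw [tendsto_iff_edist_tendsto_0] at h2
  refine h2.congr fun z => ?_
  rw [Lp.edist_def]
  refine eLpNorm_congr_ae ?_
  have e1 : ∀ z : Space N, ⇑((DomAddAct.mk (-z) : (Space N)ᵈᵃᵃ) +ᵥ hf.toLp f) =ᵐ[volume]
      fun x => f (-z + x) := fun z => by
    rw [DomAddAct.mk_vadd_toLp]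
    exact MemLp.coeFn_toLp _
  filter_upwards [e1 z, e1 0] with x hx1 hx2
  rw [Pi.sub_apply, hx1, hx2, neg_zero, zero_add]

/-- Half of the Gaussian exponent pays for the small factor; the other half is the kernel at time
2τ, which still has mass 1. -/
theorem heatKernel_le_of_le_norm {τ η : ℝ} (hτ : 0 < τ) (hη : 0 ≤ η) {z : Space N} (hz : η ≤ ‖z‖) :
    heatKernel N τ z ≤ 2 ^ ((N : ℝ) / 2) * Real.exp (-(η ^ 2 / (8 * τ))) * heatKernel N (2 * τ) z := by
  have h1 : Real.exp (-‖z‖ ^ 2 / (4 * τ)) ≤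
      Real.exp (-(η ^ 2 / (8 * τ))) * Real.exp (-‖z‖ ^ 2 / (4 * (2 * τ))) := by
    rw [← Real.exp_add]
    refine Real.exp_le_exp.2 ?_
    have h2 : η ^ 2 ≤ ‖z‖ ^ 2 := by gcongr
    have h3 : η ^ 2 / (8 * τ) ≤ ‖z‖ ^ 2 / (8 * τ) := by gcongr
    have h4 : -‖z‖ ^ 2 / (4 * τ) = -(‖z‖ ^ 2 / (8 * τ)) - ‖z‖ ^ 2 / (8 * τ) := by field_simp; ring
    have h5 : -‖z‖ ^ 2 / (4 * (2 * τ)) = -(‖z‖ ^ 2 / (8 * τ)) := by field_simp; ring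
    linarith
  have h2 : (4 * Real.pi * τ) ^ (-(N : ℝ) / 2) =
      2 ^ ((N : ℝ) / 2) * (4 * Real.pi * (2 * τ)) ^ (-(N : ℝ) / 2) := by
    rw [show 4 * Real.pi * (2 * τ) = 2 * (4 * Real.pi * τ) by ring,
      Real.mul_rpow two_pos.le (by positivity), ← mul_assoc, ← Real.rpow_add two_pos,
      show (N : ℝ) / 2 + -(N : ℝ) / 2 = 0 by ring, Real.rpow_zero, one_mul]
  unfold heatKernel
  rw [h2]
  calc _ ≤ 2 ^ ((N : ℝ) / 2) * (4 * Real.pi * (2 * τ)) ^ (-(N : ℝ) / 2) *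
        (Real.exp (-(η ^ 2 / (8 * τ))) * Real.exp (-‖z‖ ^ 2 / (4 * (2 * τ)))) := by gcongr
    _ = _ := by ring

theorem lintegral_heatKernel_mul_le {h : Space N → ℝ≥0∞} (hm : Measurable h) {A ε : ℝ≥0∞}
    (hA : ∀ z, h z ≤ A) {η : ℝ} (hη : 0 ≤ η) (hε : ∀ z, ‖z‖ < η → h z ≤ ε) {τ : ℝ} (hτ : 0 < τ) :
    ∫⁻ z, ofReal (heatKernel N τ z) * h z ≤
      ε + A * ofReal (2 ^ ((N : ℝ) / 2) * Real.exp (-(η ^ 2 / (8 * τ)))) := by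
  have hk : ∀ τ : ℝ, Measurable fun z : Space N => ofReal (heatKernel N τ z) := fun τ =>
    (measurable_heatKernel.comp (measurable_prodMk_left (x := τ))).ennreal_ofReal
  have hpt : ∀ z : Space N, ofReal (heatKernel N τ z) * h z ≤
      ofReal (heatKernel N τ z) * ε +
        A * ofReal (2 ^ ((N : ℝ) / 2) * Real.exp (-(η ^ 2 / (8 * τ)))) *
          ofReal (heatKernel N (2 * τ) z) := by
    intro z
    rcases lt_or_ge ‖z‖ η with hz | hz
    · exact (mul_le_mul_right (hε z hz) _).trans le_self_add
    · refine le_trans ?_ le_add_self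
      rw [mul_assoc, ← ofReal_mul (by positivity), mul_comm]
      exact mul_le_mul' (hA z) (ofReal_le_ofReal (heatKernel_le_of_le_norm hτ hη hz))
  refine (lintegral_mono hpt).trans (le_of_eq ?_)
  rw [lintegral_add_left ((hk τ).mul_const _), lintegral_mul_const _ (hk τ),
    lintegral_const_mul _ (hk _), lintegral_heatKernel hτ, lintegral_heatKernel (by positivity),
    one_mul, mul_one]

/-- As t → 0 the density concentrates at τ = 0, since its tail beyond any T > 0 is continuous in t
and vanishes at t = 0. -/
theorem tendsto_lintegral_subDens (P : SymbolParams k α) {Φ : ℝ → ℝ≥0∞} (hm : Measurable Φ)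
    {A : ℝ≥0∞} (hA : A ≠ ∞) (hΦA : ∀ τ, 0 < τ → Φ τ ≤ A) (hΦ : Tendsto Φ (𝓝[>] 0) (𝓝 0)) :
    Tendsto (fun t => ∫⁻ τ in Ioi (0 : ℝ), ‖subDens k α t τ‖ₑ * Φ τ) (𝓝[>] 0) (𝓝 0) := by
  rw [ENNReal.tendsto_nhds_zero]
  intro ε hε
  have hε2 : 0 < ε / 2 := ENNReal.half_pos hε.ne'
  obtain ⟨T, hT, hT2⟩ := mem_nhdsGT_iff_exists_Ioc_subset.1 (ENNReal.tendsto_nhds_zero.1 hΦ _ hε2)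
  have hT : 0 < T := hT
  have hlim : Tendsto (fun t => A * ofReal (subTail k α t T)) (𝓝[>] 0) (𝓝 0) := by
    have h1 : Tendsto (fun t => subTail k α t T) (𝓝[>] 0) (𝓝 0) := by
      have := (continuous_subTail P hT).tendsto 0
      rw [subTail_zero P hT] at this
      exact this.mono_left nhdsWithin_le_nhds
    simpa using ENNReal.Tendsto.const_mul (tendsto_ofReal h1) (Or.inr hA)
  filter_upwards [ENNReal.tendsto_nhds_zero.1 hlim _ hε2, self_mem_nhdsWithin] with t h1 ht
  have ht : 0 < t := ht
  rw [← lintegral_subMeasure P ht.le hm]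
  have hae : ∀ᵐ τ ∂(subMeasure k α t), τ ∈ Ioi (0 : ℝ) :=
    (withDensity_absolutelyContinuous _ _).ae_le (ae_restrict_mem measurableSet_Ioi)
  calc ∫⁻ τ, Φ τ ∂(subMeasure k α t)
      ≤ ∫⁻ τ, (ε / 2 + (Ioi T).indicator (fun _ => A) τ) ∂(subMeasure k α t) := by
        refine lintegral_mono_ae (hae.mono fun τ hτ => ?_)
        have hτ : 0 < τ := hτ
        rcases le_or_gt τ T with h | h
        · have h2 : Φ τ ≤ ε / 2 := hT2 ⟨hτ, h⟩
          exact h2.trans le_self_add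
        · rw [indicator_of_mem (show τ ∈ Ioi T from h)]
          exact (hΦA τ hτ).trans le_add_self
    _ = ε / 2 + A * ofReal (subTail k α t T) := by
        rw [lintegral_add_left measurable_const, lintegral_const, subMeasure_univ P ht, mul_one,
          lintegral_indicator_const measurableSet_Ioi, subMeasure_Ioi P ht.le hT]
    _ ≤ ε / 2 + ε / 2 := by gcongr
    _ = ε := ENNReal.add_halves ε

/-- The density and the heat kernel both have mass 1, so the difference is an average of f(· - z) -
f, to which Minkowski's inequality applies. -/
theorem nrm_linOp_sub_le (P : SymbolParams k α) {r : ℝ} (hr : 1 ≤ r) {t : ℝ} (ht : 0 < t)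
    {f : Space N → ℝ} (hf : Measurable f) (hfr : nrm r f < ∞) :
    nrm r (fun x => linOp k α t f x - f x) ≤ ∫⁻ τ in Ioi (0 : ℝ), ‖subDens k α t τ‖ₑ *
      ∫⁻ z : Space N, ofReal (heatKernel N τ z) * nrm r fun x => f (-z + x) - f x := by
  have hr0 : 0 < r := one_pos.trans_le hr
  set μI : Measure ℝ := volume.restrict (Ioi 0) with hμI
  set F : (ℝ × Space N) → Space N → ℝ≥0∞ := fun q x =>
    ‖subDens k α t q.1‖ₑ * ofReal (heatKernel N q.1 q.2) * ‖f (-q.2 + x) - f x‖ₑ with hF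
  have hw := measurable_subDens_right (k := k) (α := α) t
  have hdiff : Measurable (uncurry fun (z : Space N) (x : Space N) => f (-z + x) - f x) :=
    (hf.comp (f := fun p : Space N × Space N => -p.1 + p.2) (by fun_prop)).sub
      (hf.comp measurable_snd)
  have hk := measurable_heatKernel (N := N)
  have hFm : Measurable (uncurry F) := by
    have h1 : Measurable fun p : (ℝ × Space N) × Space N => subDens k α t p.1.1 :=
      hw.comp (by fun_prop)
    have h2 : Measurable fun p : (ℝ × Space N) × Space N => heatKernel N p.1.1 p.1.2 :=
      hk.comp measurable_fst
    have h3 : Measurable fun p : (ℝ × Space N) × Space N => f (-p.1.2 + p.2) - f p.2 :=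
      hdiff.comp (f := fun p : (ℝ × Space N) × Space N => (p.1.2, p.2)) (by fun_prop)
    exact (h1.enorm.mul h2.ennreal_ofReal).mul h3.enorm
  have hl : Measurable fun z : Space N => lpn r fun x => ‖f (-z + x) - f x‖ₑ :=
    measurable_lpn_family hdiff r
  have hm : Measurable fun q : ℝ × Space N => ‖subDens k α t q.1‖ₑ *
      ofReal (heatKernel N q.1 q.2) * lpn r fun x => ‖f (-q.2 + x) - f x‖ₑ :=
    ((hw.comp measurable_fst).enorm.mul hk.ennreal_ofReal).mul (hl.comp measurable_snd)
  have hmink := lpn_lintegral_le (μ := μI.prod (volume : Measure (Space N)))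
    (ν := (volume : Measure (Space N))) hr hFm hm.aemeasurable (Eventually.of_forall fun q => by
      rw [hF]
      refine (lpn_const_mul hr0 _ ?_).le
      exact (hdiff.comp (measurable_prodMk_left (x := q.2))).enorm)
  have hpt : ∀ᵐ x : Space N, ‖linOp k α t f x - f x‖ₑ ≤
      ∫⁻ q, F q x ∂(μI.prod (volume : Measure (Space N))) := by
    filter_upwards [ae_heatAbs_lin_lt_top hr hw (moment_subDens_lt_top P ht) hf hfr] with x hx
    have hconst : heatAbs μI id (fun τ _ => subDens k α t τ * f x) x < ∞ := by
      have : heatAbs μI id (fun τ _ => subDens k α t τ * f x) x = moment 0 (subDens k α t) * ‖f x‖ₑ := by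
        rw [heatAbs, moment, ← lintegral_mul_const _ (by fun_prop)]
        refine setLIntegral_congr_fun measurableSet_Ioi fun τ hτ => ?_
        have hτ : 0 < τ := hτ
        simp only [heatConv, id]
        rw [lintegral_mul_const _ (measurable_heatKernel_sub τ x).ennreal_ofReal,
          lintegral_heatKernel_sub hτ, enorm_mul]
        simp
      rw [this]
      exact mul_lt_top (moment_subDens_lt_top P ht) enorm_lt_top
    -- The number f(x) is written as the superposition applied to the constant function f(x), so
    -- that it can be subtracted inside the integral.
    have hval : heatOp μI id (fun τ (_ : Space N) => subDens k α t τ * f x) x = f x := by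
      have hi := integrable_heatOp measurable_id ae_id_pos
        (measurable_linDens t (measurable_const (a := f x))) hconst
      rw [heatOp, integral_prod _ hi]
      calc _ = ∫ τ in Ioi (0 : ℝ), subDens k α t τ * f x := by
            refine setIntegral_congr_fun measurableSet_Ioi fun τ hτ => ?_
            have hτ : 0 < τ := hτ
            simp only [id]
            rw [integral_mul_const]
            have h1 : ∫ y : Space N, heatKernel N τ (x - y) = 1 := by
              rw [integral_eq_lintegral_of_nonneg_ae (Eventually.of_forall fun y =>
                heatKernel_nonneg τ hτ.le _) (measurable_heatKernel_sub τ x).aestronglyMeasurable,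
                lintegral_heatKernel_sub hτ, ENNReal.toReal_one]
            rw [h1, one_mul]
        _ = f x := by rw [integral_mul_const, integral_subDens P ht, one_mul]
    have hsub := heatOp_sub measurable_id ae_id_pos (measurable_linDens t hf)
      (measurable_linDens t (measurable_const (a := f x))) hx hconst
    rw [hval] at hsub
    rw [linOp, hsub]
    refine (enorm_heatOp_le measurable_id ae_id_pos ?_ x).trans (le_of_eq ?_)
    · exact (measurable_linDens t hf).sub (measurable_linDens t (measurable_const (a := f x)))
    have hFx : Measurable fun q => F q x := hFm.of_uncurry_right
    rw [lintegral_prod _ hFx.aemeasurable, heatAbs]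
    refine lintegral_congr fun τ => ?_
    simp only [hF, heatConv, id]
    rw [← lintegral_sub_left_eq_self _ x]
    refine lintegral_congr fun z => ?_
    rw [sub_sub_cancel, ← mul_sub, enorm_mul, neg_add_eq_sub]
    ring
  rw [nrm_eq_lpn hr0]
  refine (lpn_mono hr0 hpt).trans (hmink.trans (le_of_eq ?_))
  rw [lintegral_prod _ hm.aemeasurable]
  refine lintegral_congr fun τ => ?_
  have hkτ : Measurable fun z : Space N => ofReal (heatKernel N τ z) :=
    (hk.comp (measurable_prodMk_left (x := τ))).ennreal_ofReal
  simp_rw [mul_assoc]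
  have hkl : Measurable fun z : Space N => ofReal (heatKernel N τ z) *
      lpn r fun x => ‖f (-z + x) - f x‖ₑ := hkτ.mul hl
  rw [lintegral_const_mul _ hkl]
  simp_rw [nrm_eq_lpn hr0]

/-- Continuity of translations in L^r makes the average over the heat kernel small as τ → 0, and the
density concentrates there as t → 0. -/
theorem tendsto_linOp_zero (P : SymbolParams k α) {r : ℝ} (hr : 1 ≤ r) {f : Space N → ℝ}
    (hf : Measurable f) (hfr : nrm r f < ∞) :
    Tendsto (fun t => nrm r fun x => linOp k α t f x - f x) (𝓝[>] 0) (𝓝 0) := by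
  have hr0 : 0 < r := one_pos.trans_le hr
  set h : Space N → ℝ≥0∞ := fun z => nrm r fun x => f (-z + x) - f x with hh
  have hdiff : Measurable (uncurry fun (z : Space N) (x : Space N) => f (-z + x) - f x) :=
    (hf.comp (f := fun p : Space N × Space N => -p.1 + p.2) (by fun_prop)).sub
      (hf.comp measurable_snd)
  have hm : Measurable h := by
    simp_rw [hh, nrm_eq_lpn hr0]
    exact measurable_lpn_family hdiff r
  have hA : ∀ z, h z ≤ nrm r f + nrm r f := fun z => by
    have hft : Measurable fun x => f (-z + x) := hf.comp (measurable_const_add _)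
    refine (nrm_sub_le hr hft.aestronglyMeasurable hf.aestronglyMeasurable).trans (le_of_eq ?_)
    congr 1
    exact eLpNorm_comp_measurePreserving hf.aestronglyMeasurable
      (measurePreserving_add_left volume (-z))
  have hAt : nrm r f + nrm r f ≠ ∞ := (add_lt_top.2 ⟨hfr, hfr⟩).ne
  have h0 : Tendsto h (𝓝 0) (𝓝 0) := tendsto_translation hr ⟨hf.aestronglyMeasurable, hfr⟩
  set Φ : ℝ → ℝ≥0∞ := fun τ => ∫⁻ z : Space N, ofReal (heatKernel N τ z) * h z with hΦ
  have hΦm : Measurable Φ := by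
    refine Measurable.lintegral_prod_right' (f := fun q : ℝ × Space N =>
      ofReal (heatKernel N q.1 q.2) * h q.2) ?_
    exact measurable_heatKernel.ennreal_ofReal.mul (hm.comp measurable_snd)
  have hΦA : ∀ τ, 0 < τ → Φ τ ≤ nrm r f + nrm r f := fun τ hτ => by
    have hkτ : Measurable fun z : Space N => ofReal (heatKernel N τ z) :=
      (measurable_heatKernel.comp (measurable_prodMk_left (x := τ))).ennreal_ofReal
    calc Φ τ ≤ ∫⁻ z : Space N, ofReal (heatKernel N τ z) * (nrm r f + nrm r f) :=
          lintegral_mono fun z => mul_le_mul_right (hA z) _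
      _ = _ := by rw [lintegral_mul_const _ hkτ, lintegral_heatKernel hτ, one_mul]
  have hΦ0 : Tendsto Φ (𝓝[>] 0) (𝓝 0) := by
    rw [ENNReal.tendsto_nhds_zero]
    intro ε hε
    have hε2 : 0 < ε / 2 := ENNReal.half_pos hε.ne'
    obtain ⟨η, hη, hη2⟩ := Metric.eventually_nhds_iff.1 (ENNReal.tendsto_nhds_zero.1 h0 _ hε2)
    have hlim : Tendsto (fun τ : ℝ => (nrm r f + nrm r f) *
        ofReal (2 ^ ((N : ℝ) / 2) * Real.exp (-(η ^ 2 / (8 * τ))))) (𝓝[>] 0) (𝓝 0) := by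
      have h1 : Tendsto (fun τ : ℝ => η ^ 2 / (8 * τ)) (𝓝[>] 0) atTop := by
        have := tendsto_inv_nhdsGT_zero (𝕜 := ℝ)
        have h2 := this.const_mul_atTop (show 0 < η ^ 2 / 8 by positivity)
        refine h2.congr fun τ => ?_
        rw [← div_eq_mul_inv, div_div]
      have h2 := (Real.tendsto_exp_neg_atTop_nhds_zero.comp h1).const_mul ((2 : ℝ) ^ ((N : ℝ) / 2))
      rw [mul_zero] at h2
      simpa using ENNReal.Tendsto.const_mul (tendsto_ofReal h2) (Or.inr hAt)
    filter_upwards [ENNReal.tendsto_nhds_zero.1 hlim _ hε2, self_mem_nhdsWithin] with τ h1 hτ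
    refine (lintegral_heatKernel_mul_le hm hA hη.le (fun z hz => hη2 (by simpa using hz)) hτ).trans ?_
    exact (add_le_add le_rfl h1).trans_eq (ENNReal.add_halves ε)
  refine tendsto_of_tendsto_of_tendsto_of_le_of_le' tendsto_const_nhds
    (tendsto_lintegral_subDens P hΦm hAt hΦA hΦ0) (Eventually.of_forall fun _ => zero_le) ?_
  filter_upwards [self_mem_nhdsWithin] with t ht
  exact nrm_linOp_sub_le P hr ht hf hfr

end Initial

/-! ### The nonlinearity -/

/-- The properties of `s ↦ |s|^ρ` and `s ↦ |s|^{ρ-1} s` that matter. -/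
structure PowerLike (ρ : ℝ) (f : ℝ → ℝ) : Prop where
  one_le : 1 ≤ ρ
  meas : Measurable f
  abs_eq : ∀ a, |f a| = |a| ^ ρ
  lip : ∀ a b, |f a - f b| ≤ ρ * (|a| ^ (ρ - 1) * |a - b| + |b| ^ (ρ - 1) * |a - b|)
  nonneg : ∀ a, 0 ≤ a → 0 ≤ f a

/-- Bernoulli's inequality for the ratio y/x. -/
theorem rpow_sub_rpow_le {ρ x y : ℝ} (hρ : 1 ≤ ρ) (hy : 0 ≤ y) (hyx : y ≤ x) :
    x ^ ρ - y ^ ρ ≤ ρ * (x ^ (ρ - 1) * (x - y)) := by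
  rcases (hy.trans hyx).eq_or_lt with rfl | hx
  · have : y = 0 := le_antisymm hyx hy
    simp [this]
  · have h := one_add_mul_self_le_rpow_one_add (s := y / x - 1) (by
      have : 0 ≤ y / x := by positivity
      linarith) hρ
    rw [add_sub_cancel, Real.div_rpow hy hx.le, le_div_iff₀ (by positivity)] at h
    have h2 : x ^ ρ = x ^ (ρ - 1) * x := by
      rw [← Real.rpow_add_one hx.ne', sub_add_cancel]
    have h3 : ρ * (y / x - 1) * x ^ ρ = -(ρ * (x ^ (ρ - 1) * (x - y))) := by
      rw [h2]
      field_simp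
      ring
    linarith

theorem abs_rpow_abs_sub_le {ρ : ℝ} (hρ : 1 ≤ ρ) (a b : ℝ) :
    |(|a| ^ ρ - |b| ^ ρ)| ≤ ρ * (|a| ^ (ρ - 1) * |(|a| - |b|)| + |b| ^ (ρ - 1) * |(|a| - |b|)|) := by
  have key : ∀ x y : ℝ, 0 ≤ y → y ≤ x →
      |x ^ ρ - y ^ ρ| ≤ ρ * (x ^ (ρ - 1) * |x - y| + y ^ (ρ - 1) * |x - y|) := by
    intro x y hy hyx
    rw [abs_of_nonneg (sub_nonneg.2 (Real.rpow_le_rpow hy hyx (by linarith))),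
      abs_of_nonneg (sub_nonneg.2 hyx)]
    have h1 : 0 ≤ y ^ (ρ - 1) * (x - y) :=
      mul_nonneg (Real.rpow_nonneg hy _) (sub_nonneg.2 hyx)
    have := rpow_sub_rpow_le hρ hy hyx
    nlinarith
  rcases le_total |b| |a| with h | h
  · exact key _ _ (abs_nonneg b) h
  · rw [abs_sub_comm (|a| ^ ρ), abs_sub_comm |a|, add_comm]
    exact key _ _ (abs_nonneg a) h

theorem abs_rpow_mul_self_eq {ρ : ℝ} (hρ : 1 ≤ ρ) (a : ℝ) : |a| ^ (ρ - 1) * |a| = |a| ^ ρ := by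
  rcases eq_or_ne a 0 with rfl | h
  · rw [abs_zero, mul_zero, Real.zero_rpow (by linarith)]
  · rw [← Real.rpow_add_one (abs_ne_zero.2 h), sub_add_cancel]

theorem IsPower.powerLike {ρ : ℝ} {f : ℝ → ℝ} (hρ : 1 ≤ ρ) (h : IsPower ρ f) : PowerLike ρ f := by
  rcases h with rfl | rfl
  · refine ⟨hρ, by fun_prop, fun a => abs_of_nonneg (by positivity), fun a b => ?_,
      fun a _ => by positivity⟩
    refine (abs_rpow_abs_sub_le hρ a b).trans ?_
    have := abs_abs_sub_abs_le_abs_sub a b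
    gcongr
  · have habs : ∀ a : ℝ, |(|a| ^ (ρ - 1) * a)| = |a| ^ ρ := fun a => by
      rw [abs_mul, abs_of_nonneg (by positivity : 0 ≤ |a| ^ (ρ - 1)), abs_rpow_mul_self_eq hρ]
    have hpos : ∀ a : ℝ, 0 ≤ a → |a| ^ (ρ - 1) * a = |a| ^ ρ := fun a ha => by
      nth_rw 2 [← abs_of_nonneg ha]; exact abs_rpow_mul_self_eq hρ a
    have hneg : ∀ a : ℝ, a ≤ 0 → |a| ^ (ρ - 1) * a = -|a| ^ ρ := fun a ha => by
      rw [← abs_rpow_mul_self_eq hρ a, abs_of_nonpos ha]; ring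
    -- For the signed power, arguments of opposite sign are not covered by the comparison of
    -- absolute values; there |a - b| = |a| + |b|.
    have hmix : ∀ a b : ℝ, 0 ≤ a → b ≤ 0 → |a| ^ ρ + |b| ^ ρ ≤
        ρ * (|a| ^ (ρ - 1) * |a - b| + |b| ^ (ρ - 1) * |a - b|) := fun a b ha hb => by
      have h1 : |a - b| = |a| + |b| := by
        rw [abs_of_nonneg ha, abs_of_nonpos hb, abs_of_nonneg (by linarith)]; ring
      rw [h1, ← abs_rpow_mul_self_eq hρ a, ← abs_rpow_mul_self_eq hρ b]
      have hA : 0 ≤ |a| ^ (ρ - 1) := by positivity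
      have hB : 0 ≤ |b| ^ (ρ - 1) := by positivity
      have h2 : 0 ≤ |a| ^ (ρ - 1) * (|a| + |b|) + |b| ^ (ρ - 1) * (|a| + |b|) := by positivity
      have h3 : 0 ≤ |a| ^ (ρ - 1) * |b| := by positivity
      have h4 : 0 ≤ |b| ^ (ρ - 1) * |a| := by positivity
      nlinarith
    refine ⟨hρ, by fun_prop, habs, fun a b => ?_, fun a ha => by positivity⟩
    have hle : ρ * (|a| ^ (ρ - 1) * |(|a| - |b|)| + |b| ^ (ρ - 1) * |(|a| - |b|)|) ≤
        ρ * (|a| ^ (ρ - 1) * |a - b| + |b| ^ (ρ - 1) * |a - b|) := by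
      have := abs_abs_sub_abs_le_abs_sub a b
      gcongr
    rcases le_total 0 a with ha | ha <;> rcases le_total 0 b with hb | hb
    · rw [hpos a ha, hpos b hb]
      exact (abs_rpow_abs_sub_le hρ a b).trans hle
    · rw [hpos a ha, hneg b hb, sub_neg_eq_add, abs_of_nonneg (by positivity)]
      exact hmix a b ha hb
    · rw [hneg a ha, hpos b hb, ← neg_add', abs_neg, abs_of_nonneg (by positivity), add_comm,
        abs_sub_comm a b, add_comm (|a| ^ (ρ - 1) * _)]
      exact hmix b a hb ha
    · rw [hneg a ha, hneg b hb, neg_sub_neg, abs_sub_comm]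
      exact (abs_rpow_abs_sub_le hρ a b).trans hle

/-! ### The power nonlinearity between Lebesgue spaces -/

section Nemytskii

variable {N : ℕ} {ρ p : ℝ} {f : ℝ → ℝ}

theorem enorm_rpow_eq {ρ : ℝ} (hρ : 0 ≤ ρ) (a : ℝ) : ofReal (|a| ^ ρ) = ‖a‖ₑ ^ ρ := by
  rw [← ENNReal.ofReal_rpow_of_nonneg (abs_nonneg a) hρ, Real.enorm_eq_ofReal_abs]

theorem nrm_comp_power (hf : PowerLike ρ f) (hp : 0 < p) (v : Space N → ℝ) :
    nrm (p / ρ) (fun x => f (v x)) = nrm p v ^ ρ := by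
  have hρ : 0 < ρ := one_pos.trans_le hf.one_le
  rw [nrm_eq_lpn (by positivity), nrm_eq_lpn hp, lpn, lpn, ← ENNReal.rpow_mul]
  congr 1
  · refine lintegral_congr fun x => ?_
    rw [Real.enorm_eq_ofReal_abs (f (v x)), hf.abs_eq, enorm_rpow_eq hρ.le, ← ENNReal.rpow_mul,
      mul_div_cancel₀ _ hρ.ne']
  · field_simp

/-- Hölder's inequality with exponents p/(ρ-1) and p. For ρ = 1 the first exponent degenerates and
the inequality is trivial. -/
theorem lpn_rpow_mul_le (hρ : 1 ≤ ρ) (hp : 0 < p) {v w : Space N → ℝ} (hv : Measurable v)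
    (hw : Measurable w) :
    lpn (p / ρ) (fun x => ‖v x‖ₑ ^ (ρ - 1) * ‖w x‖ₑ) ≤ nrm p v ^ (ρ - 1) * nrm p w := by
  rcases hρ.eq_or_lt with rfl | hρ1
  · simp only [sub_self, ENNReal.rpow_zero, one_mul, div_one]
    rw [nrm_eq_lpn hp]
  · have h1 : 0 < ρ - 1 := by linarith
    refine (lpn_mul_le (q := p / (ρ - 1)) (r := p) (by positivity) ?_ ?_
      (hv.enorm.pow_const _).aemeasurable hw.enorm.aemeasurable).trans ?_
    · exact div_lt_div_of_pos_left hp h1 (by linarith)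
    · field_simp; ring
    · rw [← nrm_eq_lpn hp]
      refine mul_le_mul_left (le_of_eq ?_) _
      rw [nrm_eq_lpn hp, lpn, lpn, ← ENNReal.rpow_mul]
      congr 1
      · refine lintegral_congr fun x => ?_
        rw [← ENNReal.rpow_mul, mul_div_cancel₀ _ h1.ne']
      · field_simp

theorem nrm_comp_power_sub_le (hf : PowerLike ρ f) (hp : ρ ≤ p) {v w : Space N → ℝ}
    (hv : Measurable v) (hw : Measurable w) :
    nrm (p / ρ) (fun x => f (v x) - f (w x)) ≤
      ofReal ρ * ((nrm p v ^ (ρ - 1) + nrm p w ^ (ρ - 1)) * nrm p fun x => v x - w x) := by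
  have hρ1 := hf.one_le
  have hρ : 0 < ρ := one_pos.trans_le hf.one_le
  have hp0 : 0 < p := hρ.trans_le hp
  have ha : 1 ≤ p / ρ := (one_le_div hρ).2 hp
  have hd : Measurable fun x => v x - w x := hv.sub hw
  have hm1 : Measurable fun x => ‖v x‖ₑ ^ (ρ - 1) * ‖v x - w x‖ₑ := by fun_prop
  have hm2 : Measurable fun x => ‖w x‖ₑ ^ (ρ - 1) * ‖v x - w x‖ₑ := by fun_prop
  have hm12 : Measurable fun x =>
      ‖v x‖ₑ ^ (ρ - 1) * ‖v x - w x‖ₑ + ‖w x‖ₑ ^ (ρ - 1) * ‖v x - w x‖ₑ := hm1.add hm2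
  rw [nrm_eq_lpn (by positivity)]
  calc lpn (p / ρ) (fun x => ‖f (v x) - f (w x)‖ₑ)
      ≤ lpn (p / ρ) (fun x => ofReal ρ *
          (‖v x‖ₑ ^ (ρ - 1) * ‖v x - w x‖ₑ + ‖w x‖ₑ ^ (ρ - 1) * ‖v x - w x‖ₑ)) := by
        refine lpn_mono (by positivity) (Eventually.of_forall fun x => ?_)
        rw [Real.enorm_eq_ofReal_abs]
        refine (ofReal_le_ofReal (hf.lip (v x) (w x))).trans (le_of_eq ?_)
        rw [ofReal_mul hρ.le, ofReal_add (by positivity) (by positivity),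
          ofReal_mul (by positivity), ofReal_mul (by positivity),
          enorm_rpow_eq (by linarith), enorm_rpow_eq (by linarith), Real.enorm_eq_ofReal_abs (v x - w x)]
    _ = ofReal ρ * lpn (p / ρ) (fun x =>
          ‖v x‖ₑ ^ (ρ - 1) * ‖v x - w x‖ₑ + ‖w x‖ₑ ^ (ρ - 1) * ‖v x - w x‖ₑ) :=
        lpn_const_mul (one_pos.trans_le ha) _ hm12
    _ ≤ ofReal ρ * (nrm p v ^ (ρ - 1) * nrm p (fun x => v x - w x) +
          nrm p w ^ (ρ - 1) * nrm p (fun x => v x - w x)) := by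
        refine mul_le_mul_right ((lpn_add_le ha hm1.aemeasurable hm2.aemeasurable).trans ?_) _
        exact add_le_add (lpn_rpow_mul_le hρ1 hp0 hv hd) (lpn_rpow_mul_le hρ1 hp0 hw hd)
    _ = _ := by rw [← add_mul]

end Nemytskii

/-! ### Estimates of the Duhamel integral -/

section DuhamelBudget

variable {N : ℕ} {k α σ γ : ℝ}

/-- The amplitude `t (tτ)^γ`. -/
def amp (γ t τ : ℝ) : ℝ := t * (t * τ) ^ γ

theorem measurable_amp (γ t : ℝ) : Measurable (amp γ t) := by
  unfold amp
  fun_prop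

theorem amp_nonneg {t τ : ℝ} (ht : 0 < t) (hτ : 0 < τ) : 0 ≤ amp γ t τ := by
  unfold amp
  positivity

/-- The subordination density of the Duhamel integral. -/
def duhamelSub (k α t : ℝ) (τ τ' : ℝ) : ℝ := subDens k α (t * (1 - τ)) τ'

theorem measurable_duhamelSub (t : ℝ) : Measurable (uncurry (duhamelSub k α t)) :=
  measurable_subDens.comp (f := fun p : ℝ × ℝ => (t * (1 - p.1), p.2)) (by fun_prop)

/-- The rescaled nonlinear term of the Duhamel integral. -/
def duhamelSrc (γ : ℝ) (f : ℝ → ℝ) (v : ℝ → Space N → ℝ) (t τ : ℝ) (y : Space N) : ℝ :=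
  amp γ t τ * f (v (t * τ) y)

theorem measurable_time_scale {v : ℝ → Space N → ℝ} (hv : Measurable (uncurry v)) (t : ℝ) :
    Measurable (uncurry fun (τ : ℝ) (y : Space N) => v (t * τ) y) :=
  hv.comp (f := fun p : ℝ × Space N => (t * p.1, p.2)) (by fun_prop)

theorem measurable_duhamelSrc {f : ℝ → ℝ} (hf : Measurable f) {v : ℝ → Space N → ℝ}
    (hv : Measurable (uncurry v)) (t : ℝ) :
    Measurable (uncurry (duhamelSrc γ f v t)) :=
  ((measurable_amp γ t).comp measurable_fst).mul (hf.comp (measurable_time_scale hv t))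

theorem measurable_source {f : ℝ → ℝ} (hf : Measurable f) {v : ℝ → Space N → ℝ}
    (hv : Measurable (uncurry v)) : Measurable (uncurry (source σ γ f v)) := by
  have h1 : Measurable fun p : ℝ × Space N => f (v p.1 p.2) := hf.comp hv
  have h2 : Measurable fun p : ℝ × Space N => ‖p.2‖ ^ σ * p.1 ^ γ := by fun_prop
  exact h2.mul h1

theorem duhamelDens_source (f : ℝ → ℝ) (v : ℝ → Space N → ℝ) (t : ℝ) :
    duhamelDens k α (source σ γ f v) t = fun z y =>
      ‖y‖ ^ σ * (duhamelSub k α t z.1 z.2 * duhamelSrc γ f v t z.1 y) := by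
  funext z y
  simp only [duhamelDens, source, duhamelSub, duhamelSrc, amp]
  ring

theorem measurable_moment_family {ω : ℝ → ℝ → ℝ} (hω : Measurable (uncurry ω)) (β : ℝ) :
    Measurable fun τ => moment β (ω τ) := by
  refine Measurable.lintegral_prod_right' (f := fun q : ℝ × ℝ =>
    ‖ω q.1 q.2‖ₑ * ofReal (q.2 ^ (-β))) ?_
  exact hω.enorm.mul (by fun_prop)

theorem measurable_nrm_family {g : ℝ → Space N → ℝ} (hg : Measurable (uncurry g)) {a : ℝ}
    (ha : 0 < a) : Measurable fun τ => nrm a (g τ) := by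
  simp_rw [nrm_eq_lpn ha]
  exact measurable_lpn_family hg a

theorem measurable_duhamel_product {ω : ℝ → ℝ → ℝ} (hω : Measurable (uncurry ω))
    {g : ℝ → Space N → ℝ} (hg : Measurable (uncurry g)) :
    Measurable (uncurry fun (z : ℝ × ℝ) (y : Space N) => ω z.1 z.2 * g z.1 y) := by
  have h1 : Measurable fun p : (ℝ × ℝ) × Space N => ω p.1.1 p.1.2 := hω.comp measurable_fst
  have h2 : Measurable fun p : (ℝ × ℝ) × Space N => g p.1.1 p.2 :=
    hg.comp (f := fun p : (ℝ × ℝ) × Space N => (p.1.1, p.2)) (by fun_prop)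
  exact h1.mul h2

/-- The spatial norm takes the subordination density out as a factor, and the integral in τ' then
leaves its moment at each τ. -/
theorem heatBudget_duhamel {ω : ℝ → ℝ → ℝ} (hω : Measurable (uncurry ω))
    {g : ℝ → Space N → ℝ} (hg : Measurable (uncurry g)) {a β : ℝ} (ha : 0 < a) :
    heatBudget duhamelMeasure Prod.snd a β (fun z y => ω z.1 z.2 * g z.1 y) =
      ∫⁻ τ in Ioo (0 : ℝ) 1, moment β (ω τ) * nrm a (g τ) := by
  have hl : Measurable fun z : ℝ × ℝ => lpn a fun y => ‖ω z.1 z.2 * g z.1 y‖ₑ :=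
    measurable_lpn_family (measurable_duhamel_product hω hg) a
  have hm : Measurable fun z : ℝ × ℝ => ofReal (z.2 ^ (-β)) *
      lpn a fun y => ‖ω z.1 z.2 * g z.1 y‖ₑ := by fun_prop
  rw [heatBudget, duhamelMeasure, lintegral_prod _ hm.aemeasurable]
  refine lintegral_congr fun τ => ?_
  have hωτ : Measurable (ω τ) := hω.of_uncurry_left
  have hgτ : Measurable (g τ) := hg.of_uncurry_left
  rw [moment, nrm_eq_lpn ha, ← lintegral_mul_const _ (by fun_prop)]
  refine lintegral_congr fun τ' => ?_
  have e : lpn a (fun y => ‖ω τ τ' * g τ y‖ₑ) = ‖ω τ τ'‖ₑ * lpn a (fun y => ‖g τ y‖ₑ) := by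
    simp_rw [enorm_mul]
    exact lpn_const_mul ha _ hgτ.enorm
  rw [e]
  ring

theorem enorm_weight (σ : ℝ) : (fun y : Space N => ‖‖y‖ ^ σ‖ₑ) = wt σ := by
  funext y
  rw [wt, Real.enorm_of_nonneg (by positivity)]

theorem ae_snd_pos : ∀ᵐ z ∂duhamelMeasure, 0 < z.2 := ae_duhamelMeasure.mono fun _ hz => hz.2

variable {a b β C : ℝ} {f : ℝ → ℝ} {v w : ℝ → Space N → ℝ}

theorem ae_heatAbs_duhamel_lt_top (ha : 0 < a) (hb : 1 ≤ b) (hB : HeatBound N (wt σ) a b β C)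
    (hC : 0 ≤ C) (hf : Measurable f) (hv : Measurable (uncurry v)) {t : ℝ}
    (hfin : ∫⁻ τ in Ioo (0 : ℝ) 1, moment β (duhamelSub k α t τ) * nrm a (duhamelSrc γ f v t τ) < ∞) :
    ∀ᵐ x, heatAbs duhamelMeasure Prod.snd (duhamelDens k α (source σ γ f v) t) x < ∞ := by
  rw [duhamelDens_source]
  refine ae_heatAbs_lt_top measurable_snd ae_snd_pos (by fun_prop) hb (by rwa [enorm_weight]) hC
    (measurable_duhamel_product (measurable_duhamelSub t) (measurable_duhamelSrc hf hv t)) ?_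
  rwa [heatBudget_duhamel (measurable_duhamelSub t) (measurable_duhamelSrc hf hv t) ha]

theorem nrm_duhamelOp_le (ha : 0 < a) (hb : 1 ≤ b) (hB : HeatBound N (wt σ) a b β C) (hC : 0 ≤ C)
    (hf : Measurable f) (hv : Measurable (uncurry v)) (t : ℝ) :
    nrm b (duhamelOp k α (source σ γ f v) t) ≤ ofReal C *
      ∫⁻ τ in Ioo (0 : ℝ) 1, moment β (duhamelSub k α t τ) * nrm a (duhamelSrc γ f v t τ) := by
  rw [duhamelOp, duhamelDens_source, nrm_eq_lpn (one_pos.trans_le hb),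
    ← heatBudget_duhamel (measurable_duhamelSub t) (measurable_duhamelSrc hf hv t) ha]
  exact lpn_heatOp_le measurable_snd ae_snd_pos (by fun_prop) hb (by rwa [enorm_weight]) hC
    (measurable_duhamel_product (measurable_duhamelSub t) (measurable_duhamelSrc hf hv t))

theorem nrm_duhamelOp_sub_le (ha : 0 < a) (hb : 1 ≤ b) (hB : HeatBound N (wt σ) a b β C)
    (hC : 0 ≤ C) (hf : Measurable f) (hv : Measurable (uncurry v))
    (hw : Measurable (uncurry w)) {t : ℝ}
    (hvf : ∫⁻ τ in Ioo (0 : ℝ) 1, moment β (duhamelSub k α t τ) * nrm a (duhamelSrc γ f v t τ) < ∞)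
    (hwf : ∫⁻ τ in Ioo (0 : ℝ) 1, moment β (duhamelSub k α t τ) * nrm a (duhamelSrc γ f w t τ) < ∞) :
    nrm b (fun x => duhamelOp k α (source σ γ f v) t x - duhamelOp k α (source σ γ f w) t x) ≤
      ofReal C * ∫⁻ τ in Ioo (0 : ℝ) 1, moment β (duhamelSub k α t τ) *
        nrm a fun y => duhamelSrc γ f v t τ y - duhamelSrc γ f w t τ y := by
  have hs := measurable_duhamelSub (k := k) (α := α) t
  have hv' := measurable_duhamelSrc (γ := γ) hf hv t
  have hw' := measurable_duhamelSrc (γ := γ) hf hw t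
  rw [nrm_eq_lpn (one_pos.trans_le hb), ← heatBudget_duhamel hs (hv'.sub hw') ha]
  rw [← heatBudget_duhamel hs hv' ha] at hvf
  rw [← heatBudget_duhamel hs hw' ha] at hwf
  simp only [duhamelOp, duhamelDens_source]
  refine (lpn_heatOp_sub_le measurable_snd ae_snd_pos (φ := fun y : Space N => ‖y‖ ^ σ) (by fun_prop) hb (by rwa [enorm_weight]) hC
    (measurable_duhamel_product hs hv') (measurable_duhamel_product hs hw') hvf hwf).trans
    (le_of_eq ?_)
  simp_rw [← mul_sub]

/-- Both the density and the source depend on t. Their products are compared by changing one factor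
at a time, the density first and then the source. -/
theorem nrm_duhamelOp_time_sub_le (ha : 1 ≤ a) (hb : 1 ≤ b) (hB : HeatBound N (wt σ) a b β C)
    (hC : 0 ≤ C) (hf : Measurable f) (hv : Measurable (uncurry v)) {t t₀ : ℝ}
    (htf : ∫⁻ τ in Ioo (0 : ℝ) 1, moment β (duhamelSub k α t τ) * nrm a (duhamelSrc γ f v t τ) < ∞)
    (htf₀ : ∫⁻ τ in Ioo (0 : ℝ) 1,
      moment β (duhamelSub k α t₀ τ) * nrm a (duhamelSrc γ f v t₀ τ) < ∞) :
    nrm b (fun x => duhamelOp k α (source σ γ f v) t x - duhamelOp k α (source σ γ f v) t₀ x) ≤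
      ofReal C * ∫⁻ τ in Ioo (0 : ℝ) 1,
        (moment β (fun τ' => duhamelSub k α t τ τ' - duhamelSub k α t₀ τ τ') *
          nrm a (duhamelSrc γ f v t₀ τ) +
        moment β (duhamelSub k α t τ) *
          nrm a fun y => duhamelSrc γ f v t τ y - duhamelSrc γ f v t₀ τ y) := by
  have ha0 : 0 < a := one_pos.trans_le ha
  have hs := measurable_duhamelSub (k := k) (α := α) t
  have hs₀ := measurable_duhamelSub (k := k) (α := α) t₀
  have hv' := measurable_duhamelSrc (γ := γ) hf hv t
  have hv₀ := measurable_duhamelSrc (γ := γ) hf hv t₀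
  have hsd : Measurable (uncurry fun τ τ' => duhamelSub k α t τ τ' - duhamelSub k α t₀ τ τ') :=
    hs.sub hs₀
  rw [← heatBudget_duhamel hs hv' ha0] at htf
  rw [← heatBudget_duhamel hs₀ hv₀ ha0] at htf₀
  have hm1 : Measurable fun τ => moment β (fun τ' => duhamelSub k α t τ τ' - duhamelSub k α t₀ τ τ') *
      nrm a (duhamelSrc γ f v t₀ τ) :=
    (measurable_moment_family hsd β).mul (measurable_nrm_family hv₀ ha0)
  rw [nrm_eq_lpn (one_pos.trans_le hb), lintegral_add_left hm1, ← heatBudget_duhamel hs (hv'.sub hv₀) ha0,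
    ← heatBudget_duhamel hsd hv₀ ha0]
  simp only [duhamelOp, duhamelDens_source]
  refine (lpn_heatOp_sub_le measurable_snd ae_snd_pos (φ := fun y : Space N => ‖y‖ ^ σ) (by fun_prop) hb (by rwa [enorm_weight]) hC
    (measurable_duhamel_product hs hv') (measurable_duhamel_product hs₀ hv₀) htf htf₀).trans
    (mul_le_mul_right ?_ _)
  have hl := measurable_lpn_family (measurable_duhamel_product hsd hv₀) a
  unfold heatBudget
  rw [← lintegral_add_left (by fun_prop)]
  refine lintegral_mono fun z => ?_
  rw [← mul_add]
  refine mul_le_mul_right ?_ _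
  have h1 : Measurable fun y => ‖(duhamelSub k α t z.1 z.2 - duhamelSub k α t₀ z.1 z.2) *
      duhamelSrc γ f v t₀ z.1 y‖ₑ := ((hv₀.of_uncurry_left (x := z.1)).const_mul _).enorm
  have h2 : Measurable fun y => ‖duhamelSub k α t z.1 z.2 *
      (duhamelSrc γ f v t z.1 y - duhamelSrc γ f v t₀ z.1 y)‖ₑ :=
    (((hv'.of_uncurry_left (x := z.1)).sub (hv₀.of_uncurry_left (x := z.1))).const_mul _).enorm
  refine le_trans (lpn_mono ha0 (Eventually.of_forall fun y => ?_))
    (lpn_add_le ha h1.aemeasurable h2.aemeasurable)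
  refine le_trans (le_of_eq ?_) (enorm_add_le _ _)
  congr 1
  ring

end DuhamelBudget

/-! ### Weighted norms in time, inequalities for the bracket, and Beta weights -/

section Weights

variable {N : ℕ} {k α : ℝ}

/-- The weighted norm `⟨t⟩^{1/q(p,r)} ‖u(t)‖_{L^p}`. -/
def wnorm (k α r p : ℝ) (u : ℝ → Space N → ℝ) (t : ℝ) : ℝ≥0∞ :=
  bw k α (smoothing N r p) t * nrm p (u t)

/-- The supremum of the weighted norm over `t > 0`. -/
def wsup (k α r p : ℝ) (u : ℝ → Space N → ℝ) : ℝ≥0∞ := ⨆ t ∈ Ioi (0 : ℝ), wnorm k α r p u t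

theorem wnorm_le_wsup {r p : ℝ} (u : ℝ → Space N → ℝ) {t : ℝ} (ht : 0 < t) :
    wnorm k α r p u t ≤ wsup k α r p u := le_biSup (fun t => wnorm k α r p u t) (mem_Ioi.2 ht)

theorem wsup_le {r p : ℝ} {u : ℝ → Space N → ℝ} {M : ℝ≥0∞}
    (h : ∀ t, 0 < t → wnorm k α r p u t ≤ M) : wsup k α r p u ≤ M := iSup₂_le h

/-- Continuity in `L^p` on `(0,∞)`. -/
def ContPos (p : ℝ) (u : ℝ → Space N → ℝ) : Prop :=
  ∀ t₀, 0 < t₀ → Tendsto (fun t => nrm p fun x => u t x - u t₀ x) (𝓝 t₀) (𝓝 0)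

theorem nrm_eq_wnorm (P : SymbolParams k α) (r p : ℝ) (u : ℝ → Space N → ℝ) {t : ℝ} (ht : 0 < t) :
    nrm p (u t) = ofReal (bracket k α t ^ (-smoothing N r p)) * wnorm k α r p u t := by
  have hb := bracket_pos P ht
  rw [wnorm, bw, ← mul_assoc, ← ofReal_mul (by positivity), ← Real.rpow_add hb,
    neg_add_cancel, Real.rpow_zero, ofReal_one, one_mul]

theorem measurable_bracket : Measurable (bracket k α) := by
  unfold bracket
  fun_prop

theorem measurable_wnorm {r p : ℝ} (hp : 0 < p) {u : ℝ → Space N → ℝ}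
    (hu : Measurable (uncurry u)) : Measurable (wnorm k α r p u) := by
  have h1 := measurable_nrm_family hu hp
  have h2 := measurable_bracket (k := k) (α := α)
  unfold wnorm bw
  fun_prop

/-- The substitute for homogeneity: τ ≤ τ^{1-α} on (0,1]. -/
theorem mul_bracket_le (P : SymbolParams k α) {t τ : ℝ} (ht : 0 < t) (hτ : 0 < τ) (hτ1 : τ ≤ 1) :
    τ * bracket k α t ≤ bracket k α (t * τ) := by
  have := P.k_pos
  have := P.α_pos
  have h1 : τ ≤ τ ^ (1 - α) := by
    nth_rw 1 [← Real.rpow_one τ]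
    exact Real.rpow_le_rpow_of_exponent_ge hτ hτ1 (by linarith)
  unfold bracket
  rw [Real.mul_rpow ht.le hτ.le]
  have h2 : τ * (k * t ^ (1 - α)) ≤ τ ^ (1 - α) * (k * t ^ (1 - α)) :=
    mul_le_mul_of_nonneg_right h1 (by positivity)
  linarith

theorem le_bracket (P : SymbolParams k α) {t : ℝ} (ht : 0 < t) : t ≤ bracket k α t := by
  have := P.k_pos
  have : 0 ≤ k * t ^ (1 - α) := by positivity
  unfold bracket
  linarith

theorem bracket_rpow_neg_le (P : SymbolParams k α) {t τ κ : ℝ} (ht : 0 < t) (hτ : 0 < τ)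
    (hτ1 : τ ≤ 1) (hκ : 0 ≤ κ) :
    bracket k α (t * τ) ^ (-κ) ≤ τ ^ (-κ) * bracket k α t ^ (-κ) := by
  have hb := bracket_pos P ht
  rw [← Real.mul_rpow hτ.le hb.le]
  exact Real.rpow_le_rpow_of_nonpos (by positivity) (mul_bracket_le P ht hτ hτ1) (by linarith)

/-- The factor t^{1+γ} of the amplitude is bounded by ⟨t⟩^{1+γ}, since t ≤ ⟨t⟩ and γ ≥ -1.
Everything that depends on t is then a power of the bracket. -/
theorem amp_mul_bracket_le (P : SymbolParams k α) {t τ κ γ : ℝ} (ht : 0 < t) (hτ : 0 < τ)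
    (hτ1 : τ ≤ 1) (hκ : 0 ≤ κ) (hγ : -1 ≤ γ) :
    amp γ t τ * bracket k α (t * τ) ^ (-κ) ≤
      τ ^ (-(κ - γ)) * bracket k α t ^ (1 + γ - κ) := by
  have hb := bracket_pos P ht
  have h1 : amp γ t τ ≤ bracket k α t ^ (1 + γ) * τ ^ γ := by
    rw [amp, Real.mul_rpow ht.le hτ.le, ← mul_assoc]
    refine mul_le_mul_of_nonneg_right ?_ (by positivity)
    calc t * t ^ γ = t ^ (1 + γ) := by rw [Real.rpow_add ht, Real.rpow_one]
      _ ≤ _ := Real.rpow_le_rpow ht.le (le_bracket P ht) (by linarith)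
  calc _ ≤ (bracket k α t ^ (1 + γ) * τ ^ γ) * (τ ^ (-κ) * bracket k α t ^ (-κ)) :=
        mul_le_mul h1 (bracket_rpow_neg_le P ht hτ hτ1 hκ)
          (Real.rpow_nonneg (bracket_pos P (mul_pos ht hτ)).le _) (by positivity)
    _ = (τ ^ γ * τ ^ (-κ)) * (bracket k α t ^ (1 + γ) * bracket k α t ^ (-κ)) := by ring
    _ = _ := by
        rw [← Real.rpow_add hτ, ← Real.rpow_add hb]
        congr 2
        ring

/-- The weight `(1-τ)^{-β} τ^{-μ}`. -/
def betaWeight (β μ τ : ℝ) : ℝ := (1 - τ) ^ (-β) * τ ^ (-μ)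

theorem measurable_betaWeight (β μ : ℝ) : Measurable (betaWeight β μ) := by
  unfold betaWeight
  fun_prop

theorem betaWeight_nonneg {β μ τ : ℝ} (hτ : τ ∈ Ioo (0 : ℝ) 1) : 0 ≤ betaWeight β μ τ :=
  mul_nonneg (Real.rpow_nonneg (by linarith [hτ.2]) _) (Real.rpow_nonneg hτ.1.le _)

theorem integrableOn_betaWeight {β μ : ℝ} (hβ0 : 0 ≤ β) (hβ : β < 1) (hμ0 : 0 ≤ μ) (hμ : μ < 1) :
    IntegrableOn (betaWeight β μ) (Ioo 0 1) := by
  have i1 : IntegrableOn (fun τ : ℝ => τ ^ (-μ)) (Ioo 0 1) :=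
    (intervalIntegral.integrableOn_Ioo_rpow_iff one_pos).2 (by linarith)
  have i2 : IntegrableOn (fun τ : ℝ => (1 - τ) ^ (-β)) (Ioo 0 1) := by
    have h := (intervalIntegral.intervalIntegrable_rpow' (a := 0) (b := 1) (r := -β)
      (by linarith)).comp_sub_left 1
    rw [sub_zero, sub_self] at h
    exact (intervalIntegrable_iff_integrableOn_Ioo_of_le zero_le_one).1 h.symm
  -- On either side of 1/2 only one factor is singular, and the other is at most 2^β or 2^μ.
  refine ((i1.const_mul (2 ^ β)).add (i2.const_mul (2 ^ μ))).mono'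
    (measurable_betaWeight β μ).aestronglyMeasurable ?_
  refine (ae_restrict_iff' measurableSet_Ioo).2 (Eventually.of_forall fun τ hτ => ?_)
  rw [Real.norm_of_nonneg (betaWeight_nonneg hτ)]
  have h1 : 0 < 1 - τ := by linarith [hτ.2]
  have h0 : 0 < τ := hτ.1
  have key : ∀ s e : ℝ, 1 / 2 ≤ s → 0 ≤ e → s ^ (-e) ≤ 2 ^ e := fun s e hs he => by
    calc s ^ (-e) ≤ (1 / 2 : ℝ) ^ (-e) :=
          Real.rpow_le_rpow_of_nonpos (by norm_num) hs (by linarith)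
      _ = 2 ^ e := by rw [one_div, Real.inv_rpow two_pos.le, Real.rpow_neg two_pos.le, inv_inv]
  simp only [Pi.add_apply, betaWeight]
  rcases le_total τ (1 / 2) with h | h
  · have := mul_le_mul_of_nonneg_right (key (1 - τ) β (by linarith) hβ0)
      (by positivity : 0 ≤ τ ^ (-μ))
    have : 0 ≤ (2 : ℝ) ^ μ * (1 - τ) ^ (-β) := by positivity
    linarith
  · have := mul_le_mul_of_nonneg_left (key τ μ h hμ0) (by positivity : 0 ≤ (1 - τ) ^ (-β))
    have : 0 ≤ (2 : ℝ) ^ β * τ ^ (-μ) := by positivity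
    linarith

theorem lintegral_betaWeight_lt_top {β μ : ℝ} (hβ0 : 0 ≤ β) (hβ : β < 1) (hμ0 : 0 ≤ μ)
    (hμ : μ < 1) : ∫⁻ τ in Ioo (0 : ℝ) 1, ofReal (betaWeight β μ τ) < ∞ :=
  lt_of_le_of_lt (lintegral_mono fun τ => Real.ofReal_le_enorm _)
    (integrableOn_betaWeight hβ0 hβ hμ0 hμ).2

end Weights

/-- The exponents for which the Duhamel integral maps curves in `L^p`, with the weight of the
critical exponent `rv`, to curves in `L^b`, with the weight of the critical exponent `ru`. -/
structure DuhamelExp (N : ℕ) (σ γ ρ rv p ru b : ℝ) : Prop where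
  dim : 1 ≤ N
  one_le : 1 ≤ ρ
  σ_nonpos : σ ≤ 0
  γ_nonpos : γ ≤ 0
  γ_ge : -1 ≤ γ
  rv_pos : 0 < rv
  rv_le : rv ≤ p
  b_ge : 1 ≤ b
  gain : 1 / b < ρ / p - σ / N
  integrable : ρ / p - σ / N < 1
  order : (N : ℝ) / 2 * (ρ / p - 1 / b) - σ / 2 < 1
  singular : ρ * smoothing N rv p - γ < 1
  scaling : ρ / rv = 1 / ru + (σ + 2 * γ + 2) / N

/-- The order of the smoothing that the Duhamel integral needs. -/
def gainExp (N : ℕ) (σ ρ p b : ℝ) : ℝ := (N : ℝ) / 2 * (1 / (p / ρ) - 1 / b) - σ / 2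

/-- The weight in time that bounds the Duhamel integral. -/
abbrev duhamelWeight (N : ℕ) (σ γ ρ rv p b τ : ℝ) : ℝ≥0∞ :=
  ofReal (betaWeight (gainExp N σ ρ p b) (ρ * smoothing N rv p - γ) τ)

/-! ### Boundedness and Lipschitz estimates of the Duhamel integral for compatible exponents -/

namespace DuhamelExp

variable {N : ℕ} {k α σ γ ρ rv p ru b : ℝ}

theorem dim_pos (E : DuhamelExp N σ γ ρ rv p ru b) : (0 : ℝ) < N := by exact_mod_cast E.dim

theorem p_pos (E : DuhamelExp N σ γ ρ rv p ru b) : 0 < p := E.rv_pos.trans_le E.rv_le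

theorem ρ_pos (E : DuhamelExp N σ γ ρ rv p ru b) : 0 < ρ := one_pos.trans_le E.one_le

theorem ρ_le (E : DuhamelExp N σ γ ρ rv p ru b) : ρ ≤ p := by
  have h := E.integrable
  have h1 : σ / N ≤ 0 := div_nonpos_of_nonpos_of_nonneg E.σ_nonpos (by positivity)
  exact ((div_lt_one E.p_pos).1 (by linarith)).le

theorem gainExp_pos (E : DuhamelExp N σ γ ρ rv p ru b) : 0 < gainExp N σ ρ p b := by
  have h := E.gain
  have hN := E.dim_pos
  rw [gainExp, one_div_div]
  have h1 : (N : ℝ) / 2 * (ρ / p - 1 / b) - σ / 2 = (N : ℝ) / 2 * (ρ / p - σ / N - 1 / b) := by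
    field_simp
    ring
  rw [h1]
  exact mul_pos (by positivity) (by linarith)

theorem gainExp_lt (E : DuhamelExp N σ γ ρ rv p ru b) : gainExp N σ ρ p b < 1 := by
  rw [gainExp, one_div_div]
  exact E.order

theorem smoothing_nonneg (E : DuhamelExp N σ γ ρ rv p ru b) : 0 ≤ ρ * smoothing N rv p :=
  mul_nonneg E.ρ_pos.le (RayleighStokes.smoothing_nonneg E.rv_pos E.rv_le)

/-- The only use of the scaling relation. It says that the weight of the target space is exactly
what is left of the smoothing loss, the weight of the source and the gain 1 + γ from the time
integral. -/
theorem smoothing_eq (E : DuhamelExp N σ γ ρ rv p ru b) :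
    smoothing N ru b = gainExp N σ ρ p b + ρ * smoothing N rv p - 1 - γ := by
  have h := E.scaling
  have hN := E.dim_pos
  have h1 : 1 / ru = ρ / rv - (σ + 2 * γ + 2) / N := by linarith
  rw [gainExp, one_div_div, smoothing, smoothing, h1]
  field_simp
  ring

theorem exists_heatBound (E : DuhamelExp N σ γ ρ rv p ru b) :
    ∃ C : ℝ, 0 < C ∧ HeatBound N (wt σ) (p / ρ) b (gainExp N σ ρ p b) C := by
  have h := exists_heatBound_wt (a := p / ρ) (b := b) E.dim E.σ_nonpos (div_pos E.p_pos E.ρ_pos)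
    (one_pos.trans_le E.b_ge) (by rw [one_div_div]; exact E.gain)
    (by rw [one_div_div]; exact E.integrable)
  exact h

theorem exists_moment_le (E : DuhamelExp N σ γ ρ rv p ru b) (P : SymbolParams k α) :
    ∃ C : ℝ, 0 < C ∧ ∀ t τ : ℝ, 0 < t → τ ∈ Ioo (0 : ℝ) 1 →
      moment (gainExp N σ ρ p b) (duhamelSub k α t τ) ≤
        ofReal (C * ((1 - τ) ^ (-gainExp N σ ρ p b) *
          bracket k α t ^ (-gainExp N σ ρ p b))) := by
  obtain ⟨C, hC, h⟩ := exists_moment_subDens_le P E.gainExp_pos.le E.gainExp_lt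
  refine ⟨C, hC, fun t τ ht hτ => ?_⟩
  have h1 : 0 < 1 - τ := by linarith [hτ.2]
  refine (h (t * (1 - τ)) (mul_pos ht h1)).trans (ofReal_le_ofReal ?_)
  exact mul_le_mul_of_nonneg_left
    (bracket_rpow_neg_le P ht h1 (by linarith [hτ.1]) E.gainExp_pos.le) hC.le

/-- The bound for the source term at time `tτ`. -/
theorem ofReal_amp_mul_le (E : DuhamelExp N σ γ ρ rv p ru b) (P : SymbolParams k α) {t τ : ℝ}
    (ht : 0 < t) (hτ : τ ∈ Ioo (0 : ℝ) 1) (A : ℝ≥0∞) :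
    ofReal (amp γ t τ) *
        (ofReal (bracket k α (t * τ) ^ (-(ρ * smoothing N rv p))) * A) ≤
      ofReal (τ ^ (-(ρ * smoothing N rv p - γ)) *
        bracket k α t ^ (1 + γ - ρ * smoothing N rv p)) * A := by
  rw [← mul_assoc, ← ofReal_mul (amp_nonneg ht hτ.1)]
  exact mul_le_mul_left (ofReal_le_ofReal
    (amp_mul_bracket_le P ht hτ.1 hτ.2.le E.smoothing_nonneg E.γ_ge)) _

theorem nrm_duhamelSrc (E : DuhamelExp N σ γ ρ rv p ru b) {f : ℝ → ℝ} (hf : PowerLike ρ f)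
    (v : ℝ → Space N → ℝ) {t τ : ℝ} (ht : 0 < t) (hτ : 0 < τ) :
    nrm (p / ρ) (duhamelSrc γ f v t τ) = ofReal (amp γ t τ) * nrm p (v (t * τ)) ^ ρ := by
  have h := eLpNorm_const_smul (amp γ t τ) (fun y => f (v (t * τ) y)) (ofReal (p / ρ)) volume
  rw [Real.enorm_of_nonneg (amp_nonneg ht hτ)] at h
  rw [← nrm_comp_power hf E.p_pos, ← h]
  rfl

theorem nrm_rpow_eq (E : DuhamelExp N σ γ ρ rv p ru b) (P : SymbolParams k α)
    (v : ℝ → Space N → ℝ) {s e : ℝ} (hs : 0 < s) (he : 0 ≤ e) :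
    nrm p (v s) ^ e = ofReal (bracket k α s ^ (-(e * smoothing N rv p))) *
      wnorm k α rv p v s ^ e := by
  have hb := bracket_pos P hs
  rw [nrm_eq_wnorm P rv p v hs, mul_rpow_of_nonneg _ _ he,
    ENNReal.ofReal_rpow_of_pos (by positivity), ← Real.rpow_mul hb.le]
  congr 3
  ring

theorem nrm_duhamelSrc_le (E : DuhamelExp N σ γ ρ rv p ru b) (P : SymbolParams k α) {f : ℝ → ℝ}
    (hf : PowerLike ρ f) (v : ℝ → Space N → ℝ) {t τ : ℝ} (ht : 0 < t) (hτ : τ ∈ Ioo (0 : ℝ) 1) :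
    nrm (p / ρ) (duhamelSrc γ f v t τ) ≤ ofReal (τ ^ (-(ρ * smoothing N rv p - γ)) *
      bracket k α t ^ (1 + γ - ρ * smoothing N rv p)) * wnorm k α rv p v (t * τ) ^ ρ := by
  rw [E.nrm_duhamelSrc hf v ht hτ.1, E.nrm_rpow_eq P v (mul_pos ht hτ.1) E.ρ_pos.le]
  exact E.ofReal_amp_mul_le P ht hτ _

theorem nrm_duhamelSrc_sub_le (E : DuhamelExp N σ γ ρ rv p ru b) (P : SymbolParams k α) {f : ℝ → ℝ}
    (hf : PowerLike ρ f) {v w : ℝ → Space N → ℝ} (hv : Measurable (uncurry v))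
    (hw : Measurable (uncurry w)) {t τ : ℝ} (ht : 0 < t) (hτ : τ ∈ Ioo (0 : ℝ) 1) :
    nrm (p / ρ) (fun y => duhamelSrc γ f v t τ y - duhamelSrc γ f w t τ y) ≤
      ofReal (τ ^ (-(ρ * smoothing N rv p - γ)) *
        bracket k α t ^ (1 + γ - ρ * smoothing N rv p)) * (ofReal ρ *
        ((wnorm k α rv p v (t * τ) ^ (ρ - 1) + wnorm k α rv p w (t * τ) ^ (ρ - 1)) *
          wnorm k α rv p (fun s x => v s x - w s x) (t * τ))) := by
  have hs := mul_pos ht hτ.1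
  have hb := bracket_pos P hs
  have h1 : 0 ≤ ρ - 1 := by linarith [E.one_le]
  have hvs : Measurable (v (t * τ)) := hv.of_uncurry_left
  have hws : Measurable (w (t * τ)) := hw.of_uncurry_left
  have h := eLpNorm_const_smul (amp γ t τ) (fun y => f (v (t * τ) y) - f (w (t * τ) y))
    (ofReal (p / ρ)) volume
  rw [Real.enorm_of_nonneg (amp_nonneg ht hτ.1)] at h
  have e1 : (fun y => duhamelSrc γ f v t τ y - duhamelSrc γ f w t τ y) =
      amp γ t τ • fun y => f (v (t * τ) y) - f (w (t * τ) y) := by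
    funext y
    simp only [duhamelSrc, Pi.smul_apply, smul_eq_mul]
    ring
  rw [e1, nrm, h]
  refine le_trans (mul_le_mul_right (nrm_comp_power_sub_le hf E.ρ_le hvs hws) _) ?_
  refine le_trans (le_of_eq ?_) (E.ofReal_amp_mul_le P ht hτ _)
  rw [E.nrm_rpow_eq P v hs h1, E.nrm_rpow_eq P w hs h1,
    nrm_eq_wnorm P rv p (fun s x => v s x - w s x) hs, ← mul_add]
  have e2 : bracket k α (t * τ) ^ (-(ρ * smoothing N rv p)) =
      bracket k α (t * τ) ^ (-((ρ - 1) * smoothing N rv p)) *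
        bracket k α (t * τ) ^ (-smoothing N rv p) := by
    rw [← Real.rpow_add hb]
    congr 1
    ring
  rw [e2, ofReal_mul (by positivity)]
  ring

/-- Criticality: by `smoothing_eq` the powers of ⟨t⟩ multiply to 1. The bound that remains is an
integral over (0,1) with a weight independent of t, hence global in time. -/
theorem bw_mul_mul_le (E : DuhamelExp N σ γ ρ rv p ru b) (P : SymbolParams k α) {t τ C : ℝ}
    (ht : 0 < t) (hτ : τ ∈ Ioo (0 : ℝ) 1) (hC : 0 ≤ C) (A : ℝ≥0∞) :
    bw k α (smoothing N ru b) t * (ofReal (C * ((1 - τ) ^ (-gainExp N σ ρ p b) *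
        bracket k α t ^ (-gainExp N σ ρ p b))) *
      (ofReal (τ ^ (-(ρ * smoothing N rv p - γ)) *
        bracket k α t ^ (1 + γ - ρ * smoothing N rv p)) * A)) =
      ofReal C *
        (duhamelWeight N σ γ ρ rv p b τ * A) := by
  have hb := bracket_pos P ht
  have h1 : 0 < 1 - τ := by linarith [hτ.2]
  have h0 : 0 < τ := hτ.1
  rw [bw, ← mul_assoc, ← mul_assoc, ← ofReal_mul (by positivity),
    ← ofReal_mul (by positivity), ← mul_assoc (ofReal C), ← ofReal_mul hC]
  congr 2
  rw [betaWeight]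
  have e : bracket k α t ^ smoothing N ru b * (bracket k α t ^ (-gainExp N σ ρ p b) *
      bracket k α t ^ (1 + γ - ρ * smoothing N rv p)) = 1 := by
    rw [← Real.rpow_add hb, ← Real.rpow_add hb, E.smoothing_eq]
    convert Real.rpow_zero _ using 2
    ring
  linear_combination (C * (1 - τ) ^ (-gainExp N σ ρ p b) *
    τ ^ (-(ρ * smoothing N rv p - γ))) * e

/-- The singularity at τ = 1 is integrable by `order`, the one at τ = 0 by `singular`. -/
theorem lintegral_betaWeight_lt_top (E : DuhamelExp N σ γ ρ rv p ru b) :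
    ∫⁻ τ in Ioo (0 : ℝ) 1,
      duhamelWeight N σ γ ρ rv p b τ < ∞ :=
  RayleighStokes.lintegral_betaWeight_lt_top E.gainExp_pos.le E.gainExp_lt
    (by linarith [E.smoothing_nonneg, E.γ_nonpos]) E.singular

theorem bw_ne_top (t κ : ℝ) : bw k α κ t ≠ ∞ := ofReal_ne_top

/-- The budget of the Duhamel integral of a bounded curve. -/
theorem exists_budget_le (E : DuhamelExp N σ γ ρ rv p ru b) (P : SymbolParams k α) :
    ∃ C : ℝ, 0 < C ∧ ∀ f : ℝ → ℝ, PowerLike ρ f → ∀ v : ℝ → Space N → ℝ, ∀ t : ℝ, 0 < t →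
      bw k α (smoothing N ru b) t * ∫⁻ τ in Ioo (0 : ℝ) 1,
        moment (gainExp N σ ρ p b) (duhamelSub k α t τ) * nrm (p / ρ) (duhamelSrc γ f v t τ) ≤
      ofReal C * ∫⁻ τ in Ioo (0 : ℝ) 1,
        duhamelWeight N σ γ ρ rv p b τ *
          wnorm k α rv p v (t * τ) ^ ρ := by
  obtain ⟨C, hC, hm⟩ := E.exists_moment_le P
  refine ⟨C, hC, fun f hf v t ht => ?_⟩
  rw [← lintegral_const_mul' _ _ (bw_ne_top _ _), ← lintegral_const_mul' _ _ ofReal_ne_top]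
  refine setLIntegral_mono' measurableSet_Ioo fun τ hτ => ?_
  refine le_trans ?_ (E.bw_mul_mul_le P ht hτ hC.le _).le
  exact mul_le_mul_right (mul_le_mul' (hm t τ ht hτ) (E.nrm_duhamelSrc_le P hf v ht hτ)) _

theorem budget_lt_top (E : DuhamelExp N σ γ ρ rv p ru b) (P : SymbolParams k α) {f : ℝ → ℝ}
    (hf : PowerLike ρ f) {v : ℝ → Space N → ℝ} (hv : wsup k α rv p v < ∞) {t : ℝ} (ht : 0 < t) :
    ∫⁻ τ in Ioo (0 : ℝ) 1,
      moment (gainExp N σ ρ p b) (duhamelSub k α t τ) * nrm (p / ρ) (duhamelSrc γ f v t τ) < ∞ := by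
  obtain ⟨C, hC, h⟩ := E.exists_budget_le P
  have hb := bracket_pos P ht
  have h1 : ∫⁻ τ in Ioo (0 : ℝ) 1,
      duhamelWeight N σ γ ρ rv p b τ *
        wnorm k α rv p v (t * τ) ^ ρ ≤ (∫⁻ τ in Ioo (0 : ℝ) 1,
      duhamelWeight N σ γ ρ rv p b τ) *
        wsup k α rv p v ^ ρ := by
    rw [← lintegral_mul_const _ (measurable_betaWeight _ _).ennreal_ofReal]
    refine setLIntegral_mono' measurableSet_Ioo fun τ hτ => ?_
    exact mul_le_mul_right (rpow_le_rpow (wnorm_le_wsup v (mul_pos ht hτ.1)) E.ρ_pos.le) _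
  have h2 := (h f hf v t ht).trans (mul_le_mul_right h1 _)
  have h3 := h2.trans_lt (mul_lt_top ofReal_lt_top
    (mul_lt_top E.lintegral_betaWeight_lt_top
      (rpow_lt_top_of_nonneg E.ρ_pos.le hv.ne)))
  -- The estimate bounds the budget multiplied by a power of the bracket. Finiteness of the budget
  -- itself follows because that power is not zero.
  have hbw : bw k α (smoothing N ru b) t ≠ 0 := by
    rw [bw, ne_eq, ENNReal.ofReal_eq_zero, not_le]
    positivity
  rcases ENNReal.mul_lt_top_iff.1 h3 with h | h | h
  · exact h.2
  · exact absurd h hbw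
  · rw [h]; exact ENNReal.zero_lt_top

theorem ae_heatAbs_lt_top (E : DuhamelExp N σ γ ρ rv p ru b) (P : SymbolParams k α) {f : ℝ → ℝ}
    (hf : PowerLike ρ f) {v : ℝ → Space N → ℝ} (hv : Measurable (uncurry v))
    (hvM : wsup k α rv p v < ∞) {t : ℝ} (ht : 0 < t) :
    ∀ᵐ x, heatAbs duhamelMeasure Prod.snd (duhamelDens k α (source σ γ f v) t) x < ∞ := by
  obtain ⟨C, hC, hB⟩ := E.exists_heatBound
  exact ae_heatAbs_duhamel_lt_top (div_pos E.p_pos E.ρ_pos) E.b_ge hB hC.le hf.meas hv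
    (E.budget_lt_top P hf hvM ht)

theorem exists_wnorm_duhamelOp_le (E : DuhamelExp N σ γ ρ rv p ru b) (P : SymbolParams k α) :
    ∃ K : ℝ, 0 < K ∧ ∀ f : ℝ → ℝ, PowerLike ρ f → ∀ v : ℝ → Space N → ℝ,
      Measurable (uncurry v) → ∀ t : ℝ, 0 < t →
      wnorm k α ru b (duhamelOp k α (source σ γ f v)) t ≤
        ofReal K * ∫⁻ τ in Ioo (0 : ℝ) 1,
          duhamelWeight N σ γ ρ rv p b τ *
            wnorm k α rv p v (t * τ) ^ ρ := by
  obtain ⟨C, hC, hB⟩ := E.exists_heatBound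
  obtain ⟨D, hD, h⟩ := E.exists_budget_le P
  refine ⟨C * D, mul_pos hC hD, fun f hf v hv t ht => ?_⟩
  have h1 := nrm_duhamelOp_le (k := k) (α := α) (γ := γ) (div_pos E.p_pos E.ρ_pos) E.b_ge hB hC.le hf.meas hv t
  rw [ofReal_mul hC.le, mul_assoc]
  refine (mul_le_mul_right h1 _).trans ?_
  rw [mul_left_comm]
  exact mul_le_mul_right (h f hf v t ht) _

theorem exists_wnorm_duhamelOp_sub_le (E : DuhamelExp N σ γ ρ rv p ru b) (P : SymbolParams k α) :
    ∃ K : ℝ, 0 < K ∧ ∀ f : ℝ → ℝ, PowerLike ρ f → ∀ v w : ℝ → Space N → ℝ,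
      Measurable (uncurry v) → Measurable (uncurry w) →
      wsup k α rv p v < ∞ → wsup k α rv p w < ∞ → ∀ t : ℝ, 0 < t →
      wnorm k α ru b (fun s x => duhamelOp k α (source σ γ f v) s x -
          duhamelOp k α (source σ γ f w) s x) t ≤
        ofReal K * ∫⁻ τ in Ioo (0 : ℝ) 1,
          duhamelWeight N σ γ ρ rv p b τ *
            ((wnorm k α rv p v (t * τ) ^ (ρ - 1) + wnorm k α rv p w (t * τ) ^ (ρ - 1)) *
              wnorm k α rv p (fun s x => v s x - w s x) (t * τ)) := by
  obtain ⟨C, hC, hB⟩ := E.exists_heatBound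
  obtain ⟨D, hD, hm⟩ := E.exists_moment_le P
  have hρ := E.ρ_pos
  refine ⟨C * D * ρ, by positivity, fun f hf v w hv hw hvM hwM t ht => ?_⟩
  have h1 := nrm_duhamelOp_sub_le (k := k) (α := α) (γ := γ) (div_pos E.p_pos E.ρ_pos) E.b_ge hB hC.le hf.meas hv hw
    (E.budget_lt_top P hf hvM ht) (E.budget_lt_top P hf hwM ht)
  refine (mul_le_mul_right h1 _).trans ?_
  rw [mul_left_comm, ofReal_mul (by positivity), ofReal_mul hC.le, mul_assoc, mul_assoc]
  refine mul_le_mul_right ?_ _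
  rw [← lintegral_const_mul' _ _ (bw_ne_top _ _), ← mul_assoc, ← ofReal_mul hD.le,
    ← lintegral_const_mul' _ _ ofReal_ne_top]
  refine setLIntegral_mono' measurableSet_Ioo fun τ hτ => ?_
  refine (mul_le_mul_right (mul_le_mul' (hm t τ ht hτ)
    (E.nrm_duhamelSrc_sub_le P hf hv hw ht hτ)) _).trans (le_of_eq ?_)
  rw [E.bw_mul_mul_le P ht hτ hD.le, ofReal_mul hD.le]
  ring

end DuhamelExp

/-! ### Norms over all times, decay at time zero, and continuity in time of the Duhamel integral -/

namespace DuhamelExp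

variable {N : ℕ} {k α σ γ ρ rv p ru b : ℝ}

theorem exists_wsup_duhamelOp_le (E : DuhamelExp N σ γ ρ rv p ru b) (P : SymbolParams k α) :
    ∃ K : ℝ, 0 < K ∧ ∀ f : ℝ → ℝ, PowerLike ρ f → ∀ v : ℝ → Space N → ℝ,
      Measurable (uncurry v) →
      wsup k α ru b (duhamelOp k α (source σ γ f v)) ≤ ofReal K * wsup k α rv p v ^ ρ := by
  obtain ⟨K, hK, h⟩ := E.exists_wnorm_duhamelOp_le P
  set I := ∫⁻ τ in Ioo (0 : ℝ) 1,
      duhamelWeight N σ γ ρ rv p b τ with hI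
  have hIt : I ≠ ∞ := E.lintegral_betaWeight_lt_top.ne
  -- The summand 1 only keeps the constant positive.
  refine ⟨K * (I.toReal + 1), by positivity, fun f hf v hv => wsup_le fun t ht => ?_⟩
  refine (h f hf v hv t ht).trans ?_
  rw [ofReal_mul hK.le, mul_assoc]
  refine mul_le_mul_right ?_ _
  calc _ ≤ ∫⁻ τ in Ioo (0 : ℝ) 1,
        duhamelWeight N σ γ ρ rv p b τ *
          wsup k α rv p v ^ ρ := by
        refine setLIntegral_mono' measurableSet_Ioo fun τ hτ => mul_le_mul_right ?_ _
        exact rpow_le_rpow (wnorm_le_wsup v (mul_pos ht hτ.1)) E.ρ_pos.le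
    _ = I * wsup k α rv p v ^ ρ := lintegral_mul_const _ (measurable_betaWeight _ _).ennreal_ofReal
    _ ≤ _ := by
        refine mul_le_mul_left ?_ _
        rw [← ENNReal.ofReal_toReal hIt]
        exact ofReal_le_ofReal (by rw [ENNReal.toReal_ofReal ENNReal.toReal_nonneg]; linarith)

theorem exists_wsup_duhamelOp_sub_le (E : DuhamelExp N σ γ ρ rv p ru b) (P : SymbolParams k α) :
    ∃ K : ℝ, 0 < K ∧ ∀ f : ℝ → ℝ, PowerLike ρ f → ∀ v w : ℝ → Space N → ℝ,
      Measurable (uncurry v) → Measurable (uncurry w) →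
      wsup k α rv p v < ∞ → wsup k α rv p w < ∞ →
      wsup k α ru b (fun s x => duhamelOp k α (source σ γ f v) s x -
          duhamelOp k α (source σ γ f w) s x) ≤
        ofReal K * ((wsup k α rv p v ^ (ρ - 1) + wsup k α rv p w ^ (ρ - 1)) *
          wsup k α rv p (fun s x => v s x - w s x)) := by
  obtain ⟨K, hK, h⟩ := E.exists_wnorm_duhamelOp_sub_le P
  set I := ∫⁻ τ in Ioo (0 : ℝ) 1,
      duhamelWeight N σ γ ρ rv p b τ with hI
  have hIt : I ≠ ∞ := E.lintegral_betaWeight_lt_top.ne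
  have hρ : 0 ≤ ρ - 1 := by linarith [E.one_le]
  refine ⟨K * (I.toReal + 1), by positivity, fun f hf v w hv hw hvM hwM => wsup_le fun t ht => ?_⟩
  refine (h f hf v w hv hw hvM hwM t ht).trans ?_
  rw [ofReal_mul hK.le, mul_assoc]
  refine mul_le_mul_right ?_ _
  calc _ ≤ ∫⁻ τ in Ioo (0 : ℝ) 1,
        duhamelWeight N σ γ ρ rv p b τ *
          ((wsup k α rv p v ^ (ρ - 1) + wsup k α rv p w ^ (ρ - 1)) *
          wsup k α rv p (fun s x => v s x - w s x)) := by
        refine setLIntegral_mono' measurableSet_Ioo fun τ hτ => mul_le_mul_right ?_ _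
        have hs := mul_pos ht hτ.1
        exact mul_le_mul' (add_le_add (rpow_le_rpow (wnorm_le_wsup v hs) hρ)
          (rpow_le_rpow (wnorm_le_wsup w hs) hρ)) (wnorm_le_wsup (fun s x => v s x - w s x) hs)
    _ = I * _ := lintegral_mul_const _ (measurable_betaWeight _ _).ennreal_ofReal
    _ ≤ _ := by
        refine mul_le_mul_left ?_ _
        rw [← ENNReal.ofReal_toReal hIt]
        exact ofReal_le_ofReal (by rw [ENNReal.toReal_ofReal ENNReal.toReal_nonneg]; linarith)

/-- Dominated convergence on (0,1): for each τ the argument tτ tends to zero with t, and the decay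
of v applies. -/
theorem tendsto_wnorm_duhamelOp (E : DuhamelExp N σ γ ρ rv p ru b) (P : SymbolParams k α)
    {f : ℝ → ℝ} (hf : PowerLike ρ f) {v : ℝ → Space N → ℝ} (hv : Measurable (uncurry v))
    (hvM : wsup k α rv p v < ∞) (hv0 : Tendsto (wnorm k α rv p v) (𝓝[>] 0) (𝓝 0)) :
    Tendsto (wnorm k α ru b (duhamelOp k α (source σ γ f v))) (𝓝[>] 0) (𝓝 0) := by
  obtain ⟨K, hK, h⟩ := E.exists_wnorm_duhamelOp_le P
  have hρ := E.ρ_pos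
  set B : ℝ → ℝ≥0∞ := fun τ =>
    duhamelWeight N σ γ ρ rv p b τ with hB
  have hBm : Measurable B := (measurable_betaWeight _ _).ennreal_ofReal
  have hBt : ∀ τ, B τ ≠ ∞ := fun τ => ofReal_ne_top
  have hlim : Tendsto (fun t => ∫⁻ τ in Ioo (0 : ℝ) 1, B τ * wnorm k α rv p v (t * τ) ^ ρ)
      (𝓝[>] 0) (𝓝 (∫⁻ _ in Ioo (0 : ℝ) 1, 0)) := by
    refine tendsto_lintegral_filter_of_dominated_convergence
      (fun τ => B τ * wsup k α rv p v ^ ρ) (Eventually.of_forall fun t => ?_) ?_ ?_ ?_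
    · exact hBm.mul (((measurable_wnorm E.p_pos hv).comp (measurable_const_mul t)).pow_const ρ)
    · filter_upwards [self_mem_nhdsWithin] with t ht
      refine (ae_restrict_iff' measurableSet_Ioo).2 (Eventually.of_forall fun τ hτ => ?_)
      exact mul_le_mul_right (rpow_le_rpow (wnorm_le_wsup v (mul_pos ht hτ.1)) hρ.le) _
    · rw [lintegral_mul_const _ hBm]
      exact (mul_lt_top E.lintegral_betaWeight_lt_top
        (rpow_lt_top_of_nonneg hρ.le hvM.ne)).ne
    · refine (ae_restrict_iff' measurableSet_Ioo).2 (Eventually.of_forall fun τ hτ => ?_)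
      have h1 : Tendsto (fun t => t * τ) (𝓝[>] 0) (𝓝[>] 0) := by
        refine tendsto_nhdsWithin_iff.2 ⟨?_, ?_⟩
        · have : Tendsto (fun t : ℝ => t * τ) (𝓝 0) (𝓝 (0 * τ)) := tendsto_id.mul_const τ
          rw [zero_mul] at this
          exact this.mono_left nhdsWithin_le_nhds
        · filter_upwards [self_mem_nhdsWithin] with t ht using mul_pos ht hτ.1
      have h2 := ((ENNReal.continuous_rpow_const (y := ρ)).tendsto 0).comp (hv0.comp h1)
      rw [ENNReal.zero_rpow_of_pos hρ] at h2
      simpa using ENNReal.Tendsto.const_mul h2 (Or.inr (hBt τ))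
  rw [lintegral_zero] at hlim
  have hlim2 : Tendsto (fun t => ofReal K *
      ∫⁻ τ in Ioo (0 : ℝ) 1, B τ * wnorm k α rv p v (t * τ) ^ ρ) (𝓝[>] 0) (𝓝 0) := by
    simpa using ENNReal.Tendsto.const_mul hlim (Or.inr ofReal_ne_top)
  refine tendsto_zero_of_le hlim2 ?_
  filter_upwards [self_mem_nhdsWithin] with t ht using h f hf v hv t ht

theorem continuousAt_bracket_rpow (P : SymbolParams k α) {t₀ : ℝ} (ht₀ : 0 < t₀) (e : ℝ) :
    ContinuousAt (fun t => bracket k α t ^ e) t₀ := by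
  have h1 : Continuous fun t => bracket k α t := by
    unfold bracket
    have := Real.continuous_rpow_const (q := 1 - α) (by linarith [P.α_lt])
    fun_prop
  exact h1.continuousAt.rpow_const (Or.inl (bracket_pos P ht₀).ne')

theorem nrm_le_of_sub {p : ℝ} (hp : 1 ≤ p) {f g : Space N → ℝ} (hf : Measurable f)
    (hg : Measurable g) : nrm p f ≤ nrm p g + nrm p fun x => f x - g x := by
  refine le_trans (le_of_eq (congrArg (nrm p) ?_)) (nrm_add_le hp hg.aestronglyMeasurable
    (hf.sub hg).aestronglyMeasurable)
  funext x
  simp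

/-- The change of the amplitude is separated from the change of v, and the latter is handled by the
local Lipschitz estimate of the power. -/
theorem tendsto_nrm_duhamelSrc_sub (E : DuhamelExp N σ γ ρ rv p ru b) (P : SymbolParams k α)
    {f : ℝ → ℝ} (hf : PowerLike ρ f) {v : ℝ → Space N → ℝ} (hv : Measurable (uncurry v))
    (hvM : wsup k α rv p v < ∞) (hvc : ContPos p v) {t₀ τ : ℝ} (ht₀ : 0 < t₀) (hτ : 0 < τ) :
    Tendsto (fun t => nrm (p / ρ) fun y => duhamelSrc γ f v t τ y - duhamelSrc γ f v t₀ τ y)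
      (𝓝 t₀) (𝓝 0) := by
  have hρ := E.ρ_pos
  have hp1 : 1 ≤ p := E.one_le.trans E.ρ_le
  have hs₀ : 0 < t₀ * τ := mul_pos ht₀ hτ
  have hvm : ∀ s, Measurable (v s) := fun s => hv.of_uncurry_left
  have hfin : nrm p (v (t₀ * τ)) < ∞ := by
    rw [nrm_eq_wnorm P rv p v hs₀]
    exact mul_lt_top ofReal_lt_top ((wnorm_le_wsup v hs₀).trans_lt hvM)
  -- A bound for the norms of v at all nearby times, by continuity in L^p.
  set L := nrm p (v (t₀ * τ)) + 1 with hL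
  have hLt : L ≠ ∞ := (add_lt_top.2 ⟨hfin, ENNReal.one_lt_top⟩).ne
  have hsc : Tendsto (fun t => t * τ) (𝓝 t₀) (𝓝 (t₀ * τ)) := tendsto_id.mul_const τ
  have hd := (hvc _ hs₀).comp hsc
  have ha : Tendsto (fun t => amp γ t τ - amp γ t₀ τ) (𝓝 t₀) (𝓝 0) := by
    have : ContinuousAt (fun t => amp γ t τ) t₀ := by
      unfold amp
      exact continuousAt_id.mul (((continuousAt_id.mul continuousAt_const)).rpow_const
        (Or.inl hs₀.ne'))
    simpa using this.tendsto.sub_const (amp γ t₀ τ)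
  have hlim : Tendsto (fun t => ‖amp γ t τ - amp γ t₀ τ‖ₑ * L ^ ρ + ‖amp γ t₀ τ‖ₑ *
      (ofReal ρ * ((L ^ (ρ - 1) + L ^ (ρ - 1)) *
        nrm p fun x => v (t * τ) x - v (t₀ * τ) x))) (𝓝 t₀) (𝓝 0) := by
    have h1 : Tendsto (fun t => ‖amp γ t τ - amp γ t₀ τ‖ₑ * L ^ ρ) (𝓝 t₀) (𝓝 0) := by
      have := (continuous_enorm.tendsto (0 : ℝ)).comp ha
      rw [enorm_zero] at this
      simpa using ENNReal.Tendsto.mul_const this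
        (Or.inr (rpow_ne_top_of_nonneg hρ.le hLt))
    have hρ1 : 0 ≤ ρ - 1 := by linarith [E.one_le]
    have hc1 : L ^ (ρ - 1) + L ^ (ρ - 1) ≠ ∞ := by
      have := rpow_lt_top_of_nonneg hρ1 hLt
      exact (add_lt_top.2 ⟨this, this⟩).ne
    have h2 := ENNReal.Tendsto.const_mul (a := ‖amp γ t₀ τ‖ₑ) (ENNReal.Tendsto.const_mul
      (a := ofReal ρ) (ENNReal.Tendsto.const_mul hd (Or.inr hc1))
      (Or.inr ofReal_ne_top)) (Or.inr enorm_lt_top.ne)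
    simp only [mul_zero] at h2
    simpa using h1.add h2
  refine tendsto_zero_of_le hlim ?_
  filter_upwards [hd.eventually (gt_mem_nhds zero_lt_one)] with t ht
  have hvt : nrm p (v (t * τ)) ≤ L := (nrm_le_of_sub hp1 (hvm _) (hvm (t₀ * τ))).trans
    (add_le_add le_rfl (le_of_lt ht))
  have hv₀ : nrm p (v (t₀ * τ)) ≤ L := le_self_add
  have e : (fun y => duhamelSrc γ f v t τ y - duhamelSrc γ f v t₀ τ y) =
      fun y => ((amp γ t τ - amp γ t₀ τ) • fun y => f (v (t * τ) y)) y +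
        (amp γ t₀ τ • fun y => f (v (t * τ) y) - f (v (t₀ * τ) y)) y := by
    funext y
    simp only [duhamelSrc, Pi.smul_apply, smul_eq_mul]
    ring
  have m1 : Measurable fun y => f (v (t * τ) y) := hf.meas.comp (hvm _)
  have m2 : Measurable fun y => f (v (t₀ * τ) y) := hf.meas.comp (hvm _)
  rw [e]
  refine (nrm_add_le ((one_le_div hρ).2 E.ρ_le) (m1.const_smul _).aestronglyMeasurable
    ((m1.sub m2).const_smul _).aestronglyMeasurable).trans ?_
  rw [nrm, nrm, eLpNorm_const_smul, eLpNorm_const_smul]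
  refine add_le_add (mul_le_mul_right ?_ _) (mul_le_mul_right ?_ _)
  · rw [← nrm, nrm_comp_power hf E.p_pos]
    exact rpow_le_rpow hvt hρ.le
  · refine (nrm_comp_power_sub_le hf E.ρ_le (hvm _) (hvm _)).trans
      (mul_le_mul_right (mul_le_mul_left ?_ _) _)
    have hρ1 : 0 ≤ ρ - 1 := by linarith [E.one_le]
    exact add_le_add (rpow_le_rpow hvt hρ1) (rpow_le_rpow hv₀ hρ1)

/-- After the substitution the interval of integration is fixed, so dominated convergence gives
continuity: the densities converge in the moment and the sources in the norm, for each τ. For t near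
t₀ a multiple of the Beta weight dominates. -/
theorem contPos_duhamelOp (E : DuhamelExp N σ γ ρ rv p ru b) (P : SymbolParams k α)
    {f : ℝ → ℝ} (hf : PowerLike ρ f) {v : ℝ → Space N → ℝ} (hv : Measurable (uncurry v))
    (hvM : wsup k α rv p v < ∞) (hvc : ContPos p v) :
    ContPos b (duhamelOp k α (source σ γ f v)) := by
  intro t₀ ht₀
  obtain ⟨C, hC, hB⟩ := E.exists_heatBound
  obtain ⟨D, hD, hm⟩ := E.exists_moment_le P
  have hρ := E.ρ_pos
  have ha : 1 ≤ p / ρ := (one_le_div hρ).2 E.ρ_le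
  have ha0 : 0 < p / ρ := one_pos.trans_le ha
  set β := gainExp N σ ρ p b with hβ
  set κ := ρ * smoothing N rv p with hκ
  set M := wsup k α rv p v ^ ρ with hM
  have hMt : M ≠ ∞ := rpow_ne_top_of_nonneg hρ.le hvM.ne
  set A : ℝ := bracket k α t₀ ^ (-β) + 1 with hA
  set A' : ℝ := bracket k α t₀ ^ (1 + γ - κ) + 1 with hA'
  have hb₀ := bracket_pos P ht₀
  have hAp : 0 < A := by positivity
  have hAp' : 0 < A' := by positivity
  have hev : ∀ᶠ t in 𝓝 t₀, 0 < t ∧ bracket k α t ^ (-β) ≤ A ∧ bracket k α t ^ (1 + γ - κ) ≤ A' := by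
    filter_upwards [lt_mem_nhds ht₀,
      (continuousAt_bracket_rpow P ht₀ (-β)).eventually (gt_mem_nhds (lt_add_one _)),
      (continuousAt_bracket_rpow P ht₀ (1 + γ - κ)).eventually (gt_mem_nhds (lt_add_one _))]
      with t h1 h2 h3 using ⟨h1, le_of_lt h2, le_of_lt h3⟩
  set mb : ℝ → ℝ≥0∞ := fun τ => ofReal (D * ((1 - τ) ^ (-β) * A)) with hmb
  set sb : ℝ → ℝ≥0∞ := fun τ => ofReal (τ ^ (-(κ - γ)) * A') * M with hsb
  have hmom : ∀ t, (0 < t ∧ bracket k α t ^ (-β) ≤ A ∧ bracket k α t ^ (1 + γ - κ) ≤ A') →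
      ∀ τ ∈ Ioo (0 : ℝ) 1, moment β (duhamelSub k α t τ) ≤ mb τ := fun t ht τ hτ => by
    refine (hm t τ ht.1 hτ).trans (ofReal_le_ofReal ?_)
    have : 0 ≤ 1 - τ := by linarith [hτ.2]
    exact mul_le_mul_of_nonneg_left (mul_le_mul_of_nonneg_left ht.2.1 (by positivity)) hD.le
  have hsrc : ∀ t, (0 < t ∧ bracket k α t ^ (-β) ≤ A ∧ bracket k α t ^ (1 + γ - κ) ≤ A') →
      ∀ τ ∈ Ioo (0 : ℝ) 1, nrm (p / ρ) (duhamelSrc γ f v t τ) ≤ sb τ := fun t ht τ hτ => by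
    refine (E.nrm_duhamelSrc_le P hf v ht.1 hτ).trans (mul_le_mul' (ofReal_le_ofReal ?_)
      (rpow_le_rpow (wnorm_le_wsup v (mul_pos ht.1 hτ.1)) hρ.le))
    exact mul_le_mul_of_nonneg_left ht.2.2 (Real.rpow_nonneg hτ.1.le _)
  have h₀ := hev.self_of_nhds
  have hsm : ∀ t, Measurable (uncurry (duhamelSub k α t)) := measurable_duhamelSub
  have hgm : ∀ t, Measurable (uncurry (duhamelSrc γ f v t)) :=
    measurable_duhamelSrc hf.meas hv
  have hgmt : ∀ t τ, Measurable (duhamelSrc γ f v t τ) := fun t τ => (hgm t).of_uncurry_left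
  have hlim : Tendsto (fun t => ∫⁻ τ in Ioo (0 : ℝ) 1,
      (moment β (fun τ' => duhamelSub k α t τ τ' - duhamelSub k α t₀ τ τ') *
        nrm (p / ρ) (duhamelSrc γ f v t₀ τ) +
      moment β (duhamelSub k α t τ) *
        nrm (p / ρ) fun y => duhamelSrc γ f v t τ y - duhamelSrc γ f v t₀ τ y)) (𝓝 t₀)
      (𝓝 (∫⁻ _ in Ioo (0 : ℝ) 1, 0)) := by
    refine tendsto_lintegral_filter_of_dominated_convergence
      -- Each of the two products contains one difference, bounded by twice the bound of a single
      -- term, so each contributes 2.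
      (fun τ => 4 * (mb τ * sb τ)) (Eventually.of_forall fun t => ?_) ?_ ?_ ?_
    · have m1 : Measurable (uncurry fun τ τ' => duhamelSub k α t τ τ' - duhamelSub k α t₀ τ τ') :=
        (hsm t).sub (hsm t₀)
      have m2 : Measurable (uncurry fun τ y =>
        duhamelSrc γ f v t τ y - duhamelSrc γ f v t₀ τ y) := (hgm t).sub (hgm t₀)
      exact ((measurable_moment_family m1 β).mul (measurable_nrm_family (hgm t₀) ha0)).add
        ((measurable_moment_family (hsm t) β).mul (measurable_nrm_family m2 ha0))
    · filter_upwards [hev] with t ht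
      refine (ae_restrict_iff' measurableSet_Ioo).2 (Eventually.of_forall fun τ hτ => ?_)
      have b1 : moment β (fun τ' => duhamelSub k α t τ τ' - duhamelSub k α t₀ τ τ') ≤ 2 * mb τ := by
        rw [two_mul]
        exact (moment_sub_le _ _ _ (hsm t).of_uncurry_left).trans
          (add_le_add (hmom t ht τ hτ) (hmom t₀ h₀ τ hτ))
      have b2 : nrm (p / ρ) (fun y => duhamelSrc γ f v t τ y - duhamelSrc γ f v t₀ τ y) ≤ 2 * sb τ := by
        rw [two_mul]
        exact (nrm_sub_le ha (hgmt t τ).aestronglyMeasurable (hgmt t₀ τ).aestronglyMeasurable).trans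
          (add_le_add (hsrc t ht τ hτ) (hsrc t₀ h₀ τ hτ))
      refine (add_le_add (mul_le_mul' b1 (hsrc t₀ h₀ τ hτ)) (mul_le_mul' (hmom t ht τ hτ) b2)).trans
        (le_of_eq ?_)
      ring
    · have hle : ∀ τ ∈ Ioo (0 : ℝ) 1, 4 * (mb τ * sb τ) =
          (4 * ofReal (D * A * A') * M) * ofReal (betaWeight β (κ - γ) τ) := by
        intro τ hτ
        have h1 : 0 ≤ 1 - τ := by linarith [hτ.2]
        have h2 := hτ.1
        have key : ofReal (D * ((1 - τ) ^ (-β) * A)) * ofReal (τ ^ (-(κ - γ)) * A') =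
            ofReal (D * A * A') * ofReal (betaWeight β (κ - γ) τ) := by
          rw [← ofReal_mul (by positivity), ← ofReal_mul (by positivity)]
          congr 1
          rw [betaWeight]
          ring
        simp only [hmb, hsb]
        rw [← mul_assoc (ofReal (D * _)), key]
        ring
      rw [setLIntegral_congr_fun measurableSet_Ioo hle,
        lintegral_const_mul _ (measurable_betaWeight _ _).ennreal_ofReal]
      exact (mul_lt_top (mul_lt_top (mul_lt_top (by simp)
        ofReal_lt_top) hMt.lt_top) E.lintegral_betaWeight_lt_top).ne
    · refine (ae_restrict_iff' measurableSet_Ioo).2 (Eventually.of_forall fun τ hτ => ?_)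
      have hτ1 : 0 < 1 - τ := by linarith [hτ.2]
      have c1 : Tendsto (fun t => moment β (fun τ' => duhamelSub k α t τ τ' - duhamelSub k α t₀ τ τ') *
          nrm (p / ρ) (duhamelSrc γ f v t₀ τ)) (𝓝 t₀) (𝓝 0) := by
        have hsc : Tendsto (fun t => t * (1 - τ)) (𝓝 t₀) (𝓝 (t₀ * (1 - τ))) := tendsto_id.mul_const _
        have h1 := (tendsto_moment_sub P (mul_pos ht₀ hτ1) E.gainExp_pos.le E.gainExp_lt).comp hsc
        have hne : nrm (p / ρ) (duhamelSrc γ f v t₀ τ) ≠ ∞ :=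
          ((hsrc t₀ h₀ τ hτ).trans_lt (mul_lt_top ofReal_lt_top hMt.lt_top)).ne
        have h2 := ENNReal.Tendsto.mul_const h1 (Or.inr hne)
        rw [zero_mul] at h2
        exact h2
      have c2 : Tendsto (fun t => moment β (duhamelSub k α t τ) *
          nrm (p / ρ) fun y => duhamelSrc γ f v t τ y - duhamelSrc γ f v t₀ τ y) (𝓝 t₀) (𝓝 0) := by
        have h1 := ENNReal.Tendsto.const_mul (a := mb τ)
          (E.tendsto_nrm_duhamelSrc_sub P hf hv hvM hvc ht₀ hτ.1) (Or.inr ofReal_ne_top)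
        rw [mul_zero] at h1
        refine tendsto_zero_of_le h1 ?_
        filter_upwards [hev] with t ht using mul_le_mul_left (hmom t ht τ hτ) _
      simpa using c1.add c2
  rw [lintegral_zero] at hlim
  have hlim2 := ENNReal.Tendsto.const_mul (a := ofReal C) hlim (Or.inr ofReal_ne_top)
  rw [mul_zero] at hlim2
  refine tendsto_zero_of_le hlim2 ?_
  filter_upwards [lt_mem_nhds ht₀] with t ht
  exact nrm_duhamelOp_time_sub_le ha E.b_ge hB hC.le hf.meas hv (E.budget_lt_top P hf hvM ht)
    (E.budget_lt_top P hf hvM ht₀)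

end DuhamelExp

/-! ### The mild formulation for jointly measurable curves -/

section Curves

variable {N : ℕ} {k α σ γ r p : ℝ}

theorem Measurable.curve {u : ℝ → Space N → ℝ} (hu : Measurable (uncurry u)) (t : ℝ) :
    Measurable (u t) := hu.of_uncurry_left

theorem aesm_curve {u : ℝ → Space N → ℝ} (hu : Measurable (uncurry u)) (t : ℝ) :
    AEStronglyMeasurable (u t) := (Measurable.curve hu t).aestronglyMeasurable

theorem ae_eq_of_nrm_sub_eq_zero (hp : 1 ≤ p) {f g : Space N → ℝ} (hf : AEStronglyMeasurable f)
    (hg : AEStronglyMeasurable g) (h : nrm p (fun x => f x - g x) = 0) : f =ᵐ[volume] g := by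
  have h2 := (eLpNorm_eq_zero_iff (hf.sub hg) (one_pos.trans_le (one_le_ofReal hp)).ne').1 h
  filter_upwards [h2] with x hx using sub_eq_zero.1 hx

theorem ae_eq_of_wnorm_sub_eq_zero (P : SymbolParams k α) (hp : 1 ≤ p)
    {u u' : ℝ → Space N → ℝ} (hu : Measurable (uncurry u))
    (hu' : Measurable (uncurry u')) {t : ℝ} (ht : 0 < t)
    (h : wnorm k α r p (fun s x => u s x - u' s x) t = 0) : u t =ᵐ[volume] u' t :=
  ae_eq_of_nrm_sub_eq_zero hp (aesm_curve hu t) (aesm_curve hu' t) (by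
    rw [nrm_eq_wnorm P r p (fun s x => u s x - u' s x) ht, h, mul_zero])

theorem wnorm_add_le (hp : 1 ≤ p) {u v : ℝ → Space N → ℝ} (hu : Measurable (uncurry u))
    (hv : Measurable (uncurry v)) (t : ℝ) :
    wnorm k α r p (fun s x => u s x + v s x) t ≤ wnorm k α r p u t + wnorm k α r p v t := by
  rw [wnorm, wnorm, wnorm, ← mul_add]
  exact mul_le_mul_right (nrm_add_le hp (aesm_curve hu t)
    (aesm_curve hv t)) _

theorem wsup_add_le (hp : 1 ≤ p) {u v : ℝ → Space N → ℝ} (hu : Measurable (uncurry u))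
    (hv : Measurable (uncurry v)) :
    wsup k α r p (fun s x => u s x + v s x) ≤ wsup k α r p u + wsup k α r p v :=
  wsup_le fun _ ht => (wnorm_add_le hp hu hv _).trans
    (add_le_add (wnorm_le_wsup u ht) (wnorm_le_wsup v ht))

theorem wnorm_congr {u v : ℝ → Space N → ℝ} {t : ℝ} (h : u t =ᵐ[volume] v t) :
    wnorm k α r p u t = wnorm k α r p v t := by
  rw [wnorm, wnorm, nrm, eLpNorm_congr_ae h]

theorem wsup_congr {u v : ℝ → Space N → ℝ} (h : ∀ t, 0 < t → u t =ᵐ[volume] v t) :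
    wsup k α r p u = wsup k α r p v :=
  le_antisymm (wsup_le fun t ht => (wnorm_congr (h t ht)).trans_le (wnorm_le_wsup v ht))
    (wsup_le fun t ht => (wnorm_congr (h t ht).symm).trans_le (wnorm_le_wsup u ht))

theorem wnorm_sub_comm (u v : ℝ → Space N → ℝ) (t : ℝ) :
    wnorm k α r p (fun s x => u s x - v s x) t = wnorm k α r p (fun s x => v s x - u s x) t := by
  rw [wnorm, wnorm]
  congr 1
  exact eLpNorm_sub_comm (u t) (v t) _ _

theorem wsup_sub_comm (u v : ℝ → Space N → ℝ) :
    wsup k α r p (fun s x => u s x - v s x) = wsup k α r p (fun s x => v s x - u s x) := by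
  unfold wsup
  simp_rw [wnorm_sub_comm u v]

theorem wsup_sub_le (hp : 1 ≤ p) {u v w : ℝ → Space N → ℝ} (hu : Measurable (uncurry u))
    (hv : Measurable (uncurry v)) (hw : Measurable (uncurry w)) :
    wsup k α r p (fun s x => u s x - w s x) ≤
      wsup k α r p (fun s x => u s x - v s x) + wsup k α r p (fun s x => v s x - w s x) := by
  have h := wsup_add_le (k := k) (α := α) (r := r) hp (u := fun s x => u s x - v s x)
    (v := fun s x => v s x - w s x) (hu.sub hv) (hv.sub hw)
  simpa using h

theorem wsup_le_add_sub (hp : 1 ≤ p) {u v : ℝ → Space N → ℝ} (hu : Measurable (uncurry u))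
    (hv : Measurable (uncurry v)) :
    wsup k α r p u ≤ wsup k α r p v + wsup k α r p (fun s x => u s x - v s x) := by
  have h := wsup_add_le (k := k) (α := α) (r := r) hp (u := v) (v := fun s x => u s x - v s x)
    hv (hu.sub hv)
  simpa using h

theorem wnorm_le_add_sub (hp : 1 ≤ p) {u v : ℝ → Space N → ℝ} (hu : Measurable (uncurry u))
    (hv : Measurable (uncurry v)) (t : ℝ) :
    wnorm k α r p u t ≤ wnorm k α r p v t + wnorm k α r p (fun s x => u s x - v s x) t := by
  have h := wnorm_add_le (k := k) (α := α) (r := r) hp (u := v) (v := fun s x => u s x - v s x)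
    hv (hu.sub hv) t
  simpa using h

theorem ContPos.add (hp : 1 ≤ p) {u v : ℝ → Space N → ℝ} (hu : Measurable (uncurry u))
    (hv : Measurable (uncurry v)) (hcu : ContPos p u) (hcv : ContPos p v) :
    ContPos p fun s x => u s x + v s x := by
  intro t₀ ht₀
  have h := (hcu t₀ ht₀).add (hcv t₀ ht₀)
  rw [add_zero] at h
  refine tendsto_zero_of_le h (.of_forall fun t => ?_)
  refine le_trans (le_of_eq (congrArg (nrm p) ?_)) (nrm_add_le hp
    ((Measurable.curve hu t).sub (Measurable.curve hu t₀)).aestronglyMeasurable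
    ((Measurable.curve hv t).sub (Measurable.curve hv t₀)).aestronglyMeasurable)
  funext x
  simp only [Pi.sub_apply]
  ring

theorem ContPos.congr {u v : ℝ → Space N → ℝ} (h : ∀ t, 0 < t → u t =ᵐ[volume] v t)
    (hu : ContPos p u) : ContPos p v := by
  intro t₀ ht₀
  refine (hu t₀ ht₀).congr' ?_
  filter_upwards [lt_mem_nhds ht₀] with t ht
  refine eLpNorm_congr_ae ?_
  filter_upwards [h t ht, h t₀ ht₀] with x h1 h2
  rw [h1, h2]

/-- Boundedness, continuity and decay at zero in the weighted space of exponent `p`. -/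
structure Good (k α r p : ℝ) (u : ℝ → Space N → ℝ) : Prop where
  bdd : wsup k α r p u < ∞
  cont : ContPos p u
  van : Tendsto (wnorm k α r p u) (𝓝[>] 0) (𝓝 0)

theorem Good.congr {u v : ℝ → Space N → ℝ} (h : ∀ t, 0 < t → u t =ᵐ[volume] v t)
    (hu : Good k α r p u) : Good k α r p v := by
  refine ⟨(wsup_congr h) ▸ hu.bdd, hu.cont.congr h, hu.van.congr' ?_⟩
  filter_upwards [self_mem_nhdsWithin] with t ht using wnorm_congr (h t ht)

theorem Good.add (hp : 1 ≤ p) {u v : ℝ → Space N → ℝ} (hu : Measurable (uncurry u))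
    (hv : Measurable (uncurry v)) (hgu : Good k α r p u) (hgv : Good k α r p v) :
    Good k α r p fun s x => u s x + v s x := by
  refine ⟨(wsup_add_le hp hu hv).trans_lt (add_lt_top.2 ⟨hgu.bdd, hgv.bdd⟩),
    hgu.cont.add hp hu hv hgv.cont, ?_⟩
  have h := hgu.van.add hgv.van
  rw [add_zero] at h
  exact tendsto_zero_of_le h (.of_forall (wnorm_add_le hp hu hv))

theorem exists_wsup_linOp_le (P : SymbolParams k α) (hr : 1 ≤ r) (hrp : r ≤ p)
    (hκ : smoothing N r p < 1) : ∃ C : ℝ, 0 < C ∧ ∀ f : Space N → ℝ, Measurable f →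
      wsup k α r p (fun t => linOp k α t f) ≤ ofReal C * nrm r f := by
  obtain ⟨C, hC, h⟩ := exists_linOp_le (N := N) P hr hrp hκ
  refine ⟨C, hC, fun f hf => wsup_le fun t ht => ?_⟩
  refine (mul_le_mul_right (h t ht f hf) _).trans (le_of_eq ?_)
  rw [← mul_assoc, bw_mul_bw_neg P ht _ _ hC.le]

theorem good_linOp (P : SymbolParams k α) (hN : 1 ≤ N) (hr : 1 ≤ r) (hrp : r < p)
    (hκ : smoothing N r p < 1) {f : Space N → ℝ} (hf : Measurable f) (hfr : nrm r f < ∞) :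
    Good k α r p fun t => linOp k α t f := by
  obtain ⟨C, hC, h⟩ := exists_wsup_linOp_le P hr hrp.le hκ
  exact ⟨(h f hf).trans_lt (mul_lt_top ofReal_lt_top hfr),
    fun t₀ ht₀ => tendsto_linOp_sub P hr hrp.le hκ hf hfr ht₀,
    tendsto_weighted_linOp P hr hrp hN hκ hf hfr⟩

theorem wsup_linOp_sub (P : SymbolParams k α) (hr : 1 ≤ r)
    {f g : Space N → ℝ} (hf : Measurable f) (hg : Measurable g) (hfr : nrm r f < ∞)
    (hgr : nrm r g < ∞) :
    wsup k α r p (fun t x => linOp k α t f x - linOp k α t g x) =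
      wsup k α r p (fun t => linOp k α t fun x => f x - g x) :=
  wsup_congr fun _ ht => linOp_sub P hr ht hf hg hfr hgr

/-- The right-hand side of the mild formulation. -/
def mildMap (k α σ γ : ℝ) (f : ℝ → ℝ) (u₀ : Space N → ℝ) (v : ℝ → Space N → ℝ) (t : ℝ)
    (x : Space N) : ℝ := linOp k α t u₀ x + duhamelOp k α (source σ γ f v) t x

theorem measurable_mildMap {f : ℝ → ℝ} (hf : Measurable f) {u₀ : Space N → ℝ} (hu₀ : Measurable u₀)
    {v : ℝ → Space N → ℝ} (hv : Measurable (uncurry v)) :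
    Measurable (uncurry (mildMap k α σ γ f u₀ v)) :=
  (measurable_linOp hu₀).add (measurable_duhamelOp (measurable_source hf hv))

/-- The Duhamel integral sees only the equivalence classes of the curve at positive times. Equality
therefore holds at every x. -/
theorem duhamelOp_congr {f : ℝ → ℝ} (hf : Measurable f) {v w : ℝ → Space N → ℝ}
    (hv : Measurable (uncurry v)) (hw : Measurable (uncurry w))
    (h : ∀ t, 0 < t → v t =ᵐ[volume] w t) {t : ℝ} (ht : 0 < t) (x : Space N) :
    duhamelOp k α (source σ γ f v) t x = duhamelOp k α (source σ γ f w) t x := by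
  refine heatOp_congr (measurable_duhamelDens_right (measurable_source hf hv) t)
    (measurable_duhamelDens_right (measurable_source hf hw) t) ?_ x
  filter_upwards [ae_duhamelMeasure] with z hz
  filter_upwards [h (t * z.1) (mul_pos ht hz.1.1)] with y hy
  simp only [duhamelDens, source, hy]

theorem mildMap_congr {f : ℝ → ℝ} (hf : Measurable f) {u₀ : Space N → ℝ} {v w : ℝ → Space N → ℝ}
    (hv : Measurable (uncurry v)) (hw : Measurable (uncurry w))
    (h : ∀ t, 0 < t → v t =ᵐ[volume] w t) {t : ℝ} (ht : 0 < t) :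
    mildMap k α σ γ f u₀ v t = mildMap k α σ γ f u₀ w t := by
  funext x
  rw [mildMap, mildMap, duhamelOp_congr hf hv hw h ht]

theorem duhamelOp_nonneg (P : SymbolParams k α) {ρ : ℝ} {f : ℝ → ℝ} (hf : PowerLike ρ f)
    {v : ℝ → Space N → ℝ} (hv : Measurable (uncurry v))
    (h : ∀ t, 0 < t → 0 ≤ᵐ[volume] v t) {t : ℝ} (ht : 0 < t) (x : Space N) :
    0 ≤ duhamelOp k α (source σ γ f v) t x := by
  refine heatOp_nonneg ae_snd_pos ?_ (measurable_duhamelDens_right (measurable_source hf.meas hv) t) x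
  filter_upwards [ae_duhamelMeasure] with z hz
  have hs : 0 < t * z.1 := mul_pos ht hz.1.1
  filter_upwards [h (t * z.1) hs] with y hy
  have h1 := subDens_nonneg P (t := t * (1 - z.1)) (mul_nonneg ht.le (by linarith [hz.1.2])) hz.2
  have h2 := hf.nonneg _ hy
  simp only [duhamelDens, source]
  positivity

theorem mildMap_nonneg (P : SymbolParams k α) {ρ : ℝ} {f : ℝ → ℝ} (hf : PowerLike ρ f)
    {u₀ : Space N → ℝ} (hu₀ : Measurable u₀) (hu₀n : 0 ≤ᵐ[volume] u₀)
    {v : ℝ → Space N → ℝ} (hv : Measurable (uncurry v))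
    (h : ∀ t, 0 < t → 0 ≤ᵐ[volume] v t) {t : ℝ} (ht : 0 < t) (x : Space N) :
    0 ≤ mildMap k α σ γ f u₀ v t x :=
  add_nonneg (linOp_nonneg P ht.le hu₀ hu₀n x) (duhamelOp_nonneg P hf hv h ht x)

variable {ρ rv pv ru b : ℝ}

theorem DuhamelExp.good_duhamelOp (E : DuhamelExp N σ γ ρ rv pv ru b) (P : SymbolParams k α)
    {f : ℝ → ℝ} (hf : PowerLike ρ f) {v : ℝ → Space N → ℝ} (hv : Measurable (uncurry v))
    (hg : Good k α rv pv v) : Good k α ru b (duhamelOp k α (source σ γ f v)) := by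
  obtain ⟨K, hK, h⟩ := E.exists_wsup_duhamelOp_le P
  exact ⟨(h f hf v hv).trans_lt (mul_lt_top ofReal_lt_top
    (rpow_lt_top_of_nonneg E.ρ_pos.le hg.bdd.ne)),
    E.contPos_duhamelOp P hf hv hg.bdd hg.cont, E.tendsto_wnorm_duhamelOp P hf hv hg.bdd hg.van⟩

theorem DuhamelExp.good_mildMap (E : DuhamelExp N σ γ ρ rv pv ru b) (P : SymbolParams k α)
    (hru : 1 ≤ ru) (hrub : ru < b) (hκ : smoothing N ru b < 1)
    {f : ℝ → ℝ} (hf : PowerLike ρ f) {u₀ : Space N → ℝ} (hu₀ : Measurable u₀)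
    (hu₀r : nrm ru u₀ < ∞) {v : ℝ → Space N → ℝ} (hv : Measurable (uncurry v))
    (hg : Good k α rv pv v) : Good k α ru b (mildMap k α σ γ f u₀ v) :=
  (good_linOp P E.dim hru hrub hκ hu₀ hu₀r).add E.b_ge (measurable_linOp hu₀)
    (measurable_duhamelOp (measurable_source hf.meas hv)) (E.good_duhamelOp P hf hv hg)

/-- Boundedness and Lipschitz continuity of `mildMap` in the weighted norms, with constant `K`. -/
structure MildEst (N : ℕ) (k α σ γ ρ rv pv ru b K : ℝ) : Prop where
  bound : ∀ f : ℝ → ℝ, PowerLike ρ f → ∀ u₀ : Space N → ℝ, Measurable u₀ →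
    ∀ v : ℝ → Space N → ℝ, Measurable (uncurry v) →
    wsup k α ru b (mildMap k α σ γ f u₀ v) ≤
      ofReal K * (nrm ru u₀ + wsup k α rv pv v ^ ρ)
  lip : ∀ f : ℝ → ℝ, PowerLike ρ f → ∀ u₀ u₀' : Space N → ℝ, Measurable u₀ →
    Measurable u₀' → nrm ru u₀ < ∞ → nrm ru u₀' < ∞ →
    ∀ v w : ℝ → Space N → ℝ, Measurable (uncurry v) → Measurable (uncurry w) →
    wsup k α rv pv v < ∞ → wsup k α rv pv w < ∞ →
    wsup k α ru b (fun s x => mildMap k α σ γ f u₀ v s x - mildMap k α σ γ f u₀' w s x) ≤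
      ofReal K * (nrm ru (fun x => u₀ x - u₀' x) +
        (wsup k α rv pv v ^ (ρ - 1) + wsup k α rv pv w ^ (ρ - 1)) *
          wsup k α rv pv (fun s x => v s x - w s x))

theorem DuhamelExp.exists_mildEst (E : DuhamelExp N σ γ ρ rv pv ru b) (P : SymbolParams k α)
    (hru : 1 ≤ ru) (hrub : ru ≤ b) (hκ : smoothing N ru b < 1) :
    ∃ K : ℝ, 1 ≤ K ∧ MildEst N k α σ γ ρ rv pv ru b K := by
  obtain ⟨K, hK, h⟩ := E.exists_wsup_duhamelOp_le P
  obtain ⟨K', hK', h'⟩ := E.exists_wsup_duhamelOp_sub_le P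
  obtain ⟨C, hC, hl⟩ := exists_wsup_linOp_le (N := N) P hru hrub hκ
  have hm : ∀ {c : ℝ} {x y : ℝ≥0∞}, c ≤ 1 + K + K' + C → x ≤ ofReal c * y →
      x ≤ ofReal (1 + K + K' + C) * y := fun hc hx =>
    hx.trans (mul_le_mul_left (ofReal_le_ofReal hc) _)
  refine ⟨1 + K + K' + C, by linarith, fun f hf u₀ hu₀ v hv => ?_,
    fun f hf u₀ u₀' hu₀ hu₀' hr hr' v w hv hw hvM hwM => ?_⟩
  · rw [mul_add]
    exact (wsup_add_le E.b_ge (measurable_linOp hu₀)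
      (measurable_duhamelOp (measurable_source hf.meas hv))).trans
      (add_le_add (hm (by linarith) (hl u₀ hu₀)) (hm (by linarith) (h f hf v hv)))
  · have e : (fun s x => mildMap k α σ γ f u₀ v s x - mildMap k α σ γ f u₀' w s x) = fun s x =>
        (linOp k α s u₀ x - linOp k α s u₀' x) +
          (duhamelOp k α (source σ γ f v) s x - duhamelOp k α (source σ γ f w) s x) := by
      funext s x
      simp only [mildMap]
      ring
    rw [e]
    refine (wsup_add_le (u := fun s x => linOp k α s u₀ x - linOp k α s u₀' x)
      (v := fun s x => duhamelOp k α (source σ γ f v) s x - duhamelOp k α (source σ γ f w) s x)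
      E.b_ge ((measurable_linOp hu₀).sub (measurable_linOp hu₀'))
      ((measurable_duhamelOp (measurable_source hf.meas hv)).sub
        (measurable_duhamelOp (measurable_source hf.meas hw)))).trans ?_
    rw [mul_add, wsup_linOp_sub P hru hu₀ hu₀' hr hr']
    exact add_le_add (hm (by linarith) (hl _ (hu₀.sub hu₀')))
      (hm (by linarith) (h' f hf v w hv hw hvM hwM))

end Curves

/-! ### Limits and jointly measurable versions of curves -/

section Limits

variable {N : ℕ} {k α r p : ℝ}

/-- A pointwise limit is used because it is jointly measurable; limits in L^p chosen separately for
each time need not be. -/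
theorem measurable_limCurve {w : ℕ → ℝ → Space N → ℝ} (hw : ∀ n, Measurable (uncurry (w n))) :
    Measurable (uncurry fun t x => limUnder atTop fun n => w n t x) := by
  have h := StronglyMeasurable.limUnder (l := atTop) fun n => (hw n).stronglyMeasurable
  exact h.measurable

theorem ae_tendsto_limUnder (hp : 1 ≤ p) {w : ℕ → Space N → ℝ}
    (hw : ∀ n, AEStronglyMeasurable (w n)) {D : ℝ}
    (h : ∀ M n m, M ≤ n → M ≤ m →
      nrm p (fun x => w n x - w m x) < ofReal (D * (1 / 2) ^ M)) :
    ∀ᵐ x, Tendsto (fun n => w n x) atTop (𝓝 (limUnder atTop fun n => w n x)) := by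
  have hs : ∑' i : ℕ, ofReal (D * (1 / 2) ^ i) ≠ ∞ :=
    (summable_geometric_two.mul_left D).tsum_ofReal_ne_top
  filter_upwards [Lp.ae_tendsto_of_cauchy_eLpNorm hw (one_le_ofReal hp) hs h] with x hx
  exact tendsto_nhds_limUnder hx

theorem nrm_le_of_tendsto {f : ℕ → Space N → ℝ} (hf : ∀ n, AEStronglyMeasurable (f n))
    {g : Space N → ℝ} (h : ∀ᵐ x, Tendsto (fun n => f n x) atTop (𝓝 (g x))) {M : ℝ≥0∞}
    (hM : ∀ᶠ n in atTop, nrm p (f n) ≤ M) : nrm p g ≤ M :=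
  (Lp.eLpNorm_lim_le_liminf_eLpNorm hf g h).trans (liminf_le_of_frequently_le' hM.frequently)

/-- At each positive time the sequence is geometrically Cauchy in L^p, hence converges almost
everywhere, and Fatou's lemma carries the norm bounds to the limit. -/
theorem exists_limit_curve (P : SymbolParams k α) (hp : 1 ≤ p) {w : ℕ → ℝ → Space N → ℝ}
    (hw : ∀ n, Measurable (uncurry (w n))) {c : ℝ} (hc : 0 ≤ c)
    (h : ∀ n, wsup k α r p (fun s x => w (n + 1) s x - w n s x) ≤ ofReal (c * (1 / 2) ^ n)) :
    ∃ u : ℝ → Space N → ℝ, Measurable (uncurry u) ∧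
      (∀ n, wsup k α r p (fun s x => u s x - w n s x) ≤ ofReal (2 * c * (1 / 2) ^ n)) ∧
      ∀ t, 0 < t → ∀ᵐ x, Tendsto (fun n => w n t x) atTop (𝓝 (u t x)) := by
  -- The partial sums of the geometric series from n to n + j - 1, in closed form.
  have htel : ∀ n j, wsup k α r p (fun s x => w (n + j) s x - w n s x) ≤
      ofReal (2 * c * ((1 / 2) ^ n - (1 / 2) ^ (n + j))) := by
    intro n j
    induction j with
    | zero =>
      refine (wsup_le fun t _ => ?_).trans zero_le
      simp [wnorm, nrm]
    | succ j ih =>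
      refine (wsup_sub_le hp (hw _) (hw (n + j)) (hw _)).trans ?_
      refine (add_le_add (h (n + j)) ih).trans (le_of_eq ?_)
      have h1 : ((1 : ℝ) / 2) ^ (n + j) ≤ (1 / 2) ^ n :=
        pow_le_pow_of_le_one (by norm_num) (by norm_num) (Nat.le_add_right _ _)
      rw [← ofReal_add (by positivity)
        (mul_nonneg (by positivity) (sub_nonneg.2 h1)), ← add_assoc n j 1, pow_succ _ (n + j)]
      congr 1
      ring
  have hcau : ∀ M n, M ≤ n → wsup k α r p (fun s x => w n s x - w M s x) ≤
      ofReal (2 * c * (1 / 2) ^ M) := by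
    intro M n hMn
    obtain ⟨j, rfl⟩ := Nat.exists_eq_add_of_le hMn
    refine (htel M j).trans (ofReal_le_ofReal (mul_le_mul_of_nonneg_left ?_ (by positivity)))
    have : (0 : ℝ) ≤ (1 / 2) ^ (M + j) := by positivity
    linarith
  have hlim : ∀ t, 0 < t → ∀ᵐ x, Tendsto (fun n => w n t x) atTop
      (𝓝 (limUnder atTop fun n => w n t x)) := by
    intro t ht
    have hb := bracket_pos P ht
    set B := bracket k α t ^ (-smoothing N r p) with hB
    have hB0 : 0 < B := by positivity
    -- The criterion asks for a strict inequality; the summand 1 provides it even if c = 0.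
    refine ae_tendsto_limUnder (D := B * (4 * c) + 1) hp
      (fun n => (aesm_curve (hw n) t)) fun M n m hn hm => ?_
    rw [nrm_eq_wnorm P r p (fun s x => w n s x - w m s x) ht]
    have h1 : wsup k α r p (fun s x => w n s x - w m s x) ≤ ofReal (4 * c * (1 / 2) ^ M) := by
      refine (wsup_sub_le hp (hw n) (hw M) (hw m)).trans ?_
      rw [wsup_sub_comm (w M) (w m)]
      refine (add_le_add (hcau M n hn) (hcau M m hm)).trans (le_of_eq ?_)
      rw [← ofReal_add (by positivity) (by positivity)]
      congr 1
      ring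
    refine (mul_le_mul_right ((wnorm_le_wsup _ ht).trans h1) _).trans_lt ?_
    rw [← ofReal_mul hB0.le]
    refine (ENNReal.ofReal_lt_ofReal_iff (by positivity)).2 ?_
    have : (0 : ℝ) < (1 / 2) ^ M := by positivity
    nlinarith
  refine ⟨fun t x => limUnder atTop fun n => w n t x, measurable_limCurve hw, fun n => ?_, hlim⟩
  refine wsup_le fun t ht => ?_
  have hb := bracket_pos P ht
  have h1 : nrm p (fun x => (limUnder atTop fun n => w n t x) - w n t x) ≤
      ofReal (bracket k α t ^ (-smoothing N r p)) * ofReal (2 * c * (1 / 2) ^ n) := by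
    refine nrm_le_of_tendsto (f := fun m x => w m t x - w n t x) (fun m =>
      ((Measurable.curve (hw m) t).sub (Measurable.curve (hw n) t)).aestronglyMeasurable) ?_ ?_
    · filter_upwards [hlim t ht] with x hx using hx.sub_const _
    · filter_upwards [eventually_ge_atTop n] with m hm
      rw [nrm_eq_wnorm P r p (fun s x => w m s x - w n s x) ht]
      exact mul_le_mul_right ((wnorm_le_wsup _ ht).trans (hcau n m hm)) _
  rw [wnorm]
  refine (mul_le_mul_right h1 _).trans (le_of_eq ?_)
  rw [← mul_assoc]
  have := bw_mul_bw_neg P ht (smoothing N r p) 1 zero_le_one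
  rw [one_mul, ofReal_one] at this
  rw [this, one_mul]

theorem isOpen_nrm_lt (hp : 1 ≤ p) {u : ℝ → Space N → ℝ} (hc : ContPos p u)
    (hm : ∀ t, 0 < t → AEStronglyMeasurable (u t)) {q : ℝ} (hq : 0 < q) (ε : ℝ≥0∞) :
    IsOpen {t | 0 < t ∧ nrm p (fun x => u q x - u t x) < ε} := by
  rw [isOpen_iff_mem_nhds]
  intro t₀ ht
  obtain ⟨ht₀, hlt⟩ := ht
  have h1 : Tendsto (fun t => nrm p (fun x => u q x - u t₀ x) + nrm p (fun x => u t x - u t₀ x))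
      (𝓝 t₀) (𝓝 (nrm p (fun x => u q x - u t₀ x) + 0)) := tendsto_const_nhds.add (hc t₀ ht₀)
  rw [add_zero] at h1
  filter_upwards [lt_mem_nhds ht₀, h1.eventually (gt_mem_nhds hlt)] with t ht hlt'
  refine ⟨ht, lt_of_le_of_lt ?_ hlt'⟩
  refine le_trans (le_of_eq (congrArg (nrm p) ?_)) (nrm_sub_le hp ((hm q hq).sub (hm t₀ ht₀))
    ((hm t ht).sub (hm t₀ ht₀)))
  funext x
  simp

/-- Continuity in L^p leaves the representative free at each time, so joint measurability can fail.
Each time is replaced by the first rational, in a fixed enumeration, at which u is within 2⁻ⁿ in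
L^p. This approximation takes countably many values in time, hence is jointly measurable, and it
converges geometrically. -/
theorem exists_measurable_version (hp : 1 ≤ p) {u : ℝ → Space N → ℝ} (hc : ContPos p u)
    (hm : ∀ t, 0 < t → AEStronglyMeasurable (u t)) :
    ∃ v : ℝ → Space N → ℝ, Measurable (uncurry v) ∧ ∀ t, 0 < t → v t =ᵐ[volume] u t := by
  classical
  set q : ℕ → ℝ := fun j => (((Denumerable.eqv ℚ).symm j : ℚ) : ℝ) with hq
  set ε : ℕ → ℝ≥0∞ := fun n => ofReal ((1 / 2) ^ n) with hε
  have hε0 : ∀ n, 0 < ε n := fun n => ENNReal.ofReal_pos.2 (by positivity)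
  -- The alternative t ≤ 0 makes the selection defined at every time.
  set pr : ℕ → ℝ → ℕ → Prop := fun n t j =>
    t ≤ 0 ∨ (0 < q j ∧ 0 < t ∧ nrm p (fun x => u (q j) x - u t x) < ε n) with hpr
  have hex : ∀ n t, ∃ j, pr n t j := by
    intro n t
    rcases le_or_gt t 0 with ht | ht
    · exact ⟨0, Or.inl ht⟩
    · have h1 := (lt_mem_nhds ht).and ((hc t ht).eventually (gt_mem_nhds (hε0 n)))
      obtain ⟨_, ⟨a, rfl⟩, h2, h3⟩ := Rat.denseRange_cast.inter_nhds_nonempty h1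
      refine ⟨Denumerable.eqv ℚ a, Or.inr ?_⟩
      have : q (Denumerable.eqv ℚ a) = (a : ℝ) := by
        simp only [hq, Equiv.symm_apply_apply]
      rw [this]
      exact ⟨h2, ht, h3⟩
  have hmeas : ∀ n j, MeasurableSet {t | pr n t j} := by
    intro n j
    by_cases hj : 0 < q j
    · have : {t | pr n t j} = Iic 0 ∪ {t | 0 < t ∧ nrm p (fun x => u (q j) x - u t x) < ε n} := by
        ext t
        simp [hpr, hj]
      rw [this]
      exact measurableSet_Iic.union (isOpen_nrm_lt hp hc hm hj _).measurableSet
    · have : {t | pr n t j} = Iic 0 := by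
        ext t
        simp [hpr, hj]
      rw [this]
      exact measurableSet_Iic
  set U : ℕ → Space N → ℝ := fun j => if h : 0 < q j then (hm (q j) h).mk (u (q j)) else 0 with hU
  have hUm : ∀ j, Measurable (U j) := fun j => by
    by_cases h : 0 < q j
    · simp only [hU, h, dif_pos]
      exact (hm (q j) h).stronglyMeasurable_mk.measurable
    · simp only [hU, h, dif_neg, not_false_eq_true]
      exact measurable_const
  have hUae : ∀ j, 0 < q j → U j =ᵐ[volume] u (q j) := fun j h => by
    simp only [hU, h, dif_pos]
    exact (hm (q j) h).ae_eq_mk.symm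
  set w : ℕ → ℝ → Space N → ℝ := fun n t => U (Nat.find (hex n t)) with hw
  have hwm : ∀ n, Measurable (uncurry (w n)) := fun n => by
    have h1 : Measurable fun q : ℕ × Space N => U q.1 q.2 :=
      measurable_from_prod_countable_right fun j => hUm j
    have h2 : Measurable fun t => Nat.find (hex n t) := measurable_find (hex n) (hmeas n)
    exact h1.comp (f := fun z : ℝ × Space N => (Nat.find (hex n z.1), z.2))
      ((h2.comp measurable_fst).prodMk measurable_snd)
  have hwu : ∀ n t, 0 < t → nrm p (fun x => w n t x - u t x) < ε n := by
    intro n t ht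
    rcases Nat.find_spec (hex n t) with h | ⟨h1, _, h2⟩
    · exact absurd h (not_le.2 ht)
    · refine lt_of_le_of_lt (le_of_eq (eLpNorm_congr_ae ?_)) h2
      filter_upwards [hUae _ h1] with x hx
      simp only [hw]
      rw [hx]
  refine ⟨fun t x => limUnder atTop fun n => w n t x, measurable_limCurve hwm, fun t ht => ?_⟩
  have hwt : ∀ n, AEStronglyMeasurable (w n t) := fun n =>
    (aesm_curve (hwm n) t)
  have hlim : ∀ᵐ x, Tendsto (fun n => w n t x) atTop (𝓝 (limUnder atTop fun n => w n t x)) := by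
    refine ae_tendsto_limUnder (D := 2) hp hwt fun M n m hn hm' => ?_
    have h1 : nrm p (fun x => w n t x - w m t x) ≤
        nrm p (fun x => w n t x - u t x) + nrm p (fun x => w m t x - u t x) := by
      refine le_trans (le_of_eq (congrArg (nrm p) ?_))
        (nrm_sub_le hp ((hwt n).sub (hm t ht)) ((hwt m).sub (hm t ht)))
      funext x
      simp
    have hmono : ∀ i, M ≤ i → ε i ≤ ε M := fun i hi =>
      ofReal_le_ofReal (pow_le_pow_of_le_one (by norm_num) (by norm_num) hi)
    refine h1.trans_lt ((ENNReal.add_lt_add ((hwu n t ht).trans_le (hmono n hn))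
      ((hwu m t ht).trans_le (hmono m hm'))).trans_le (le_of_eq ?_))
    rw [← ofReal_add (by positivity) (by positivity)]
    congr 1
    ring
  have hzero : nrm p (fun x => (limUnder atTop fun n => w n t x) - u t x) ≤ 0 := by
    refine (Lp.eLpNorm_lim_le_liminf_eLpNorm (f := fun n x => w n t x - u t x)
      (fun n => (hwt n).sub (hm t ht)) _ ?_).trans ?_
    · filter_upwards [hlim] with x hx using hx.sub_const _
    · have hε : Tendsto ε atTop (𝓝 0) := by
        have := tendsto_ofReal (tendsto_pow_atTop_nhds_zero_of_lt_one
          (r := (1 : ℝ) / 2) (by norm_num) (by norm_num))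
        rwa [ENNReal.ofReal_zero] at this
      have h2 : Tendsto (fun n => nrm p fun x => w n t x - u t x) atTop (𝓝 0) :=
        tendsto_zero_of_le hε (.of_forall fun n => (hwu n t ht).le)
      exact h2.liminf_eq.le
  exact ae_eq_of_nrm_sub_eq_zero hp (aesm_curve (measurable_limCurve hwm) t) (hm t ht)
    (le_antisymm hzero zero_le)

end Limits

/-! ### Estimates of the mild map and of the composition of two of them -/

section Picard

variable {N : ℕ} {k α σ γ : ℝ}

variable {ρ rv pv ru b K K' : ℝ}

theorem MildEst.mono (h : MildEst N k α σ γ ρ rv pv ru b K) (hK : K ≤ K') :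
    MildEst N k α σ γ ρ rv pv ru b K' :=
  ⟨fun f hf u₀ hu₀ v hv => (h.bound f hf u₀ hu₀ v hv).trans
    (mul_le_mul_left (ofReal_le_ofReal hK) _),
  fun f hf u₀ u₀' hu₀ hu₀' hr hr' v w hv hw hvM hwM =>
    (h.lip f hf u₀ u₀' hu₀ hu₀' hr hr' v w hv hw hvM hwM).trans
      (mul_le_mul_left (ofReal_le_ofReal hK) _)⟩

variable {ρ₁ ρ₂ r₁ r₂ p₁ p₂ R : ℝ}

/-- The radius `R` is small compared with the constant `K` of the estimates. -/
structure SmallRadius (ρ₁ K R : ℝ) : Prop where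
  one_le : 1 ≤ K
  pos : 0 < R
  le_one : R ≤ 1
  small : (2 * K * R) ^ (ρ₁ - 1) ≤ 1 / (8 * K ^ 2)

theorem exists_smallRadius (hρ : 1 < ρ₁) (hK : 1 ≤ K) : ∃ R, SmallRadius ρ₁ K R := by
  have h1 : Tendsto (fun R : ℝ => (2 * K * R) ^ (ρ₁ - 1)) (𝓝[>] 0) (𝓝 0) := by
    have hc : Continuous fun R : ℝ => (2 * K * R) ^ (ρ₁ - 1) :=
      (continuous_const.mul continuous_id).rpow_const fun _ => Or.inr (by linarith)
    have := (hc.tendsto 0).mono_left (nhdsWithin_le_nhds (s := Ioi 0))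
    rwa [mul_zero, Real.zero_rpow (by linarith)] at this
  have h2 : ∀ᶠ R : ℝ in 𝓝[>] 0, R ∈ Ioc (0 : ℝ) 1 := Ioc_mem_nhdsGT one_pos
  obtain ⟨R, hR, hR1⟩ := ((h1.eventually (gt_mem_nhds (by positivity : 0 < 1 / (8 * K ^ 2)))).and
    h2).exists
  exact ⟨R, hK, hR1.1, hR1.2, hR.le⟩

theorem SmallRadius.rpow_le (S : SmallRadius ρ₁ K R) (hρ : 1 ≤ ρ₁) {a : ℝ≥0∞}
    (ha : a ≤ ofReal (2 * K * R)) :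
    a ^ (ρ₁ - 1) ≤ ofReal (1 / (8 * K ^ 2)) := by
  have := S.one_le
  have := S.pos
  refine (rpow_le_rpow ha (by linarith)).trans ?_
  rw [ENNReal.ofReal_rpow_of_pos (by positivity)]
  exact ofReal_le_ofReal S.small

/-- No smallness is gained here, since ρ₂ may be 1: only R^{ρ₂} ≤ R for R ≤ 1 is used. The norm may
grow by the factor 2K, because K(R/(2K) + R) ≤ 2KR. -/
theorem SmallRadius.wsup_mildMap_le (S : SmallRadius ρ₁ K R) (hρ₂ : 1 ≤ ρ₂)
    (e₂ : MildEst N k α σ γ ρ₂ r₁ p₁ r₂ p₂ K) {f₂ : ℝ → ℝ} (hf₂ : PowerLike ρ₂ f₂)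
    {v₀ : Space N → ℝ} (hv₀ : Measurable v₀) (hv : nrm r₂ v₀ ≤ ofReal (R / (2 * K)))
    {u : ℝ → Space N → ℝ} (hu : Measurable (uncurry u))
    (huR : wsup k α r₁ p₁ u ≤ ofReal R) :
    wsup k α r₂ p₂ (mildMap k α σ γ f₂ v₀ u) ≤ ofReal (2 * K * R) := by
  have hK := S.one_le
  have hR := S.pos
  have hp : wsup k α r₁ p₁ u ^ ρ₂ ≤ ofReal R := by
    refine (rpow_le_rpow huR (by linarith)).trans ?_
    rw [ENNReal.ofReal_rpow_of_pos hR]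
    refine ofReal_le_ofReal ?_
    nth_rw 2 [← Real.rpow_one R]
    exact Real.rpow_le_rpow_of_exponent_ge hR S.le_one hρ₂
  refine (e₂.bound f₂ hf₂ v₀ hv₀ u hu).trans ((mul_le_mul_right (add_le_add hv hp) _).trans ?_)
  rw [← ofReal_add (by positivity) hR.le, ← ofReal_mul (by positivity)]
  refine ofReal_le_ofReal ?_
  have : K * (R / (2 * K) + R) = R / 2 + K * R := by field_simp
  nlinarith

/-- The power ρ₁ > 1 of the first equation repays the factor 2K: the choice of R gives (2KR)^{ρ₁} ≤
R/(4K), and K(R/(2K) + R/(4K)) = 3R/4. -/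
theorem SmallRadius.wsup_mildMap_mildMap_le (S : SmallRadius ρ₁ K R) (hρ₁ : 1 ≤ ρ₁) (hρ₂ : 1 ≤ ρ₂)
    (e₁ : MildEst N k α σ γ ρ₁ r₂ p₂ r₁ p₁ K)
    (e₂ : MildEst N k α σ γ ρ₂ r₁ p₁ r₂ p₂ K) {f₁ f₂ : ℝ → ℝ} (hf₁ : PowerLike ρ₁ f₁)
    (hf₂ : PowerLike ρ₂ f₂) {u₀ v₀ : Space N → ℝ} (hu₀ : Measurable u₀) (hv₀ : Measurable v₀)
    (hu₀R : nrm r₁ u₀ ≤ ofReal (R / (2 * K)))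
    (hv₀R : nrm r₂ v₀ ≤ ofReal (R / (2 * K)))
    {u : ℝ → Space N → ℝ} (hu : Measurable (uncurry u))
    (huR : wsup k α r₁ p₁ u ≤ ofReal R) :
    wsup k α r₁ p₁ (mildMap k α σ γ f₁ u₀ (mildMap k α σ γ f₂ v₀ u)) ≤ ofReal R := by
  have hK := S.one_le
  have hR := S.pos
  have hv := S.wsup_mildMap_le hρ₂ e₂ hf₂ hv₀ hv₀R hu huR
  have hp : wsup k α r₂ p₂ (mildMap k α σ γ f₂ v₀ u) ^ ρ₁ ≤ ofReal (R / (4 * K)) := by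
    refine (rpow_le_rpow hv (by linarith)).trans ?_
    rw [ENNReal.ofReal_rpow_of_pos (by positivity)]
    refine ofReal_le_ofReal ?_
    calc (2 * K * R) ^ ρ₁ = (2 * K * R) ^ (ρ₁ - 1) * (2 * K * R) := by
          rw [Real.rpow_sub_one (by positivity)]
          field_simp
      _ ≤ 1 / (8 * K ^ 2) * (2 * K * R) := mul_le_mul_of_nonneg_right S.small (by positivity)
      _ = R / (4 * K) := by
          field_simp
          norm_num
  refine (e₁.bound f₁ hf₁ u₀ hu₀ _ (measurable_mildMap hf₂.meas hv₀ hu)).trans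
    ((mul_le_mul_right (add_le_add hu₀R hp) _).trans ?_)
  rw [← ofReal_add (by positivity) (by positivity), ← ofReal_mul (by positivity)]
  refine ofReal_le_ofReal ?_
  have : K * (R / (2 * K) + R / (4 * K)) = 3 / 4 * R := by
    field_simp
    norm_num
  linarith

theorem SmallRadius.wsup_mildMap_sub_le (S : SmallRadius ρ₁ K R) (hρ₂ : 1 ≤ ρ₂)
    (e₂ : MildEst N k α σ γ ρ₂ r₁ p₁ r₂ p₂ K) {f₂ : ℝ → ℝ} (hf₂ : PowerLike ρ₂ f₂)
    {v₀ v₀' : Space N → ℝ} (hv₀ : Measurable v₀) (hv₀' : Measurable v₀')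
    (hv : nrm r₂ v₀ < ∞) (hv' : nrm r₂ v₀' < ∞)
    {u u' : ℝ → Space N → ℝ} (hu : Measurable (uncurry u))
    (hu' : Measurable (uncurry u'))
    (huR : wsup k α r₁ p₁ u ≤ ofReal R) (huR' : wsup k α r₁ p₁ u' ≤ ofReal R) :
    wsup k α r₂ p₂ (fun s x => mildMap k α σ γ f₂ v₀ u s x - mildMap k α σ γ f₂ v₀' u' s x) ≤
      ofReal K * (nrm r₂ (fun x => v₀ x - v₀' x) +
        2 * wsup k α r₁ p₁ fun s x => u s x - u' s x) := by
  have h1 : ∀ a : ℝ≥0∞, a ≤ ofReal R → a ^ (ρ₂ - 1) ≤ 1 := fun a ha =>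
    ENNReal.rpow_le_one (ha.trans (ENNReal.ofReal_le_one.2 S.le_one)) (by linarith)
  refine (e₂.lip f₂ hf₂ v₀ v₀' hv₀ hv₀' hv hv' u u' hu hu' (huR.trans_lt ofReal_lt_top)
    (huR'.trans_lt ofReal_lt_top)).trans (mul_le_mul_right (add_le_add le_rfl
      (mul_le_mul_left ?_ _)) _)
  rw [← one_add_one_eq_two]
  exact add_le_add (h1 _ huR) (h1 _ huR')

/-- The contraction constant 1/2 is the product of K, of 2/(8K²) from the two powers ρ₁ - 1, and of
the Lipschitz constant 2K of the second map. -/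
theorem SmallRadius.wsup_mildMap_mildMap_sub_le (S : SmallRadius ρ₁ K R) (hρ₁ : 1 ≤ ρ₁)
    (hρ₂ : 1 ≤ ρ₂) (e₁ : MildEst N k α σ γ ρ₁ r₂ p₂ r₁ p₁ K)
    (e₂ : MildEst N k α σ γ ρ₂ r₁ p₁ r₂ p₂ K) {f₁ f₂ : ℝ → ℝ} (hf₁ : PowerLike ρ₁ f₁)
    (hf₂ : PowerLike ρ₂ f₂) {u₀ v₀ u₀' v₀' : Space N → ℝ} (hu₀ : Measurable u₀)
    (hv₀ : Measurable v₀) (hu₀' : Measurable u₀') (hv₀' : Measurable v₀')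
    (hu₀R : nrm r₁ u₀ < ∞) (hu₀R' : nrm r₁ u₀' < ∞)
    (hv₀R : nrm r₂ v₀ ≤ ofReal (R / (2 * K)))
    (hv₀R' : nrm r₂ v₀' ≤ ofReal (R / (2 * K)))
    {u u' : ℝ → Space N → ℝ} (hu : Measurable (uncurry u))
    (hu' : Measurable (uncurry u'))
    (huR : wsup k α r₁ p₁ u ≤ ofReal R) (huR' : wsup k α r₁ p₁ u' ≤ ofReal R) :
    wsup k α r₁ p₁ (fun s x => mildMap k α σ γ f₁ u₀ (mildMap k α σ γ f₂ v₀ u) s x -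
        mildMap k α σ γ f₁ u₀' (mildMap k α σ γ f₂ v₀' u') s x) ≤
      ofReal K * (nrm r₁ (fun x => u₀ x - u₀' x) + nrm r₂ (fun x => v₀ x - v₀' x)) +
        ofReal (1 / 2) * wsup k α r₁ p₁ fun s x => u s x - u' s x := by
  have hK := S.one_le
  have hR := S.pos
  have hv := S.wsup_mildMap_le hρ₂ e₂ hf₂ hv₀ hv₀R hu huR
  have hv' := S.wsup_mildMap_le hρ₂ e₂ hf₂ hv₀' hv₀R' hu' huR'
  have hd := S.wsup_mildMap_sub_le hρ₂ e₂ hf₂ hv₀ hv₀' (hv₀R.trans_lt ofReal_lt_top)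
    (hv₀R'.trans_lt ofReal_lt_top) hu hu' huR huR'
  have hc := add_le_add (S.rpow_le hρ₁ hv) (S.rpow_le hρ₁ hv')
  rw [← ofReal_add (by positivity) (by positivity)] at hc
  refine (e₁.lip f₁ hf₁ u₀ u₀' hu₀ hu₀' hu₀R hu₀R' _ _ (measurable_mildMap hf₂.meas hv₀ hu)
    (measurable_mildMap hf₂.meas hv₀' hu') (hv.trans_lt ofReal_lt_top)
    (hv'.trans_lt ofReal_lt_top)).trans
    ((mul_le_mul_right (add_le_add le_rfl (mul_le_mul' hc hd)) _).trans ?_)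
  generalize nrm r₁ (fun x => u₀ x - u₀' x) = a
  generalize nrm r₂ (fun x => v₀ x - v₀' x) = b
  generalize wsup k α r₁ p₁ (fun s x => u s x - u' s x) = d
  rw [mul_add, mul_add _ a b, add_assoc]
  refine add_le_add le_rfl ?_
  rw [← mul_assoc, ← mul_assoc, ← ofReal_mul (by positivity),
    ← ofReal_mul (by positivity), mul_add]
  have e : K * (1 / (8 * K ^ 2) + 1 / (8 * K ^ 2)) * K = 1 / 4 := by
    field_simp
    norm_num
  rw [e]
  refine add_le_add (mul_le_mul_left (ofReal_le_ofReal (by linarith)) _) (le_of_eq ?_)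
  rw [← mul_assoc, ← ENNReal.ofReal_ofNat, ← ofReal_mul (by positivity)]
  norm_num

end Picard

/-! ### Existence and Lipschitz dependence for one pair of auxiliary exponents -/

section Existence

variable {N : ℕ} {k α σ γ r p : ℝ}

/-- Jointly measurable solutions of the mild equations for `t > 0`. -/
structure IsSystem (k α σ γ : ℝ) (f₁ f₂ : ℝ → ℝ) (u₀ v₀ : Space N → ℝ)
    (u v : ℝ → Space N → ℝ) : Prop where
  meas_u : Measurable (uncurry u)
  meas_v : Measurable (uncurry v)
  eq_u : ∀ t, 0 < t → u t =ᵐ[volume] mildMap k α σ γ f₁ u₀ v t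
  eq_v : ∀ t, 0 < t → v t =ᵐ[volume] mildMap k α σ γ f₂ v₀ u t

theorem Good.of_limit (P : SymbolParams k α) (hp : 1 ≤ p) {u : ℝ → Space N → ℝ}
    (hu : Measurable (uncurry u)) {w : ℕ → ℝ → Space N → ℝ}
    (hw : ∀ n, Measurable (uncurry (w n))) (hg : ∀ n, Good k α r p (w n))
    (hlim : Tendsto (fun n => wsup k α r p fun s x => u s x - w n s x) atTop (𝓝 0)) :
    Good k α r p u := by
  obtain ⟨n₁, hn₁⟩ := (hlim.eventually (gt_mem_nhds one_pos)).exists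
  refine ⟨(wsup_le_add_sub hp hu (hw n₁)).trans_lt
    (add_lt_top.2 ⟨(hg n₁).bdd, hn₁.trans ENNReal.one_lt_top⟩), fun t₀ ht₀ => ?_, ?_⟩
  · set B : ℝ → ℝ≥0∞ := fun t => ofReal (bracket k α t ^ (-smoothing N r p)) with hB
    have hBc : Tendsto B (𝓝 t₀) (𝓝 (B t₀)) :=
      tendsto_ofReal (DuhamelExp.continuousAt_bracket_rpow P ht₀ _)
    have hB' : ∀ᶠ t in 𝓝 t₀, B t < B t₀ + 1 :=
      hBc.eventually (gt_mem_nhds (ENNReal.lt_add_right ofReal_ne_top one_ne_zero))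
    have hC : 2 * (B t₀ + 1) ≠ ∞ :=
      mul_ne_top (by simp) (add_ne_top.2 ⟨ofReal_ne_top, by simp⟩)
    rw [ENNReal.tendsto_nhds_zero]
    intro ε hε
    have h3 : Tendsto (fun n => 2 * (B t₀ + 1) * wsup k α r p fun s x => u s x - w n s x) atTop
        (𝓝 0) := by
      have := ENNReal.Tendsto.const_mul (a := 2 * (B t₀ + 1)) hlim (Or.inr hC)
      rwa [mul_zero] at this
    obtain ⟨n, hn⟩ := (h3.eventually (gt_mem_nhds (ENNReal.half_pos hε.ne'))).exists
    have hd : ∀ t, 0 < t → B t < B t₀ + 1 →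
        nrm p (fun x => u t x - w n t x) ≤ (B t₀ + 1) * wsup k α r p fun s x => u s x - w n s x := by
      intro t ht hBt
      rw [nrm_eq_wnorm P r p (fun s x => u s x - w n s x) ht]
      exact mul_le_mul' hBt.le (wnorm_le_wsup _ ht)
    filter_upwards [lt_mem_nhds ht₀, hB', ((hg n).cont t₀ ht₀).eventually
      (gt_mem_nhds (ENNReal.half_pos hε.ne'))] with t ht hBt hwt
    have hm : ∀ s, AEStronglyMeasurable (fun x => u s x - w n s x) := fun s =>
      ((Measurable.curve hu s).sub (Measurable.curve (hw n) s)).aestronglyMeasurable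
    have h4 : nrm p (fun x => u t x - u t₀ x) ≤ (nrm p (fun x => u t x - w n t x) +
        nrm p (fun x => u t₀ x - w n t₀ x)) + nrm p (fun x => w n t x - w n t₀ x) := by
      refine le_trans (le_of_eq (congrArg (nrm p) ?_)) ((nrm_add_le hp ((hm t).sub (hm t₀))
        ((Measurable.curve (hw n) t).sub (Measurable.curve (hw n) t₀)).aestronglyMeasurable).trans
        (add_le_add (nrm_sub_le hp (hm t) (hm t₀)) le_rfl))
      funext x
      simp only [Pi.sub_apply]
      ring
    refine h4.trans ((add_le_add (add_le_add (hd t ht hBt) (hd t₀ ht₀ (ENNReal.lt_add_right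
      ofReal_ne_top one_ne_zero))) hwt.le).trans ?_)
    rw [← two_mul, ← mul_assoc]
    exact (add_le_add hn.le le_rfl).trans (ENNReal.add_halves ε).le
  · rw [ENNReal.tendsto_nhds_zero]
    intro ε hε
    obtain ⟨n, hn⟩ := (hlim.eventually (gt_mem_nhds (ENNReal.half_pos hε.ne'))).exists
    filter_upwards [self_mem_nhdsWithin,
      (hg n).van.eventually (gt_mem_nhds (ENNReal.half_pos hε.ne'))] with t ht hwt
    refine (wnorm_le_add_sub hp hu (hw n) t).trans ((add_le_add hwt.le
      ((wnorm_le_wsup _ ht).trans hn.le)).trans (ENNReal.add_halves ε).le)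

theorem good_zero : Good (N := N) k α r p fun _ _ => 0 := by
  have h : wnorm (N := N) k α r p (fun _ _ => 0) = fun _ => 0 := by
    funext t
    simp [wnorm, nrm]
  refine ⟨?_, fun t₀ _ => ?_, ?_⟩
  · simp [wsup, h]
  · simp [nrm]
  · rw [h]
    exact tendsto_const_nhds

variable {ρ₁ ρ₂ r₁ r₂ p₁ p₂ K R : ℝ} {f₁ f₂ : ℝ → ℝ} {u₀ v₀ u₀' v₀' : Space N → ℝ}

/-- Picard iteration of the composed map for u alone. For the pair of unknowns the mild map need not
contract, because ρ₂ = 1 is allowed. -/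
theorem exists_isSystem (P : SymbolParams k α) (S : SmallRadius ρ₁ K R)
    (E₁ : DuhamelExp N σ γ ρ₁ r₂ p₂ r₁ p₁) (E₂ : DuhamelExp N σ γ ρ₂ r₁ p₁ r₂ p₂)
    (hr₁ : 1 ≤ r₁) (hr₂ : 1 ≤ r₂) (hp₁ : r₁ < p₁) (hp₂ : r₂ < p₂) (hκ₁ : smoothing N r₁ p₁ < 1)
    (hκ₂ : smoothing N r₂ p₂ < 1) (e₁ : MildEst N k α σ γ ρ₁ r₂ p₂ r₁ p₁ K)
    (e₂ : MildEst N k α σ γ ρ₂ r₁ p₁ r₂ p₂ K) (hf₁ : PowerLike ρ₁ f₁) (hf₂ : PowerLike ρ₂ f₂)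
    (hu₀ : Measurable u₀) (hv₀ : Measurable v₀)
    (hu₀R : nrm r₁ u₀ ≤ ofReal (R / (2 * K)))
    (hv₀R : nrm r₂ v₀ ≤ ofReal (R / (2 * K))) :
    ∃ u v : ℝ → Space N → ℝ, IsSystem k α σ γ f₁ f₂ u₀ v₀ u v ∧ Good k α r₁ p₁ u ∧
      Good k α r₂ p₂ v ∧ wsup k α r₁ p₁ u ≤ ofReal R ∧
      (0 ≤ᵐ[volume] u₀ → 0 ≤ᵐ[volume] v₀ → ∀ t, 0 < t → ∀ x, 0 ≤ u t x ∧ 0 ≤ v t x) := by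
  have hp1 : 1 ≤ p₁ := hr₁.trans hp₁.le
  have hρ₁ := E₁.one_le
  have hρ₂ := E₂.one_le
  have hu₀t := hu₀R.trans_lt ofReal_lt_top
  have hv₀t := hv₀R.trans_lt ofReal_lt_top
  set Ψ : (ℝ → Space N → ℝ) → ℝ → Space N → ℝ := mildMap k α σ γ f₂ v₀ with hΨ
  set Φ : (ℝ → Space N → ℝ) → ℝ → Space N → ℝ := fun u => mildMap k α σ γ f₁ u₀ (Ψ u) with hΦ
  have hΨm : ∀ u, Measurable (uncurry u) → Measurable (uncurry (Ψ u)) :=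
    fun u hu => measurable_mildMap hf₂.meas hv₀ hu
  have hΦm : ∀ u, Measurable (uncurry u) → Measurable (uncurry (Φ u)) :=
    fun u hu => measurable_mildMap hf₁.meas hu₀ (hΨm u hu)
  have hΨg : ∀ u, Measurable (uncurry u) → Good k α r₁ p₁ u → Good k α r₂ p₂ (Ψ u) :=
    fun u hu hg => E₂.good_mildMap P hr₂ hp₂ hκ₂ hf₂ hv₀ hv₀t hu hg
  have hΦg : ∀ u, Measurable (uncurry u) → Good k α r₁ p₁ u → Good k α r₁ p₁ (Φ u) :=
    fun u hu hg => E₁.good_mildMap P hr₁ hp₁ hκ₁ hf₁ hu₀ hu₀t (hΨm u hu) (hΨg u hu hg)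
  have hΦR : ∀ u, Measurable (uncurry u) → wsup k α r₁ p₁ u ≤ ofReal R →
      wsup k α r₁ p₁ (Φ u) ≤ ofReal R := fun u hu huR =>
    S.wsup_mildMap_mildMap_le hρ₁ hρ₂ e₁ e₂ hf₁ hf₂ hu₀ hv₀ hu₀R hv₀R hu huR
  have hΦc : ∀ u u', Measurable (uncurry u) → Measurable (uncurry u') →
      wsup k α r₁ p₁ u ≤ ofReal R → wsup k α r₁ p₁ u' ≤ ofReal R →
      wsup k α r₁ p₁ (fun s x => Φ u s x - Φ u' s x) ≤
        ofReal (1 / 2) * wsup k α r₁ p₁ fun s x => u s x - u' s x := by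
    intro u u' hu hu' huR huR'
    refine (S.wsup_mildMap_mildMap_sub_le hρ₁ hρ₂ e₁ e₂ hf₁ hf₂ hu₀ hv₀ hu₀ hv₀ hu₀t hu₀t hv₀R hv₀R
      hu hu' huR huR').trans (le_of_eq ?_)
    simp [nrm]
  set w : ℕ → ℝ → Space N → ℝ := fun n => Φ^[n] fun _ _ => 0 with hw
  have hws : ∀ n, w (n + 1) = Φ (w n) := fun n => Function.iterate_succ_apply' Φ n _
  have hwm : ∀ n, Measurable (uncurry (w n)) := fun n => by
    induction n with
    | zero => exact measurable_const
    | succ n ih => rw [hws]; exact hΦm _ ih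
  have hwg : ∀ n, Good k α r₁ p₁ (w n) := fun n => by
    induction n with
    | zero => exact good_zero
    | succ n ih => rw [hws]; exact hΦg _ (hwm n) ih
  have hw0 : wsup k α r₁ p₁ (w 0) = 0 :=
    le_antisymm (wsup_le fun t _ => by simp [hw, wnorm, nrm]) zero_le
  have hwR : ∀ n, wsup k α r₁ p₁ (w n) ≤ ofReal R := fun n => by
    induction n with
    | zero => rw [hw0]; exact zero_le
    | succ n ih => rw [hws]; exact hΦR _ (hwm n) ih
  have hwc : ∀ n, wsup k α r₁ p₁ (fun s x => w (n + 1) s x - w n s x) ≤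
      ofReal (R * (1 / 2) ^ n) := fun n => by
    induction n with
    | zero =>
      rw [pow_zero, mul_one]
      refine le_trans (le_of_eq ?_) (hwR 1)
      simp [hw]
    | succ n ih =>
      have h := (hΦc _ _ (hwm (n + 1)) (hwm n) (hwR _) (hwR _)).trans (mul_le_mul_right ih _)
      rw [← hws, ← hws, ← ofReal_mul (by positivity)] at h
      refine h.trans (le_of_eq ?_)
      rw [pow_succ]
      congr 1
      ring
  obtain ⟨u, hu, huw, hut⟩ := exists_limit_curve P hp1 hwm S.pos.le hwc
  have hlim : Tendsto (fun n => wsup k α r₁ p₁ fun s x => u s x - w n s x) atTop (𝓝 0) := by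
    have h1 := tendsto_ofReal ((tendsto_pow_atTop_nhds_zero_of_lt_one
      (r := (1 : ℝ) / 2) (by norm_num) (by norm_num)).const_mul (2 * R))
    rw [mul_zero, ENNReal.ofReal_zero] at h1
    exact tendsto_zero_of_le h1 (.of_forall huw)
  have hug : Good k α r₁ p₁ u := Good.of_limit P hp1 hu hwm hwg hlim
  have huR : wsup k α r₁ p₁ u ≤ ofReal R := by
    have h1 := (tendsto_const_nhds (x := ofReal R)).add hlim
    rw [add_zero] at h1
    exact ge_of_tendsto' h1 fun n => (wsup_le_add_sub hp1 hu (hwm n)).trans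
      (add_le_add (hwR n) le_rfl)
  -- The limit u is compared with Φ u through the iterate w (n+1), to which both are close.
  have hfix : wsup k α r₁ p₁ (fun s x => Φ u s x - u s x) = 0 := by
    have h1 := (ENNReal.Tendsto.const_mul (a := ofReal (1 / 2)) hlim
      (Or.inr ofReal_ne_top)).add (hlim.comp (tendsto_add_atTop_nat 1))
    rw [mul_zero, add_zero] at h1
    refine le_antisymm (ge_of_tendsto' h1 fun n => ?_) zero_le
    refine (wsup_sub_le hp1 (hΦm u hu) (hwm (n + 1)) hu).trans (add_le_add ?_ ?_)
    · rw [hws]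
      exact hΦc _ _ hu (hwm n) huR (hwR n)
    · exact (wsup_sub_comm _ _).le
  have hΦu : ∀ t, 0 < t → Φ u t =ᵐ[volume] u t := by
    intro t ht
    exact ae_eq_of_wnorm_sub_eq_zero P hp1 (hΦm u hu) hu ht
      (le_antisymm ((wnorm_le_wsup _ ht).trans hfix.le) zero_le)
  have hΨe : ∀ t, 0 < t → Ψ u t = Ψ (Φ u) t := fun t ht =>
    mildMap_congr hf₂.meas hu (hΦm u hu) (fun s hs => (hΦu s hs).symm) ht
  -- The limit u is a fixed point only almost everywhere. With Φ u in its place the first equation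
  -- holds by definition, the second because Ψ does not distinguish u from Φ u, and nonnegativity
  -- holds at every point.
  refine ⟨Φ u, Ψ u, ⟨hΦm u hu, hΨm u hu, fun t _ => Eventually.of_forall fun x => rfl,
    fun t ht => Eventually.of_forall fun x => congrFun (hΨe t ht) x⟩, hΦg u hu hug, hΨg u hu hug,
    (wsup_congr hΦu).trans_le huR, fun h1 h2 t ht x => ?_⟩
  have hwn : ∀ n t, 0 < t → ∀ x, 0 ≤ w n t x := by
    intro n
    induction n with
    | zero => exact fun t ht x => le_rfl
    | succ n ih =>
      intro t ht x
      rw [hws]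
      exact mildMap_nonneg P hf₁ hu₀ h1 (hΨm _ (hwm n)) (fun s hs => Eventually.of_forall
        (mildMap_nonneg P hf₂ hv₀ h2 (hwm n) (fun s' hs' => Eventually.of_forall (ih s' hs')) hs)) ht x
  have hun : ∀ t, 0 < t → 0 ≤ᵐ[volume] u t := fun t ht => by
    filter_upwards [hut t ht] with x hx using ge_of_tendsto' hx fun n => hwn n t ht x
  have hvn : ∀ t, 0 < t → ∀ x, 0 ≤ Ψ u t x := fun t ht =>
    mildMap_nonneg P hf₂ hv₀ h2 hu hun ht
  exact ⟨mildMap_nonneg P hf₁ hu₀ h1 (hΨm u hu) (fun s hs => Eventually.of_forall (hvn s hs)) ht x,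
    hvn t ht x⟩

/-- The contraction gives d ≤ K D + d/2 for the distance d of the first components, hence d ≤ 2K D.
The second components then differ by at most K(1 + 4K)D ≤ 5K²D. -/
theorem IsSystem.wsup_sub_le (S : SmallRadius ρ₁ K R) (hρ₁ : 1 ≤ ρ₁) (hρ₂ : 1 ≤ ρ₂)
    (hp₁ : 1 ≤ p₁) (e₁ : MildEst N k α σ γ ρ₁ r₂ p₂ r₁ p₁ K)
    (e₂ : MildEst N k α σ γ ρ₂ r₁ p₁ r₂ p₂ K) (hf₁ : PowerLike ρ₁ f₁) (hf₂ : PowerLike ρ₂ f₂)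
    (hu₀ : Measurable u₀) (hv₀ : Measurable v₀) (hu₀' : Measurable u₀') (hv₀' : Measurable v₀')
    (hu₀R : nrm r₁ u₀ ≤ ofReal (R / (2 * K)))
    (hv₀R : nrm r₂ v₀ ≤ ofReal (R / (2 * K)))
    (hu₀R' : nrm r₁ u₀' ≤ ofReal (R / (2 * K)))
    (hv₀R' : nrm r₂ v₀' ≤ ofReal (R / (2 * K)))
    {u v u' v' : ℝ → Space N → ℝ} (H : IsSystem k α σ γ f₁ f₂ u₀ v₀ u v)
    (H' : IsSystem k α σ γ f₁ f₂ u₀' v₀' u' v')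
    (hu : wsup k α r₁ p₁ u ≤ ofReal R) (hu' : wsup k α r₁ p₁ u' ≤ ofReal R) :
    wsup k α r₁ p₁ (fun s x => u s x - u' s x) ≤ ofReal (5 * K ^ 2) *
      (nrm r₁ (fun x => u₀ x - u₀' x) + nrm r₂ (fun x => v₀ x - v₀' x)) ∧
    wsup k α r₂ p₂ (fun s x => v s x - v' s x) ≤ ofReal (5 * K ^ 2) *
      (nrm r₁ (fun x => u₀ x - u₀' x) + nrm r₂ (fun x => v₀ x - v₀' x)) := by
  have hK := S.one_le
  have hu₀t := hu₀R.trans_lt ofReal_lt_top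
  have hv₀t := hv₀R.trans_lt ofReal_lt_top
  have hu₀t' := hu₀R'.trans_lt ofReal_lt_top
  have hv₀t' := hv₀R'.trans_lt ofReal_lt_top
  have h1 := S.wsup_mildMap_mildMap_sub_le hρ₁ hρ₂ e₁ e₂ hf₁ hf₂ hu₀ hv₀ hu₀' hv₀' hu₀t hu₀t'
    hv₀R hv₀R' H.meas_u H'.meas_u hu hu'
  have h2 := S.wsup_mildMap_sub_le hρ₂ e₂ hf₂ hv₀ hv₀' hv₀t hv₀t' H.meas_u H'.meas_u hu hu'
  have e1 : wsup k α r₁ p₁ (fun s x => mildMap k α σ γ f₁ u₀ (mildMap k α σ γ f₂ v₀ u) s x -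
      mildMap k α σ γ f₁ u₀' (mildMap k α σ γ f₂ v₀' u') s x) =
      wsup k α r₁ p₁ (fun s x => u s x - u' s x) := by
    refine wsup_congr fun t ht => ?_
    rw [← mildMap_congr hf₁.meas H.meas_v (measurable_mildMap hf₂.meas hv₀ H.meas_u) H.eq_v ht,
      ← mildMap_congr hf₁.meas H'.meas_v (measurable_mildMap hf₂.meas hv₀' H'.meas_u) H'.eq_v ht]
    exact (H.eq_u t ht).symm.sub (H'.eq_u t ht).symm
  have e2 : wsup k α r₂ p₂ (fun s x => mildMap k α σ γ f₂ v₀ u s x - mildMap k α σ γ f₂ v₀' u' s x) =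
      wsup k α r₂ p₂ (fun s x => v s x - v' s x) :=
    wsup_congr fun t ht => (H.eq_v t ht).symm.sub (H'.eq_v t ht).symm
  rw [e1] at h1
  rw [e2] at h2
  -- Finiteness of the distance is needed to absorb d/2 on the left.
  have hdt : wsup k α r₁ p₁ (fun s x => u s x - u' s x) ≠ ∞ := by
    refine ne_top_of_le_ne_top ?_ (RayleighStokes.wsup_sub_le hp₁ H.meas_u (v := fun _ _ => 0)
      measurable_const H'.meas_u)
    rw [wsup_sub_comm (fun _ _ => 0) u']
    simp only [sub_zero]
    exact (add_lt_top.2 ⟨hu.trans_lt ofReal_lt_top,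
      hu'.trans_lt ofReal_lt_top⟩).ne
  set d := wsup k α r₁ p₁ (fun s x => u s x - u' s x)
  set D := nrm r₁ (fun x => u₀ x - u₀' x) + nrm r₂ (fun x => v₀ x - v₀' x) with hD
  have h3 : d ≤ ofReal (2 * K) * D := by
    have h4 : d - ofReal (1 / 2) * d ≤ ofReal K * D := tsub_le_iff_right.2 h1
    have h5 : d = ofReal (1 / 2) * d + ofReal (1 / 2) * d := by
      rw [← add_mul, ← ofReal_add (by positivity) (by positivity)]
      norm_num
    have h6 : ofReal (1 / 2) * d ≤ ofReal K * D := by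
      refine le_trans (le_of_eq ?_) h4
      nth_rw 2 [h5]
      rw [ENNReal.add_sub_cancel_right (mul_ne_top ofReal_ne_top hdt)]
    calc d = ofReal 2 * (ofReal (1 / 2) * d) := by
          rw [← mul_assoc, ← ofReal_mul (by positivity)]
          norm_num
      _ ≤ ofReal 2 * (ofReal K * D) := mul_le_mul_right h6 _
      _ = _ := by rw [← mul_assoc, ← ofReal_mul (by positivity)]
  refine ⟨h3.trans (mul_le_mul_left (ofReal_le_ofReal (by nlinarith)) _), h2.trans ?_⟩
  calc _ ≤ ofReal K * (D + 2 * (ofReal (2 * K) * D)) :=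
        mul_le_mul_right (add_le_add le_add_self (mul_le_mul_right h3 _)) _
    _ = ofReal (K * (1 + 2 * (2 * K))) * D := by
        rw [ofReal_mul (p := K) (by positivity), ofReal_add (by positivity)
          (by positivity), ofReal_mul (q := 2 * K) two_pos.le, ofReal_one,
          ENNReal.ofReal_ofNat]
        ring
    _ ≤ _ := mul_le_mul_left (ofReal_le_ofReal (by nlinarith)) _

end Existence

/-! ### Uniqueness for one pair of auxiliary exponents -/

section Uniqueness

theorem eq_zero_of_le_half_mul {S q : ℝ≥0∞} (hS : S ≠ ∞) (h : S ≤ q * S) (hq : q ≤ 2⁻¹) : S = 0 := by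
  by_contra h0
  have h1 : S ≤ S / 2 := by
    rw [div_eq_mul_inv, mul_comm]
    exact h.trans (mul_le_mul_left hq _)
  exact absurd h1 (not_le.2 (ENNReal.half_lt_self h0 hS))

/-- In the norm sup t^{-m}d(t) the kernel acquires the factor τ^m, because t^{-m}(tτ)^m = τ^m. -/
theorem iSup_le_of_volterra {A : Set ℝ} (hA : ∀ t ∈ A, 0 < t ∧ ∀ τ ∈ Ioo (0 : ℝ) 1, t * τ ∈ A)
    {d e a B : ℝ → ℝ≥0∞} (hB : Measurable B)
    (h : ∀ t ∈ A, d t ≤ ∫⁻ τ in Ioo (0 : ℝ) 1, B τ * (a (t * τ) * e (t * τ)))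
    {c : ℝ≥0∞} (ha : ∀ t ∈ A, a t ≤ c) (m : ℕ) :
    ⨆ t ∈ A, ofReal (t ^ m)⁻¹ * d t ≤
      (c * ∫⁻ τ in Ioo (0 : ℝ) 1, B τ * ofReal (τ ^ m)) *
        ⨆ t ∈ A, ofReal (t ^ m)⁻¹ * e t := by
  set S := ⨆ t ∈ A, ofReal (t ^ m)⁻¹ * e t with hS
  refine iSup₂_le fun t ht => ?_
  have ht0 := (hA t ht).1
  have hBm : Measurable fun τ : ℝ => B τ * ofReal (τ ^ m) := by fun_prop
  have h1 : d t ≤ ofReal (t ^ m) *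
      ∫⁻ τ in Ioo (0 : ℝ) 1, B τ * ofReal (τ ^ m) * (c * S) := by
    rw [← lintegral_const_mul' _ _ ofReal_ne_top]
    refine (h t ht).trans (setLIntegral_mono' measurableSet_Ioo fun τ hτ => ?_)
    have hs := (hA t ht).2 τ hτ
    have hs0 := (hA _ hs).1
    have h2 : e (t * τ) ≤ ofReal ((t * τ) ^ m) * S := by
      refine le_trans (le_of_eq ?_) (mul_le_mul_right
        (le_biSup (fun t => ofReal (t ^ m)⁻¹ * e t) hs) _)
      rw [← mul_assoc, ← ofReal_mul (by positivity), mul_inv_cancel₀ (by positivity),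
        ofReal_one, one_mul]
    refine (mul_le_mul_right (mul_le_mul' (ha _ hs) h2) _).trans (le_of_eq ?_)
    rw [mul_pow, ofReal_mul (by positivity)]
    ring
  refine (mul_le_mul_right h1 _).trans (le_of_eq ?_)
  rw [← mul_assoc, ← ofReal_mul (by positivity), inv_mul_cancel₀ (by positivity),
    ofReal_one, one_mul, lintegral_mul_const _ hBm]
  ring

theorem tendsto_lintegral_mul_pow {B : ℝ → ℝ≥0∞} (hB : Measurable B)
    (hBt : ∫⁻ τ in Ioo (0 : ℝ) 1, B τ ≠ ∞) :
    Tendsto (fun m : ℕ => ∫⁻ τ in Ioo (0 : ℝ) 1, B τ * ofReal (τ ^ m)) atTop (𝓝 0) := by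
  have h := tendsto_lintegral_of_dominated_convergence (μ := volume.restrict (Ioo (0 : ℝ) 1))
    (F := fun (m : ℕ) τ => B τ * ofReal (τ ^ m)) (f := fun _ => 0) B
    (fun m => by fun_prop) (fun m => ?_) hBt ?_
  · simpa using h
  · refine (ae_restrict_iff' measurableSet_Ioo).2 (Eventually.of_forall fun τ hτ => ?_)
    exact mul_le_of_le_one_right' (ENNReal.ofReal_le_one.2 (pow_le_one₀ hτ.1.le hτ.2.le))
  · have h1 := ae_lt_top hB hBt
    filter_upwards [h1, (ae_restrict_iff' measurableSet_Ioo).2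
      (Eventually.of_forall fun τ hτ => hτ)] with τ h1 hτ
    have h2 := ENNReal.Tendsto.const_mul (a := B τ) (tendsto_ofReal
      (tendsto_pow_atTop_nhds_zero_of_lt_one hτ.1.le hτ.2)) (Or.inr h1.ne)
    rwa [ENNReal.ofReal_zero, mul_zero] at h2

/-- The two inequalities are composed. On a short interval (0,T) the coefficient a₁ is small, which
gives d₁ = 0 there with m = 0. Since d₁ vanishes near zero, sup t^{-m}d₁(t) is finite for every m,
and for large m the kernels are small whatever the size of the coefficients. -/
theorem eq_zero_of_volterra {d₁ d₂ a₁ a₂ B₁ B₂ : ℝ → ℝ≥0∞} (hB₁ : Measurable B₁)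
    (hB₂ : Measurable B₂) (hB₁t : ∫⁻ τ in Ioo (0 : ℝ) 1, B₁ τ ≠ ∞)
    (hB₂t : ∫⁻ τ in Ioo (0 : ℝ) 1, B₂ τ ≠ ∞) {M : ℝ≥0∞} (hM : M ≠ ∞)
    (hd₁ : ∀ t, 0 < t → d₁ t ≤ M) (ha₁ : ∀ t, 0 < t → a₁ t ≤ M)
    (ha₂ : ∀ t, 0 < t → a₂ t ≤ M) (ha₁0 : Tendsto a₁ (𝓝[>] 0) (𝓝 0))
    (h₁ : ∀ t, 0 < t → d₁ t ≤ ∫⁻ τ in Ioo (0 : ℝ) 1, B₁ τ * (a₁ (t * τ) * d₂ (t * τ)))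
    (h₂ : ∀ t, 0 < t → d₂ t ≤ ∫⁻ τ in Ioo (0 : ℝ) 1, B₂ τ * (a₂ (t * τ) * d₁ (t * τ)))
    {t : ℝ} (ht : 0 < t) : d₁ t = 0 ∧ d₂ t = 0 := by
  set J₁ : ℕ → ℝ≥0∞ := fun m => ∫⁻ τ in Ioo (0 : ℝ) 1, B₁ τ * ofReal (τ ^ m) with hJ₁
  set J₂ : ℕ → ℝ≥0∞ := fun m => ∫⁻ τ in Ioo (0 : ℝ) 1, B₂ τ * ofReal (τ ^ m) with hJ₂
  have hJ : J₁ 0 * (M * J₂ 0) ≠ ∞ := by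
    simp only [hJ₁, hJ₂, pow_zero, ofReal_one, mul_one]
    exact mul_ne_top hB₁t (mul_ne_top hM hB₂t)
  obtain ⟨T, hT, hTd⟩ : ∃ T, 0 < T ∧ ∀ t, 0 < t → t < T → d₁ t = 0 := by
    have h3 := ENNReal.Tendsto.mul_const ha₁0 (Or.inr hJ)
    rw [zero_mul] at h3
    obtain ⟨T, hT, hTa⟩ := mem_nhdsGT_iff_exists_Ioo_subset.1
      (h3.eventually (ge_mem_nhds (by simp : (0 : ℝ≥0∞) < 2⁻¹)))
    have hA : ∀ t ∈ Ioo 0 T, 0 < t ∧ ∀ τ ∈ Ioo (0 : ℝ) 1, t * τ ∈ Ioo 0 T := fun t ht =>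
      ⟨ht.1, fun τ hτ => ⟨mul_pos ht.1 hτ.1, (mul_lt_of_lt_one_right ht.1 hτ.2).trans ht.2⟩⟩
    set c := ⨆ t ∈ Ioo 0 T, a₁ t with hc
    have hcq : c * (J₁ 0 * (M * J₂ 0)) ≤ 2⁻¹ := by
      rw [hc, ENNReal.iSup_mul]
      refine iSup_le fun t => ?_
      rw [ENNReal.iSup_mul]
      exact iSup_le fun ht => hTa ht
    have h4 := iSup_le_of_volterra hA hB₁ (fun t ht => h₁ t ht.1)
      (fun t ht => le_biSup a₁ ht) 0
    have h5 := iSup_le_of_volterra hA hB₂ (fun t ht => h₂ t ht.1) (fun t ht => ha₂ t ht.1) 0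
    simp only [pow_zero, inv_one, ofReal_one, one_mul] at h4 h5
    have h6 : ⨆ t ∈ Ioo 0 T, d₁ t = 0 := by
      refine eq_zero_of_le_half_mul (ne_top_of_le_ne_top hM (iSup₂_le fun t ht => hd₁ t ht.1))
        (h4.trans ((mul_le_mul_right h5 _).trans (le_of_eq ?_))) hcq
      simp only [hJ₁, hJ₂, pow_zero, ofReal_one]
      ring
    exact ⟨T, hT, fun t ht htT => le_antisymm ((le_biSup d₁ (⟨ht, htT⟩ : t ∈ Ioo 0 T)).trans h6.le)
      zero_le⟩
  have hA : ∀ t ∈ Ioi (0 : ℝ), 0 < t ∧ ∀ τ ∈ Ioo (0 : ℝ) 1, t * τ ∈ Ioi (0 : ℝ) := fun t ht =>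
    ⟨ht, fun τ hτ => mul_pos ht hτ.1⟩
  have hq : Tendsto (fun m => (M * J₁ m) * (M * J₂ m)) atTop (𝓝 0) := by
    have h3 := ENNReal.Tendsto.const_mul (tendsto_lintegral_mul_pow hB₁ hB₁t) (Or.inr hM)
    have h4 := ENNReal.Tendsto.const_mul (tendsto_lintegral_mul_pow hB₂ hB₂t) (Or.inr hM)
    have := ENNReal.Tendsto.mul h3 (by simp) h4 (by simp)
    simpa using this
  obtain ⟨m, hm⟩ := (hq.eventually (ge_mem_nhds (by simp : (0 : ℝ≥0∞) < 2⁻¹))).exists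
  have h4 := iSup_le_of_volterra hA hB₁ (fun t ht => h₁ t ht) (fun t ht => ha₁ t ht) m
  have h5 := iSup_le_of_volterra hA hB₂ (fun t ht => h₂ t ht) (fun t ht => ha₂ t ht) m
  have h6 : ⨆ t ∈ Ioi (0 : ℝ), ofReal (t ^ m)⁻¹ * d₁ t = 0 := by
    refine eq_zero_of_le_half_mul ?_ (h4.trans ((mul_le_mul_right h5 _).trans_eq
      (mul_assoc _ _ _).symm)) hm
    refine ne_top_of_le_ne_top (mul_ne_top (ofReal_ne_top (r := (T ^ m)⁻¹)) hM)
      (iSup₂_le fun t ht => ?_)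
    have ht0 : 0 < t := ht
    rcases lt_or_ge t T with h | h
    · rw [hTd t ht h, mul_zero]
      exact zero_le
    · exact mul_le_mul' (ofReal_le_ofReal (inv_anti₀ (by positivity)
        (pow_le_pow_left₀ hT.le h m))) (hd₁ t ht)
  rw [h6, mul_zero] at h5
  have key : ∀ x : ℝ≥0∞, ofReal (t ^ m)⁻¹ * x ≤ 0 → x = 0 := fun x hx => by
    rcases mul_eq_zero.1 (le_antisymm hx zero_le) with h | h
    · exact absurd h (ENNReal.ofReal_pos.2 (by positivity)).ne'
    · exact h
  exact ⟨key _ ((le_biSup (fun t => ofReal (t ^ m)⁻¹ * d₁ t) (mem_Ioi.2 ht)).trans h6.le),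
    key _ ((le_biSup (fun t => ofReal (t ^ m)⁻¹ * d₂ t) (mem_Ioi.2 ht)).trans h5)⟩

variable {N : ℕ} {k α σ γ ρ₁ ρ₂ r₁ r₂ p₁ p₂ : ℝ} {f₁ f₂ : ℝ → ℝ} {u₀ v₀ : Space N → ℝ}

theorem wnorm_mildMap_sub (f : ℝ → ℝ) {ru b : ℝ} (v v' : ℝ → Space N → ℝ) (t : ℝ) :
    wnorm k α ru b (fun s x => mildMap k α σ γ f u₀ v s x - mildMap k α σ γ f u₀ v' s x) t =
      wnorm k α ru b (fun s x => duhamelOp k α (source σ γ f v) s x -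
        duhamelOp k α (source σ γ f v') s x) t := by
  simp only [mildMap, add_sub_add_left_eq_sub]

/-- The coefficient a₁ contains the weighted norms of v and v' to the power ρ₁ - 1 > 0, so it decays
at time zero. The coefficient a₂ is only bounded, since ρ₂ may be 1, and that suffices. -/
theorem IsSystem.unique (P : SymbolParams k α)
    (E₁ : DuhamelExp N σ γ ρ₁ r₂ p₂ r₁ p₁) (E₂ : DuhamelExp N σ γ ρ₂ r₁ p₁ r₂ p₂) (hρ₁ : 1 < ρ₁)
    (hf₁ : PowerLike ρ₁ f₁) (hf₂ : PowerLike ρ₂ f₂)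
    {u v u' v' : ℝ → Space N → ℝ} (H : IsSystem k α σ γ f₁ f₂ u₀ v₀ u v)
    (H' : IsSystem k α σ γ f₁ f₂ u₀ v₀ u' v') (hu : Good k α r₁ p₁ u) (hv : Good k α r₂ p₂ v)
    (hu' : Good k α r₁ p₁ u') (hv' : Good k α r₂ p₂ v') {t : ℝ} (ht : 0 < t) :
    u t =ᵐ[volume] u' t ∧ v t =ᵐ[volume] v' t := by
  obtain ⟨K₁, hK₁, h₁⟩ := E₁.exists_wnorm_duhamelOp_sub_le P
  obtain ⟨K₂, hK₂, h₂⟩ := E₂.exists_wnorm_duhamelOp_sub_le P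
  have hρ₁' : 0 < ρ₁ - 1 := by linarith
  have hρ₂' : 0 ≤ ρ₂ - 1 := by linarith [E₂.one_le]
  set d₁ := wnorm k α r₁ p₁ fun s x => u s x - u' s x with hd₁
  set d₂ := wnorm k α r₂ p₂ fun s x => v s x - v' s x with hd₂
  set a₁ : ℝ → ℝ≥0∞ := fun s => wnorm k α r₂ p₂ v s ^ (ρ₁ - 1) + wnorm k α r₂ p₂ v' s ^ (ρ₁ - 1)
    with ha₁
  set a₂ : ℝ → ℝ≥0∞ := fun s => wnorm k α r₁ p₁ u s ^ (ρ₂ - 1) + wnorm k α r₁ p₁ u' s ^ (ρ₂ - 1)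
    with ha₂
  set A₁ := wsup k α r₂ p₂ v ^ (ρ₁ - 1) + wsup k α r₂ p₂ v' ^ (ρ₁ - 1) with hA₁
  set A₂ := wsup k α r₁ p₁ u ^ (ρ₂ - 1) + wsup k α r₁ p₁ u' ^ (ρ₂ - 1) with hA₂
  have hA₁t : A₁ ≠ ∞ := add_ne_top.2 ⟨rpow_ne_top_of_nonneg hρ₁'.le hv.bdd.ne,
    rpow_ne_top_of_nonneg hρ₁'.le hv'.bdd.ne⟩
  have hA₂t : A₂ ≠ ∞ := add_ne_top.2 ⟨rpow_ne_top_of_nonneg hρ₂' hu.bdd.ne,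
    rpow_ne_top_of_nonneg hρ₂' hu'.bdd.ne⟩
  have hd₁S : ∀ s, 0 < s → d₁ s ≤ wsup k α r₁ p₁ u + wsup k α r₁ p₁ u' := fun s hs => by
    refine (le_of_eq ?_).trans ((mul_le_mul_right (nrm_sub_le E₁.b_ge
      (aesm_curve H.meas_u s)
      (aesm_curve H'.meas_u s)) _).trans
      ((mul_add _ _ _).trans_le (add_le_add (wnorm_le_wsup u hs) (wnorm_le_wsup u' hs))))
    rfl
  have ha₁0 : Tendsto a₁ (𝓝[>] 0) (𝓝 0) := by
    have h3 := (hv.van.ennrpow_const (ρ₁ - 1)).add (hv'.van.ennrpow_const (ρ₁ - 1))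
    rwa [ENNReal.zero_rpow_of_pos hρ₁', add_zero] at h3
  have hM : A₁ + A₂ + (wsup k α r₁ p₁ u + wsup k α r₁ p₁ u') ≠ ∞ :=
    add_ne_top.2 ⟨add_ne_top.2 ⟨hA₁t, hA₂t⟩,
      add_ne_top.2 ⟨hu.bdd.ne, hu'.bdd.ne⟩⟩
  have key := eq_zero_of_volterra (d₁ := d₁) (d₂ := d₂) (a₁ := a₁) (a₂ := a₂)
    (B₁ := fun τ => ofReal K₁ * duhamelWeight N σ γ ρ₁ r₂ p₂ p₁ τ)
    (B₂ := fun τ => ofReal K₂ * duhamelWeight N σ γ ρ₂ r₁ p₁ p₂ τ)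
    ((measurable_betaWeight _ _).ennreal_ofReal.const_mul _)
    ((measurable_betaWeight _ _).ennreal_ofReal.const_mul _)
    (by
      rw [lintegral_const_mul' _ _ ofReal_ne_top]
      exact mul_ne_top ofReal_ne_top E₁.lintegral_betaWeight_lt_top.ne)
    (by
      rw [lintegral_const_mul' _ _ ofReal_ne_top]
      exact mul_ne_top ofReal_ne_top E₂.lintegral_betaWeight_lt_top.ne)
    hM (fun s hs => (hd₁S s hs).trans le_add_self)
    (fun s hs => (add_le_add (rpow_le_rpow (wnorm_le_wsup v hs) hρ₁'.le)
      (rpow_le_rpow (wnorm_le_wsup v' hs) hρ₁'.le)).trans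
      (le_self_add.trans le_self_add))
    (fun s hs => (add_le_add (rpow_le_rpow (wnorm_le_wsup u hs) hρ₂')
      (rpow_le_rpow (wnorm_le_wsup u' hs) hρ₂')).trans
      (le_add_self.trans le_self_add)) ha₁0
    (fun s hs => by
      refine (le_of_eq ?_).trans ((h₁ f₁ hf₁ v v' H.meas_v H'.meas_v hv.bdd hv'.bdd s hs).trans_eq ?_)
      · rw [← wnorm_mildMap_sub (u₀ := u₀)]
        exact wnorm_congr ((H.eq_u s hs).sub (H'.eq_u s hs))
      · rw [← lintegral_const_mul' _ _ ofReal_ne_top]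
        simp only [mul_assoc]
        rfl)
    (fun s hs => by
      refine (le_of_eq ?_).trans ((h₂ f₂ hf₂ u u' H.meas_u H'.meas_u hu.bdd hu'.bdd s hs).trans_eq ?_)
      · rw [← wnorm_mildMap_sub (u₀ := v₀)]
        exact wnorm_congr ((H.eq_v s hs).sub (H'.eq_v s hs))
      · rw [← lintegral_const_mul' _ _ ofReal_ne_top]
        simp only [mul_assoc]
        rfl) ht
  exact ⟨ae_eq_of_wnorm_sub_eq_zero P E₁.b_ge H.meas_u H'.meas_u ht key.1,
    ae_eq_of_wnorm_sub_eq_zero P E₂.b_ge H.meas_v H'.meas_v ht key.2⟩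

end Uniqueness

/-! ### Exponents -/

/-- The standing assumptions on the exponents. -/
structure SystemParams (N : ℕ) (σ γ ρ₁ ρ₂ r₁ r₂ : ℝ) : Prop where
  dim : 1 ≤ N
  σ_nonpos : σ ≤ 0
  γ_nonpos : γ ≤ 0
  s_pos : 0 < σ + 2 * γ + 2
  σ_gt : -(N : ℝ) < σ
  ρ₂_ge : 1 ≤ ρ₂
  ρ₁_gt : 1 < ρ₁
  r₁_gt : 1 < r₁
  r₁_le : r₁ ≤ r₂
  scaling₁ : ρ₁ / r₂ = 1 / r₁ + (σ + 2 * γ + 2) / N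
  scaling₂ : ρ₂ / r₁ = 1 / r₂ + (σ + 2 * γ + 2) / N

/-- As ρ₁ ≥ ρ₂, the maximum in the critical product is ρ₁ + 1, and the supercritical condition is r₁
> 1. It also forces ρ₁ρ₂ > 1 and thereby ρ₁ > 1. -/
theorem systemParams_of_critical {N : ℕ} (hN : 1 ≤ N) {σ γ ρ₁ ρ₂ r₁ r₂ : ℝ}
    (hσ : σ ≤ 0) (hγ : γ ≤ 0) (hσγ : 0 < σ + 2 * (γ + 1)) (hσN : -(N : ℝ) < σ)
    (hρ₂ : 1 ≤ ρ₂) (hρ : ρ₂ ≤ ρ₁) (hcrit : criticalProduct N σ γ ρ₁ ρ₂ < ρ₁ * ρ₂)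
    (hr₁ : r₁ = criticalR N σ γ ρ₁ ρ₂ ρ₁) (hr₂ : r₂ = criticalR N σ γ ρ₁ ρ₂ ρ₂) :
    SystemParams N σ γ ρ₁ ρ₂ r₁ r₂ := by
  have hN0 : (0 : ℝ) < N := by exact_mod_cast hN
  have hs : 0 < σ + 2 * γ + 2 := by linarith
  have h1 : 0 < ρ₁ + 1 := by linarith
  have h2 : 0 < ρ₂ + 1 := by linarith
  have hc : (σ + 2 * γ + 2) * (ρ₁ + 1) < N * (ρ₁ * ρ₂ - 1) := by
    have h3 : 1 + (σ + 2 * γ + 2) / N * (ρ₁ + 1) < ρ₁ * ρ₂ := by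
      refine lt_of_le_of_lt (le_of_eq ?_) hcrit
      rw [criticalProduct, max_eq_left (by linarith)]
      ring
    have h4 : (σ + 2 * γ + 2) / N * (ρ₁ + 1) < ρ₁ * ρ₂ - 1 := by linarith
    rw [div_mul_eq_mul_div, div_lt_iff₀ hN0] at h4
    linarith
  have hq : 0 < ρ₁ * ρ₂ - 1 := by
    have : 0 < (σ + 2 * γ + 2) * (ρ₁ + 1) := mul_pos hs h1
    exact pos_of_mul_pos_right (this.trans hc) hN0.le
  have hρ₁ : 1 < ρ₁ := by nlinarith
  rw [criticalR] at hr₁ hr₂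
  refine ⟨hN, hσ, hγ, hs, hσN, hρ₂, hρ₁, ?_, ?_, ?_, ?_⟩
  · rw [hr₁, lt_div_iff₀ (by positivity)]
    linarith
  · rw [hr₁, hr₂]
    exact div_le_div_of_nonneg_left (by positivity) (by positivity)
      (mul_le_mul_of_nonneg_right (by linarith) hs.le)
  · rw [hr₁, hr₂]
    field_simp
    ring
  · have hq' : ρ₂ * ρ₁ - 1 ≠ 0 := by rw [mul_comm]; exact hq.ne'
    rw [hr₁, hr₂, mul_comm ρ₁ ρ₂]
    field_simp
    ring

/-- The ratios `θ` for which the nonlinear terms can be estimated in terms of the auxiliary norms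
with exponents `θ r₁` and `θ r₂` alone. -/
structure Window (N : ℕ) (σ γ ρ₁ r₁ r₂ θ : ℝ) : Prop where
  adm : Admissible N r₁ θ
  integrable : ρ₁ / (θ * r₂) - σ / N < 1
  singular : ρ₁ / r₂ * (1 - 1 / θ) < 2 * (1 + γ) / N

/-- The Duhamel term maps the scale with ratio `θ` to the scale with ratio `θ'`. -/
def Reaches (N : ℕ) (σ ρ₁ r₁ r₂ θ θ' : ℝ) : Prop :=
  ρ₁ / (θ * r₂) - 1 / (θ' * r₁) < (2 + σ) / N

namespace SystemParams

variable {N : ℕ} {σ γ ρ₁ ρ₂ r₁ r₂ θ θ' : ℝ}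

theorem dim_pos (Q : SystemParams N σ γ ρ₁ ρ₂ r₁ r₂) : (0 : ℝ) < N := by exact_mod_cast Q.dim

theorem r₁_pos (Q : SystemParams N σ γ ρ₁ ρ₂ r₁ r₂) : 0 < r₁ := one_pos.trans Q.r₁_gt

theorem r₂_gt (Q : SystemParams N σ γ ρ₁ ρ₂ r₁ r₂) : 1 < r₂ := Q.r₁_gt.trans_le Q.r₁_le

theorem r₂_pos (Q : SystemParams N σ γ ρ₁ ρ₂ r₁ r₂) : 0 < r₂ := one_pos.trans Q.r₂_gt

theorem γ_gt (Q : SystemParams N σ γ ρ₁ ρ₂ r₁ r₂) : -1 < γ := by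
  linarith [Q.s_pos, Q.σ_nonpos]

/-- The order of smoothing from L^r to L^{θr} is N(θ-1)/(2rθ). It is less than 1 exactly if θ(N -
2r) < N, which is the admissibility of θ for r = r₁ and weaker for larger r. -/
theorem smoothing_lt_one (Q : SystemParams N σ γ ρ₁ ρ₂ r₁ r₂) (h : Admissible N r₁ θ) {r : ℝ}
    (hr : r₁ ≤ r) : smoothing N r (θ * r) < 1 := by
  have hr0 := Q.r₁_pos.trans_le hr
  have hθ : 0 < θ := one_pos.trans h.1
  have h1 : θ * (N - 2 * r) < N :=
    lt_of_le_of_lt (mul_le_mul_of_nonneg_left ((by linarith : (N : ℝ) - 2 * r ≤ N - 2 * r₁).trans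
      (le_max_left _ _)) hθ.le) h.2
  have e : smoothing N r (θ * r) = (N * (θ - 1)) / (2 * r * θ) := by
    simp only [smoothing]
    field_simp
  rw [e, div_lt_one (by positivity)]
  linarith

/-- By the scaling relation `singular` also yields `gain`: it says that ρ₁/(θr₂) - σ/N exceeds 1/r₁,
which is at least 1/(θ'r₁). The field `order` is `Reaches` multiplied by N/2. -/
theorem duhamelExp₁ (Q : SystemParams N σ γ ρ₁ ρ₂ r₁ r₂) (W : Window N σ γ ρ₁ r₁ r₂ θ)
    (hθ' : 1 ≤ θ') (h : Reaches N σ ρ₁ r₁ r₂ θ θ') :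
    DuhamelExp N σ γ ρ₁ r₂ (θ * r₂) r₁ (θ' * r₁) := by
  have hN := Q.dim_pos
  have hr₁ := Q.r₁_pos
  have hr₂ := Q.r₂_pos
  have hθ : 0 < θ := one_pos.trans W.adm.1
  have e : ρ₁ / (θ * r₂) = ρ₁ / r₂ - ρ₁ / r₂ * (1 - 1 / θ) := by
    field_simp
    ring
  refine ⟨Q.dim, Q.ρ₁_gt.le, Q.σ_nonpos, Q.γ_nonpos, Q.γ_gt.le, hr₂,
    le_mul_of_one_le_left hr₂.le W.adm.1.le, one_le_mul_of_one_le_of_one_le hθ' Q.r₁_gt.le, ?_,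
    W.integrable, ?_, ?_, Q.scaling₁⟩
  · have h1 : 1 / (θ' * r₁) ≤ 1 / r₁ :=
      one_div_le_one_div_of_le hr₁ (le_mul_of_one_le_left hr₁.le hθ')
    have h2 := W.singular
    have h3 := Q.scaling₁
    have h4 : (σ + 2 * γ + 2) / N = σ / N + 2 * (1 + γ) / N := by ring
    linarith
  · have h1 := mul_lt_mul_of_pos_left h (by positivity : (0 : ℝ) < N / 2)
    have h2 : (N : ℝ) / 2 * ((2 + σ) / N) = 1 + σ / 2 := by
      field_simp
    linarith
  · have h1 := mul_lt_mul_of_pos_left W.singular (by positivity : (0 : ℝ) < N / 2)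
    have h2 : (N : ℝ) / 2 * (2 * (1 + γ) / N) = 1 + γ := by
      field_simp
    have h3 : ρ₁ * smoothing N r₂ (θ * r₂) = (N : ℝ) / 2 * (ρ₁ / r₂ * (1 - 1 / θ)) := by
      simp only [smoothing]
      field_simp
    linarith

/-- The conditions of the first equation imply those of the second, because ρ₂/r₁ ≤ ρ₁/r₂ by the
scaling relations and r₁ ≤ r₂. -/
theorem duhamelExp₂ (Q : SystemParams N σ γ ρ₁ ρ₂ r₁ r₂) (W : Window N σ γ ρ₁ r₁ r₂ θ)
    (hθ' : 1 ≤ θ') (h : Reaches N σ ρ₁ r₁ r₂ θ θ') :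
    DuhamelExp N σ γ ρ₂ r₁ (θ * r₁) r₂ (θ' * r₂) := by
  have hN := Q.dim_pos
  have hr₁ := Q.r₁_pos
  have hr₂ := Q.r₂_pos
  have hθ : 0 < θ := one_pos.trans W.adm.1
  have hθ'0 : 0 < θ' := one_pos.trans_le hθ'
  have hx : 0 < 1 - 1 / θ := sub_pos.2 ((div_lt_one hθ).2 W.adm.1)
  have hA : ρ₂ / r₁ ≤ ρ₁ / r₂ := by
    rw [Q.scaling₁, Q.scaling₂]
    have := one_div_le_one_div_of_le hr₁ Q.r₁_le
    linarith
  have e : ρ₂ / (θ * r₁) = ρ₂ / r₁ - ρ₂ / r₁ * (1 - 1 / θ) := by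
    field_simp
    ring
  have hs := (mul_le_mul_of_nonneg_right hA hx.le).trans_lt W.singular
  have e₁ : ρ₁ / (θ * r₂) = ρ₁ / r₂ * (1 / θ) := by field_simp
  have e₂ : ρ₂ / (θ * r₁) = ρ₂ / r₁ * (1 / θ) := by field_simp
  refine ⟨Q.dim, Q.ρ₂_ge, Q.σ_nonpos, Q.γ_nonpos, Q.γ_gt.le, hr₁,
    le_mul_of_one_le_left hr₁.le W.adm.1.le, one_le_mul_of_one_le_of_one_le hθ' Q.r₂_gt.le, ?_,
    ?_, ?_, ?_, Q.scaling₂⟩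
  · have h1 : 1 / (θ' * r₂) ≤ 1 / r₂ :=
      one_div_le_one_div_of_le hr₂ (le_mul_of_one_le_left hr₂.le hθ')
    have h3 := Q.scaling₂
    have h4 : (σ + 2 * γ + 2) / N = σ / N + 2 * (1 + γ) / N := by ring
    linarith
  · have h1 := W.integrable
    have h2 := mul_le_mul_of_nonneg_right hA (by positivity : 0 ≤ 1 / θ)
    linarith
  · have key : ρ₂ / (θ * r₁) - 1 / (θ' * r₂) < (2 + σ) / N := by
      have f₁ : 1 / (θ' * r₁) = 1 / r₁ * (1 / θ') := by field_simp
      have f₂ : 1 / (θ' * r₂) = 1 / r₂ * (1 / θ') := by field_simp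
      -- If the ratio grows, the difference 1/θ - 1/θ' is weighted by 1/r₂ instead of the larger
      -- 1/r₁, and the hypothesis suffices. If it does not grow, that term is at most zero and what
      -- remains is below (σ+2γ+2)/N.
      rcases le_total (1 / θ') (1 / θ) with h1 | h1
      · have h2 := mul_le_mul_of_nonneg_right (one_div_le_one_div_of_le hr₁ Q.r₁_le)
          (sub_nonneg.2 h1)
        have h3 : ρ₁ / (θ * r₂) - 1 / (θ' * r₁) < (2 + σ) / N := h
        rw [e₁, f₁, Q.scaling₁] at h3
        rw [e₂, f₂, Q.scaling₂]
        linarith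
      · rw [e₂, f₂, Q.scaling₂]
        have h2 := mul_le_mul_of_nonneg_left h1 (by positivity : 0 ≤ 1 / r₂)
        have h3 : 0 < (σ + 2 * γ + 2) / N := div_pos Q.s_pos hN
        have h4 := mul_pos h3 hx
        have h5 : (σ + 2 * γ + 2) / N ≤ (2 + σ) / N :=
          div_le_div_of_nonneg_right (by linarith [Q.γ_nonpos]) hN.le
        linarith
    have h1 := mul_lt_mul_of_pos_left key (by positivity : (0 : ℝ) < N / 2)
    have h2 : (N : ℝ) / 2 * ((2 + σ) / N) = 1 + σ / 2 := by
      field_simp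
    linarith
  · have h1 := mul_lt_mul_of_pos_left hs (by positivity : (0 : ℝ) < N / 2)
    have h2 : (N : ℝ) / 2 * (2 * (1 + γ) / N) = 1 + γ := by
      field_simp
    have h3 : ρ₂ * smoothing N r₁ (θ * r₁) = (N : ℝ) / 2 * (ρ₂ / r₁ * (1 - 1 / θ)) := by
      simp only [smoothing]
      field_simp
    linarith

/-- In the variable x = 1/θ all conditions become affine inequalities, and the ratios that reach θ'
are those whose reciprocal lies below an increasing affine function of 1/θ'. -/
theorem reaches_iff (Q : SystemParams N σ γ ρ₁ ρ₂ r₁ r₂) (hθ : 0 < θ) (hθ' : 0 < θ') :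
    Reaches N σ ρ₁ r₁ r₂ θ θ' ↔ 1 / θ < (1 / θ' + r₁ * ((2 + σ) / N)) / (r₁ * (ρ₁ / r₂)) := by
  have hr₁ := Q.r₁_pos
  have hr₂ := Q.r₂_pos
  have hρ : 0 < ρ₁ := one_pos.trans Q.ρ₁_gt
  have e₁ : ρ₁ / (θ * r₂) = ρ₁ / r₂ * (1 / θ) := by field_simp
  have f₁ : 1 / (θ' * r₁) = 1 / r₁ * (1 / θ') := by field_simp
  have e : r₁ * (ρ₁ / r₂ * (1 / θ) - 1 / r₁ * (1 / θ')) =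
      1 / θ * (r₁ * (ρ₁ / r₂)) - 1 / θ' := by
    field_simp
  rw [Reaches, e₁, f₁, lt_div_iff₀ (by positivity : 0 < r₁ * (ρ₁ / r₂)), ← mul_lt_mul_iff_right₀ hr₁, e]
  constructor <;> intro h <;> linarith

theorem reaches_of_le (Q : SystemParams N σ γ ρ₁ ρ₂ r₁ r₂) (hθ : 1 < θ) (hθ' : 0 < θ')
    (h : θ' ≤ θ) : Reaches N σ ρ₁ r₁ r₂ θ θ' := by
  have hr₁ := Q.r₁_pos
  have hN := Q.dim_pos
  have hθ0 : 0 < θ := one_pos.trans hθ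
  have e₁ : ρ₁ / (θ * r₂) = ρ₁ / r₂ * (1 / θ) := by field_simp
  have f₁ : 1 / (θ' * r₁) = 1 / r₁ * (1 / θ') := by field_simp
  have hx : 0 < 1 - 1 / θ := sub_pos.2 ((div_lt_one hθ0).2 hθ)
  have h2 := mul_le_mul_of_nonneg_left (one_div_le_one_div_of_le hθ' h)
    (by positivity : 0 ≤ 1 / r₁)
  have h3 : 0 < (σ + 2 * γ + 2) / N := div_pos Q.s_pos hN
  have h4 := mul_pos h3 hx
  have h5 : (σ + 2 * γ + 2) / N ≤ (2 + σ) / N :=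
    div_le_div_of_nonneg_right (by linarith [Q.γ_nonpos]) hN.le
  rw [Reaches, e₁, f₁, Q.scaling₁]
  linarith

theorem admissible_iff (Q : SystemParams N σ γ ρ₁ ρ₂ r₁ r₂) (hθ : 1 < θ) :
    Admissible N r₁ θ ↔ 1 - 2 * r₁ / N < 1 / θ := by
  have hN := Q.dim_pos
  have hθ0 : 0 < θ := one_pos.trans hθ
  have e : 1 - 2 * r₁ / N < 1 / θ ↔ θ * (N - 2 * r₁) < N := by
    rw [lt_div_iff₀ hθ0, ← mul_lt_mul_iff_left₀ hN]
    have : (1 - 2 * r₁ / N) * θ * N = θ * (N - 2 * r₁) := by field_simp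
    rw [this, one_mul]
  rw [e, Admissible, mul_max_of_nonneg _ _ hθ0.le, max_lt_iff]
  simp [hθ, hN]

theorem window_one_div (Q : SystemParams N σ γ ρ₁ ρ₂ r₁ r₂) {x : ℝ} (hx0 : 0 < x) (hx1 : x < 1)
    (h1 : 1 - 2 * (1 + γ) / N / (ρ₁ / r₂) < x) (h2 : 1 - 2 * r₁ / N < x)
    (h3 : x < (1 + σ / N) / (ρ₁ / r₂)) : Window N σ γ ρ₁ r₁ r₂ (1 / x) := by
  have hr₂ := Q.r₂_pos
  have hρ : 0 < ρ₁ := one_pos.trans Q.ρ₁_gt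
  have hθ : 1 < 1 / x := (one_lt_div hx0).2 hx1
  refine ⟨(Q.admissible_iff hθ).2 (by rwa [one_div_one_div]), ?_, ?_⟩
  · have e : ρ₁ / (1 / x * r₂) = x * (ρ₁ / r₂) := by field_simp
    rw [lt_div_iff₀ (by positivity)] at h3
    rw [e]
    linarith
  · rw [one_div_one_div, mul_comm, ← lt_div_iff₀ (by positivity)]
    linarith

/-- There is a ratio in the window from which every admissible ratio is reached in two steps
through the window. -/
theorem exists_window (Q : SystemParams N σ γ ρ₁ ρ₂ r₁ r₂) :
    ∃ θ₀, Window N σ γ ρ₁ r₁ r₂ θ₀ ∧ ∀ θ', Admissible N r₁ θ' →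
      ∃ θ₁, Window N σ γ ρ₁ r₁ r₂ θ₁ ∧ Reaches N σ ρ₁ r₁ r₂ θ₀ θ₁ ∧
        Reaches N σ ρ₁ r₁ r₂ θ₁ θ' := by
  have hr₁ := Q.r₁_pos
  have hr₂ := Q.r₂_pos
  have hN := Q.dim_pos
  have hγ := Q.γ_gt
  have hρ : 0 < ρ₁ := one_pos.trans Q.ρ₁_gt
  set A := ρ₁ / r₂ with hA
  have hA0 : 0 < A := by positivity
  have hAr : r₁ * A = 1 + r₁ * ((σ + 2 * γ + 2) / N) := by
    rw [hA, Q.scaling₁, mul_add, mul_one_div_cancel hr₁.ne']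
  -- The window in the variable x = 1/θ is the interval between L and min 1 U: the bound L₁ comes
  -- from `singular`, ℓ from admissibility, and U from `integrable`.
  set L₁ := 1 - 2 * (1 + γ) / N / A with hL₁
  set ℓ := max (1 - 2 * r₁ / N) 0 with hℓ
  set L := max L₁ ℓ with hL
  set U := (1 + σ / N) / A with hU
  have hs : 0 < (σ + 2 * γ + 2) / N := div_pos Q.s_pos hN
  have hsum : (σ + 2 * γ + 2) / N = σ / N + 2 * (1 + γ) / N := by ring
  have hγN : 0 < 2 * (1 + γ) / N := by
    have : 0 < 1 + γ := by linarith
    positivity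
  have hγN' : 2 * (1 + γ) / N ≤ 2 / N := div_le_div_of_nonneg_right (by linarith [Q.γ_nonpos]) hN.le
  have hc : (2 + σ) / N = σ / N + 2 / N := by ring
  have hr1 : 1 / r₁ < 1 := (div_lt_one hr₁).2 Q.r₁_gt
  have hA' : A = 1 / r₁ + (σ + 2 * γ + 2) / N := Q.scaling₁
  have hσN : 0 < 1 + σ / N := by
    have h1 := (lt_div_iff₀ hN).2 (by linarith [Q.σ_gt] : -1 * (N : ℝ) < σ)
    linarith
  have hrN : 2 * r₁ / N = r₁ * (2 / N) := by ring
  -- the window is nonempty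
  have hLU : L < min 1 U := by
    refine max_lt (lt_min ?_ ?_) (max_lt (lt_min ?_ ?_) (lt_min one_pos ?_))
    · have : 0 < 2 * (1 + γ) / N / A := by positivity
      linarith
    · rw [hU, lt_div_iff₀ hA0, hL₁, sub_mul, div_mul_cancel₀ _ hA0.ne', one_mul]
      linarith
    · have : 0 < 2 * r₁ / N := by positivity
      linarith
    · rw [hU, lt_div_iff₀ hA0]
      have h1 : (1 - 2 * r₁ / N) * A = A - 2 / N * (r₁ * A) := by ring
      have h2 : 0 < 2 / N * (r₁ * ((σ + 2 * γ + 2) / N)) := by positivity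
      rw [h1, hAr]
      linarith
    · positivity
  -- the lower end of the window reaches every admissible ratio
  have hT : ∀ y, ℓ < y → L < (y + r₁ * ((2 + σ) / N)) / (r₁ * A) := by
    intro y hy
    have h0 : r₁ * ((σ + 2 * γ + 2) / N) ≤ r₁ * ((2 + σ) / N) :=
      mul_le_mul_of_nonneg_left (by linarith) hr₁.le
    rw [lt_div_iff₀ (by positivity)]
    rcases le_total ℓ L₁ with h | h
    · rw [hL, max_eq_left h]
      have h1 : L₁ * (r₁ * A) = r₁ * A - r₁ * (2 * (1 + γ) / N) := by
        rw [hL₁]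
        field_simp
      have h2 : 1 - 2 * r₁ / N < y := (le_max_left _ _).trans_lt hy
      have h3 : r₁ * ((σ + 2 * γ + 2) / N) = r₁ * (σ / N) + r₁ * (2 * (1 + γ) / N) := by
        rw [hsum, mul_add]
      have h4 : r₁ * ((2 + σ) / N) = r₁ * (σ / N) + r₁ * (2 / N) := by rw [hc, mul_add]
      rw [h1, hAr]
      linarith
    · rw [hL, max_eq_right h, hAr]
      have h1 : ℓ ≤ 1 := max_le (by linarith [(by positivity : 0 < 2 * r₁ / N)]) zero_le_one
      have h2 : 0 ≤ ℓ := le_max_right _ _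
      have h3 := mul_le_mul_of_nonneg_right h1 (mul_pos hr₁ hs).le
      linarith
  have hwin : ∀ x, L < x → x < min 1 U → Window N σ γ ρ₁ r₁ r₂ (1 / x) := fun x h1 h2 =>
    Q.window_one_div (((le_max_right _ _).trans (le_max_right _ _)).trans_lt h1)
      (h2.trans_le (min_le_left _ _)) ((le_max_left _ _).trans_lt h1)
      (((le_max_left _ _).trans (le_max_right _ _)).trans_lt h1) (h2.trans_le (min_le_right _ _))
  have hpos : ∀ x, L < x → 0 < x := fun x h =>
    ((le_max_right _ _).trans (le_max_right _ _)).trans_lt h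
  -- The affine bound of `reaches_iff` exceeds L at L itself. So x₀ can be chosen just above L and
  -- below its value there; the bound increases, hence x₀ reaches every x₁ > L.
  have hTL : L < (L + r₁ * ((2 + σ) / N)) / (r₁ * A) := by
    rw [lt_div_iff₀ (by positivity), hAr]
    have h1 := mul_lt_mul_of_pos_right (hLU.trans_le (min_le_left _ _)) (mul_pos hr₁ hs)
    have h0 : r₁ * ((σ + 2 * γ + 2) / N) ≤ r₁ * ((2 + σ) / N) :=
      mul_le_mul_of_nonneg_left (by linarith) hr₁.le
    linarith
  obtain ⟨x₀, hx₀, hx₀'⟩ := exists_between (lt_min hLU hTL)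
  refine ⟨1 / x₀, hwin x₀ hx₀ (hx₀'.trans_le (min_le_left _ _)), fun θ' hθ' => ?_⟩
  have hθ'0 : 0 < θ' := one_pos.trans hθ'.1
  have hy : ℓ < 1 / θ' := max_lt ((Q.admissible_iff hθ'.1).1 hθ') (by positivity)
  obtain ⟨x₁, hx₁, hx₁'⟩ := exists_between (lt_min hLU (hT _ hy))
  have h0 := hpos _ hx₀
  have h1 := hpos _ hx₁
  refine ⟨1 / x₁, hwin x₁ hx₁ (hx₁'.trans_le (min_le_left _ _)), ?_, ?_⟩
  · rw [Q.reaches_iff (by positivity) (by positivity), one_div_one_div, one_div_one_div]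
    refine (hx₀'.trans_le (min_le_right _ _)).trans ?_
    exact div_lt_div_of_pos_right (by linarith) (by positivity)
  · rw [Q.reaches_iff (by positivity) hθ'0, one_div_one_div]
    exact hx₁'.trans_le (min_le_right _ _)

/-- Below two ratios, one in the window and one for which the nonlinear term is integrable, there is
another ratio in the window. -/
theorem exists_window_lt (Q : SystemParams N σ γ ρ₁ ρ₂ r₁ r₂) (W : Window N σ γ ρ₁ r₁ r₂ θ)
    (hθ' : Admissible N r₁ θ') (h : ρ₁ / (θ' * r₂) - σ / N < 1) :
    ∃ θ₁, Window N σ γ ρ₁ r₁ r₂ θ₁ ∧ θ₁ < θ' := by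
  have hr₂ := Q.r₂_pos
  have hρ : 0 < ρ₁ := one_pos.trans Q.ρ₁_gt
  have hA0 : 0 < ρ₁ / r₂ := by positivity
  have key : ∀ θ, 1 < θ → ρ₁ / (θ * r₂) - σ / N < 1 → 1 / θ < min 1 ((1 + σ / N) / (ρ₁ / r₂)) := by
    intro θ hθ h
    have hθ0 : 0 < θ := one_pos.trans hθ
    refine lt_min ((div_lt_one hθ0).2 hθ) ?_
    rw [lt_div_iff₀ hA0]
    have e : 1 / θ * (ρ₁ / r₂) = ρ₁ / (θ * r₂) := by field_simp
    linarith
  -- The lower bounds on x are inherited from the ratio in the window, since x > 1/θ. The upper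
  -- bounds leave room above both 1/θ and 1/θ'.
  obtain ⟨x, hx, hx'⟩ := exists_between (max_lt (key θ W.adm.1 W.integrable) (key θ' hθ'.1 h))
  have hθ0 : 0 < θ := one_pos.trans W.adm.1
  have hθ'0 : 0 < θ' := one_pos.trans hθ'.1
  have h1 := (le_max_left _ _).trans_lt hx
  have h2 := (le_max_right _ _).trans_lt hx
  have hx0 : 0 < x := (by positivity : 0 < 1 / θ).trans h1
  refine ⟨1 / x, Q.window_one_div hx0 (hx'.trans_le (min_le_left _ _)) ?_ ?_
    (hx'.trans_le (min_le_right _ _)), ?_⟩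
  · refine lt_trans ?_ h1
    have h3 := W.singular
    rw [mul_comm, ← lt_div_iff₀ hA0] at h3
    linarith
  · exact ((Q.admissible_iff W.adm.1).1 W.adm).trans h1
  · rw [div_lt_comm₀ hx0 hθ'0]
    exact h2

end SystemParams

/-! ### Interpolation, and passage between mild solutions and jointly measurable systems -/

section Interpolation

variable {N : ℕ} {k α : ℝ}

theorem nrm_le_interpolate {a b c l : ℝ} (ha : 0 < a) (hb : 0 < b) (hc : 0 < c) (hl0 : 0 ≤ l)
    (hl1 : l ≤ 1) (h : 1 / c = (1 - l) / a + l / b) {f : Space N → ℝ} (hf : AEStronglyMeasurable f) :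
    nrm c f ≤ nrm a f ^ (1 - l) * nrm b f ^ l := by
  rw [nrm_eq_lpn hc, nrm_eq_lpn ha, nrm_eq_lpn hb, lpn, lpn, lpn]
  have h1 : c * (1 - l) / a + c * l / b = 1 := by
    have : c * (1 - l) / a + c * l / b = c * ((1 - l) / a + l / b) := by ring
    rw [this, ← h, mul_one_div_cancel hc.ne']
  have hl : 0 ≤ 1 - l := by linarith
  have key := ENNReal.lintegral_mul_norm_pow_le (μ := (volume : Measure (Space N)))
    (hf.enorm.pow_const a) (hf.enorm.pow_const b) (p := c * (1 - l) / a) (q := c * l / b)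
    (by positivity) (by positivity) h1
  have e : ∀ x, (‖f x‖ₑ ^ a) ^ (c * (1 - l) / a) * (‖f x‖ₑ ^ b) ^ (c * l / b) = ‖f x‖ₑ ^ c := by
    intro x
    rw [← ENNReal.rpow_mul, ← ENNReal.rpow_mul, ← ENNReal.rpow_add_of_nonneg _ _ (by positivity)
      (by positivity)]
    congr 1
    field_simp
    ring
  simp_rw [e] at key
  refine (rpow_le_rpow key (by positivity)).trans (le_of_eq ?_)
  rw [mul_rpow_of_nonneg _ _ (by positivity)]
  simp only [← ENNReal.rpow_mul]
  congr 2 <;> field_simp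

/-- The order of smoothing is affine in 1/p and vanishes at p = r, so the weights interpolate
exactly. The positive power of the L^{θr} norm carries the decay at zero, and the positive power of
the L^r norm carries the continuity. -/
theorem Good.interpolate (P : SymbolParams k α) {r θ θ₁ : ℝ} (hr : 1 ≤ r) (h1 : 1 < θ₁) (hθ : θ₁ < θ)
    {u : ℝ → Space N → ℝ} (hu : Measurable (uncurry u)) (hc : ContPos r u) {M : ℝ≥0∞}
    (hM : M ≠ ∞) (hb : ∀ t, 0 < t → nrm r (u t) ≤ M) (hw : wsup k α r (θ * r) u < ∞)
    (hv : Tendsto (wnorm k α r (θ * r) u) (𝓝[>] 0) (𝓝 0)) : Good k α r (θ₁ * r) u := by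
  have hr0 : 0 < r := one_pos.trans_le hr
  have hθ₁0 : 0 < θ₁ := one_pos.trans h1
  have hθ0 : 0 < θ := hθ₁0.trans hθ
  have hθ1 : 0 < 1 - 1 / θ := sub_pos.2 ((div_lt_one hθ0).2 (h1.trans hθ))
  -- The interpolation parameter with 1/(θ₁r) = (1-l)/r + l/(θr); it lies strictly between 0 and 1
  -- since 1 < θ₁ < θ.
  set l := (1 - 1 / θ₁) / (1 - 1 / θ) with hl
  have hl0 : 0 < l := div_pos (sub_pos.2 ((div_lt_one hθ₁0).2 h1)) hθ1
  have hl1 : l < 1 := by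
    rw [hl, div_lt_one hθ1]
    linarith [one_div_lt_one_div_of_lt hθ₁0 hθ]
  have hlθ : l * (1 - 1 / θ) = 1 - 1 / θ₁ := div_mul_cancel₀ _ hθ1.ne'
  have hcomb : 1 / (θ₁ * r) = (1 - l) / r + l / (θ * r) := by
    have h2 : 1 / (θ₁ * r) = 1 / θ₁ / r := by field_simp
    have h3 : (1 - l) / r + l / (θ * r) = (1 - l * (1 - 1 / θ)) / r := by
      field_simp
      ring
    rw [h2, h3, hlθ, sub_sub_cancel]
  have hint : ∀ {f : Space N → ℝ}, AEStronglyMeasurable f →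
      nrm (θ₁ * r) f ≤ nrm r f ^ (1 - l) * nrm (θ * r) f ^ l := fun hf =>
    nrm_le_interpolate hr0 (by positivity) (by positivity) hl0.le hl1.le hcomb hf
  have hsm : smoothing N r (θ₁ * r) = smoothing N r (θ * r) * l := by
    have h2 : smoothing N r (θ₁ * r) = (N : ℝ) / 2 * ((1 - 1 / θ₁) / r) := by
      simp only [smoothing]
      field_simp
    have h3 : smoothing N r (θ * r) = (N : ℝ) / 2 * ((1 - 1 / θ) / r) := by
      simp only [smoothing]
      field_simp
    rw [h2, h3, ← hlθ]
    ring
  have hwn : ∀ t, 0 < t → wnorm k α r (θ₁ * r) u t ≤ M ^ (1 - l) * wnorm k α r (θ * r) u t ^ l := by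
    intro t ht
    have hbr := bracket_pos P ht
    have h2 := (hint (aesm_curve hu t)).trans
      (mul_le_mul_left (rpow_le_rpow (hb t ht) (by linarith)) _)
    refine (mul_le_mul_right h2 _).trans (le_of_eq ?_)
    rw [wnorm, mul_rpow_of_nonneg _ _ hl0.le, bw, bw, hsm, Real.rpow_mul hbr.le,
      ENNReal.ofReal_rpow_of_nonneg (by positivity) hl0.le]
    ring
  have hMl : M ^ (1 - l) ≠ ∞ := rpow_ne_top_of_nonneg (by linarith) hM
  refine ⟨?_, fun t₀ ht₀ => ?_, ?_⟩
  · refine lt_of_le_of_lt (wsup_le fun t ht => (hwn t ht).trans (mul_le_mul_right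
      (rpow_le_rpow (wnorm_le_wsup u ht) hl0.le) _)) ?_
    exact mul_lt_top hMl.lt_top (rpow_lt_top_of_nonneg hl0.le hw.ne)
  · set B : ℝ → ℝ≥0∞ := fun t => ofReal (bracket k α t ^ (-smoothing N r (θ * r))) with hB
    set D := ((B t₀ + 1) + B t₀) * wsup k α r (θ * r) u with hD
    have hD' : D ≠ ∞ := mul_ne_top (add_ne_top.2 ⟨add_ne_top.2
      ⟨ofReal_ne_top, ENNReal.one_ne_top⟩, ofReal_ne_top⟩) hw.ne
    have hBc : Tendsto B (𝓝 t₀) (𝓝 (B t₀)) :=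
      tendsto_ofReal (DuhamelExp.continuousAt_bracket_rpow P ht₀ _)
    have hbd : ∀ t, 0 < t → nrm (θ * r) (u t) ≤ B t * wsup k α r (θ * r) u := fun t ht => by
      rw [nrm_eq_wnorm P r (θ * r) u ht]
      exact mul_le_mul_right (wnorm_le_wsup u ht) _
    have hlim : Tendsto (fun t => nrm r (fun x => u t x - u t₀ x) ^ (1 - l) * D ^ l) (𝓝 t₀) (𝓝 0) := by
      have h3 := ENNReal.Tendsto.mul_const ((hc t₀ ht₀).ennrpow_const (1 - l))
        (Or.inr (rpow_ne_top_of_nonneg hl0.le hD'))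
      rwa [ENNReal.zero_rpow_of_pos (by linarith), zero_mul] at h3
    refine tendsto_zero_of_le hlim ?_
    filter_upwards [lt_mem_nhds ht₀, hBc.eventually (gt_mem_nhds (ENNReal.lt_add_right
      ofReal_ne_top one_ne_zero))] with t ht hBt
    have hm : ∀ s, AEStronglyMeasurable (u s) := fun s => aesm_curve hu s
    refine (hint ((hm t).sub (hm t₀))).trans (mul_le_mul_right (rpow_le_rpow ?_ hl0.le) _)
    refine (nrm_sub_le (one_le_mul_of_one_le_of_one_le (h1.trans hθ).le hr) (hm t) (hm t₀)).trans
      ((add_le_add (hbd t ht) (hbd t₀ ht₀)).trans ?_)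
    rw [hD, add_mul]
    exact add_le_add (mul_le_mul_left hBt.le _) le_rfl
  · have h3 := ENNReal.Tendsto.const_mul (a := M ^ (1 - l)) (hv.ennrpow_const l) (Or.inr hMl)
    rw [ENNReal.zero_rpow_of_pos hl0, mul_zero] at h3
    refine tendsto_zero_of_le h3 ?_
    filter_upwards [self_mem_nhdsWithin] with t ht using hwn t ht

end Interpolation

section Conversion

variable {N : ℕ} {k α σ γ ρ rv pv ru b r p : ℝ}

theorem nrm_weighted (P : SymbolParams k α) (u : ℝ → Space N → ℝ) {t : ℝ} (ht : 0 < t) :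
    nrm p (weighted k α p r u t) = wnorm k α r p u t := by
  have hb := bracket_pos P ht
  have h := eLpNorm_const_smul (bracket k α t ^ invQ N p r) (u t) (ofReal p) volume
  have e : ‖bracket k α t ^ invQ N p r‖ₑ = bw k α (smoothing N r p) t :=
    Real.enorm_of_nonneg (by positivity)
  rw [e] at h
  exact h

theorem MemC.contPos {u : ℝ → Space N → ℝ} (h : MemC p u) : ContPos p u := fun t₀ ht₀ => by
  have h1 := h.2 t₀ ht₀.le
  rwa [nhdsWithin_eq_nhds.2 (Ici_mem_nhds ht₀)] at h1

/-- The bridge from the kernel formulation to superpositions of heat operators. The primed data and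
curve are arbitrary representatives, and only the unprimed ones are measurable; the integrals do not
see the difference. -/
theorem duhamel_eq_mildMap (E : DuhamelExp N σ γ ρ rv pv ru b) (P : SymbolParams k α) {f : ℝ → ℝ}
    (hf : PowerLike ρ f) (hr : 1 ≤ r) {u₀ u₀' : Space N → ℝ} (hu₀ : Measurable u₀) (hu₀r : nrm r u₀ < ∞)
    (hu₀' : u₀' =ᵐ[volume] u₀) {v v' : ℝ → Space N → ℝ} (hv : Measurable (uncurry v))
    (hvM : wsup k α rv pv v < ∞) (hv' : ∀ t, 0 < t → v' t =ᵐ[volume] v t) {t : ℝ} (ht : 0 < t) :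
    ∀ᵐ x : Space N,
      (∀ᵐ s ∂(volume.restrict (Ioo 0 t)),
        Integrable (fun y => solutionKernel N k α (t - s) (x - y) * source σ γ f v' s y)) ∧
      IntervalIntegrable (fun s => solutionOp k α (t - s) (source σ γ f v' s) x) volume 0 t ∧
      solutionOp k α t u₀' x + ∫ s in (0 : ℝ)..t, solutionOp k α (t - s) (source σ γ f v' s) x =
        mildMap k α σ γ f u₀ v t x := by
  have hsrc : ∀ s, 0 < s → source σ γ f v' s =ᵐ[volume] source σ γ f v s := fun s hs => by
    filter_upwards [hv' s hs] with y hy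
    rw [source, source, hy]
  filter_upwards [E.ae_heatAbs_lt_top P hf hv hvM ht, ae_heatAbs_lin_lt_top hr
    (measurable_subDens.of_uncurry_left (x := t)) (moment_subDens_lt_top P ht) hu₀ hu₀r] with x h1 h2
  obtain ⟨ha, hb, hc⟩ := duhamel_conversion E.dim P ht (measurable_source hf.meas hv) h1
  have hop : EqOn (fun s => solutionOp k α (t - s) (source σ γ f v s) x)
      (fun s => solutionOp k α (t - s) (source σ γ f v' s) x) (Ioo 0 t) := fun s hs =>
    solutionOp_congr (sub_ne_zero.2 hs.2.ne') (hsrc s hs.1).symm x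
  refine ⟨?_, ?_, ?_⟩
  · filter_upwards [ha, (ae_restrict_iff' measurableSet_Ioo).2
      (Eventually.of_forall fun s hs => hs)] with s h3 hs
    refine h3.congr ?_
    filter_upwards [hsrc s hs.1] with y hy
    rw [hy]
  · rw [intervalIntegrable_iff_integrableOn_Ioo_of_le ht.le] at hb ⊢
    exact hb.congr_fun hop measurableSet_Ioo
  · rw [solutionOp_congr ht.ne' hu₀', solutionOp_eq_linOp E.dim P ht.ne' hu₀ h2, mildMap, ← hc]
    congr 1
    rw [intervalIntegral.integral_of_le ht.le, intervalIntegral.integral_of_le ht.le,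
      integral_Ioc_eq_integral_Ioo, integral_Ioc_eq_integral_Ioo]
    exact (setIntegral_congr_fun measurableSet_Ioo hop).symm

theorem Duhamel.ae_eq_zero {f : ℝ → ℝ} {u₀ : Space N → ℝ} {u v : ℝ → Space N → ℝ}
    (h : Duhamel k α σ γ f u₀ u v) : u 0 =ᵐ[volume] u₀ := by
  filter_upwards [h 0 (mem_Ici.2 le_rfl)] with x hx
  rw [hx.2.2, intervalIntegral.integral_same, add_zero, solutionOp, if_pos rfl]

/-- Passing to the smaller ratio θ₁ costs nothing and allows it to be chosen inside the window. -/
theorem exists_good_version (P : SymbolParams k α) {θ θ₁ : ℝ} (hr : 1 ≤ r) (h1 : 1 < θ₁) (hθ : θ₁ < θ)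
    {u : ℝ → Space N → ℝ} (h : MemX k α (θ * r) r u) :
    ∃ w : ℝ → Space N → ℝ, Measurable (uncurry w) ∧ (∀ t, 0 < t → w t =ᵐ[volume] u t) ∧
      Good k α r (θ₁ * r) w := by
  have hc := MemC.contPos h.1.1
  obtain ⟨w, hw, hwu⟩ := exists_measurable_version hr hc fun t ht => (h.1.1.1 t ht.le).1
  have hsup : ∀ t, 0 < t → wnorm k α r (θ * r) w t = nrm (θ * r) (weighted k α (θ * r) r u t) :=
    fun t ht => by rw [nrm_weighted P u ht, wnorm_congr (hwu t ht)]
  refine ⟨w, hw, hwu, Good.interpolate P hr h1 hθ hw (hc.congr fun t ht => (hwu t ht).symm)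
    h.1.2.ne (fun t ht => ?_) (lt_of_le_of_lt (wsup_le fun t ht => ?_) h.2.1.2) ?_⟩
  · rw [nrm, eLpNorm_congr_ae (hwu t ht)]
    exact le_biSup (fun t => eLpNorm (u t) (ofReal r) volume) (mem_Ici.2 ht.le)
  · rw [hsup t ht]
    exact le_biSup (fun t => eLpNorm (weighted k α (θ * r) r u t) (ofReal (θ * r)) volume)
      (mem_Ici.2 ht.le)
  · refine h.2.2.congr' ?_
    filter_upwards [self_mem_nhdsWithin] with t ht using (hsup t ht).symm

end Conversion

/-! ### All admissible auxiliary exponents -/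

section Step

variable {N : ℕ} {k α σ γ ρ rv pv ru b : ℝ}

theorem contPos_linOp (P : SymbolParams k α) {r p : ℝ} (hr : 1 ≤ r) (hrp : r ≤ p)
    (hκ : smoothing N r p < 1) {f : Space N → ℝ} (hf : Measurable f) (hfr : nrm r f < ∞) :
    ContPos p fun t => linOp k α t f := fun _ ht₀ => tendsto_linOp_sub P hr hrp hκ hf hfr ht₀

theorem DuhamelExp.contPos_mildMap (E : DuhamelExp N σ γ ρ rv pv ru b) (P : SymbolParams k α)
    (hru : 1 ≤ ru) (hrub : ru ≤ b) (hκ : smoothing N ru b < 1) {f : ℝ → ℝ} (hf : PowerLike ρ f)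
    {u₀ : Space N → ℝ} (hu₀ : Measurable u₀) (hu₀r : nrm ru u₀ < ∞) {v : ℝ → Space N → ℝ}
    (hv : Measurable (uncurry v)) (hvM : wsup k α rv pv v < ∞) (hvc : ContPos pv v) :
    ContPos b (mildMap k α σ γ f u₀ v) :=
  (contPos_linOp P hru hrub hκ hu₀ hu₀r).add E.b_ge (measurable_linOp hu₀)
    (measurable_duhamelOp (measurable_source hf.meas hv)) (E.contPos_duhamelOp P hf hv hvM hvc)

/-- With target exponent b = ru the weight is 1, so the decay of the weighted norm says that the
Duhamel term tends to zero in L^{ru}. The linear part attains the initial value. -/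
theorem DuhamelExp.tendsto_mildMap_sub (E : DuhamelExp N σ γ ρ rv pv ru ru) (P : SymbolParams k α)
    {f : ℝ → ℝ} (hf : PowerLike ρ f)
    {u₀ : Space N → ℝ} (hu₀ : Measurable u₀) (hu₀r : nrm ru u₀ < ∞) {v : ℝ → Space N → ℝ}
    (hv : Measurable (uncurry v)) (hg : Good k α rv pv v) :
    Tendsto (fun t => nrm ru fun x => mildMap k α σ γ f u₀ v t x - u₀ x) (𝓝[>] 0) (𝓝 0) := by
  have h1 := (tendsto_linOp_zero P E.b_ge hu₀ hu₀r).add (E.tendsto_wnorm_duhamelOp P hf hv hg.bdd hg.van)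
  rw [add_zero] at h1
  refine tendsto_zero_of_le h1 (.of_forall fun t => ?_)
  have hD : Measurable (duhamelOp k α (source σ γ f v) t) :=
    Measurable.curve (measurable_duhamelOp (measurable_source hf.meas hv)) t
  have hL : Measurable (linOp k α t u₀) := Measurable.curve (measurable_linOp hu₀) t
  have h2 := nrm_add_le E.b_ge (hL.sub hu₀).aestronglyMeasurable hD.aestronglyMeasurable
  rw [wnorm, smoothing_self, bw, Real.rpow_zero, ofReal_one, one_mul]
  refine le_trans (le_of_eq (congrArg (nrm ru) ?_)) h2
  funext x
  simp only [mildMap, Pi.sub_apply]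
  ring

/-- The new constant depends only on δ and L and not on the data or the solutions, so the step can
be iterated with bounds uniform over all small solutions. -/
theorem MildEst.exists_step {K : ℝ} (e : MildEst N k α σ γ ρ rv pv ru b K) (hK : 1 ≤ K) (hρ : 1 ≤ ρ)
    {f : ℝ → ℝ} (hf : PowerLike ρ f) {δ L : ℝ} (hδ : 0 ≤ δ) (hL : 0 ≤ L) :
    ∃ L' : ℝ, 0 ≤ L' ∧
      (∀ (u₀ : Space N → ℝ) (u v : ℝ → Space N → ℝ), Measurable u₀ → nrm ru u₀ ≤ ofReal δ →
        Measurable (uncurry v) → wsup k α rv pv v ≤ ofReal L →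
        (∀ t, 0 < t → u t =ᵐ[volume] mildMap k α σ γ f u₀ v t) →
        wsup k α ru b u ≤ ofReal L') ∧
      ∀ (u₀ u₀' : Space N → ℝ) (u v u' v' : ℝ → Space N → ℝ) (D : ℝ≥0∞), Measurable u₀ →
        Measurable u₀' → nrm ru u₀ ≤ ofReal δ → nrm ru u₀' ≤ ofReal δ →
        Measurable (uncurry v) → Measurable (uncurry v') →
        wsup k α rv pv v ≤ ofReal L → wsup k α rv pv v' ≤ ofReal L →
        (∀ t, 0 < t → u t =ᵐ[volume] mildMap k α σ γ f u₀ v t) →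
        (∀ t, 0 < t → u' t =ᵐ[volume] mildMap k α σ γ f u₀' v' t) →
        nrm ru (fun x => u₀ x - u₀' x) ≤ D →
        wsup k α rv pv (fun s x => v s x - v' s x) ≤ ofReal L * D →
        wsup k α ru b (fun s x => u s x - u' s x) ≤ ofReal L' * D := by
  have hK0 : 0 ≤ K := zero_le_one.trans hK
  refine ⟨K * (δ + L ^ ρ) + K * (1 + 2 * L ^ (ρ - 1) * L), by positivity,
    fun u₀ u v hu₀ hδ₀ hv hvL hu => ?_,
    fun u₀ u₀' u v u' v' D hu₀ hu₀' hδ₀ hδ₀' hv hv' hvL hvL' hu hu' hD hd => ?_⟩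
  · rw [wsup_congr hu]
    refine (e.bound f hf u₀ hu₀ v hv).trans ((mul_le_mul_right (add_le_add hδ₀
      (rpow_le_rpow hvL (by linarith))) _).trans ?_)
    rw [ENNReal.ofReal_rpow_of_nonneg hL (by linarith), ← ofReal_add hδ (by positivity),
      ← ofReal_mul hK0]
    exact ofReal_le_ofReal (le_add_of_nonneg_right (by positivity))
  · rw [wsup_congr (u := fun s x => u s x - u' s x) (v := fun s x => mildMap k α σ γ f u₀ v s x -
      mildMap k α σ γ f u₀' v' s x) fun t ht => (hu t ht).sub (hu' t ht)]
    have hp : ∀ a : ℝ≥0∞, a ≤ ofReal L → a ^ (ρ - 1) ≤ ofReal (L ^ (ρ - 1)) :=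
      fun a ha => by
        rw [← ENNReal.ofReal_rpow_of_nonneg hL (by linarith)]
        exact rpow_le_rpow ha (by linarith)
    refine (e.lip f hf u₀ u₀' hu₀ hu₀' (hδ₀.trans_lt ofReal_lt_top)
      (hδ₀'.trans_lt ofReal_lt_top) v v' hv hv' (hvL.trans_lt ofReal_lt_top)
      (hvL'.trans_lt ofReal_lt_top)).trans ((mul_le_mul_right (add_le_add hD
      (mul_le_mul' (add_le_add (hp _ hvL) (hp _ hvL')) hd)) _).trans ?_)
    have h1 : 0 ≤ L ^ (ρ - 1) := by positivity
    calc _ = ofReal (K * (1 + 2 * L ^ (ρ - 1) * L)) * D := by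
          rw [ofReal_mul hK0, ofReal_add zero_le_one (by positivity),
            ofReal_mul (q := L) (by positivity), two_mul, ofReal_add h1 h1,
            ofReal_one]
          ring
      _ ≤ _ := mul_le_mul_left (ofReal_le_ofReal
          (le_add_of_nonneg_left (by positivity))) _

end Step

/-! ### From one ratio in the window to all admissible ratios -/

section Controlled

variable {N : ℕ} {k α σ γ ρ₁ ρ₂ r₁ r₂ θ₀ θ θ' δ R : ℝ} {f₁ f₂ : ℝ → ℝ}

/-- Small solutions of the system with small data. -/
structure SmallSystem (k α σ γ : ℝ) (f₁ f₂ : ℝ → ℝ) (r₁ r₂ θ₀ δ R : ℝ) (u₀ v₀ : Space N → ℝ)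
    (u v : ℝ → Space N → ℝ) : Prop extends IsSystem k α σ γ f₁ f₂ u₀ v₀ u v where
  meas_u₀ : Measurable u₀
  meas_v₀ : Measurable v₀
  u₀_le : nrm r₁ u₀ ≤ ofReal δ
  v₀_le : nrm r₂ v₀ ≤ ofReal δ
  good_u : Good k α r₁ (θ₀ * r₁) u
  good_v : Good k α r₂ (θ₀ * r₂) v
  u_le : wsup k α r₁ (θ₀ * r₁) u ≤ ofReal R

theorem SmallSystem.u₀_lt {u₀ v₀ : Space N → ℝ} {u v : ℝ → Space N → ℝ}
    (H : SmallSystem k α σ γ f₁ f₂ r₁ r₂ θ₀ δ R u₀ v₀ u v) : nrm r₁ u₀ < ∞ :=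
  H.u₀_le.trans_lt ofReal_lt_top

theorem SmallSystem.v₀_lt {u₀ v₀ : Space N → ℝ} {u v : ℝ → Space N → ℝ}
    (H : SmallSystem k α σ γ f₁ f₂ r₁ r₂ θ₀ δ R u₀ v₀ u v) : nrm r₂ v₀ < ∞ :=
  H.v₀_le.trans_lt ofReal_lt_top

/-- Continuity, decay at zero, and uniform and Lipschitz bounds for small solutions in the norms
with ratio `θ`. -/
structure Controlled (N : ℕ) (k α σ γ : ℝ) (f₁ f₂ : ℝ → ℝ) (r₁ r₂ θ₀ δ R θ : ℝ) : Prop where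
  cont : ∀ (u₀ v₀ : Space N → ℝ) (u v : ℝ → Space N → ℝ),
    SmallSystem k α σ γ f₁ f₂ r₁ r₂ θ₀ δ R u₀ v₀ u v → ContPos (θ * r₁) u ∧ ContPos (θ * r₂) v
  van : 1 < θ → ∀ (u₀ v₀ : Space N → ℝ) (u v : ℝ → Space N → ℝ),
    SmallSystem k α σ γ f₁ f₂ r₁ r₂ θ₀ δ R u₀ v₀ u v →
      Tendsto (wnorm k α r₁ (θ * r₁) u) (𝓝[>] 0) (𝓝 0) ∧
      Tendsto (wnorm k α r₂ (θ * r₂) v) (𝓝[>] 0) (𝓝 0)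
  est : ∃ L : ℝ, 0 ≤ L ∧
    (∀ (u₀ v₀ : Space N → ℝ) (u v : ℝ → Space N → ℝ),
      SmallSystem k α σ γ f₁ f₂ r₁ r₂ θ₀ δ R u₀ v₀ u v →
        wsup k α r₁ (θ * r₁) u ≤ ofReal L ∧ wsup k α r₂ (θ * r₂) v ≤ ofReal L) ∧
    ∀ (u₀ v₀ : Space N → ℝ) (u v : ℝ → Space N → ℝ) (u₀' v₀' : Space N → ℝ)
      (u' v' : ℝ → Space N → ℝ), SmallSystem k α σ γ f₁ f₂ r₁ r₂ θ₀ δ R u₀ v₀ u v →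
      SmallSystem k α σ γ f₁ f₂ r₁ r₂ θ₀ δ R u₀' v₀' u' v' →
        wsup k α r₁ (θ * r₁) (fun s x => u s x - u' s x) ≤ ofReal L *
          (nrm r₁ (fun x => u₀ x - u₀' x) + nrm r₂ (fun x => v₀ x - v₀' x)) ∧
        wsup k α r₂ (θ * r₂) (fun s x => v s x - v' s x) ≤ ofReal L *
          (nrm r₁ (fun x => u₀ x - u₀' x) + nrm r₂ (fun x => v₀ x - v₀' x))

theorem Controlled.good (C : Controlled N k α σ γ f₁ f₂ r₁ r₂ θ₀ δ R θ) (hθ : 1 < θ)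
    {u₀ v₀ : Space N → ℝ} {u v : ℝ → Space N → ℝ}
    (H : SmallSystem k α σ γ f₁ f₂ r₁ r₂ θ₀ δ R u₀ v₀ u v) :
    Good k α r₁ (θ * r₁) u ∧ Good k α r₂ (θ * r₂) v := by
  obtain ⟨L, -, hL, -⟩ := C.est
  obtain ⟨h1, h2⟩ := hL _ _ _ _ H
  obtain ⟨h3, h4⟩ := C.cont _ _ _ _ H
  obtain ⟨h5, h6⟩ := C.van hθ _ _ _ _ H
  exact ⟨⟨h1.trans_lt ofReal_lt_top, h3, h5⟩, ⟨h2.trans_lt ofReal_lt_top, h4, h6⟩⟩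

/-- Any property of small solutions at a ratio in the window is carried by the mild equations to
every ratio it reaches. The value θ' = 1 is included for the norms of L^{r_i}; decay at zero is
false there in general and is claimed only for ratios above 1. -/
theorem Controlled.step (Q : SystemParams N σ γ ρ₁ ρ₂ r₁ r₂) (P : SymbolParams k α)
    (hf₁ : PowerLike ρ₁ f₁) (hf₂ : PowerLike ρ₂ f₂) (hδ : 0 ≤ δ)
    (C : Controlled N k α σ γ f₁ f₂ r₁ r₂ θ₀ δ R θ) (W : Window N σ γ ρ₁ r₁ r₂ θ) (hθ' : 1 ≤ θ')
    (h : Reaches N σ ρ₁ r₁ r₂ θ θ') (hκ₁ : smoothing N r₁ (θ' * r₁) < 1)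
    (hκ₂ : smoothing N r₂ (θ' * r₂) < 1) : Controlled N k α σ γ f₁ f₂ r₁ r₂ θ₀ δ R θ' := by
  have E₁ := Q.duhamelExp₁ W hθ' h
  have E₂ := Q.duhamelExp₂ W hθ' h
  have hr₁ := Q.r₁_gt.le
  have hr₂ := Q.r₂_gt.le
  have hp₁ : r₁ ≤ θ' * r₁ := le_mul_of_one_le_left Q.r₁_pos.le hθ'
  have hp₂ : r₂ ≤ θ' * r₂ := le_mul_of_one_le_left Q.r₂_pos.le hθ'
  obtain ⟨K₁, hK₁, e₁⟩ := E₁.exists_mildEst P hr₁ hp₁ hκ₁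
  obtain ⟨K₂, hK₂, e₂⟩ := E₂.exists_mildEst P hr₂ hp₂ hκ₂
  refine ⟨fun u₀ v₀ u v H => ?_, fun hθ u₀ v₀ u v H => ?_, ?_⟩
  · obtain ⟨g₁, g₂⟩ := C.good W.adm.1 H
    exact ⟨(E₁.contPos_mildMap P hr₁ hp₁ hκ₁ hf₁ H.meas_u₀ H.u₀_lt
      H.meas_v g₂.bdd g₂.cont).congr fun t ht => (H.eq_u t ht).symm,
      (E₂.contPos_mildMap P hr₂ hp₂ hκ₂ hf₂ H.meas_v₀ H.v₀_lt
      H.meas_u g₁.bdd g₁.cont).congr fun t ht => (H.eq_v t ht).symm⟩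
  · obtain ⟨g₁, g₂⟩ := C.good W.adm.1 H
    exact ⟨((E₁.good_mildMap P hr₁ (lt_mul_of_one_lt_left Q.r₁_pos hθ) hκ₁ hf₁ H.meas_u₀
      H.u₀_lt H.meas_v g₂).congr
        fun t ht => (H.eq_u t ht).symm).van,
      ((E₂.good_mildMap P hr₂ (lt_mul_of_one_lt_left Q.r₂_pos hθ) hκ₂ hf₂ H.meas_v₀
      H.v₀_lt H.meas_u g₁).congr
        fun t ht => (H.eq_v t ht).symm).van⟩
  · obtain ⟨L, hL0, hL, hLip⟩ := C.est
    obtain ⟨L₁, hL₁, hb₁, hl₁⟩ := e₁.exists_step hK₁ E₁.one_le hf₁ hδ hL0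
    obtain ⟨L₂, hL₂, hb₂, hl₂⟩ := e₂.exists_step hK₂ E₂.one_le hf₂ hδ hL0
    refine ⟨L₁ + L₂, by positivity, fun u₀ v₀ u v H => ?_,
      fun u₀ v₀ u v u₀' v₀' u' v' H H' => ?_⟩
    · obtain ⟨h1, h2⟩ := hL _ _ _ _ H
      exact ⟨(hb₁ u₀ u v H.meas_u₀ H.u₀_le H.meas_v h2 H.eq_u).trans
        (ofReal_le_ofReal (by linarith)),
        (hb₂ v₀ v u H.meas_v₀ H.v₀_le H.meas_u h1 H.eq_v).trans
        (ofReal_le_ofReal (by linarith))⟩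
    · obtain ⟨h1, h2⟩ := hL _ _ _ _ H
      obtain ⟨h1', h2'⟩ := hL _ _ _ _ H'
      obtain ⟨h3, h4⟩ := hLip _ _ _ _ _ _ _ _ H H'
      exact ⟨(hl₁ u₀ u₀' u v u' v' _ H.meas_u₀ H'.meas_u₀ H.u₀_le H'.u₀_le H.meas_v H'.meas_v h2 h2'
        H.eq_u H'.eq_u le_self_add h4).trans
        (mul_le_mul_left (ofReal_le_ofReal (by linarith)) _),
        (hl₂ v₀ v₀' v u v' u' _ H.meas_v₀ H'.meas_v₀ H.v₀_le H'.v₀_le H.meas_u H'.meas_u h1 h1'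
        H.eq_v H'.eq_v le_add_self h3).trans
        (mul_le_mul_left (ofReal_le_ofReal (by linarith)) _)⟩

/-- Existence of small solutions, and their properties for all admissible ratios. -/
theorem exists_smallSystem (Q : SystemParams N σ γ ρ₁ ρ₂ r₁ r₂) (P : SymbolParams k α)
    (hf₁ : PowerLike ρ₁ f₁) (hf₂ : PowerLike ρ₂ f₂) :
    ∃ θ₀ δ R : ℝ, Window N σ γ ρ₁ r₁ r₂ θ₀ ∧ 0 < δ ∧
      (∀ u₀ v₀ : Space N → ℝ, Measurable u₀ → Measurable v₀ → nrm r₁ u₀ ≤ ofReal δ →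
        nrm r₂ v₀ ≤ ofReal δ → ∃ u v : ℝ → Space N → ℝ,
          SmallSystem k α σ γ f₁ f₂ r₁ r₂ θ₀ δ R u₀ v₀ u v ∧
          (0 ≤ᵐ[volume] u₀ → 0 ≤ᵐ[volume] v₀ → ∀ t, 0 < t → ∀ x, 0 ≤ u t x ∧ 0 ≤ v t x)) ∧
      (∀ θ, Admissible N r₁ θ → Controlled N k α σ γ f₁ f₂ r₁ r₂ θ₀ δ R θ) ∧
      Controlled N k α σ γ f₁ f₂ r₁ r₂ θ₀ δ R 1 := by
  obtain ⟨θ₀, W, hW⟩ := Q.exists_window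
  have hθ₀ := W.adm.1
  have hθ₀0 : 0 < θ₀ := one_pos.trans hθ₀
  have hκ := fun {θ : ℝ} (h : Admissible N r₁ θ) {r : ℝ} (hr : r₁ ≤ r) => Q.smoothing_lt_one h hr
  have hR₀ := Q.reaches_of_le hθ₀ hθ₀0 le_rfl
  have E₁ := Q.duhamelExp₁ W hθ₀.le hR₀
  have E₂ := Q.duhamelExp₂ W hθ₀.le hR₀
  have hr₁ := Q.r₁_gt.le
  have hr₂ := Q.r₂_gt.le
  have hp₁ : r₁ < θ₀ * r₁ := lt_mul_of_one_lt_left Q.r₁_pos hθ₀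
  have hp₂ : r₂ < θ₀ * r₂ := lt_mul_of_one_lt_left Q.r₂_pos hθ₀
  obtain ⟨K₁, hK₁, e₁⟩ := E₁.exists_mildEst P hr₁ hp₁.le (hκ W.adm le_rfl)
  obtain ⟨K₂, hK₂, e₂⟩ := E₂.exists_mildEst P hr₂ hp₂.le (hκ W.adm Q.r₁_le)
  have e₁ := e₁.mono (le_max_left K₁ K₂)
  have e₂ := e₂.mono (le_max_right K₁ K₂)
  set K := max K₁ K₂
  have hK : 1 ≤ K := hK₁.trans (le_max_left _ _)
  obtain ⟨R, S⟩ := exists_smallRadius Q.ρ₁_gt hK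
  have hR := S.pos
  have hδ : 0 < R / (2 * K) := by positivity
  -- At θ₀ the qualitative properties are part of the definition of a small solution, and the bounds
  -- are those of the contraction.
  have C₀ : Controlled N k α σ γ f₁ f₂ r₁ r₂ θ₀ (R / (2 * K)) R θ₀ := by
    refine ⟨fun u₀ v₀ u v H => ⟨H.good_u.cont, H.good_v.cont⟩,
      fun _ u₀ v₀ u v H => ⟨H.good_u.van, H.good_v.van⟩, 2 * K * R + 5 * K ^ 2, by positivity,
      fun u₀ v₀ u v H => ⟨H.u_le.trans (ofReal_le_ofReal (by nlinarith)), ?_⟩,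
      fun u₀ v₀ u v u₀' v₀' u' v' H H' => ?_⟩
    · rw [wsup_congr H.eq_v]
      exact (S.wsup_mildMap_le Q.ρ₂_ge e₂ hf₂ H.meas_v₀ H.v₀_le H.meas_u H.u_le).trans
        (ofReal_le_ofReal (le_add_of_nonneg_right (by positivity)))
    · have h := H.toIsSystem.wsup_sub_le S Q.ρ₁_gt.le Q.ρ₂_ge E₁.b_ge e₁ e₂ hf₁ hf₂ H.meas_u₀
        H.meas_v₀ H'.meas_u₀ H'.meas_v₀ H.u₀_le H.v₀_le H'.u₀_le H'.v₀_le H'.toIsSystem H.u_le H'.u_le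
      have hle : ofReal (5 * K ^ 2) ≤ ofReal (2 * K * R + 5 * K ^ 2) :=
        ofReal_le_ofReal (le_add_of_nonneg_left (by positivity))
      exact ⟨h.1.trans (mul_le_mul_left hle _), h.2.trans (mul_le_mul_left hle _)⟩
  refine ⟨θ₀, R / (2 * K), R, W, hδ, fun u₀ v₀ hu₀ hv₀ hu₀R hv₀R => ?_, fun θ hθ => ?_, ?_⟩
  · obtain ⟨u, v, H, gu, gv, huR, hn⟩ := exists_isSystem P S E₁ E₂ hr₁ hr₂ hp₁ hp₂ (hκ W.adm le_rfl)
      (hκ W.adm Q.r₁_le) e₁ e₂ hf₁ hf₂ hu₀ hv₀ hu₀R hv₀R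
    exact ⟨u, v, ⟨H, hu₀, hv₀, hu₀R, hv₀R, gu, gv, huR⟩, hn⟩
  · obtain ⟨θ₁, W₁, h1, h2⟩ := hW θ hθ
    -- Two steps with an intermediate ratio θ₁ in the window, since θ₀ need not reach θ directly.
    have C₁ := C₀.step Q P hf₁ hf₂ hδ.le W W₁.adm.1.le h1 (hκ W₁.adm le_rfl) (hκ W₁.adm Q.r₁_le)
    exact C₁.step Q P hf₁ hf₂ hδ.le W₁ hθ.1.le h2 (hκ hθ le_rfl) (hκ hθ Q.r₁_le)
  · exact C₀.step Q P hf₁ hf₂ hδ.le W le_rfl (Q.reaches_of_le hθ₀ one_pos hθ₀.le)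
      (by rw [one_mul, smoothing_self]; exact one_pos) (by rw [one_mul, smoothing_self]; exact one_pos)

end Controlled

/-! ### Curves with an initial value -/

section Initial

variable {N : ℕ} {k α r p θ : ℝ}

/-- The curve `u` on `(0,∞)` with value `u₀` at `0`. -/
def withInitial (u₀ : Space N → ℝ) (u : ℝ → Space N → ℝ) (t : ℝ) : Space N → ℝ :=
  if t = 0 then u₀ else u t

theorem withInitial_zero (u₀ : Space N → ℝ) (u : ℝ → Space N → ℝ) : withInitial u₀ u 0 = u₀ :=
  if_pos rfl

theorem withInitial_of_pos (u₀ : Space N → ℝ) (u : ℝ → Space N → ℝ) {t : ℝ} (ht : 0 < t) :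
    withInitial u₀ u t = u t := if_neg ht.ne'

theorem memC_of_contPos {w : ℝ → Space N → ℝ} (hm : ∀ t ∈ Ici (0 : ℝ), MemLp (w t) (ofReal p))
    (hc : ContPos p w) (h0 : Tendsto (fun t => nrm p fun x => w t x - w 0 x) (𝓝[>] 0) (𝓝 0)) :
    MemC p w := by
  refine ⟨hm, fun t₀ ht₀ => ?_⟩
  rcases (mem_Ici.1 ht₀).eq_or_lt with rfl | ht₀
  · rw [← Ioi_insert, nhdsWithin_insert, tendsto_sup]
    refine ⟨tendsto_pure_left.2 fun s hs => ?_, h0⟩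
    rw [sub_self, eLpNorm_zero]
    exact mem_of_mem_nhds hs
  · exact (hc t₀ ht₀).mono_left nhdsWithin_le_nhds

theorem ContPos.weighted (P : SymbolParams k α) (hp : 1 ≤ p) {u : ℝ → Space N → ℝ}
    (hu : Measurable (uncurry u)) (hc : ContPos p u) (hb : ∀ t, 0 < t → nrm p (u t) < ∞) :
    ContPos p (weighted k α p r u) := by
  intro t₀ ht₀
  set g : ℝ → ℝ := fun t => bracket k α t ^ invQ N p r with hg
  have hgc : ContinuousAt g t₀ := DuhamelExp.continuousAt_bracket_rpow P ht₀ _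
  have h1 : Tendsto (fun t => ‖g t‖ₑ * nrm p (fun x => u t x - u t₀ x) + ‖g t - g t₀‖ₑ * nrm p (u t₀))
      (𝓝 t₀) (𝓝 (‖g t₀‖ₑ * 0 + ‖(0 : ℝ)‖ₑ * nrm p (u t₀))) := by
    refine (ENNReal.Tendsto.mul hgc.enorm (Or.inr (by simp)) (hc t₀ ht₀) (Or.inr (by simp))).add
      (ENNReal.Tendsto.mul_const ?_ (Or.inr (hb t₀ ht₀).ne))
    have h2 : Tendsto (fun t => g t - g t₀) (𝓝 t₀) (𝓝 (g t₀ - g t₀)) := hgc.sub_const _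
    rw [sub_self] at h2
    exact h2.enorm
  rw [mul_zero, enorm_zero, zero_mul, add_zero] at h1
  refine tendsto_zero_of_le h1 (.of_forall fun t => ?_)
  have hm : ∀ s, Measurable (u s) := fun s => Measurable.curve hu s
  have e1 : nrm p (fun x => g t * (u t x - u t₀ x)) = ‖g t‖ₑ * nrm p fun x => u t x - u t₀ x :=
    eLpNorm_const_smul (g t) (fun x => u t x - u t₀ x) _ _
  have e2 : nrm p (fun x => (g t - g t₀) * u t₀ x) = ‖g t - g t₀‖ₑ * nrm p (u t₀) :=
    eLpNorm_const_smul (g t - g t₀) (u t₀) _ _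
  have h3 := nrm_add_le hp (((hm t).sub (hm t₀)).const_mul (g t)).aestronglyMeasurable
    ((hm t₀).const_mul (g t - g t₀)).aestronglyMeasurable
  refine le_trans (le_of_eq (congrArg (nrm p) ?_)) (h3.trans (le_of_eq (congrArg₂ _ e1 e2)))
  funext x
  simp only [RayleighStokes.weighted, Pi.sub_apply, hg]
  ring

theorem ContPos.withInitial {u : ℝ → Space N → ℝ} (hc : ContPos p u) (u₀ : Space N → ℝ) :
    ContPos p (withInitial u₀ u) :=
  hc.congr fun t ht => by rw [withInitial_of_pos u₀ u ht]

theorem bracket_zero (P : SymbolParams k α) : bracket k α 0 = 0 := by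
  rw [bracket, Real.zero_rpow (by linarith [P.α_lt]), mul_zero, add_zero]

theorem weighted_zero (P : SymbolParams k α) (hN : 1 ≤ N) (hr : 0 < r) (hrp : r < p)
    (u : ℝ → Space N → ℝ) : weighted k α p r u 0 = 0 := by
  have hN0 : (0 : ℝ) < N := by exact_mod_cast hN
  have h1 : 0 < invQ N p r :=
    mul_pos (by positivity) (sub_pos.2 (one_div_lt_one_div_of_lt hr hrp))
  funext x
  rw [weighted, bracket_zero P, Real.zero_rpow h1.ne', zero_mul, Pi.zero_apply]

theorem wnorm_self (u : ℝ → Space N → ℝ) (t : ℝ) : wnorm k α r r u t = nrm r (u t) := by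
  rw [wnorm, smoothing_self, bw, Real.rpow_zero, ofReal_one, one_mul]

theorem supNorm_le {w : ℝ → Space N → ℝ} {M : ℝ≥0∞} (h0 : nrm p (w 0) ≤ M)
    (h : ∀ t, 0 < t → nrm p (w t) ≤ M) : supNorm p w ≤ M :=
  iSup₂_le fun t ht => (mem_Ici.1 ht).eq_or_lt.elim (fun e => e ▸ h0) (h t)

/-- At t = 0 the curve is continuous in L^r by the attained initial value. The weighted curve is
zero there, because ⟨0⟩ = 0 and the exponent is positive, so its continuity at 0 is the decay of the
weighted norm. -/
theorem memX_withInitial (P : SymbolParams k α) (hN : 1 ≤ N) (hr : 1 ≤ r) (hrp : r < p)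
    {u₀ : Space N → ℝ} (hu₀ : MemLp u₀ (ofReal r)) {u : ℝ → Space N → ℝ}
    (hu : Measurable (uncurry u)) (hc : ContPos r u) (hb : wsup k α r r u < ∞)
    (h0 : Tendsto (fun t => nrm r fun x => u t x - u₀ x) (𝓝[>] 0) (𝓝 0)) (hg : Good k α r p u) :
    MemX k α p r (withInitial u₀ u) := by
  have hr0 : 0 < r := one_pos.trans_le hr
  have hbr : ∀ t, 0 < t → nrm r (u t) ≤ wsup k α r r u := fun t ht => by
    rw [← wnorm_self (k := k) (α := α)]
    exact wnorm_le_wsup u ht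
  have hbp : ∀ t, 0 < t → nrm p (u t) < ∞ := fun t ht => by
    rw [nrm_eq_wnorm P r p u ht]
    exact mul_lt_top ofReal_lt_top ((wnorm_le_wsup u ht).trans_lt hg.bdd)
  have hw : ∀ t, 0 < t → weighted k α p r (withInitial u₀ u) t = weighted k α p r u t := by
    intro t ht
    funext x
    rw [weighted, weighted, withInitial_of_pos u₀ u ht]
  have hwn : ∀ t, 0 < t → nrm p (weighted k α p r (withInitial u₀ u) t) = wnorm k α r p u t :=
    fun t ht => by rw [hw t ht, nrm_weighted P u ht]
  have hz := weighted_zero P hN hr0 hrp (withInitial u₀ u)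
  have hvan : Tendsto (fun t => nrm p (weighted k α p r (withInitial u₀ u) t)) (𝓝[>] 0) (𝓝 0) := by
    refine hg.van.congr' ?_
    filter_upwards [self_mem_nhdsWithin] with t ht using (hwn t ht).symm
  refine ⟨⟨memC_of_contPos (fun t ht => ?_) (hc.withInitial u₀) ?_, ?_⟩,
    ⟨memC_of_contPos (fun t ht => ?_) ?_ ?_, ?_⟩, hvan⟩
  · rcases (mem_Ici.1 ht).eq_or_lt with rfl | ht
    · rwa [withInitial_zero]
    · rw [withInitial_of_pos u₀ u ht]
      exact ⟨(aesm_curve hu t), (hbr t ht).trans_lt hb⟩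
  · refine h0.congr' ?_
    filter_upwards [self_mem_nhdsWithin] with t ht
    rw [withInitial_of_pos u₀ u ht, withInitial_zero]
  · refine lt_of_le_of_lt (supNorm_le (M := max (nrm r u₀) (wsup k α r r u)) ?_ fun t ht => ?_)
      (max_lt hu₀.2 hb)
    · rw [withInitial_zero]
      exact le_max_left _ _
    · rw [withInitial_of_pos u₀ u ht]
      exact (hbr t ht).trans (le_max_right _ _)
  · rcases (mem_Ici.1 ht).eq_or_lt with rfl | ht
    · rw [hz]
      exact MemLp.zero
    · refine ⟨?_, ?_⟩
      · rw [hw t ht]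
        exact ((Measurable.curve hu t).const_mul _).aestronglyMeasurable
      · exact (hwn t ht).trans_lt ((wnorm_le_wsup u ht).trans_lt hg.bdd)
  · exact (ContPos.weighted P (hr.trans hrp.le) hu hg.cont hbp).congr fun t ht => by rw [hw t ht]
  · rw [hz]
    simpa using hvan
  · refine lt_of_le_of_lt (supNorm_le (M := wsup k α r p u) ?_ fun t ht => ?_) hg.bdd
    · rw [hz, nrm, eLpNorm_zero]
      exact zero_le
    · exact (hwn t ht).trans_le (wnorm_le_wsup u ht)

theorem normX_sub_le (P : SymbolParams k α) (hN : 1 ≤ N) (hr : 0 < r) (hrp : r < p)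
    {w w' u u' : ℝ → Space N → ℝ} {L M : ℝ≥0∞} (h0 : nrm r (w' 0 - w 0) ≤ L)
    (h : ∀ t, 0 < t → w t =ᵐ[volume] u t) (h' : ∀ t, 0 < t → w' t =ᵐ[volume] u' t)
    (hL : wsup k α r r (fun s x => u' s x - u s x) ≤ L)
    (hM : wsup k α r p (fun s x => u' s x - u s x) ≤ M) :
    normX k α p r (w' - w) ≤ L + M := by
  have hd : ∀ t, 0 < t → (w' - w) t =ᵐ[volume] fun x => u' t x - u t x := fun t ht =>
    (h' t ht).sub (h t ht)
  refine add_le_add (supNorm_le h0 fun t ht => ?_) (supNorm_le ?_ fun t ht => ?_)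
  · rw [nrm, eLpNorm_congr_ae (hd t ht)]
    exact (wnorm_self (k := k) (α := α) (fun s x => u' s x - u s x) t).symm.trans_le
      ((wnorm_le_wsup _ ht).trans hL)
  · rw [weighted_zero P hN hr hrp, nrm, eLpNorm_zero]
    exact zero_le
  · rw [nrm_weighted P (w' - w) ht, wnorm_congr (v := fun s x => u' s x - u s x) (hd t ht)]
    exact (wnorm_le_wsup _ ht).trans hM

end Initial

/-! ### Small systems as global solutions, and their uniqueness -/

section Solutions

variable {N : ℕ} {k α σ γ ρ rv pv ru b ρ₁ ρ₂ r₁ r₂ θ₀ θ δ R : ℝ} {f₁ f₂ : ℝ → ℝ}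
  {u₀ v₀ u₁ v₁ : Space N → ℝ} {u v w z : ℝ → Space N → ℝ}

theorem DuhamelExp.duhamel_withInitial (E : DuhamelExp N σ γ ρ rv pv ru b) (P : SymbolParams k α)
    (hru : 1 ≤ ru) {f : ℝ → ℝ} (hf : PowerLike ρ f) (hu₁ : Measurable u₁) (hu₁r : nrm ru u₁ < ∞)
    (hu₀ : u₀ =ᵐ[volume] u₁) (hv : Measurable (uncurry v)) (hvM : wsup k α rv pv v < ∞)
    (hu : ∀ t, 0 < t → u t =ᵐ[volume] mildMap k α σ γ f u₁ v t) :
    Duhamel k α σ γ f u₀ (withInitial u₀ u) (withInitial v₀ v) := by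
  intro t ht
  rcases (mem_Ici.1 ht).eq_or_lt with rfl | ht
  · refine Eventually.of_forall fun x => ⟨by simp, by simp, ?_⟩
    rw [withInitial_zero, solutionOp, if_pos rfl, intervalIntegral.integral_same, add_zero]
  · filter_upwards [hu t ht, duhamel_eq_mildMap E P hf hru hu₁ hu₁r hu₀ hv hvM
      (v' := withInitial v₀ v) (fun s hs => by rw [withInitial_of_pos v₀ v hs]) ht] with x h1 h2
    refine ⟨h2.1, h2.2.1, ?_⟩
    rw [withInitial_of_pos u₀ u ht, h1, h2.2.2]

theorem SmallSystem.isGlobalSolution (Q : SystemParams N σ γ ρ₁ ρ₂ r₁ r₂) (P : SymbolParams k α)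
    (hf₁ : PowerLike ρ₁ f₁) (hf₂ : PowerLike ρ₂ f₂) (W : Window N σ γ ρ₁ r₁ r₂ θ₀)
    (hC : ∀ θ, Admissible N r₁ θ → Controlled N k α σ γ f₁ f₂ r₁ r₂ θ₀ δ R θ)
    (hC₁ : Controlled N k α σ γ f₁ f₂ r₁ r₂ θ₀ δ R 1)
    (H : SmallSystem k α σ γ f₁ f₂ r₁ r₂ θ₀ δ R u₁ v₁ u v)
    (hu₀ : MemLp u₀ (ofReal r₁)) (hv₀ : MemLp v₀ (ofReal r₂))
    (hu : u₀ =ᵐ[volume] u₁) (hv : v₀ =ᵐ[volume] v₁) :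
    IsGlobalSolution k α σ γ f₁ f₂ r₁ r₂ u₀ v₀ (withInitial u₀ u) (withInitial v₀ v) := by
  have hr₁ := Q.r₁_gt.le
  have hr₂ := Q.r₂_gt.le
  -- The target ratio 1 gives the Duhamel estimate in L^{r_i} without weight, by which the initial
  -- value is attained.
  have hR := Q.reaches_of_le W.adm.1 one_pos W.adm.1.le
  have E₁ := Q.duhamelExp₁ W le_rfl hR
  have E₂ := Q.duhamelExp₂ W le_rfl hR
  rw [one_mul] at E₁ E₂
  obtain ⟨c₁, c₂⟩ := hC₁.cont _ _ _ _ H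
  obtain ⟨L, -, hL, -⟩ := hC₁.est
  obtain ⟨b₁, b₂⟩ := hL _ _ _ _ H
  rw [one_mul] at c₁ c₂ b₁ b₂
  have key : ∀ {r : ℝ} {a a' : Space N → ℝ} {y y' : ℝ → Space N → ℝ}, a' =ᵐ[volume] a →
      (∀ t, 0 < t → y t =ᵐ[volume] y' t) →
      Tendsto (fun t => nrm r fun x => y' t x - a x) (𝓝[>] 0) (𝓝 0) →
      Tendsto (fun t => nrm r fun x => y t x - a' x) (𝓝[>] 0) (𝓝 0) := by
    intro r a a' y y' ha hy h
    refine h.congr' ?_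
    filter_upwards [self_mem_nhdsWithin] with t ht using eLpNorm_congr_ae ((hy t ht).sub ha).symm
  have hX : ∀ θ, Admissible N r₁ θ → MemX k α (θ * r₁) r₁ (withInitial u₀ u) ∧
      MemX k α (θ * r₂) r₂ (withInitial v₀ v) := by
    intro θ hθ
    obtain ⟨g₁, g₂⟩ := (hC θ hθ).good hθ.1 H
    exact ⟨memX_withInitial P Q.dim hr₁ (lt_mul_of_one_lt_left Q.r₁_pos hθ.1) hu₀ H.meas_u c₁
      (b₁.trans_lt ofReal_lt_top) (key hu H.eq_u
        (E₁.tendsto_mildMap_sub P hf₁ H.meas_u₀ H.u₀_lt H.meas_v H.good_v)) g₁,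
      memX_withInitial P Q.dim hr₂ (lt_mul_of_one_lt_left Q.r₂_pos hθ.1) hv₀ H.meas_v c₂
      (b₂.trans_lt ofReal_lt_top) (key hv H.eq_v
        (E₂.tendsto_mildMap_sub P hf₂ H.meas_v₀ H.v₀_lt H.meas_u H.good_u)) g₂⟩
  exact ⟨⟨(hX θ₀ W.adm).1.1.1, (hX θ₀ W.adm).2.1.1,
    E₁.duhamel_withInitial P hr₁ hf₁ H.meas_u₀ H.u₀_lt hu H.meas_v H.good_v.bdd H.eq_u,
    E₂.duhamel_withInitial P hr₂ hf₂ H.meas_v₀ H.v₀_lt hv H.meas_u H.good_u.bdd H.eq_v⟩, hX⟩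

/-- A small solution agrees with every mild solution in the space of one admissible ratio for which
the nonlinear term is locally integrable. -/
theorem SmallSystem.ae_eq (Q : SystemParams N σ γ ρ₁ ρ₂ r₁ r₂) (P : SymbolParams k α)
    (hf₁ : PowerLike ρ₁ f₁) (hf₂ : PowerLike ρ₂ f₂) (W : Window N σ γ ρ₁ r₁ r₂ θ₀)
    (hC : ∀ θ, Admissible N r₁ θ → Controlled N k α σ γ f₁ f₂ r₁ r₂ θ₀ δ R θ)
    (H : SmallSystem k α σ γ f₁ f₂ r₁ r₂ θ₀ δ R u₁ v₁ u v)
    (hu : u₀ =ᵐ[volume] u₁) (hv : v₀ =ᵐ[volume] v₁) (hθ : Admissible N r₁ θ)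
    (hint : ρ₁ / (θ * r₂) - σ / N < 1) (hS : IsMildSolution k α σ γ f₁ f₂ r₁ r₂ u₀ v₀ w z)
    (hw : MemX k α (θ * r₁) r₁ w) (hz : MemX k α (θ * r₂) r₂ z) {t : ℝ} (ht : 0 < t) :
    w t =ᵐ[volume] u t ∧ z t =ᵐ[volume] v t := by
  -- The given ratio may lie above the window, where `singular` fails. Interpolation moves both
  -- solutions to a smaller ratio in the window, and they are compared there.
  obtain ⟨θ₁, W₁, hlt⟩ := Q.exists_window_lt W hθ hint
  have hθ₁ := W₁.adm.1
  have hr₁ := Q.r₁_gt.le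
  have hr₂ := Q.r₂_gt.le
  have hR := Q.reaches_of_le hθ₁ (one_pos.trans hθ₁) le_rfl
  have E₁ := Q.duhamelExp₁ W₁ hθ₁.le hR
  have E₂ := Q.duhamelExp₂ W₁ hθ₁.le hR
  obtain ⟨w', hw'm, hw', gw⟩ := exists_good_version P hr₁ hθ₁ hlt hw
  obtain ⟨z', hz'm, hz', gz⟩ := exists_good_version P hr₂ hθ₁ hlt hz
  have H' : IsSystem k α σ γ f₁ f₂ u₁ v₁ w' z' := by
    refine ⟨hw'm, hz'm, fun s hs => ?_, fun s hs => ?_⟩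
    · filter_upwards [hw' s hs, hS.eq_u s hs.le, duhamel_eq_mildMap E₁ P hf₁ hr₁ H.meas_u₀
        H.u₀_lt hu hz'm gz.bdd (fun s hs => (hz' s hs).symm) hs]
        with x h1 h2 h3
      rw [h1, h2.2.2, h3.2.2]
    · filter_upwards [hz' s hs, hS.eq_v s hs.le, duhamel_eq_mildMap E₂ P hf₂ hr₂ H.meas_v₀
        H.v₀_lt hv hw'm gw.bdd (fun s hs => (hw' s hs).symm) hs]
        with x h1 h2 h3
      rw [h1, h2.2.2, h3.2.2]
  obtain ⟨g₁, g₂⟩ := (hC θ₁ W₁.adm).good hθ₁ H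
  obtain ⟨h1, h2⟩ := H'.unique P E₁ E₂ Q.ρ₁_gt hf₁ hf₂ H.toIsSystem gw gz g₁ g₂ ht
  exact ⟨(hw' t ht).symm.trans h1, (hz' t ht).symm.trans h2⟩

end Solutions

/-! ### Lipschitz dependence on the data -/

section Dependence

variable {N : ℕ} {k α σ γ ρ₁ ρ₂ r₁ r₂ θ₀ θ δ R : ℝ} {f₁ f₂ : ℝ → ℝ}

/-- Small mild solutions with equal ratios depend Lipschitz continuously on the data. -/
theorem exists_normX_sub_le (Q : SystemParams N σ γ ρ₁ ρ₂ r₁ r₂) (P : SymbolParams k α)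
    (hf₁ : PowerLike ρ₁ f₁) (hf₂ : PowerLike ρ₂ f₂) (W : Window N σ γ ρ₁ r₁ r₂ θ₀)
    (hC : ∀ θ, Admissible N r₁ θ → Controlled N k α σ γ f₁ f₂ r₁ r₂ θ₀ δ R θ)
    (hC₁ : Controlled N k α σ γ f₁ f₂ r₁ r₂ θ₀ δ R 1) (hθ : Admissible N r₁ θ) :
    ∃ L : ℝ, 0 < L ∧ ∀ (u₀ v₀ u₁ v₁ : Space N → ℝ) (u v w z : ℝ → Space N → ℝ)
      (u₀' v₀' u₁' v₁' : Space N → ℝ) (u' v' w' z' : ℝ → Space N → ℝ),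
      SmallSystem k α σ γ f₁ f₂ r₁ r₂ θ₀ δ R u₁ v₁ u v → u₀ =ᵐ[volume] u₁ → v₀ =ᵐ[volume] v₁ →
      IsGlobalSolution k α σ γ f₁ f₂ r₁ r₂ u₀ v₀ w z →
      SmallSystem k α σ γ f₁ f₂ r₁ r₂ θ₀ δ R u₁' v₁' u' v' → u₀' =ᵐ[volume] u₁' →
      v₀' =ᵐ[volume] v₁' → IsGlobalSolution k α σ γ f₁ f₂ r₁ r₂ u₀' v₀' w' z' →
      max (normX k α (θ * r₁) r₁ (w' - w)) (normX k α (θ * r₂) r₂ (z' - z)) ≤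
        ofReal L * (nrm r₁ (u₀' - u₀) + nrm r₂ (v₀' - v₀)) := by
  obtain ⟨L₁, hL₁0, -, hL₁⟩ := hC₁.est
  obtain ⟨L₂, hL₂0, -, hL₂⟩ := (hC θ hθ).est
  refine ⟨1 + L₁ + L₂, by positivity, fun u₀ v₀ u₁ v₁ u v w z u₀' v₀' u₁' v₁' u' v' w' z' H hu hv S
    H' hu' hv' S' => ?_⟩
  -- By uniqueness each given solution is almost everywhere the constructed one, so the Lipschitz
  -- bounds of the latter transfer to it.
  have h := fun (t : ℝ) (ht : 0 < t) => H.ae_eq Q P hf₁ hf₂ W hC hu hv W.adm W.integrable S.1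
    (S.2 θ₀ W.adm).1 (S.2 θ₀ W.adm).2 ht
  have h' := fun (t : ℝ) (ht : 0 < t) => H'.ae_eq Q P hf₁ hf₂ W hC hu' hv' W.adm W.integrable S'.1
    (S'.2 θ₀ W.adm).1 (S'.2 θ₀ W.adm).2 ht
  have e₁ : nrm r₁ (fun x => u₁' x - u₁ x) = nrm r₁ (u₀' - u₀) :=
    eLpNorm_congr_ae (hu'.sub hu).symm
  have e₂ : nrm r₂ (fun x => v₁' x - v₁ x) = nrm r₂ (v₀' - v₀) :=
    eLpNorm_congr_ae (hv'.sub hv).symm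
  obtain ⟨a₁, a₂⟩ := hL₁ _ _ _ _ _ _ _ _ H' H
  obtain ⟨b₁, b₂⟩ := hL₂ _ _ _ _ _ _ _ _ H' H
  rw [e₁, e₂] at a₁ a₂ b₁ b₂
  rw [one_mul] at a₁ a₂
  set D := nrm r₁ (u₀' - u₀) + nrm r₂ (v₀' - v₀) with hD
  have hle : ∀ {x : ℝ≥0∞}, x ≤ ofReal L₁ * D → x ≤ ofReal (1 + L₁) * D := fun hx =>
    hx.trans (mul_le_mul_left (ofReal_le_ofReal (by linarith)) _)
  have hone : D ≤ ofReal (1 + L₁) * D :=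
    le_mul_of_one_le_left' (ENNReal.one_le_ofReal.2 (by linarith))
  have hsum : ofReal (1 + L₁) * D + ofReal L₂ * D =
      ofReal (1 + L₁ + L₂) * D := by
    rw [← add_mul, ← ofReal_add (by positivity) hL₂0]
  have i₁ : nrm r₁ (w' 0 - w 0) = nrm r₁ (u₀' - u₀) :=
    eLpNorm_congr_ae (S'.1.eq_u.ae_eq_zero.sub S.1.eq_u.ae_eq_zero)
  have i₂ : nrm r₂ (z' 0 - z 0) = nrm r₂ (v₀' - v₀) :=
    eLpNorm_congr_ae (S'.1.eq_v.ae_eq_zero.sub S.1.eq_v.ae_eq_zero)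
  rw [← hsum]
  exact max_le
    (normX_sub_le P Q.dim Q.r₁_pos (lt_mul_of_one_lt_left Q.r₁_pos hθ.1)
      (i₁.trans_le (le_self_add.trans hone)) (fun t ht => (h t ht).1) (fun t ht => (h' t ht).1)
      (hle a₁) b₁)
    (normX_sub_le P Q.dim Q.r₂_pos (lt_mul_of_one_lt_left Q.r₂_pos hθ.1)
      (i₂.trans_le (le_add_self.trans hone)) (fun t ht => (h t ht).2) (fun t ht => (h' t ht).2)
      (hle a₂) b₂)

end Dependence

end RayleighStokes

end

/-! ### Proof of the theorem -/

open RayleighStokes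

theorem theorem1p5
    (N : ℕ) (hN : 1 ≤ N)
    (k α σ γ ρ₁ ρ₂ r₁ r₂ : ℝ)
    (hk : 0 < k) (hα0 : 0 < α) (hα1 : α < 1)
    (hσ : σ ≤ 0) (hγ : γ ≤ 0) (hσγ : 0 < σ + 2 * (γ + 1))
    -- local integrability of the weight; automatic if `N ≥ 2`
    (hσN : -(N : ℝ) < σ)
    (hρ₂ : 1 ≤ ρ₂) (hρ : ρ₂ ≤ ρ₁)
    (hcrit : RayleighStokes.criticalProduct N σ γ ρ₁ ρ₂ < ρ₁ * ρ₂)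
    (hr₁ : r₁ = RayleighStokes.criticalR N σ γ ρ₁ ρ₂ ρ₁)
    (hr₂ : r₂ = RayleighStokes.criticalR N σ γ ρ₁ ρ₂ ρ₂)
    (f₁ f₂ : ℝ → ℝ)
    (hf₁ : RayleighStokes.IsPower ρ₁ f₁) (hf₂ : RayleighStokes.IsPower ρ₂ f₂) :
    ∃ δ : ℝ, 0 < δ ∧
      (∀ u₀ v₀ : RayleighStokes.Space N → ℝ, RayleighStokes.SmallData δ r₁ r₂ u₀ v₀ →
        ∃ u v : ℝ → RayleighStokes.Space N → ℝ,
          -- existence, in the spaces of all admissible `θ`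
          RayleighStokes.IsGlobalSolution k α σ γ f₁ f₂ r₁ r₂ u₀ v₀ u v ∧
          -- uniqueness in the intersection of these spaces
          (∀ u' v' : ℝ → RayleighStokes.Space N → ℝ,
            RayleighStokes.IsGlobalSolution k α σ γ f₁ f₂ r₁ r₂ u₀ v₀ u' v' →
            ∀ t : ℝ, 0 ≤ t → u' t =ᵐ[volume] u t ∧ v' t =ᵐ[volume] v t) ∧
          -- uniqueness in the space of any one admissible `θ` for which the nonlinear terms
          -- are locally integrable on the whole space
          (∀ θ : ℝ, RayleighStokes.Admissible N r₁ θ →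
            ρ₁ / (θ * r₂) - σ / N < 1 → ρ₂ / (θ * r₁) - σ / N < 1 →
            ∀ u' v' : ℝ → RayleighStokes.Space N → ℝ,
              RayleighStokes.IsMildSolution k α σ γ f₁ f₂ r₁ r₂ u₀ v₀ u' v' →
              RayleighStokes.MemX k α (θ * r₁) r₁ u' →
              RayleighStokes.MemX k α (θ * r₂) r₂ v' →
              ∀ t : ℝ, 0 ≤ t → u' t =ᵐ[volume] u t ∧ v' t =ᵐ[volume] v t) ∧
          -- nonnegativity
          (0 ≤ᵐ[volume] u₀ → 0 ≤ᵐ[volume] v₀ →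
            ∀ t : ℝ, 0 ≤ t → 0 ≤ᵐ[volume] u t ∧ 0 ≤ᵐ[volume] v t)) ∧
      -- continuous dependence on the data
      (∀ θ : ℝ, RayleighStokes.Admissible N r₁ θ →
        ∀ (u₀ v₀ : RayleighStokes.Space N → ℝ) (u v : ℝ → RayleighStokes.Space N → ℝ),
          RayleighStokes.SmallData δ r₁ r₂ u₀ v₀ →
          RayleighStokes.IsGlobalSolution k α σ γ f₁ f₂ r₁ r₂ u₀ v₀ u v →
          ∀ ε : ℝ, 0 < ε → ∃ η : ℝ, 0 < η ∧
            ∀ (u₀' v₀' : RayleighStokes.Space N → ℝ) (u' v' : ℝ → RayleighStokes.Space N → ℝ),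
              RayleighStokes.SmallData δ r₁ r₂ u₀' v₀' →
              RayleighStokes.IsGlobalSolution k α σ γ f₁ f₂ r₁ r₂ u₀' v₀' u' v' →
              eLpNorm (u₀' - u₀) (ENNReal.ofReal r₁) volume ≤ ENNReal.ofReal η →
              eLpNorm (v₀' - v₀) (ENNReal.ofReal r₂) volume ≤ ENNReal.ofReal η →
              max (RayleighStokes.normX k α (θ * r₁) r₁ (u' - u))
                (RayleighStokes.normX k α (θ * r₂) r₂ (v' - v)) ≤ ENNReal.ofReal ε) := by
  have Q := systemParams_of_critical hN hσ hγ hσγ hσN hρ₂ hρ hcrit hr₁ hr₂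
  have P : SymbolParams k α := ⟨hk, hα0, hα1⟩
  have hp₁ := hf₁.powerLike (hρ₂.trans hρ)
  have hp₂ := hf₂.powerLike hρ₂
  obtain ⟨θ₀, δ, R, W, hδ, hex, hC, hC₁⟩ := exists_smallSystem Q P hp₁ hp₂
  -- The construction needs measurable data, whereas elements of L^r are only almost everywhere
  -- equal to measurable functions.
  have hsol : ∀ u₀ v₀ : Space N → ℝ, SmallData δ r₁ r₂ u₀ v₀ → ∃ u₁ v₁ u v,
      u₀ =ᵐ[volume] u₁ ∧ v₀ =ᵐ[volume] v₁ ∧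
      SmallSystem k α σ γ f₁ f₂ r₁ r₂ θ₀ δ R u₁ v₁ u v ∧
      (0 ≤ᵐ[volume] u₁ → 0 ≤ᵐ[volume] v₁ → ∀ t, 0 < t → ∀ x, 0 ≤ u t x ∧ 0 ≤ v t x) := by
    intro u₀ v₀ h
    have hu := h.1.1.ae_eq_mk
    have hv := h.2.1.1.ae_eq_mk
    obtain ⟨u, v, H⟩ := hex _ _ h.1.1.stronglyMeasurable_mk.measurable
      h.2.1.1.stronglyMeasurable_mk.measurable ((eLpNorm_congr_ae hu).symm.trans_le h.2.2.1)
      ((eLpNorm_congr_ae hv).symm.trans_le h.2.2.2)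
    exact ⟨_, _, u, v, hu, hv, H⟩
  refine ⟨δ, hδ, fun u₀ v₀ hd => ?_, fun θ hθ u₀ v₀ u v hd hS ε hε => ?_⟩
  · obtain ⟨u₁, v₁, u, v, hu, hv, H, hn⟩ := hsol u₀ v₀ hd
    have huniq : ∀ θ : ℝ, Admissible N r₁ θ → ρ₁ / (θ * r₂) - σ / N < 1 →
        ∀ w z : ℝ → Space N → ℝ, IsMildSolution k α σ γ f₁ f₂ r₁ r₂ u₀ v₀ w z →
        MemX k α (θ * r₁) r₁ w → MemX k α (θ * r₂) r₂ z → ∀ t : ℝ, 0 ≤ t →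
        w t =ᵐ[volume] withInitial u₀ u t ∧ z t =ᵐ[volume] withInitial v₀ v t := by
      intro θ hθ hint w z hS hw hz t ht
      rcases ht.eq_or_lt with rfl | ht
      · rw [withInitial_zero, withInitial_zero]
        exact ⟨hS.eq_u.ae_eq_zero, hS.eq_v.ae_eq_zero⟩
      · rw [withInitial_of_pos u₀ u ht, withInitial_of_pos v₀ v ht]
        exact H.ae_eq Q P hp₁ hp₂ W hC hu hv hθ hint hS hw hz ht
    refine ⟨withInitial u₀ u, withInitial v₀ v,
      H.isGlobalSolution Q P hp₁ hp₂ W hC hC₁ hd.1 hd.2.1 hu hv,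
      fun w z hS => huniq θ₀ W.adm W.integrable w z hS.1 (hS.2 θ₀ W.adm).1 (hS.2 θ₀ W.adm).2,
      fun θ hθ hint _ => huniq θ hθ hint, fun hu₀ hv₀ t ht => ?_⟩
    rcases ht.eq_or_lt with rfl | ht
    · rw [withInitial_zero, withInitial_zero]
      exact ⟨hu₀, hv₀⟩
    · rw [withInitial_of_pos u₀ u ht, withInitial_of_pos v₀ v ht]
      have h := hn (hu₀.trans_eq hu) (hv₀.trans_eq hv) t ht
      exact ⟨Eventually.of_forall fun x => (h x).1, Eventually.of_forall fun x => (h x).2⟩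
  · obtain ⟨L, hL, hLip⟩ := exists_normX_sub_le Q P hp₁ hp₂ W hC hC₁ hθ
    -- The Lipschitz bound involves the sum of two data norms, each at most η, so 2Lη = ε.
    refine ⟨ε / (2 * L), by positivity, fun u₀' v₀' u' v' hd' hS' hη₁ hη₂ => ?_⟩
    obtain ⟨u₁, v₁, U, V, hu, hv, H, -⟩ := hsol u₀ v₀ hd
    obtain ⟨u₁', v₁', U', V', hu', hv', H', -⟩ := hsol u₀' v₀' hd'
    refine (hLip _ _ _ _ _ _ _ _ _ _ _ _ _ _ _ _ H hu hv hS H' hu' hv' hS').trans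
      ((mul_le_mul_right (add_le_add hη₁ hη₂) _).trans (le_of_eq ?_))
    rw [← ENNReal.ofReal_add (by positivity) (by positivity), ← ENNReal.ofReal_mul hL.le]
    congr 1
    field_simp
    ring
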